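/- Let $(M,\omega)$ be a compact Kähler manifold of dimension $m\ge 2$, $\omega=\sqrt{-1}\,g_{\alpha\bar\beta}\,dz^\alpha\wedge d\bar z^\beta$, let $\pi:\mathcal X\to M$ be a holomorphic fibration (a proper surjective holomorphic map of complex manifolds whose differential has maximal rank everywhere) with fibres of dimension $n$, and let $L$ be a holomorphic line bundle over $\mathcal X$. For a smooth Hermitian metric $\phi$ on $L$ (with local weights $\phi=-\log|e|^2$, $e$ a local holomorphic frame) and $i\ge 0$ put $$S_i(L,\phi)=\int_{\mathcal X/M}\Big(\tfrac{\sqrt{-1}}{2\pi}\partial\bar\partial\phi\Big)^{n+i}$$ (integration along the fibres), write $S_0(L)$ for the function $S_0(L,\phi)$ on $M$, and, when $S_0(L)$ has no zeros, define $C_k(L,\phi)$, of degree $2k$, by $\sum_k C_k(L,\phi)=1/\sum_i S_i(L,\phi)$, with $C_0(L)=1/S_0(L)$. The classes $S_i(L)\in H^{2i}(M,\mathbb R)$ are the de Rham classes of $S_i(L,\psi)$ for any smooth metric $\psi$ on $L$, and $\sum_k C_k(L)=1/\sum_i S_i(L)$. In holomorphic coordinates $(z;v)$ of $\mathcal X$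 and $z$ of $M$ with $\pi(z;v)=z$, for $\phi$ with $\sqrt{-1}\partial\bar\partial\phi>0$ on all fibres, the geodesic curvature is $$c(\phi)=\big(\phi_{\alpha\bar\beta}-\phi_{\alpha\bar j}\phi^{i\bar j}\phi_{i\bar\beta}\big)\sqrt{-1}\,dz^\alpha\wedge d\bar z^\beta .$$ Suppose that $\phi$ is geodesic-Einstein with respect to $\omega$, i.e. $\sqrt{-1}\partial\bar\partial\phi>0$ on all fibres and $tr_\omega c(\phi)=g^{\alpha\bar\beta}c(\phi)_{\alpha\bar\beta}$ is constant on $\mathcal X$. Then at every point $y\in M$ $$\big(n\,C_1(L,\phi)^2-2(n+1)\,C_0(L)\,C_2(L,\phi)\big)\wedge\omega^{m-2}\le 0,$$ and equality holds at $y$ if and only if $c(\phi)=\frac{2\pi}{(n+1)S_0(L)}\,\pi^*S_1(L,\phi)$ at all points of $\pi^{-1}(y)$. Moreover, $$\int_M\big(n\,C_1(L)^2-2(n+1)\,C_0(L)\,C_2(L)\big)\wedge[\omega]^{m-2}\le 0 .$$ -/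

import Mathlib

open scoped Manifold ContDiff Topology
open MeasureTheory

noncomputable section

namespace GeodesicEinstein

/-! ### Multilinear algebra -/

section Algebra

variable {E : Type*} [NormedAddCommGroup E] [NormedSpace ℝ E]

/-- The exterior product of real alternating forms, in the normalization for which
`(α ∧ β)(u₁, …, u_{k+l})` is the sum over `(k,l)`-shuffles, i.e. `1/(k! l!)` times the signed sum
over all permutations; for instance `(dx ∧ dy)(e₁, e₂) = 1`. -/
def wedge {k l : ℕ} (α : E [⋀^Fin k]→L[ℝ] ℝ) (β : E [⋀^Fin l]→L[ℝ] ℝ) :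
    E [⋀^Fin (k + l)]→L[ℝ] ℝ :=
  ((k.factorial : ℝ) * (l.factorial : ℝ))⁻¹ •
    ContinuousMultilinearMap.alternatization
      ((α.toContinuousMultilinearMap.smulRight
        β.toContinuousMultilinearMap).uncurrySum.domDomCongr finSumFinEquiv)

/-- Insertion of the vectors `w 0, …, w (l-1)` in the first `l` slots of a `(k + l)`-form. -/
def insertVectors {k : ℕ} : {l : ℕ} → (Fin l → E) → (E [⋀^Fin (k + l)]→L[ℝ] ℝ) →
    (E [⋀^Fin k]→L[ℝ] ℝ)
  | 0, _, θ => θ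
  | _ + 1, w, θ => insertVectors (fun j => w j.succ)
      (ContinuousAlternatingMap.curryLeft θ (w 0))

/-- The standard real frame `e₁, i e₁, e₂, i e₂, …` of `ℂ^d`, in the order that is positive for the
complex orientation. -/
def stdFrame (d : ℕ) : Fin (2 * d) → (Fin d → ℂ) := fun j a =>
  if (a : ℕ) = (j : ℕ) / 2 then (if (j : ℕ) % 2 = 0 then 1 else Complex.I) else 0

variable [NormedSpace ℂ E] [IsScalarTower ℝ ℂ E]

/-- Multiplication by `√-1`, as a real linear map. -/
def complexStructure (E : Type*) [NormedAddCommGroup E] [NormedSpace ℝ E] [NormedSpace ℂ E]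
    [IsScalarTower ℝ ℂ E] : E →L[ℝ] E :=
  (Complex.I • ContinuousLinearMap.id ℂ E).restrictScalars ℝ

/-- The coefficients of a real `(1,1)`-form: if `η = √-1 ∑ η_{a b̄} dz^a ∧ dz̄^b`, then
`hermCoeff η u v = ∑ η_{a b̄} u^a v̄^b`; in particular `hermCoeff η e_a e_b = η_{a b̄}`. -/
def hermCoeff (η : E [⋀^Fin 2]→L[ℝ] ℝ) (u v : E) : ℂ :=
  ((η ![u, Complex.I • v] : ℝ) - Complex.I * (η ![u, v] : ℝ)) / 2

/-- The real `(1,1)`-form `√-1 ∂∂̄ f` of a smooth real function `f` on a complex vector space,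
computed as `√-1 ∂∂̄ f = -½ d(df ∘ J)`; its value on `(u, v)` is `½ (D²f(Ju, v) - D²f(u, Jv))`. -/
def iddbar (f : E → ℝ) (p : E) : E [⋀^Fin 2]→L[ℝ] ℝ :=
  -(2⁻¹ : ℝ) • extDeriv (fun q => ContinuousAlternatingMap.ofSubsingleton ℝ E ℝ (0 : Fin 1)
    ((fderiv ℝ f q).comp (complexStructure E))) p

end Algebra

/-! ### Differential forms on complex manifolds

`X` is a complex manifold modelled on the complex vector space `E`. The tangent space at `x` is `E`,
through the derivative of the preferred chart `chartAt E x` at `x` (as for `TangentSpace`). -/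

section Forms

variable {E : Type*} [NormedAddCommGroup E] [NormedSpace ℝ E]
  {X : Type*} [TopologicalSpace X] [ChartedSpace E X]

/-- Real differential forms of degree `k` (not necessarily smooth). -/
abbrev DiffForm (E : Type*) [NormedAddCommGroup E] [NormedSpace ℝ E] (X : Type*) (k : ℕ) :=
  X → E [⋀^Fin k]→L[ℝ] ℝ

/-- Transport of a form along an equality of degrees. -/
def castDeg {k l : ℕ} (h : k = l) (η : DiffForm E X k) : DiffForm E X l := h ▸ η

/-- The coordinate expression of the form `η` in the chart `e`: the pullback of `η` under
`e.symm`. -/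
def inChart {k : ℕ} (e : OpenPartialHomeomorph X E) (η : DiffForm E X k) (p : E) :
    E [⋀^Fin k]→L[ℝ] ℝ :=
  (η (e.symm p)).compContinuousLinearMap
    (fderiv ℝ (fun q => chartAt E (e.symm p) (e.symm q)) p)

/-- Smoothness of a form. -/
def IsSmoothForm {k : ℕ} (η : DiffForm E X k) : Prop :=
  ∀ e ∈ atlas E X, ContDiffOn ℝ ∞ (inChart e η) e.target

/-- The exterior derivative. -/
def extD {k : ℕ} (η : DiffForm E X k) : DiffForm E X (k + 1) := fun x =>
  extDeriv (inChart (chartAt E x) η) (chartAt E x x)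

/-- Smooth closed forms. -/
def IsClosedForm {k : ℕ} (η : DiffForm E X k) : Prop :=
  IsSmoothForm η ∧ extD η = 0

/-- Exact forms: derivatives of smooth forms. Only `0` is exact in degree `0`. -/
def IsExactForm : {k : ℕ} → DiffForm E X k → Prop
  | 0, η => η = 0
  | k + 1, η => ∃ γ : DiffForm E X k, IsSmoothForm γ ∧ η = extD γ

/-- Two closed forms with the same de Rham cohomology class. -/
def Cohomologous {k : ℕ} (α β : DiffForm E X k) : Prop :=
  IsClosedForm α ∧ IsClosedForm β ∧ IsExactForm (α - β)

/-- The pointwise exterior product of forms. -/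
def wedgeForm {k l : ℕ} (α : DiffForm E X k) (β : DiffForm E X l) : DiffForm E X (k + l) :=
  fun x => wedge (α x) (β x)

/-- The exterior power `η ∧ ⋯ ∧ η` (`k` factors) of a 2-form. -/
def wedgePow (η : DiffForm E X 2) : (k : ℕ) → DiffForm E X (2 * k)
  | 0 => fun _ => ContinuousAlternatingMap.constOfIsEmpty ℝ E (Fin 0) 1
  | k + 1 => wedgeForm (wedgePow η k) η

/-- A function, as a form of degree zero. -/
def zeroForm (f : X → ℝ) : DiffForm E X 0 := fun x =>
  ContinuousAlternatingMap.constOfIsEmpty ℝ E (Fin 0) (f x)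

/-- The value at `x` of a form of degree zero. -/
def zeroFormValue (η : DiffForm E X 0) (x : X) : ℝ := η x ![]

variable [NormedSpace ℂ E] [IsScalarTower ℝ ℂ E]

/-- Kähler forms: closed, smooth, real forms of type `(1,1)` that are positive. If
`ωM = √-1 ∑ g_{α β̄} dz^α ∧ dz̄^β`, then `ωM(u, Ju) = 2 ∑ g_{α β̄} u^α ū^β`. -/
structure IsKahlerForm (ωM : DiffForm E X 2) : Prop where
  closed : IsClosedForm ωM
  type_one_one : ∀ x u v, ωM x ![Complex.I • u, Complex.I • v] = ωM x ![u, v]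
  pos : ∀ x u, u ≠ 0 → 0 < ωM x ![u, Complex.I • u]

variable (E X) in
/-- A finite family of holomorphic charts of a compact complex manifold with a smooth partition of
unity subordinate to it. -/
structure ChartPartition where
  N : ℕ
  chart : Fin N → OpenPartialHomeomorph X E
  chart_mem : ∀ i, chart i ∈ IsManifold.maximalAtlas 𝓘(ℂ, E) ω X
  ρ : Fin N → X → ℝ
  smooth : ∀ i, ContMDiff 𝓘(ℝ, E) 𝓘(ℝ, ℝ) ∞ (ρ i)
  nonneg : ∀ i x, 0 ≤ ρ i x
  sum_eq_one : ∀ x, ∑ i, ρ i x = 1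
  tsupport_subset : ∀ i, tsupport (ρ i) ⊆ (chart i).source

end Forms

/-- The integral of a top-degree form over a compact complex manifold of dimension `d`, with its
complex orientation, by means of a partition of unity (the choice of which is immaterial for
continuous forms; one exists on every compact Hausdorff complex manifold). -/
def integral {d : ℕ} {M : Type*} [TopologicalSpace M] [ChartedSpace (Fin d → ℂ) M]
    (Θ : DiffForm (Fin d → ℂ) M (2 * d)) : ℝ :=
  open Classical in
  if h : Nonempty (ChartPartition (Fin d → ℂ) M) then
    ∑ i, ∫ p in (h.some.chart i).target,
      h.some.ρ i ((h.some.chart i).symm p) * inChart (h.some.chart i) Θ p (stdFrame d)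
  else 0

/-! ### Hermitian metrics on holomorphic line bundles -/

section LineBundle

variable {E : Type*} [NormedAddCommGroup E] [NormedSpace ℝ E]
  {X : Type*} [TopologicalSpace X] [ChartedSpace E X]
  {L : X → Type*} [∀ x, AddCommGroup (L x)] [∀ x, Module ℂ (L x)]
  [∀ x, TopologicalSpace (L x)] [TopologicalSpace (Bundle.TotalSpace ℂ L)] [FiberBundle ℂ L]

variable (E L) in
/-- A smooth Hermitian metric on the line bundle `L` over `X`, given by `s ↦ |s|²`. -/
structure HermitianMetric where
  normSq : ∀ x, L x → ℝ
  pos : ∀ x (s : L x), s ≠ 0 → 0 < normSq x s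
  smul : ∀ x (c : ℂ) (s : L x), normSq x (c • s) = ‖c‖ ^ 2 * normSq x s
  smooth : ∀ (t : Bundle.Trivialization ℂ (Bundle.TotalSpace.proj : Bundle.TotalSpace ℂ L → X))
    [MemTrivializationAtlas t],
    ContMDiffOn 𝓘(ℝ, E) 𝓘(ℝ, ℝ) ∞ (fun x => normSq x (t.symm x 1)) t.baseSet

/-- The local weight `φ = -log |e|²` of the metric with respect to the local holomorphic frame
`e` given by a trivialization. -/
def HermitianMetric.weight (φ : HermitianMetric E L)
    (t : Bundle.Trivialization ℂ (Bundle.TotalSpace.proj : Bundle.TotalSpace ℂ L → X)) (x : X) : ℝ :=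
  -Real.log (φ.normSq x (t.symm x 1))

variable [NormedSpace ℂ E] [IsScalarTower ℝ ℂ E]

/-- The curvature form `√-1 ∂∂̄ φ` (independent of the local frame and of the coordinates). -/
def HermitianMetric.curvature (φ : HermitianMetric E L) : DiffForm E X 2 := fun x =>
  iddbar (fun p => φ.weight (trivializationAt ℂ L x) ((chartAt E x).symm p)) (chartAt E x x)

/-- The Chern form `c₁(L, φ) = (√-1 / 2π) ∂∂̄ φ`. -/
def HermitianMetric.chernForm (φ : HermitianMetric E L) : DiffForm E X 2 :=
  (2 * Real.pi)⁻¹ • φ.curvature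

end LineBundle

/-! ### Holomorphic fibrations -/

section Fibration

variable {m n : ℕ}
  {M : Type*} [TopologicalSpace M] [ChartedSpace (Fin m → ℂ) M]
  {X : Type*} [TopologicalSpace X] [ChartedSpace ((Fin m → ℂ) × (Fin n → ℂ)) X]

variable (m n) in
/-- A holomorphic fibration: a proper surjective holomorphic map whose differential has maximal rank
everywhere. -/
structure IsHolomorphicFibration (π : X → M) : Prop where
  holomorphic : ContMDiff 𝓘(ℂ, (Fin m → ℂ) × (Fin n → ℂ)) 𝓘(ℂ, Fin m → ℂ) ω π
  proper : IsProperMap π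
  surjective : Function.Surjective π
  submersion : ∀ x, Function.Surjective
    (mfderiv 𝓘(ℂ, (Fin m → ℂ) × (Fin n → ℂ)) 𝓘(ℂ, Fin m → ℂ) π x)

/-- Admissible coordinates: a holomorphic chart `e = (z; v)` of `X` and a holomorphic chart `z` of
`M` with `π(z; v) = z`. -/
structure IsAdmissible (π : X → M) (e : OpenPartialHomeomorph X ((Fin m → ℂ) × (Fin n → ℂ)))
    (z : OpenPartialHomeomorph M (Fin m → ℂ)) : Prop where
  total_mem : e ∈ IsManifold.maximalAtlas 𝓘(ℂ, (Fin m → ℂ) × (Fin n → ℂ)) ω X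
  base_mem : z ∈ IsManifold.maximalAtlas 𝓘(ℂ, Fin m → ℂ) ω M
  mapsTo : Set.MapsTo π e.source z.source
  fst_eq : ∀ x ∈ e.source, (e x).1 = z (π x)

/-- A finite family of admissible charts covering `X` with a subordinate smooth partition of
unity. -/
structure AdmissiblePartition (π : X → M) extends
    ChartPartition ((Fin m → ℂ) × (Fin n → ℂ)) X where
  base : Fin N → OpenPartialHomeomorph M (Fin m → ℂ)
  admissible : ∀ i, IsAdmissible π (chart i) (base i)

/-- Integration along the fibres, `∫_{X/M}`, of a form `η` of degree `k + 2n`, computed with a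
partition of unity: in admissible coordinates `(z; v)`,
`(∫_{X/M} η)(Y₁, …, Y_k) = ∫_{X_y} η(f₁, …, f_{2n}, Y₁, …, Y_k) dλ(v)`,
where `f` is the standard frame of the fibre directions and `λ` is Lebesgue measure. -/
def AdmissiblePartition.fibreIntegral {π : X → M} (P : AdmissiblePartition (m := m) (n := n) π) {N k : ℕ}
    (h : N = k + 2 * n) (η : DiffForm ((Fin m → ℂ) × (Fin n → ℂ)) X N) :
    DiffForm (Fin m → ℂ) M k := fun y =>
  open Classical in
  ∑ i, if y ∈ (P.base i).source then
    (∫ v in {v : Fin n → ℂ | (P.base i y, v) ∈ (P.chart i).target},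
      P.ρ i ((P.chart i).symm (P.base i y, v)) •
        (insertVectors (fun j => ((0 : Fin m → ℂ), stdFrame n j))
          (inChart (P.chart i) (castDeg h η) (P.base i y, v))).compContinuousLinearMap
            (ContinuousLinearMap.inl ℝ (Fin m → ℂ) (Fin n → ℂ))).compContinuousLinearMap
      (fderiv ℝ (fun q => P.base i ((chartAt (Fin m → ℂ) y).symm q)) (chartAt (Fin m → ℂ) y y))
  else 0

/-- Integration along the fibres (the choice of the partition is immaterial for continuous forms;
one exists for every holomorphic fibration with compact Hausdorff total space). -/
def fibreIntegral (π : X → M) {N k : ℕ} (h : N = k + 2 * n)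
    (η : DiffForm ((Fin m → ℂ) × (Fin n → ℂ)) X N) : DiffForm (Fin m → ℂ) M k :=
  open Classical in
  if hP : Nonempty (AdmissiblePartition (m := m) (n := n) π) then hP.some.fibreIntegral h η else 0

variable {L : X → Type*} [∀ x, AddCommGroup (L x)] [∀ x, Module ℂ (L x)]
  [∀ x, TopologicalSpace (L x)] [TopologicalSpace (Bundle.TotalSpace ℂ L)] [FiberBundle ℂ L]

/-- `φ ∈ F⁺(L)`: the curvature is positive on every fibre of `π`. -/
def IsFibrewisePositive (π : X → M) (φ : HermitianMetric ((Fin m → ℂ) × (Fin n → ℂ)) L) : Prop :=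
  ∀ (x : X) (w : (Fin m → ℂ) × (Fin n → ℂ)), w ≠ 0 →
    mfderiv 𝓘(ℂ, (Fin m → ℂ) × (Fin n → ℂ)) 𝓘(ℂ, Fin m → ℂ) π x w = 0 →
    0 < φ.curvature x ![w, Complex.I • w]

/-- The coefficients `c(φ)_{α β̄} = φ_{α β̄} - φ_{α j̄} φ^{i j̄} φ_{i β̄}` at `x` of the geodesic
curvature in the admissible chart `e = (z; v)` of `X`. -/
def geodesicCoeff (φ : HermitianMetric ((Fin m → ℂ) × (Fin n → ℂ)) L)
    (e : OpenPartialHomeomorph X ((Fin m → ℂ) × (Fin n → ℂ))) (x : X) :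
    Matrix (Fin m) (Fin m) ℂ :=
  let η := inChart e φ.curvature (e x)
  let h : Fin m → (Fin m → ℂ) × (Fin n → ℂ) := fun α => (Pi.single α 1, 0)
  let v : Fin n → (Fin m → ℂ) × (Fin n → ℂ) := fun i => (0, Pi.single i 1)
  Matrix.of (fun α β => hermCoeff η (h α) (h β)) -
    Matrix.of (fun α j => hermCoeff η (h α) (v j)) *
      (Matrix.of (fun i j => hermCoeff η (v i) (v j)))⁻¹ *
      Matrix.of (fun i β => hermCoeff η (v i) (h β))

/-- The geodesic curvature `c(φ) = c(φ)_{α β̄} √-1 dz^α ∧ dz̄^β` at `x`, evaluated on two tangent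
vectors of `X` with components `u` and `w` in the admissible chart `e`. -/
def geodesicCurvature (φ : HermitianMetric ((Fin m → ℂ) × (Fin n → ℂ)) L)
    (e : OpenPartialHomeomorph X ((Fin m → ℂ) × (Fin n → ℂ))) (x : X)
    (u w : (Fin m → ℂ) × (Fin n → ℂ)) : ℂ :=
  ∑ α, ∑ β, geodesicCoeff φ e x α β * Complex.I *
    (u.1 α * (starRingEnd ℂ) (w.1 β) - w.1 α * (starRingEnd ℂ) (u.1 β))

/-- The matrix `(g_{α β̄})` at `y` of `ωM = √-1 g_{α β̄} dz^α ∧ dz̄^β` in the chart `z` of `M`. -/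
def kahlerCoeff (ωM : DiffForm (Fin m → ℂ) M 2) (z : OpenPartialHomeomorph M (Fin m → ℂ)) (y : M) :
    Matrix (Fin m) (Fin m) ℂ :=
  Matrix.of fun α β => hermCoeff (inChart z ωM (z y)) (Pi.single α 1) (Pi.single β 1)

/-- Geodesic-Einstein metrics: `φ ∈ F⁺(L)` and `tr_ωM c(φ) = g^{α β̄} c(φ)_{α β̄}` is constant. -/
def IsGeodesicEinstein (π : X → M) (ωM : DiffForm (Fin m → ℂ) M 2)
    (φ : HermitianMetric ((Fin m → ℂ) × (Fin n → ℂ)) L) : Prop :=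
  IsFibrewisePositive π φ ∧ ∃ c : ℝ, ∀ e z, IsAdmissible π e z → ∀ x ∈ e.source,
    (geodesicCoeff φ e x * (kahlerCoeff ωM z (π x))⁻¹).trace = (c : ℂ)

/-- The `S`-forms `S_i(L, φ) = ∫_{X/M} c₁(L, φ)^{n+i}`. -/
def sForm (π : X → M) (φ : HermitianMetric ((Fin m → ℂ) × (Fin n → ℂ)) L) (i : ℕ) :
    DiffForm (Fin m → ℂ) M (2 * i) :=
  fibreIntegral π (by ring : 2 * (n + i) = 2 * i + 2 * n) (wedgePow φ.chernForm (n + i))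

variable (n L) in
/-- `s` represents in de Rham cohomology the class `S_i(L) = π_*(c₁(L)^{n+i})`, where `c₁(L)` is
represented by the Chern form of an arbitrary smooth Hermitian metric on `L`. -/
def RepresentsSClass (π : X → M) (i : ℕ) (s : DiffForm (Fin m → ℂ) M (2 * i)) : Prop :=
  ∃ ψ : HermitianMetric ((Fin m → ℂ) × (Fin n → ℂ)) L, Cohomologous s (sForm π ψ i)

/-- The homogeneous components `C_k` of the inverse `C = 1 / S` of a total form `S = ∑ S_i` in the
commutative algebra of forms of even degree: `C_0 = 1 / S_0` and `∑_{j ≤ k} C_j ∧ S_{k-j} = 0` for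
`k ≥ 1`. -/
def inverseForm (s : ∀ i, DiffForm (Fin m → ℂ) M (2 * i)) :
    (k : ℕ) → DiffForm (Fin m → ℂ) M (2 * k)
  | 0 => zeroForm fun y => (zeroFormValue (s 0) y)⁻¹
  | k + 1 => fun y => -(zeroFormValue (s 0) y)⁻¹ •
      ∑ j : Fin (k + 1), castDeg (by have := j.2; omega)
        (wedgeForm (inverseForm s j) (s (k + 1 - j))) y

/-- The top-degree form `(n C_1² - 2(n+1) C_0 C_2) ∧ w^{m-2}`, where `C = 1 / S`. -/
def kobayashiLubkeForm (n : ℕ) (hm : 2 ≤ m) (s : ∀ i, DiffForm (Fin m → ℂ) M (2 * i))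
    (w : DiffForm (Fin m → ℂ) M 2) : DiffForm (Fin m → ℂ) M (2 * m) :=
  castDeg (by omega : 4 + 2 * (m - 2) = 2 * m)
    (wedgeForm
      (((n : ℝ) • wedgeForm (inverseForm s 1) (inverseForm s 1) : DiffForm (Fin m → ℂ) M 4) -
        (2 * ((n : ℝ) + 1)) • (wedgeForm (inverseForm s 0) (inverseForm s 2) :
          DiffForm (Fin m → ℂ) M 4))
      (wedgePow w (m - 2)))

end Fibration

end GeodesicEinstein

end

/-!
The theorem is a reverse Jensen inequality for the geodesic curvature `c(φ)` on a fibre.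

Along the fibre over `y`, tangent vectors split into vertical ones and horizontal ones, the latter
being orthogonal to the fibre for the curvature form `√-1 ∂∂̄ φ`. The restriction of the curvature
form to the horizontal vectors is `c(φ)`, which is the meaning of the Schur complement in its
definition (`hermCoeff_geodesicForm`). Since the two parts are orthogonal, the powers of the curvature
form split as well, and the vertical part of `(√-1 ∂∂̄ φ)^(n+i)` is the binomial coefficient
`(n+i).choose n` times `(√-1 ∂∂̄ φ)^n ∧ c(φ)^i` (`pow_fibreFrame_append`). Hence `S_i(L, φ)` at `y` is,
up to a constant, the integral of `c(φ)^i` over the fibre with respect to the positive measure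
`(√-1 ∂∂̄ φ)^n` (`AdmissiblePartition.toList_fibreForm`): `S_0` is the total mass `μ`, and `S_1` is `μ`
times the mean `c` of `c(φ)`. With these values, the form of the theorem is a positive multiple of
`∫ (c(φ)^2 - c^2) ∧ ω^(m-2)`, that is, of `∫ (c(φ) - c)^2 ∧ ω^(m-2)`
(`AdmissiblePartition.kobayashiLubkeForm_eq`).

The trace of `c(φ)` is constant by the geodesic-Einstein condition, so that it agrees with the trace of
the mean, and the deviations `c(φ) - c` are primitive forms of type `(1,1)`. By the Hodge–Riemann
relation (`hodgeRiemann`) the integrand `(c(φ) - c)^2 ∧ ω^(m-2)` is nonpositive and vanishes only where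
`c(φ) = c`. This is the pointwise inequality with its case of equality
(`AdmissiblePartition.kobayashiLubkeForm_nonpos`, `AdmissiblePartition.geodesic_eq_mean_iff`).

For the inequality of classes, the curvature forms of two metrics differ by `√-1 ∂∂̄` of a function
(`HermitianMetric.cohomologous_curvature`). Exterior products preserve cohomology by the Leibniz rule,
and integration along the fibres does so because it commutes with the exterior derivative
(`Cohomologous.fibreIntegral`). By Stokes' theorem (`integral_castDeg_extD`) the integral in question
is therefore that of the pointwise nonpositive form. Both facts are reduced by partitions of unity to
compactly supported forms in charts; the terms that arise from the derivatives of the partition cancel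
(`sum_apply_mulForm_extD`), because the integrals do not depend on the charts (`chartIntegral_eq`,
`pushChart_eq`). Coordinates of the total space adapted to the fibration come from the inverse function
theorem (`IsHolomorphicFibration.exists_isAdmissible`).

To compute with exterior products, alternating forms are regarded as functions on lists of vectors. On
these the exterior product is the signed shuffle product, given by the recursion that insertion of a
vector is an antiderivation (`ListForm`, `toList_wedge`). The shuffle product is an associative
product, so that powers of two-forms and their binomial expansions are computed in a ring.
-/

set_option linter.unusedSectionVars false

noncomputable section

namespace GeodesicEinstein

/-! ### The signed shuffle algebra -/

/-- Functions on finite lists of vectors, thought of as forms of mixed degree: a `k`-form is the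
function that vanishes on the lists whose length is not `k`. No multilinearity is required. -/
structure ListForm (E : Type*) where
  toFun : List E → ℝ

namespace ListForm

variable {E : Type*}

instance : CoeFun (ListForm E) (fun _ => List E → ℝ) := ⟨toFun⟩

@[ext] theorem ext {a b : ListForm E} (h : ∀ ws, a ws = b ws) : a = b := by
  cases a; cases b; congr; exact funext h

instance : Zero (ListForm E) := ⟨⟨0⟩⟩
instance : Add (ListForm E) := ⟨fun a b => ⟨fun ws => a ws + b ws⟩⟩
instance : Neg (ListForm E) := ⟨fun a => ⟨fun ws => -a ws⟩⟩
instance : Sub (ListForm E) := ⟨fun a b => ⟨fun ws => a ws - b ws⟩⟩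
instance {S : Type*} [SMul S ℝ] : SMul S (ListForm E) := ⟨fun c a => ⟨fun ws => c • a ws⟩⟩

theorem toFun_injective : Function.Injective (toFun : ListForm E → List E → ℝ) :=
  fun _ _ h => ext (congrFun h)

instance : AddCommGroup (ListForm E) :=
  toFun_injective.addCommGroup _ rfl (fun _ _ => rfl) (fun _ => rfl) (fun _ _ => rfl)
    (fun _ _ => rfl) (fun _ _ => rfl)

instance : Module ℝ (ListForm E) :=
  toFun_injective.module ℝ ⟨⟨toFun, rfl⟩, fun _ _ => rfl⟩ (fun _ _ => rfl)

@[simp] theorem add_apply (a b : ListForm E) (ws : List E) : (a + b) ws = a ws + b ws := rfl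
@[simp] theorem sub_apply (a b : ListForm E) (ws : List E) : (a - b) ws = a ws - b ws := rfl
@[simp] theorem neg_apply (a : ListForm E) (ws : List E) : (-a) ws = -a ws := rfl
@[simp] theorem zero_apply (ws : List E) : (0 : ListForm E) ws = 0 := rfl
@[simp] theorem smul_apply (c : ℝ) (a : ListForm E) (ws : List E) : (c • a) ws = c * a ws := rfl

/-- Insertion of a vector in the first slot. -/
def ins (w : E) (a : ListForm E) : ListForm E := ⟨fun ws => a (w :: ws)⟩

/-- The grading involution: multiplication by `(-1)^k` in degree `k`. -/
def inv (a : ListForm E) : ListForm E := ⟨fun ws => (-1) ^ ws.length * a ws⟩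

/-- The signed shuffle product, evaluated on a list. The recursion says that insertion of a vector
is an antiderivation. -/
def shuffle : List E → ListForm E → ListForm E → ℝ
  | [], a, b => a [] * b []
  | w :: ws, a, b => shuffle ws (ins w a) b + shuffle ws (inv a) (ins w b)

instance : Mul (ListForm E) := ⟨fun a b => ⟨fun ws => shuffle ws a b⟩⟩
instance : One (ListForm E) := ⟨⟨fun ws => if ws = [] then 1 else 0⟩⟩

theorem mul_nil (a b : ListForm E) : (a * b) [] = a [] * b [] := rfl
theorem mul_cons (a b : ListForm E) (w : E) (ws : List E) :
    (a * b) (w :: ws) = (ins w a * b) ws + (inv a * ins w b) ws := rfl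

@[simp] theorem one_nil : (1 : ListForm E) [] = 1 := rfl
@[simp] theorem one_cons (w : E) (ws : List E) : (1 : ListForm E) (w :: ws) = 0 := rfl

theorem ins_apply (w : E) (a : ListForm E) (ws : List E) : ins w a ws = a (w :: ws) := rfl
theorem inv_apply (a : ListForm E) (ws : List E) : inv a ws = (-1) ^ ws.length * a ws := rfl

@[simp] theorem ins_add (w : E) (a b : ListForm E) : ins w (a + b) = ins w a + ins w b := rfl
@[simp] theorem ins_neg (w : E) (a : ListForm E) : ins w (-a) = -ins w a := rfl
@[simp] theorem ins_zero (w : E) : ins w (0 : ListForm E) = 0 := rfl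
@[simp] theorem ins_one (w : E) : ins w (1 : ListForm E) = 0 := rfl
@[simp] theorem ins_smul (w : E) (c : ℝ) (a : ListForm E) : ins w (c • a) = c • ins w a := rfl

@[simp] theorem inv_add (a b : ListForm E) : inv (a + b) = inv a + inv b := by
  ext ws; simp [inv, mul_add]
@[simp] theorem inv_zero : inv (0 : ListForm E) = 0 := by ext ws; simp [inv]
@[simp] theorem inv_smul (c : ℝ) (a : ListForm E) : inv (c • a) = c • inv a := by
  ext ws; simp [inv]; ring
@[simp] theorem inv_inv (a : ListForm E) : inv (inv a) = a := by
  ext ws; simp [inv, ← mul_assoc, ← mul_pow]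
@[simp] theorem inv_one : inv (1 : ListForm E) = 1 := by
  ext ws; cases ws <;> simp [inv]
theorem ins_inv (w : E) (a : ListForm E) : ins w (inv a) = -inv (ins w a) := by
  ext ws; simp [inv, ins, pow_succ]

theorem mul_apply_add (ws : List E) : ∀ a b c : ListForm E,
    (a * (b + c)) ws = (a * b) ws + (a * c) ws := by
  induction ws with
  | nil => intro a b c; simp [mul_nil, mul_add]
  | cons w ws ih => intro a b c; simp only [mul_cons, ih, ins_add]; ring

theorem add_mul_apply (ws : List E) : ∀ a b c : ListForm E,
    ((a + b) * c) ws = (a * c) ws + (b * c) ws := by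
  induction ws with
  | nil => intro a b c; simp [mul_nil, add_mul]
  | cons w ws ih => intro a b c; simp only [mul_cons, ih, ins_add, inv_add]; ring

theorem smul_mul_apply (r : ℝ) (ws : List E) : ∀ a b : ListForm E,
    ((r • a) * b) ws = r * (a * b) ws := by
  induction ws with
  | nil => intro a b; simp [mul_nil, mul_assoc]
  | cons w ws ih => intro a b; simp only [mul_cons, ih, ins_smul, inv_smul]; ring

theorem mul_smul_apply (r : ℝ) (ws : List E) : ∀ a b : ListForm E,
    (a * (r • b)) ws = r * (a * b) ws := by
  induction ws with
  | nil => intro a b; simp [mul_nil]; ring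
  | cons w ws ih => intro a b; simp only [mul_cons, ih, ins_smul]; ring

theorem zero_mul' (a : ListForm E) : 0 * a = 0 := by
  ext ws; simpa using smul_mul_apply 0 ws a a

theorem mul_zero' (a : ListForm E) : a * 0 = 0 := by
  ext ws; simpa using mul_smul_apply 0 ws a a

theorem neg_mul' (a b : ListForm E) : -a * b = -(a * b) := by
  ext ws; simpa using smul_mul_apply (-1) ws a b

theorem mul_neg' (a b : ListForm E) : a * -b = -(a * b) := by
  ext ws; simpa using mul_smul_apply (-1) ws a b

theorem one_mul_apply (ws : List E) : ∀ a : ListForm E, (1 * a) ws = a ws := by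
  induction ws with
  | nil => intro a; simp [mul_nil]
  | cons w ws ih => intro a; simp [mul_cons, ih, zero_mul', ins_apply]

theorem mul_one_apply (ws : List E) : ∀ a : ListForm E, (a * 1) ws = a ws := by
  induction ws with
  | nil => intro a; simp [mul_nil]
  | cons w ws ih => intro a; simp [mul_cons, ih, mul_zero', ins_apply]

theorem ins_mul (w : E) (a b : ListForm E) : ins w (a * b) = ins w a * b + inv a * ins w b := by
  ext ws; rfl

theorem inv_mul (a b : ListForm E) : inv (a * b) = inv a * inv b := by
  ext ws
  induction ws generalizing a b with
  | nil => simp [inv_apply, mul_nil]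
  | cons w ws ih =>
    have h1 := ih (ins w a) b
    have h2 := ih (inv a) (ins w b)
    simp only [mul_cons, ins_inv, neg_mul', mul_neg', neg_apply, ← h1, ← h2, inv_apply,
      List.length_cons, pow_succ]
    ring

theorem mul_assoc_apply (ws : List E) : ∀ a b c : ListForm E,
    ((a * b) * c) ws = (a * (b * c)) ws := by
  induction ws with
  | nil => intro a b c; simp [mul_nil, mul_assoc]
  | cons w ws ih =>
    intro a b c
    simp only [mul_cons, ins_mul, inv_mul, add_mul_apply, mul_apply_add, ih]
    ring

instance : Ring (ListForm E) where
  left_distrib a b c := ext fun ws => mul_apply_add ws a b c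
  right_distrib a b c := ext fun ws => add_mul_apply ws a b c
  zero_mul := zero_mul'
  mul_zero := mul_zero'
  mul_assoc a b c := ext fun ws => mul_assoc_apply ws a b c
  one_mul a := ext fun ws => one_mul_apply ws a
  mul_one a := ext fun ws => mul_one_apply ws a
  neg_add_cancel := neg_add_cancel
  zsmul := fun n a => n • a
  nsmul := fun n a => n • a

instance : IsScalarTower ℝ (ListForm E) (ListForm E) :=
  ⟨fun r a b => ext fun ws => by simpa using smul_mul_apply r ws a b⟩
instance : SMulCommClass ℝ (ListForm E) (ListForm E) :=
  ⟨fun r a b => ext fun ws => by simpa using (mul_smul_apply r ws a b).symm⟩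

@[simp] theorem sum_apply {ι : Type*} (s : Finset ι) (f : ι → ListForm E) (ws : List E) :
    (∑ i ∈ s, f i) ws = ∑ i ∈ s, f i ws := by
  classical
  induction s using Finset.induction_on with
  | empty => simp
  | insert i s hi ih => simp [Finset.sum_insert hi, ih]

/-- Graded commutativity, for a factor of pure parity. -/
theorem mul_comm_apply (ws : List E) : ∀ a b : ListForm E,
    (inv a = a → (a * b) ws = (b * a) ws) ∧ (inv a = -a → (a * b) ws = (inv b * a) ws) := by
  induction ws with
  | nil =>
    intro a b
    refine ⟨fun _ => by simp [mul_nil, mul_comm], fun h => ?_⟩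
    simp [mul_nil, mul_comm, inv_apply]
  | cons w ws ih =>
    intro a b
    constructor <;> intro h
    · have h' : inv (ins w a) = -ins w a := by
        rw [← neg_eq_iff_eq_neg, ← ins_inv, h]
      rw [mul_cons, mul_cons, (ih _ _).2 h', h, (ih _ _).1 h, add_comm]
    · have h' : inv (ins w a) = ins w a := by
        have := ins_inv w a
        rw [h, ins_neg] at this
        exact (neg_injective this).symm
      rw [mul_cons, mul_cons, (ih _ _).1 h', h, ins_inv, inv_inv, neg_mul, neg_mul,
        neg_apply, neg_apply, (ih _ _).2 h, add_comm]

theorem commute_of_inv {a : ListForm E} (h : inv a = a) (b : ListForm E) : Commute a b :=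
  ext fun ws => (mul_comm_apply ws a b).1 h

theorem inv_pow {a : ListForm E} (h : inv a = a) (N : ℕ) : inv (a ^ N) = a ^ N := by
  induction N with
  | zero => simp
  | succ N ih => rw [pow_succ, inv_mul, ih, h]

/-- Insertion is an even derivation up to sign on powers of an even form. -/
theorem ins_pow {a : ListForm E} (h : inv a = a) (w : E) (N : ℕ) :
    ins w (a ^ (N + 1)) = ((N : ℝ) + 1) • (ins w a * a ^ N) := by
  induction N with
  | zero => simp
  | succ N ih =>
    rw [pow_succ, ins_mul, ih, inv_pow h, smul_mul_assoc, mul_assoc, ← pow_succ,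
      (commute_of_inv (inv_pow h (N + 1)) (ins w a)).eq]
    push_cast
    module

/-- The value of a product on a list depends only on the values of the factors on lists of
elements of that list. -/
theorem mul_congr {a a' b b' : ListForm E} (S : Set E) (ws : List E) (hws : ∀ w ∈ ws, w ∈ S)
    (ha : ∀ us : List E, (∀ u ∈ us, u ∈ S) → us.length ≤ ws.length → a us = a' us)
    (hb : ∀ us : List E, (∀ u ∈ us, u ∈ S) → us.length ≤ ws.length → b us = b' us) :
    (a * b) ws = (a' * b') ws := by
  induction ws generalizing a a' b b' with
  | nil => simp only [mul_nil]; rw [ha [] (by simp) (by simp), hb [] (by simp) (by simp)]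
  | cons w ws ih =>
    have hw : w ∈ S := hws w (by simp)
    have hws' : ∀ u ∈ ws, u ∈ S := fun u hu => hws u (by simp [hu])
    have hc : ∀ us : List E, (∀ u ∈ us, u ∈ S) → ∀ u ∈ w :: us, u ∈ S := by
      intro us hus u hu
      rcases List.mem_cons.1 hu with rfl | h
      exacts [hw, hus u h]
    rw [mul_cons, mul_cons]
    refine congr_arg₂ (· + ·) (ih hws' ?_ ?_) (ih hws' ?_ ?_)
    · exact fun us hus hl => ha _ (hc us hus) (by simpa using hl)
    · exact fun us hus hl => hb us hus (hl.trans (by simp))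
    · exact fun us hus hl => by
        rw [inv_apply, inv_apply, ha us hus (hl.trans (by simp))]
    · exact fun us hus hl => hb _ (hc us hus) (by simpa using hl)

/-! ### Alternating list forms and the alternatization of a tensor product -/

/-- Alternating functions of exactly `k` vectors. -/
structure IsAlt (k : ℕ) (a : ListForm E) : Prop where
  degree : ∀ ws : List E, ws.length ≠ k → a ws = 0
  insertIdx : ∀ (ws : List E) (p : ℕ) (w : E), p ≤ ws.length →
    a (ws.insertIdx p w) = (-1) ^ p * a (w :: ws)

theorem IsAlt.ins {k : ℕ} {a : ListForm E} (h : IsAlt (k + 1) a) (w : E) : IsAlt k (ins w a) where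
  degree ws hws := h.degree _ (by simpa using hws)
  insertIdx ws p v hp := by
    have h1 := h.insertIdx (w :: ws) (p + 1) v (by simpa using hp)
    have h2 := h.insertIdx (v :: ws) 1 w (by simp)
    simp only [List.insertIdx_succ_cons, List.insertIdx_zero] at h1 h2
    rw [ins_apply, ins_apply, h1, h2, pow_succ]; ring

theorem IsAlt.ins_zero {a : ListForm E} (h : IsAlt 0 a) (w : E) : ListForm.ins w a = 0 :=
  ext fun ws => h.degree _ (by simp)

theorem IsAlt.inv_eq {k : ℕ} {a : ListForm E} (h : IsAlt k a) : inv a = (-1 : ℝ) ^ k • a := by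
  ext ws
  by_cases hk : ws.length = k
  · simp [inv_apply, hk]
  · simp [inv_apply, h.degree ws hk]

theorem IsAlt.inv_eq_self {k : ℕ} {a : ListForm E} (h : IsAlt (2 * k) a) : inv a = a := by
  rw [h.inv_eq]; simp

/-- A product of forms of degrees `k` and `l` has degree `k + l`. -/
theorem mul_degree {k l : ℕ} {a b : ListForm E} (ha : ∀ ws, ws.length ≠ k → a ws = 0)
    (hb : ∀ ws, ws.length ≠ l → b ws = 0) (ws : List E) (h : ws.length ≠ k + l) :
    (a * b) ws = 0 := by
  induction ws generalizing k l a b with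
  | nil =>
    rw [mul_nil]
    by_cases hk : k = 0
    · rw [hb [] (by simp at h ⊢; omega), mul_zero]
    · rw [ha [] (by simp; omega), zero_mul]
  | cons w ws ih =>
    rw [mul_cons]
    have hi : ∀ ws, ws.length ≠ k → ListForm.inv a ws = 0 := fun ws h => by
      rw [inv_apply, ha ws h, mul_zero]
    have e1 : (ListForm.ins w a * b) ws = 0 := by
      rcases k with _ | k
      · have : ListForm.ins w a = 0 := ext fun us => ha _ (by simp)
        rw [this, zero_mul]; rfl
      · exact ih (k := k) (fun us hu => ha _ (by simpa using hu)) hb (by simp at h; omega)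
    have e2 : (ListForm.inv a * ListForm.ins w b) ws = 0 := by
      rcases l with _ | l
      · have : ListForm.ins w b = 0 := ext fun us => hb _ (by simp)
        rw [this, mul_zero]; rfl
      · exact ih (l := l) hi (fun us hu => hb _ (by simpa using hu)) (by simp at h; omega)
    rw [e1, e2, add_zero]

theorem take_drop_insertIdx_of_le (w : E) : ∀ (us : List E) (k p : ℕ), p ≤ k → k ≤ us.length →
    (us.insertIdx p w).take (k + 1) = (us.take k).insertIdx p w ∧
      (us.insertIdx p w).drop (k + 1) = us.drop k
  | us, k, 0, _, _ => by simp
  | [], k, p + 1, h, h' => by simp at h'; omega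
  | u :: us, 0, p + 1, h, h' => by omega
  | u :: us, k + 1, p + 1, h, h' => by
    have := take_drop_insertIdx_of_le w us k p (by omega) (by simpa using h')
    simp [this]

theorem take_drop_insertIdx_add (w : E) : ∀ (us : List E) (k q : ℕ), k + q ≤ us.length →
    (us.insertIdx (k + q) w).take k = us.take k ∧
      (us.insertIdx (k + q) w).drop k = (us.drop k).insertIdx q w
  | us, 0, q, h => by simp
  | [], k + 1, q, h => by simp at h
  | u :: us, k + 1, q, h => by
    have := take_drop_insertIdx_add w us k q (by simp at h; omega)
    have e : k + 1 + q = k + q + 1 := by ring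
    simp [this, e]

/-- The signed sum over all rearrangements of a list. -/
def listAlt : List E → (List E → ℝ) → ℝ
  | [], f => f []
  | w :: ws, f => ∑ p ∈ Finset.range (ws.length + 1),
      (-1) ^ p * listAlt ws (fun us => f (us.insertIdx p w))

theorem listAlt_congr (ws : List E) (f g : List E → ℝ)
    (h : ∀ us : List E, us.length = ws.length → f us = g us) : listAlt ws f = listAlt ws g := by
  induction ws generalizing f g with
  | nil => exact h [] rfl
  | cons w ws ih =>
    simp only [listAlt]
    refine Finset.sum_congr rfl fun p hp => ?_
    rw [ih _ (fun us => g (us.insertIdx p w))]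
    intro us hus
    apply h
    rw [List.length_insertIdx_of_le_length (by simp at hp; omega), hus, List.length_cons]

theorem listAlt_smul (ws : List E) (c : ℝ) (f : List E → ℝ) :
    listAlt ws (fun us => c * f us) = c * listAlt ws f := by
  induction ws generalizing f with
  | nil => rfl
  | cons w ws ih =>
    simp only [listAlt, Finset.mul_sum]
    refine Finset.sum_congr rfl fun p _ => ?_
    rw [ih (fun us => f (us.insertIdx p w))]; ring

/-- The tensor product of a function of `k` vectors with another function. -/
def tens (k : ℕ) (a b : ListForm E) (ws : List E) : ℝ := a (ws.take k) * b (ws.drop k)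

/-- The alternatization of `a ⊗ b` is `k! l!` times the signed shuffle product: the first vector `w`
of the list lands in one of the `k` slots of `a`, where it contributes `ins w a * b`, or in one of
the `l` slots of `b`, where it contributes `inv a * ins w b`. -/
theorem listAlt_tens (ws : List E) : ∀ (k l : ℕ) (a b : ListForm E), IsAlt k a → IsAlt l b →
    ws.length = k + l →
    listAlt ws (tens k a b) = (k.factorial * l.factorial : ℝ) * (a * b) ws := by
  induction ws with
  | nil =>
    intro k l a b _ _ h
    obtain ⟨rfl, rfl⟩ : k = 0 ∧ l = 0 := by simp at h; omega
    simp [listAlt, tens, mul_nil]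
  | cons w ws ih =>
    intro k l a b ha hb h
    have hlen : ws.length + 1 = k + l := by simpa using h
    -- `w` is inserted in a slot of `a`; all `k` positions contribute equally.
    have first : ∑ p ∈ Finset.range k, (-1 : ℝ) ^ p *
        listAlt ws (fun us => tens k a b (us.insertIdx p w)) =
        (k.factorial * l.factorial : ℝ) * (ins w a * b) ws := by
      rcases k with _ | k
      · simp [ha.ins_zero]
      · have : ∀ p ∈ Finset.range (k + 1), (-1 : ℝ) ^ p *
            listAlt ws (fun us => tens (k + 1) a b (us.insertIdx p w)) =
            (k.factorial * l.factorial : ℝ) * (ins w a * b) ws := by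
          intro p hp
          have hp' : p ≤ k := by simp at hp; omega
          rw [listAlt_congr ws _ (fun us => (-1) ^ p * tens k (ins w a) b us), listAlt_smul,
            ih k l _ _ (ha.ins w) hb (by omega), ← mul_assoc, ← mul_pow]
          · simp
          · intro us hus
            obtain ⟨e1, e2⟩ := take_drop_insertIdx_of_le w us k p hp' (by omega)
            simp only [tens, e1, e2]
            rw [ha.insertIdx _ _ _ (by simp; omega), ins_apply]; ring
        rw [Finset.sum_congr rfl this]
        simp [Nat.factorial_succ]; ring
    -- `w` is inserted in a slot of `b`; moving it past `a` gives the sign `(-1) ^ k` of `inv a`.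
    have second : ∑ q ∈ Finset.range l, (-1 : ℝ) ^ (k + q) *
        listAlt ws (fun us => tens k a b (us.insertIdx (k + q) w)) =
        (k.factorial * l.factorial : ℝ) * (inv a * ins w b) ws := by
      rcases l with _ | l
      · simp [hb.ins_zero]
      · have : ∀ q ∈ Finset.range (l + 1), (-1 : ℝ) ^ (k + q) *
            listAlt ws (fun us => tens k a b (us.insertIdx (k + q) w)) =
            (k.factorial * l.factorial : ℝ) * (inv a * ins w b) ws := by
          intro q hq
          have hq' : q ≤ l := by simp at hq; omega
          rw [listAlt_congr ws _ (fun us => (-1) ^ q * tens k a (ins w b) us), listAlt_smul,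
            ih k l _ _ ha (hb.ins w) (by omega), ha.inv_eq, smul_mul_assoc, smul_apply,
            pow_add]
          · have : ((-1 : ℝ) ^ q) * (-1) ^ q = 1 := by rw [← mul_pow]; simp
            linear_combination ((-1 : ℝ) ^ k * (k.factorial * l.factorial) * (a * ins w b) ws) * this
          · intro us hus
            obtain ⟨e1, e2⟩ := take_drop_insertIdx_add w us k q (by omega)
            simp only [tens, e1, e2]
            rw [hb.insertIdx _ _ _ (by simp; omega), ins_apply]; ring
        rw [Finset.sum_congr rfl this]
        simp [Nat.factorial_succ]; ring
    rw [listAlt, hlen, Finset.sum_range_add, first, second, mul_cons]; ring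

end ListForm

namespace ListForm

variable {E : Type*}

/-- Permutations of `Fin (N + 1)`, classified by the position that is sent to `0`. -/
def permEquiv (N : ℕ) : Fin (N + 1) × Equiv.Perm (Fin N) ≃ Equiv.Perm (Fin (N + 1)) :=
  Equiv.ofBijective
    (fun x => (Fin.cycleRange x.1).trans (Equiv.Perm.decomposeFin.symm (0, x.2))) <| by
  rw [Fintype.bijective_iff_injective_and_card]
  constructor
  · rintro ⟨p, τ⟩ ⟨q, σ⟩ h
    have h0 := congrArg (fun f : Equiv.Perm (Fin (N + 1)) => f.symm 0) h
    have e (ρ : Equiv.Perm (Fin N)) : (Equiv.Perm.decomposeFin.symm ((0 : Fin (N + 1)), ρ)).symm 0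
        = 0 := by
      rw [Equiv.symm_apply_eq]; simp
    simp only [Equiv.symm_trans_apply, e, Fin.cycleRange_symm_zero] at h0
    subst h0
    have h1 : Equiv.Perm.decomposeFin.symm ((0 : Fin (N + 1)), τ)
        = Equiv.Perm.decomposeFin.symm (0, σ) := by
      ext j
      have := congrArg (fun f : Equiv.Perm (Fin (N + 1)) => f ((Fin.cycleRange p).symm j)) h
      simpa using congrArg Fin.val this
    simpa using h1
  · simp [Fintype.card_perm, Nat.factorial_succ]

theorem permEquiv_apply (N : ℕ) (p : Fin (N + 1)) (τ : Equiv.Perm (Fin N)) (w : E)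
    (u : Fin N → E) :
    (Fin.cons w u : Fin (N + 1) → E) ∘ permEquiv N (p, τ) = p.insertNth w (u ∘ τ) := by
  rw [← Fin.cons_comp_cycleRange]
  funext j
  simp only [permEquiv, Equiv.ofBijective_apply, Function.comp_apply, Equiv.trans_apply]
  induction (Fin.cycleRange p j) using Fin.cases with
  | zero => simp
  | succ i => simp

theorem sign_permEquiv (N : ℕ) (p : Fin (N + 1)) (τ : Equiv.Perm (Fin N)) :
    (Equiv.Perm.sign (permEquiv N (p, τ)) : ℤ) = (-1) ^ (p : ℕ) * Equiv.Perm.sign τ := by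
  simp only [permEquiv, Equiv.ofBijective_apply, Equiv.Perm.sign_trans,
    Equiv.Perm.decomposeFin.symm_sign, Fin.sign_cycleRange]
  simp [mul_comm]

theorem ofFn_insertNth : ∀ {N : ℕ} (p : Fin (N + 1)) (w : E) (u : Fin N → E),
    List.ofFn (p.insertNth w u : Fin (N + 1) → E) = (List.ofFn u).insertIdx p w
  | N, ⟨0, _⟩, w, u => by simp
  | 0, ⟨p + 1, h⟩, w, u => by omega
  | N + 1, ⟨p + 1, h⟩, w, u => by
    have ih := ofFn_insertNth (⟨p, by omega⟩ : Fin (N + 1)) w (Fin.tail u)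
    obtain ⟨x, v, rfl⟩ : ∃ x v, u = Fin.cons x v := ⟨u 0, Fin.tail u, (Fin.cons_self_tail u).symm⟩
    rw [Fin.tail_cons] at ih
    have : (Fin.insertNth (⟨p + 1, h⟩ : Fin (N + 1 + 1)) w (Fin.cons x v : Fin (N + 1) → E)
        : Fin (N + 1 + 1) → E) = Fin.cons x (Fin.insertNth (⟨p, by omega⟩ : Fin (N + 1)) w v) := by
      have e : (⟨p + 1, h⟩ : Fin (N + 1 + 1)) = Fin.succ ⟨p, by omega⟩ := rfl
      rw [e]
      funext j
      induction j using Fin.cases with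
      | zero =>
        have := Fin.insertNth_apply_succAbove (α := fun _ => E)
          (Fin.succ (⟨p, by omega⟩ : Fin (N + 1))) w (Fin.cons x v) 0
        rwa [Fin.succ_succAbove_zero, Fin.cons_zero] at this
      | succ j =>
        rcases eq_or_ne j ⟨p, by omega⟩ with rfl | hj
        · rw [Fin.insertNth_apply_same, Fin.cons_succ, Fin.insertNth_apply_same]
        · obtain ⟨i, rfl⟩ := Fin.exists_succAbove_eq hj
          rw [Fin.cons_succ, Fin.insertNth_apply_succAbove, ← Fin.succ_succAbove_succ,
            Fin.insertNth_apply_succAbove, Fin.cons_succ]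
    rw [this, List.ofFn_cons, List.ofFn_cons, ih]
    simp

/-- `listAlt` is the signed sum over all permutations of the arguments. -/
theorem listAlt_ofFn : ∀ {N : ℕ} (u : Fin N → E) (f : List E → ℝ),
    listAlt (List.ofFn u) f = ∑ σ : Equiv.Perm (Fin N),
      ((Equiv.Perm.sign σ : ℤ) : ℝ) * f (List.ofFn (u ∘ σ))
  | 0, u, f => by simp [listAlt]
  | N + 1, u, f => by
    obtain ⟨w, v, rfl⟩ : ∃ x v, u = Fin.cons x v := ⟨u 0, Fin.tail u, (Fin.cons_self_tail u).symm⟩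
    rw [List.ofFn_cons, listAlt, List.length_ofFn, Finset.sum_range, ← (permEquiv N).sum_comp,
      Fintype.sum_prod_type]
    refine Finset.sum_congr rfl fun p _ => ?_
    rw [listAlt_ofFn v, Finset.mul_sum]
    refine Finset.sum_congr rfl fun τ _ => ?_
    rw [permEquiv_apply, ofFn_insertNth, sign_permEquiv]
    push_cast; ring

end ListForm

/-! ### Alternating forms as list forms -/

section ToList

open ListForm

variable {E F : Type*} [NormedAddCommGroup E] [NormedSpace ℝ E]
  [NormedAddCommGroup F] [NormedSpace ℝ F]

/-- An alternating form as a function on lists of vectors. -/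
def toList {k : ℕ} : (E [⋀^Fin k]→L[ℝ] ℝ) →ₗ[ℝ] ListForm E where
  toFun η := ⟨fun ws => if h : ws.length = k then η (fun i => ws.get (i.cast h.symm)) else 0⟩
  map_add' η θ := by ext ws; by_cases h : ws.length = k <;> simp [h]
  map_smul' c η := by ext ws; by_cases h : ws.length = k <;> simp [h]

theorem toList_of_ne {k : ℕ} (η : E [⋀^Fin k]→L[ℝ] ℝ) {ws : List E} (h : ws.length ≠ k) :
    toList η ws = 0 := dif_neg h

@[simp] theorem toList_ofFn {k : ℕ} (η : E [⋀^Fin k]→L[ℝ] ℝ) (u : Fin k → E) :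
    toList η (List.ofFn u) = η u := by
  simp only [toList, LinearMap.coe_mk, AddHom.coe_mk, List.length_ofFn, dite_true]
  congr 1; funext i; simp

theorem exists_ofFn {α : Type*} {k : ℕ} {ws : List α} (h : ws.length = k) :
    ∃ u : Fin k → α, ws = List.ofFn u := by
  subst h; exact ⟨_, (List.ofFn_get ws).symm⟩

theorem toList_injective {k : ℕ} : Function.Injective (toList (E := E) (k := k)) := by
  intro η θ h
  ext u
  rw [← toList_ofFn, h, toList_ofFn]

theorem toList_nil (η : E [⋀^Fin 0]→L[ℝ] ℝ) : toList η [] = η ![] := by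
  simpa using toList_ofFn η ![]

theorem toList_two (η : E [⋀^Fin 2]→L[ℝ] ℝ) (u v : E) : toList η [u, v] = η ![u, v] := by
  simpa using toList_ofFn η ![u, v]

theorem listForm_ext_of_degree {k : ℕ} {a b : ListForm E} (ha : ∀ ws, ws.length ≠ k → a ws = 0)
    (hb : ∀ ws, ws.length ≠ k → b ws = 0)
    (h : ∀ u : Fin k → E, a (List.ofFn u) = b (List.ofFn u)) : a = b := by
  ext ws
  by_cases hk : ws.length = k
  · obtain ⟨u, rfl⟩ := exists_ofFn hk; exact h u
  · rw [ha _ hk, hb _ hk]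

theorem isAlt_toList {k : ℕ} (η : E [⋀^Fin k]→L[ℝ] ℝ) : IsAlt k (toList η) where
  degree ws h := toList_of_ne η h
  insertIdx ws p w hp := by
    by_cases h : ws.length + 1 = k
    · subst h
      obtain ⟨u, hu⟩ := exists_ofFn (rfl : ws.length = ws.length)
      have e1 : ws.insertIdx p w = List.ofFn
          (Fin.insertNth (⟨p, by omega⟩ : Fin (ws.length + 1)) w u : Fin (ws.length + 1) → E) := by
        rw [ofFn_insertNth, ← hu]
      have e2 : w :: ws = List.ofFn (Fin.cons w u : Fin (ws.length + 1) → E) := by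
        rw [List.ofFn_cons, ← hu]
      rw [e1, e2, toList_ofFn, toList_ofFn, ContinuousAlternatingMap.map_insertNth]
      simp [Matrix.vecCons]
    · rw [toList_of_ne, toList_of_ne, mul_zero]
      · simpa using h
      · rwa [List.length_insertIdx_of_le_length hp]

theorem inv_toList_even {k : ℕ} (η : E [⋀^Fin (2 * k)]→L[ℝ] ℝ) : inv (toList η) = toList η :=
  (isAlt_toList η).inv_eq_self

theorem inv_toList_two (η : E [⋀^Fin 2]→L[ℝ] ℝ) : inv (toList η) = toList η :=
  inv_toList_even (k := 1) η

/-- The exterior product is the signed shuffle product. -/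
theorem toList_wedge {k l : ℕ} (α : E [⋀^Fin k]→L[ℝ] ℝ) (β : E [⋀^Fin l]→L[ℝ] ℝ) :
    toList (wedge α β) = toList α * toList β := by
  refine listForm_ext_of_degree (k := k + l) (fun ws h => toList_of_ne _ h)
    (fun ws h => mul_degree (isAlt_toList α).degree (isAlt_toList β).degree ws h) fun u => ?_
  have key := listAlt_tens (List.ofFn u) k l (toList α) (toList β) (isAlt_toList α)
    (isAlt_toList β) (by simp)
  have hk : (k.factorial * l.factorial : ℝ) ≠ 0 := by positivity
  rw [toList_ofFn, ← mul_right_inj' hk, ← key, listAlt_ofFn, wedge]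
  simp only [ContinuousAlternatingMap.smul_apply, smul_eq_mul,
    ContinuousMultilinearMap.alternatization_apply_apply]
  rw [mul_inv_cancel_left₀ hk]
  refine Finset.sum_congr rfl fun σ _ => ?_
  have e1 : (List.ofFn (u ∘ σ)).take k = List.ofFn (fun i : Fin k => u (σ (Fin.castAdd l i))) := by
    rw [show u ∘ σ = Fin.append (fun i : Fin k => u (σ (Fin.castAdd l i)))
      (fun i : Fin l => u (σ (Fin.natAdd k i))) by
        funext i; refine Fin.addCases (fun i => ?_) (fun i => ?_) i <;> simp]
    rw [List.ofFn_fin_append, List.take_left']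
    simp
  have e2 : (List.ofFn (u ∘ σ)).drop k = List.ofFn (fun i : Fin l => u (σ (Fin.natAdd k i))) := by
    rw [show u ∘ σ = Fin.append (fun i : Fin k => u (σ (Fin.castAdd l i)))
      (fun i : Fin l => u (σ (Fin.natAdd k i))) by
        funext i; refine Fin.addCases (fun i => ?_) (fun i => ?_) i <;> simp]
    rw [List.ofFn_fin_append, List.drop_left']
    simp
  rw [tens, e1, e2, toList_ofFn, toList_ofFn]
  simp only [Units.smul_def, zsmul_eq_mul]
  congr 1

theorem toList_castDeg {X : Type*} {k l : ℕ} (h : k = l) (η : DiffForm E X k) (x : X) :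
    toList (castDeg h η x) = toList (η x) := by
  subst h; rfl

theorem toList_curryLeft {k : ℕ} (η : E [⋀^Fin (k + 1)]→L[ℝ] ℝ) (w : E) :
    toList (η.curryLeft w) = ins w (toList η) := by
  refine listForm_ext_of_degree (k := k) (fun ws h => toList_of_ne _ h)
    (fun ws h => toList_of_ne _ (by simpa using h)) fun u => ?_
  rw [toList_ofFn, ins_apply, ← List.ofFn_cons, toList_ofFn]
  rfl

theorem toList_insertVectors {k : ℕ} : ∀ {l : ℕ} (w : Fin l → E) (θ : E [⋀^Fin (k + l)]→L[ℝ] ℝ)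
    (ws : List E), toList (insertVectors w θ) ws = toList θ (List.ofFn w ++ ws)
  | 0, w, θ, ws => by simp [insertVectors]
  | l + 1, w, θ, ws => by
    rw [insertVectors, toList_insertVectors, toList_curryLeft, ins_apply]
    simp

theorem toList_comp {k : ℕ} (η : F [⋀^Fin k]→L[ℝ] ℝ) (f : E →L[ℝ] F) (ws : List E) :
    toList (η.compContinuousLinearMap f) ws = toList η (ws.map f) := by
  by_cases h : ws.length = k
  · obtain ⟨u, rfl⟩ := exists_ofFn h
    rw [toList_ofFn, List.map_ofFn, toList_ofFn]; rfl
  · rw [toList_of_ne _ h, toList_of_ne _ (by simpa using h)]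

/-- Pullback of list forms. -/
theorem mul_map {a b : ListForm F} {a' b' : ListForm E} (f : E → F)
    (ha : ∀ ws : List E, a' ws = a (ws.map f)) (hb : ∀ ws : List E, b' ws = b (ws.map f))
    (ws : List E) : (a' * b') ws = (a * b) (ws.map f) := by
  induction ws generalizing a b a' b' with
  | nil => simp [mul_nil, ha, hb]
  | cons w ws ih =>
    rw [List.map_cons, mul_cons, mul_cons, ih (a := ins (f w) a) (b := b) (fun us => ha _) hb,
      ih (a := inv a) (b := ins (f w) b) (fun us => by simp [inv_apply, ha]) (fun us => hb _)]

theorem wedge_comp {k l : ℕ} (α : F [⋀^Fin k]→L[ℝ] ℝ) (β : F [⋀^Fin l]→L[ℝ] ℝ) (f : E →L[ℝ] F) :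
    wedge (α.compContinuousLinearMap f) (β.compContinuousLinearMap f) =
      (wedge α β).compContinuousLinearMap f := by
  apply toList_injective
  ext ws
  rw [toList_wedge, toList_comp, toList_wedge]
  exact mul_map f (fun _ => toList_comp _ _ _) (fun _ => toList_comp _ _ _) ws

theorem toList_constOfIsEmpty (c : ℝ) :
    toList (ContinuousAlternatingMap.constOfIsEmpty ℝ E (Fin 0) c) = c • (1 : ListForm E) := by
  refine listForm_ext_of_degree (k := 0) (fun ws h => toList_of_ne _ h) (fun ws h => ?_)
    fun u => ?_
  · cases ws with
    | nil => simp at h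
    | cons w ws => simp
  · rw [toList_ofFn]; simp

theorem toList_wedgePow {X : Type*} (η : DiffForm E X 2) (N : ℕ) (x : X) :
    toList (wedgePow η N x) = toList (η x) ^ N := by
  induction N with
  | zero => rw [pow_zero]; exact (toList_constOfIsEmpty 1).trans (one_smul _ _)
  | succ N ih => rw [pow_succ, ← ih]; exact toList_wedge _ _

/-! ### Leibniz rule for the alternatization -/

/-- The alternatization of a linear family of list forms. -/
def listD : List E → (E → ListForm E) → ℝ
  | [], _ => 0
  | w :: ws, G => G w ws - listD ws (fun v => ins w (G v))

theorem listD_add (ws : List E) : ∀ G H : E → ListForm E,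
    listD ws (fun v => G v + H v) = listD ws G + listD ws H := by
  induction ws with
  | nil => intro G H; simp [listD]
  | cons w ws ih => intro G H; simp only [listD, ins_add, ih, add_apply]; ring

theorem listD_neg (ws : List E) : ∀ G : E → ListForm E,
    listD ws (fun v => -G v) = -listD ws G := by
  induction ws with
  | nil => intro G; simp [listD]
  | cons w ws ih => intro G; simp only [listD, ins_neg, ih, neg_apply]; ring

theorem listD_ofFn : ∀ {N : ℕ} (v : Fin (N + 1) → E) (G : E → ListForm E),
    listD (List.ofFn v) G = ∑ i : Fin (N + 1), (-1 : ℝ) ^ (i : ℕ) * G (v i) (List.ofFn (i.removeNth v))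
  | 0, v, G => by simp [listD]
  | N + 1, v, G => by
    obtain ⟨w, u, rfl⟩ : ∃ x u, v = Fin.cons x u := ⟨v 0, Fin.tail v, (Fin.cons_self_tail v).symm⟩
    rw [List.ofFn_cons, listD, listD_ofFn u, Fin.sum_univ_succ (n := N + 1)]
    have e (i : Fin (N + 1)) : i.succ.removeNth (Fin.cons w u : Fin (N + 2) → E) =
        Fin.cons w (i.removeNth u) := by
      funext j
      induction j using Fin.cases with
      | zero => simp [Fin.removeNth]
      | succ j => simp [Fin.removeNth]
    simp only [Fin.cons_zero, Fin.removeNth_zero, Fin.tail_cons, e, List.ofFn_cons, Fin.cons_succ,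
      Fin.val_succ, Fin.val_zero, pow_zero, one_mul, pow_succ, mul_neg, mul_one, neg_mul,
      Finset.sum_neg_distrib, sub_eq_add_neg, ins_apply]

/-- The alternatization, as a list form. -/
def alternate (G : E → ListForm E) : ListForm E := ⟨fun ws => listD ws G⟩

theorem ins_alternate (w : E) (G : E → ListForm E) :
    ins w (alternate G) = G w - alternate (fun v => ins w (G v)) := rfl

theorem inv_alternate (G : E → ListForm E) :
    inv (alternate G) = -alternate (fun v => inv (G v)) := by
  ext ws
  induction ws generalizing G with
  | nil => simp [inv_apply, alternate, listD]
  | cons w ws ih =>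
    have := ih (fun v => ins w (G v))
    simp only [inv_apply, alternate, listD, List.length_cons, pow_succ, neg_apply, ins_inv,
      listD_neg] at this ⊢
    linear_combination this

/-- A factor on the right can be pulled out of an alternatization. -/
theorem alternate_mul (G : E → ListForm E) (b : ListForm E) :
    alternate (fun v => G v * b) = alternate G * b := by
  ext ws
  induction ws generalizing G b with
  | nil => simp [alternate, listD, mul_nil]
  | cons w ws ih =>
    have h1 := ih (fun v => ins w (G v)) b
    have h2 := ih (fun v => inv (G v)) (ins w b)
    rw [mul_cons, ins_alternate, inv_alternate, sub_mul, neg_mul, sub_apply, neg_apply, ← h1, ← h2]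
    simp only [alternate, listD, ins_mul, listD_add]
    ring

/-- A factor on the left can be pulled out of an alternatization, up to the grading involution: the
new argument has to move past it. -/
theorem mul_alternate (a : ListForm E) (G : E → ListForm E) :
    alternate (fun v => a * G v) = inv a * alternate G := by
  ext ws
  induction ws generalizing G a with
  | nil => simp [alternate, listD, mul_nil]
  | cons w ws ih =>
    have h1 := ih (ins w a) G
    have h2 := ih (inv a) (fun v => ins w (G v))
    rw [mul_cons, ins_alternate, inv_inv, ins_inv, mul_sub, neg_mul, sub_apply, neg_apply, ← h1]
    rw [inv_inv] at h2
    rw [← h2]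
    simp only [alternate, listD, ins_mul, listD_add]
    ring

/-- The alternatization that defines the exterior derivative is `alternate`. -/
theorem toList_alternatizeUncurryFin {k : ℕ} (f : E →L[ℝ] E [⋀^Fin k]→L[ℝ] ℝ) :
    toList (ContinuousAlternatingMap.alternatizeUncurryFin f) =
      alternate (fun v => toList (f v)) := by
  -- Off the degree `k + 1` both sides vanish.
  have deg : ∀ (ws : List E) (k : ℕ) (G : E → ListForm E),
      (∀ v us, us.length ≠ k → G v us = 0) → ws.length ≠ k + 1 → listD ws G = 0 := by
    intro ws
    induction ws with
    | nil => intros; rfl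
    | cons w ws ih =>
      intro k G hG h
      rw [listD, hG _ _ (by simpa using h), zero_sub, neg_eq_zero]
      rcases k with _ | k
      · have : (fun v => ins w (G v)) = fun v => -(0 : ListForm E) := by
          funext v; ext us; rw [ins_apply, hG _ _ (by simp)]; simp
        rw [this, listD_neg]
        have : ∀ us : List E, listD us (fun _ => (0 : ListForm E)) = 0 := by
          intro us; simpa using listD_add us (fun _ => (0 : ListForm E)) (fun _ => 0)
        rw [this, neg_zero]
      · exact ih k _ (fun v us hu => hG _ _ (by simpa using hu)) (by simpa using h)
  refine listForm_ext_of_degree (k := k + 1) (fun ws h => toList_of_ne _ h)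
    (fun ws h => deg ws k _ (fun v us => toList_of_ne _) h) ?_
  intro u
  rw [toList_ofFn, ContinuousAlternatingMap.alternatizeUncurryFin_apply]
  change _ = listD (List.ofFn u) _
  rw [listD_ofFn]
  simp

end ToList

/-! ### Powers of two-forms -/

namespace ListForm

variable {E : Type*}

theorem mul_apply_eq_zero_left {a b : ListForm E} (ws : List E)
    (ha : ∀ us : List E, (∀ u ∈ us, u ∈ ws) → us.length ≤ ws.length → a us = 0) :
    (a * b) ws = 0 := by
  rw [mul_congr (a' := 0) (b' := b) {u | u ∈ ws} ws (fun _ h => h) (fun us h h' => ha us h h')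
    (fun _ _ _ => rfl), zero_mul]
  rfl

theorem sum_mul_apply {ι : Type*} (s : Finset ι) (f : ι → ListForm E) (a : ListForm E)
    (ws : List E) : (a * ∑ i ∈ s, f i) ws = ∑ i ∈ s, (a * f i) ws := by
  rw [Finset.mul_sum, sum_apply]

/-- A one-form that vanishes on the last vectors of a list only sees the first ones. -/
theorem mul_append {a : ListForm E} (ha : IsAlt 1 a) (b : ListForm E) (ws : List E)
    (h : ∀ w ∈ ws, a [w] = 0) (fs : List E) :
    (a * b) (fs ++ ws) = (a * ⟨fun us => b (us ++ ws)⟩) fs := by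
  induction fs generalizing a b with
  | nil =>
    rw [List.nil_append, mul_nil, ha.degree [] (by simp), zero_mul]
    refine mul_apply_eq_zero_left ws fun us hus _ => ?_
    rcases us with _ | ⟨u, _ | ⟨v, us⟩⟩
    · exact ha.degree _ (by simp)
    · exact h u (hus u (by simp))
    · exact ha.degree _ (by simp)
  | cons f fs ih =>
    have e1 : ins f a = a [f] • (1 : ListForm E) := by
      ext us
      rcases us with _ | ⟨u, us⟩
      · simp [ins_apply]
      · rw [ins_apply, ha.degree _ (by simp)]; simp
    have e2 : inv a = -a := by rw [ha.inv_eq]; simp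
    rw [List.cons_append, mul_cons, mul_cons, e1, e2, smul_mul_assoc, smul_mul_assoc, one_mul,
      one_mul, neg_mul, neg_mul, neg_apply, neg_apply, ih ha _ h]
    rfl

/-- A power of a two-form `a`, evaluated on two lists of vectors that are `a`-orthogonal to each
other, is given by the binomial theorem. -/
theorem pow_append {a : ListForm E} (ha : IsAlt 2 a) (ws : List E) (L : ℕ) :
    ∀ (N : ℕ) (fs : List E), fs.length ≤ L → (∀ f ∈ fs, ∀ w ∈ ws, a [f, w] = 0) →
      (a ^ N) (fs ++ ws) =
        ∑ j ∈ Finset.range (N + 1), (N.choose j : ℝ) * ((a ^ j) fs * (a ^ (N - j)) ws) := by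
  have hev : inv a = a := ha.inv_eq_self (k := 1)
  have nilpow : ∀ j : ℕ, (a ^ (j + 1)) [] = 0 := fun j => by
    rw [pow_succ, mul_nil, ha.degree [] (by simp), mul_zero]
  -- Insertion of the first vector `f` turns `a ^ (N + 1)` into `(N + 1) • ins f a * a ^ N`. The
  -- one-form `ins f a` vanishes on `ws`, so that only the remaining vectors of the first list pair
  -- with it, and the induction hypothesis applies to the factor `a ^ N`.
  induction L with
  | zero =>
    intro N fs hfs _
    obtain rfl : fs = [] := by simpa using hfs
    rw [Finset.sum_range_succ', Finset.sum_eq_zero (fun j _ => by rw [nilpow]; ring)]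
    simp
  | succ L ih =>
    intro N fs hfs horth
    rcases fs with _ | ⟨f, fs⟩
    · rw [Finset.sum_range_succ', Finset.sum_eq_zero (fun j _ => by rw [nilpow]; ring)]
      simp
    rcases N with _ | N
    · simp
    have hf : IsAlt 1 (ins f a) := ha.ins f
    have e : ∀ (j : ℕ) (us : List E), (a ^ (j + 1)) (f :: us) =
        ((j : ℝ) + 1) * (ins f a * a ^ j) us := fun j us => by
      rw [← ins_apply, ins_pow hev]; rfl
    rw [List.cons_append, e, mul_append hf _ _ (horth f (by simp)),
      mul_congr (a' := ins f a) (b' := ∑ j ∈ Finset.range (N + 1),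
        ((N.choose j : ℝ) * (a ^ (N - j)) ws) • a ^ j) {f | ∀ w ∈ ws, a [f, w] = 0} fs
        (fun g hg => horth g (by simp [hg])) (fun _ _ _ => rfl),
      sum_mul_apply, Finset.sum_range_succ' _ (N + 1), Finset.mul_sum]
    · simp only [pow_zero, one_cons, zero_mul, mul_zero, add_zero, mul_smul_comm, smul_apply]
      refine Finset.sum_congr rfl fun j _ => ?_
      rw [e, Nat.add_sub_add_right]
      have := congrArg (Nat.cast (R := ℝ)) (Nat.add_one_mul_choose_eq N j)
      push_cast at this
      linear_combination ((a ^ (N - j)) ws * (ins f a * a ^ j) fs) * this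
    · intro us hus hl
      change (a ^ N) (us ++ ws) = _
      rw [ih N us (by simp at hfs; omega) hus, sum_apply]
      exact Finset.sum_congr rfl fun j _ => by rw [smul_apply]; ring

theorem pow_degree {a : ListForm E} (ha : IsAlt 2 a) (N : ℕ) (ws : List E)
    (h : ws.length ≠ 2 * N) : (a ^ N) ws = 0 := by
  induction N generalizing ws with
  | zero =>
    cases ws with
    | nil => simp at h
    | cons w ws => rfl
  | succ N ih => rw [pow_succ]; exact mul_degree ih ha.degree ws (by omega)

/-- If the first list has `2 n` vectors, only one term of the binomial expansion survives. -/
theorem pow_append_of_length {a : ListForm E} (ha : IsAlt 2 a) {fs ws : List E} {n : ℕ} (i : ℕ)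
    (hfs : fs.length = 2 * n) (h : ∀ f ∈ fs, ∀ w ∈ ws, a [f, w] = 0) :
    (a ^ (n + i)) (fs ++ ws) = ((n + i).choose n : ℝ) * ((a ^ n) fs * (a ^ i) ws) := by
  rw [pow_append ha ws _ (n + i) fs le_rfl h, Finset.sum_eq_single n]
  · rw [Nat.add_sub_cancel_left]
  · intro j _ hj
    rw [pow_degree ha j fs (by omega)]; ring
  · intro hn; simp at hn

/-- The list `p a, q a, p b, q b, …`. -/
def frame {ι : Type*} (p q : ι → E) (l : List ι) : List E := l.flatMap fun a => [p a, q a]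

@[simp] theorem frame_nil {ι : Type*} (p q : ι → E) : frame p q [] = [] := rfl
@[simp] theorem frame_cons {ι : Type*} (p q : ι → E) (a : ι) (l : List ι) :
    frame p q (a :: l) = p a :: q a :: frame p q l := rfl

theorem length_frame {ι : Type*} (p q : ι → E) (l : List ι) :
    (frame p q l).length = 2 * l.length := by
  induction l with
  | nil => rfl
  | cons a l ih => simp [ih]; ring

theorem mem_frame {ι : Type*} {p q : ι → E} {l : List ι} {w : E} :
    w ∈ frame p q l ↔ ∃ a ∈ l, w = p a ∨ w = q a := by
  simp [frame]

/-- Exterior multiplication by `w ^ k` in a frame adapted to `w`: only the `w`-orthogonal planes of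
the frame matter, so that the value is a sum over the ways to give `r` of them to the other factor.
The proof inserts the first plane `p a, q a`. -/
theorem pow_mul_frame {ι : Type*} (p q : ι → E) {w : ListForm E} (hw : IsAlt 2 w) (c : ℝ)
    (hc : ∀ a, w [p a, q a] = c) (hpp : ∀ a b, a ≠ b → w [p a, p b] = 0)
    (hpq : ∀ a b, a ≠ b → w [p a, q b] = 0) (hqp : ∀ a b, a ≠ b → w [q a, p b] = 0)
    (hqq : ∀ a b, a ≠ b → w [q a, q b] = 0) (l : List ι) (hl : l.Nodup) :
    ∀ (k r : ℕ) (x : ListForm E), l.length = k + r →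
      (w ^ k * x) (frame p q l) =
        k.factorial * c ^ k * ((l.sublistsLen r).map fun l' => x (frame p q l')).sum := by
  have hev : inv w = w := hw.inv_eq_self (k := 1)
  induction l with
  | nil =>
    intro k r x h
    obtain ⟨rfl, rfl⟩ : k = 0 ∧ r = 0 := by simp at h; omega
    simp
  | cons a l ih =>
    intro k r x h
    have hal : a ∉ l := (List.nodup_cons.1 hl).1
    have ihl := ih (List.nodup_cons.1 hl).2
    rcases k with _ | k
    · rw [show r = (a :: l).length by simpa using h.symm, List.sublistsLen_length]
      simp
    have hlen : l.length = k + r := by simp at h; omega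
    -- The one-forms `w (p a, ·)` and `w (q a, ·)` vanish on the rest of the frame.
    have van1 : ∀ y z : ListForm E, (ins (p a) w * y * z) (frame p q l) = 0 := fun y z => by
      rw [mul_assoc]
      refine mul_apply_eq_zero_left _ fun us hus _ => ?_
      rcases us with _ | ⟨u, _ | ⟨v, us⟩⟩
      · exact hw.degree _ (by simp)
      · obtain ⟨b, hb, rfl | rfl⟩ := mem_frame.1 (hus u (by simp))
        · exact hpp a b (fun e => hal (e ▸ hb))
        · exact hpq a b (fun e => hal (e ▸ hb))
      · exact hw.degree _ (by simp)
    have van2 : ∀ y z : ListForm E, (ins (q a) w * y * z) (frame p q l) = 0 := fun y z => by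
      rw [mul_assoc]
      refine mul_apply_eq_zero_left _ fun us hus _ => ?_
      rcases us with _ | ⟨u, _ | ⟨v, us⟩⟩
      · exact hw.degree _ (by simp)
      · obtain ⟨b, hb, rfl | rfl⟩ := mem_frame.1 (hus u (by simp))
        · exact hqp a b (fun e => hal (e ▸ hb))
        · exact hqq a b (fun e => hal (e ▸ hb))
      · exact hw.degree _ (by simp)
    -- Both vectors of the plane inserted in the same factor `w` give the constant `c`.
    have hpqw : ins (q a) (ins (p a) w) = c • (1 : ListForm E) := by
      ext us
      rcases us with _ | ⟨u, us⟩
      · simp [ins_apply, hc]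
      · rw [ins_apply, ins_apply, hw.degree _ (by simp)]; simp
    have hinvp : inv (ins (p a) w) = -ins (p a) w := by
      rw [(hw.ins (p a)).inv_eq]; simp
    -- The plane `p a, q a` goes either to one of the factors `w` or to `x`.
    have step : (w ^ (k + 1) * x) (frame p q (a :: l)) =
        ((k : ℝ) + 1) * c * (w ^ k * x) (frame p q l) +
          (w ^ (k + 1) * ins (q a) (ins (p a) x)) (frame p q l) := by
      rw [frame_cons, ← ins_apply, ← ins_apply, ins_mul, ins_pow hev, inv_pow hev, ins_add,
        ins_mul, ins_mul, ins_smul, inv_smul, ins_mul, inv_mul, hinvp, hpqw, ins_pow hev,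
        inv_pow hev, inv_pow hev]
      simp only [smul_mul_assoc, add_mul, one_mul, neg_mul, add_apply, smul_apply, neg_apply, van1,
        van2, smul_add]
      ring
    have second : (w ^ (k + 1) * ins (q a) (ins (p a) x)) (frame p q l) =
        (k + 1).factorial * c ^ (k + 1) *
          ((l.sublistsLen r).map fun l' => x (frame p q l')).sum -
        ((k : ℝ) + 1) * c * (w ^ k * x) (frame p q l) +
        (w ^ (k + 1) * ins (q a) (ins (p a) x)) (frame p q l) := by
      rw [ihl k r x hlen, Nat.factorial_succ]; push_cast; ring
    rw [step, second]
    rcases r with _ | r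
    · have : (w ^ (k + 1) * ins (q a) (ins (p a) x)) (frame p q l) = 0 :=
        mul_apply_eq_zero_left _ fun us _ hus => pow_degree hw _ us (by
          rw [length_frame] at hus; omega)
      rw [this]; simp
    · rw [ihl (k + 1) r _ (by omega), List.sublistsLen_succ_cons, List.map_append, List.sum_append,
        List.map_map]
      simp only [Function.comp_def, frame_cons, ins_apply]
      ring

/-- A sum over pairs as half of a double sum. -/
theorem two_mul_sum_sublistsLen_two {ι : Type*} (f : ι → ι → ℝ) (hs : ∀ a b, f a b = f b a)
    (h0 : ∀ a, f a a = 0) (F : List ι → ℝ) (hF : ∀ a b, F [a, b] = f a b) (l : List ι) :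
    2 * ((l.sublistsLen 2).map F).sum = (l.map fun a => (l.map fun b => f a b).sum).sum := by
  induction l with
  | nil => simp
  | cons a l ih =>
    have e : ((l.map fun x => f x a).sum) = (l.map fun x => f a x).sum := by
      congr 1; exact List.map_congr_left fun x _ => hs x a
    have e2 : (((l.sublistsLen 1).map (List.cons a)).map F).sum = (l.map fun x => f a x).sum := by
      rw [List.sublistsLen_one, List.map_map, List.map_map, List.map_reverse, List.sum_reverse]
      congr 1; exact List.map_congr_left fun x _ => hF a x
    rw [List.sublistsLen_succ_cons, List.map_append, List.sum_append, mul_add, ih, e2]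
    simp only [List.map_cons, List.sum_cons, h0, List.sum_map_add, e]
    ring

end ListForm

/-! ### Real forms of type (1,1) -/

section OneOne

open ListForm

variable {E : Type*} [NormedAddCommGroup E] [NormedSpace ℝ E] [NormedSpace ℂ E]
  [IsScalarTower ℝ ℂ E]

theorem two_add_left (η : E [⋀^Fin 2]→L[ℝ] ℝ) (u u' v : E) :
    η ![u + u', v] = η ![u, v] + η ![u', v] := by
  have : η.curryLeft (u + u') ![v] = η.curryLeft u ![v] + η.curryLeft u' ![v] := by
    rw [map_add]; rfl
  exact this

theorem two_smul_left (η : E [⋀^Fin 2]→L[ℝ] ℝ) (c : ℝ) (u v : E) :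
    η ![c • u, v] = c * η ![u, v] := by
  have : η.curryLeft (c • u) ![v] = c * η.curryLeft u ![v] := by
    rw [map_smul]; rfl
  exact this

theorem two_swap (η : E [⋀^Fin 2]→L[ℝ] ℝ) (u v : E) : η ![u, v] = -η ![v, u] := by
  have h : ∀ w, η ![w, w] = 0 := fun w =>
    η.map_eq_zero_of_eq _ (i := 0) (j := 1) rfl (by simp)
  have hs : ∀ x y z, η ![x, y + z] = η ![x, y] + η ![x, z] := by
    intro x y z
    have : (η.curryLeft x).curryLeft (y + z) ![] = (η.curryLeft x).curryLeft y ![] +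
      (η.curryLeft x).curryLeft z ![] := by rw [map_add]; rfl
    exact this
  have := h (u + v)
  rw [two_add_left, hs, hs, h, h] at this
  linarith

theorem two_add_right (η : E [⋀^Fin 2]→L[ℝ] ℝ) (u v v' : E) :
    η ![u, v + v'] = η ![u, v] + η ![u, v'] := by
  rw [two_swap, two_add_left, two_swap η v, two_swap η v']; ring

theorem two_smul_right (η : E [⋀^Fin 2]→L[ℝ] ℝ) (c : ℝ) (u v : E) :
    η ![u, c • v] = c * η ![u, v] := by
  rw [two_swap, two_smul_left, two_swap η v]; ring

/-- Real two-forms of type `(1,1)`: those invariant under multiplication by `√-1`. -/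
def IsOneOne (η : E [⋀^Fin 2]→L[ℝ] ℝ) : Prop :=
  ∀ u v, η ![Complex.I • u, Complex.I • v] = η ![u, v]

theorem I_smul_I_smul (u : E) : Complex.I • Complex.I • u = (-1 : ℝ) • u := by
  rw [smul_smul, Complex.I_mul_I, neg_smul, neg_smul, one_smul, one_smul]

theorem IsOneOne.left {η : E [⋀^Fin 2]→L[ℝ] ℝ} (h : IsOneOne η) (u v : E) :
    η ![Complex.I • u, v] = -η ![u, Complex.I • v] := by
  rw [← h u, I_smul_I_smul, two_smul_right]; ring

theorem IsOneOne.symm {η : E [⋀^Fin 2]→L[ℝ] ℝ} (h : IsOneOne η) (u v : E) :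
    η ![u, Complex.I • v] = η ![v, Complex.I • u] := by
  rw [two_swap, h.left]; ring

theorem complex_smul_eq (c : ℂ) (u : E) : c • u = c.re • u + c.im • (Complex.I • u) := by
  conv_lhs => rw [← Complex.re_add_im c, add_smul, mul_smul]
  have e : ∀ (r : ℝ) (v : E), ((r : ℂ)) • v = r • v := fun r v => by
    conv_rhs => rw [← one_smul ℂ v, ← smul_assoc, Complex.real_smul, mul_one]
  rw [e, e]

theorem hermCoeff_add_left (η : E [⋀^Fin 2]→L[ℝ] ℝ) (u u' v : E) :
    hermCoeff η (u + u') v = hermCoeff η u v + hermCoeff η u' v := by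
  simp only [hermCoeff, two_add_left]; push_cast; ring

theorem hermCoeff_smul_left {η : E [⋀^Fin 2]→L[ℝ] ℝ} (h : IsOneOne η) (c : ℂ) (u v : E) :
    hermCoeff η (c • u) v = c * hermCoeff η u v := by
  simp only [hermCoeff, complex_smul_eq c u, two_add_left, two_smul_left, h.left, I_smul_I_smul,
    two_smul_right]
  conv_rhs => rw [← Complex.re_add_im c]
  push_cast
  linear_combination (c.im * (η ![u, v] : ℂ) / 2) * Complex.I_sq

theorem hermCoeff_conj {η : E [⋀^Fin 2]→L[ℝ] ℝ} (h : IsOneOne η) (u v : E) :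
    (starRingEnd ℂ) (hermCoeff η v u) = hermCoeff η u v := by
  simp only [hermCoeff, h.symm v u, two_swap η v u]
  simp [Complex.conj_ofNat]
  ring

theorem hermCoeff_add_right {η : E [⋀^Fin 2]→L[ℝ] ℝ} (h : IsOneOne η) (u v v' : E) :
    hermCoeff η u (v + v') = hermCoeff η u v + hermCoeff η u v' := by
  rw [← hermCoeff_conj h, hermCoeff_add_left, map_add, hermCoeff_conj h, hermCoeff_conj h]

theorem hermCoeff_smul_right {η : E [⋀^Fin 2]→L[ℝ] ℝ} (h : IsOneOne η) (c : ℂ) (u v : E) :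
    hermCoeff η u (c • v) = (starRingEnd ℂ) c * hermCoeff η u v := by
  rw [← hermCoeff_conj h, hermCoeff_smul_left h, map_mul, hermCoeff_conj h]

theorem hermCoeff_self {η : E [⋀^Fin 2]→L[ℝ] ℝ} (u : E) :
    hermCoeff η u u = ((η ![u, Complex.I • u] / 2 : ℝ) : ℂ) := by
  have : η ![u, u] = 0 := η.map_eq_zero_of_eq _ (i := 0) (j := 1) rfl (by simp)
  simp [hermCoeff, this]

theorem two_eq_hermCoeff (η : E [⋀^Fin 2]→L[ℝ] ℝ) (u v : E) :
    η ![u, v] = -2 * (hermCoeff η u v).im := by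
  simp [hermCoeff]
  ring

theorem exists_orthonormal_basis {V : Type*} [AddCommGroup V] [Module ℂ V] [FiniteDimensional ℂ V]
    (cd : InnerProductSpace.Core ℂ V) :
    ∃ b : Module.Basis (Fin (Module.finrank ℂ V)) ℂ V,
      ∀ i j, cd.inner (b i) (b j) = if i = j then 1 else 0 := by
  let : NormedAddCommGroup V := cd.toNormedAddCommGroup
  let : InnerProductSpace ℂ V := InnerProductSpace.ofCore cd.toCore
  refine ⟨(stdOrthonormalBasis ℂ V).toBasis, fun i j => ?_⟩
  have := orthonormal_iff_ite.1 (stdOrthonormalBasis ℂ V).orthonormal i j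
  simpa using this

/-- A positive `(1,1)`-form has a unitary basis. -/
theorem exists_unitary_basis [FiniteDimensional ℂ E] {η : E [⋀^Fin 2]→L[ℝ] ℝ} (h : IsOneOne η)
    (hpos : ∀ u, u ≠ 0 → 0 < η ![u, Complex.I • u]) {d : ℕ} (hd : Module.finrank ℂ E = d) :
    ∃ b : Module.Basis (Fin d) ℂ E, ∀ i j, η ![b i, b j] = 0 ∧
      η ![b i, Complex.I • b j] = if i = j then 1 else 0 := by
  subst hd
  -- The arguments are swapped because Mathlib takes inner products conjugate linear in the first
  -- argument, and the factor `2` turns the coefficient `η ![u, √-1 u] / 2` into `1` on unit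
  -- vectors.
  let cd : InnerProductSpace.Core ℂ E :=
    { inner := fun u v => 2 * hermCoeff η v u
      conj_inner_symm := fun u v => by
        rw [map_mul, hermCoeff_conj h, Complex.conj_ofNat]
      re_inner_nonneg := fun u => by
        rw [hermCoeff_self]
        rcases eq_or_ne u 0 with rfl | hu
        · have := two_smul_left η 0 0 (Complex.I • (0 : E))
          rw [zero_smul, zero_mul] at this
          simp only [this]; simp
        · have := hpos u hu
          simp; linarith
      add_left := fun u v w => by rw [hermCoeff_add_right h]; ring
      smul_left := fun u v r => by rw [hermCoeff_smul_right h]; ring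
      definite := fun u hu => by
        by_contra hne
        rw [hermCoeff_self] at hu
        have := hpos u hne
        have h2 : ((2 : ℂ) * ((η ![u, Complex.I • u] / 2 : ℝ) : ℂ)) = ((η ![u, Complex.I • u] : ℝ) : ℂ)
          := by push_cast; ring
        rw [h2, Complex.ofReal_eq_zero] at hu
        linarith }
  obtain ⟨b, hb⟩ := exists_orthonormal_basis cd
  refine ⟨b, fun i j => ?_⟩
  have e : ((η ![b i, Complex.I • b j] : ℝ) : ℂ) - Complex.I * (η ![b i, b j] : ℝ) =
      if j = i then 1 else 0 := by
    rw [← hb j i]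
    change _ = 2 * hermCoeff η (b i) (b j)
    rw [hermCoeff]; ring
  have e1 := congrArg Complex.re e
  have e2 := congrArg Complex.im e
  constructor
  · split_ifs at e2 <;> simpa using e2
  · simp only [eq_comm (a := i)]
    split_ifs at e1 ⊢ <;> simpa using e1

/-- The product of a `(1,1)`-form with itself on two complex lines is a multiple of a principal two by
two minor of its matrix of coefficients. -/
theorem sq_apply_lines {η : E [⋀^Fin 2]→L[ℝ] ℝ} (h : IsOneOne η) (u v : E) :
    (toList η * toList η) [u, Complex.I • u, v, Complex.I • v] =
      2 * (η ![u, Complex.I • u] * η ![v, Complex.I • v] - η ![u, v] ^ 2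
        - η ![u, Complex.I • v] ^ 2) := by
  simp only [mul_cons, mul_nil, ins_apply, inv_apply, List.length_cons, List.length_nil]
  have z : ∀ ws : List E, ws.length ≠ 2 → toList η ws = 0 := fun ws => toList_of_ne η
  rw [z [], z [u], z [Complex.I • u], z [v], z [Complex.I • v],
    z [u, Complex.I • u, v], z [u, Complex.I • u, Complex.I • v], z [u, v, Complex.I • v],
    z [Complex.I • u, v, Complex.I • v], z [u, Complex.I • u, v, Complex.I • v]]
  · simp only [toList_two, h.left, I_smul_I_smul, two_smul_right]
    ring
  all_goals simp

end OneOne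

/-! ### Top-degree forms and the Hodge-Riemann relation -/

section TopForms

open ListForm

variable {E : Type*} [NormedAddCommGroup E] [NormedSpace ℝ E]

/-- A top-degree form is multiplied by the determinant under a linear change of frame. -/
theorem topForm_map {N : ℕ} (hN : Module.finrank ℝ E = N) [FiniteDimensional ℝ E]
    (f : E [⋀^Fin N]→L[ℝ] ℝ) (A : E →ₗ[ℝ] E) (v : Fin N → E) :
    f (fun i => A (v i)) = LinearMap.det A * f v := by
  let e : Module.Basis (Fin N) ℝ E := Module.finBasisOfFinrankEq ℝ E hN
  have key : ∀ w : Fin N → E, f w = f e * e.det w := fun w => by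
    have := AlternatingMap.eq_smul_basis_det e f.toAlternatingMap
    have := congrArg (fun g : E [⋀^Fin N]→ₗ[ℝ] ℝ => g w) this
    simpa using this
  rw [key v, key, show (fun i => A (v i)) = A ∘ v from rfl, Module.Basis.det_comp]
  ring

/-- The standard frame lists the standard basis vectors, each followed by its multiple by `√-1`. -/
theorem stdFrame_eq_frame (d : ℕ) : List.ofFn (stdFrame d) =
    frame (fun a => Pi.single a (1 : ℂ)) (fun a => Complex.I • Pi.single a (1 : ℂ))
      (List.finRange d) := by
  rw [List.ofFn_mul', frame, List.flatMap_def, List.finRange, List.map_ofFn]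
  congr 1
  congr 1
  funext a
  simp only [List.ofFn_succ, List.ofFn_zero, Function.comp_apply]
  congr 1
  · funext b
    simp [stdFrame, Pi.single_apply, Fin.ext_iff]
  · congr 1
    funext b
    have h1 : (2 * (a : ℕ) + 1) / 2 = a := by omega
    simp [stdFrame, Pi.single_apply, Fin.ext_iff, h1]

/-- Complex linear isomorphisms preserve the orientation: the real determinant is `|det|²`. -/
theorem det_restrictScalars_pos {d : ℕ} (A : (Fin d → ℂ) →ₗ[ℂ] (Fin d → ℂ))
    (hA : LinearMap.det A ≠ 0) : 0 < LinearMap.det (A.restrictScalars ℝ) := by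
  rw [LinearMap.det_restrictScalars, Algebra.norm_complex_apply]
  exact Complex.normSq_pos.2 hA

theorem finrank_real_pi (d : ℕ) : Module.finrank ℝ (Fin d → ℂ) = 2 * d := by
  rw [finrank_real_of_complex, Module.finrank_fin_fun]

/-- Complex linear changes of frame are positive. -/
theorem topForm_frame {d : ℕ} (b : Module.Basis (Fin d) ℂ (Fin d → ℂ)) :
    ∃ r : ℝ, 0 < r ∧ ∀ f : (Fin d → ℂ) [⋀^Fin (2 * d)]→L[ℝ] ℝ,
      toList f (frame b (fun a => Complex.I • b a) (List.finRange d)) = r * f (stdFrame d) := by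
  let A : (Fin d → ℂ) ≃ₗ[ℂ] (Fin d → ℂ) := (Pi.basisFun ℂ (Fin d)).equiv b (Equiv.refl _)
  have hA : ∀ a, A (Pi.single a 1) = b a := fun a => by
    have := (Pi.basisFun ℂ (Fin d)).equiv_apply a b (Equiv.refl _)
    simpa using this
  refine ⟨_, det_restrictScalars_pos A.toLinearMap A.isUnit_det'.ne_zero, fun f => ?_⟩
  rw [← topForm_map (finrank_real_pi d), ← toList_ofFn,
    show List.ofFn (fun i => (A.toLinearMap.restrictScalars ℝ) (stdFrame d i)) =
      (List.ofFn (stdFrame d)).map A by rw [List.map_ofFn]; rfl, stdFrame_eq_frame]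
  congr 1
  simp [frame, List.map_flatMap, hA]

variable [NormedSpace ℂ E] [IsScalarTower ℝ ℂ E]

theorem hermCoeff_sum_left {ι : Type*} (η : E [⋀^Fin 2]→L[ℝ] ℝ) (s : Finset ι) (f : ι → E) (v : E) :
    hermCoeff η (∑ i ∈ s, f i) v = ∑ i ∈ s, hermCoeff η (f i) v := by
  let F : E →+ ℂ := AddMonoidHom.mk' (fun u => hermCoeff η u v)
    (fun u u' => hermCoeff_add_left η u u' v)
  exact map_sum F f s

theorem hermCoeff_sum_right {ι : Type*} {η : E [⋀^Fin 2]→L[ℝ] ℝ} (h : IsOneOne η) (s : Finset ι)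
    (f : ι → E) (u : E) :
    hermCoeff η u (∑ i ∈ s, f i) = ∑ i ∈ s, hermCoeff η u (f i) := by
  rw [← hermCoeff_conj h, hermCoeff_sum_left, map_sum]
  simp [hermCoeff_conj h]

/-- Sesquilinear expansion of the coefficients in a family of vectors. -/
theorem hermCoeff_expand {ι κ : Type*} {η : E [⋀^Fin 2]→L[ℝ] ℝ} (h : IsOneOne η)
    (s : Finset ι) (t : Finset κ) (x : ι → ℂ) (y : κ → ℂ) (f : ι → E) (g : κ → E) :
    hermCoeff η (∑ i ∈ s, x i • f i) (∑ j ∈ t, y j • g j) =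
      ∑ i ∈ s, ∑ j ∈ t, x i * (starRingEnd ℂ) (y j) * hermCoeff η (f i) (g j) := by
  rw [hermCoeff_sum_left]
  refine Finset.sum_congr rfl fun i _ => ?_
  rw [hermCoeff_smul_left h, hermCoeff_sum_right h, Finset.mul_sum]
  refine Finset.sum_congr rfl fun j _ => ?_
  rw [hermCoeff_smul_right h]; ring

theorem two_ext {η θ : E [⋀^Fin 2]→L[ℝ] ℝ} (h : ∀ u v, η ![u, v] = θ ![u, v]) : η = θ := by
  ext u
  have : u = ![u 0, u 1] := by funext i; fin_cases i <;> rfl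
  rw [this, h]

theorem eq_zero_of_basis {ι : Type*} [Fintype ι] (b : Module.Basis ι ℂ E)
    {η : E [⋀^Fin 2]→L[ℝ] ℝ} (h : IsOneOne η)
    (h1 : ∀ i j, η ![b i, b j] = 0) (h2 : ∀ i j, η ![b i, Complex.I • b j] = 0) : η = 0 := by
  refine two_ext fun u v => ?_
  rw [two_eq_hermCoeff, ← b.sum_repr u, ← b.sum_repr v, hermCoeff_expand h]
  simp [hermCoeff, h1, h2]

/-- Powers of a positive `(1,1)`-form, multiplied by a form of complementary degree, in terms of
a unitary basis. -/
theorem pow_mul_unitary_frame {d : ℕ} (b : Fin d → E) {w : E [⋀^Fin 2]→L[ℝ] ℝ} (hw : IsOneOne w)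
    (hb : ∀ i j, w ![b i, b j] = 0 ∧ w ![b i, Complex.I • b j] = if i = j then 1 else 0)
    (k r : ℕ) (x : ListForm E) (hd : d = k + r) :
    (toList w ^ k * x) (frame b (fun a => Complex.I • b a) (List.finRange d)) =
      k.factorial * (((List.finRange d).sublistsLen r).map
        fun l' => x (frame b (fun a => Complex.I • b a) l')).sum := by
  rw [pow_mul_frame b (fun a => Complex.I • b a) (isAlt_toList w) 1 _ _ _ _ _ _
    (List.nodup_finRange d) k r x (by simpa using hd), one_pow, mul_one]
  · intro a; rw [toList_two, (hb a a).2, if_pos rfl]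
  · intro a c _; rw [toList_two, (hb a c).1]
  · intro a c h; rw [toList_two, (hb a c).2, if_neg h]
  · intro a c h; rw [toList_two, hw.left, (hb a c).2, if_neg h, neg_zero]
  · intro a c _; rw [toList_two, hw, (hb a c).1]

/-- A positive `(1,1)`-form has a positive top power. -/
theorem pow_stdFrame_pos {d : ℕ} {w : (Fin d → ℂ) [⋀^Fin 2]→L[ℝ] ℝ} (hw : IsOneOne w)
    (hpos : ∀ u, u ≠ 0 → 0 < w ![u, Complex.I • u]) :
    0 < (toList w ^ d) (List.ofFn (stdFrame d)) := by
  obtain ⟨b, hb⟩ := exists_unitary_basis hw hpos (Module.finrank_fin_fun ℂ)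
  obtain ⟨r, hr, hf⟩ := topForm_frame b
  have h1 := pow_mul_unitary_frame b hw hb d 0 1 rfl
  have h2 := hf (wedgePow (X := Unit) (fun _ => w) d ())
  rw [toList_wedgePow] at h2
  rw [mul_one, h2] at h1
  rw [← toList_wedgePow (X := Unit) (fun _ => w) d (), toList_ofFn]
  simp only [List.sublistsLen_zero, List.map_cons, List.map_nil, frame_nil, one_nil,
    List.sum_cons, List.sum_nil, add_zero, mul_one] at h1
  have : (0 : ℝ) < d.factorial := by positivity
  exact pos_of_mul_pos_right (h1 ▸ this) hr.le

/-- The Hodge-Riemann relation for primitive `(1,1)`-forms: the quadratic form `θ² ∧ w^(m-2)` is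
negative definite on the `(1,1)`-forms with vanishing trace. -/
theorem hodgeRiemann {m : ℕ} (hm : 2 ≤ m) {w : (Fin m → ℂ) [⋀^Fin 2]→L[ℝ] ℝ} (hw : IsOneOne w)
    (b : Module.Basis (Fin m) ℂ (Fin m → ℂ))
    (hb : ∀ i j, w ![b i, b j] = 0 ∧ w ![b i, Complex.I • b j] = if i = j then 1 else 0)
    {θ : (Fin m → ℂ) [⋀^Fin 2]→L[ℝ] ℝ} (hθ : IsOneOne θ)
    (htr : ∑ a, θ ![b a, Complex.I • b a] = 0) :
    (toList w ^ (m - 2) * (toList θ * toList θ)) (List.ofFn (stdFrame m)) ≤ 0 ∧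
    ((toList w ^ (m - 2) * (toList θ * toList θ)) (List.ofFn (stdFrame m)) = 0 → θ = 0) := by
  obtain ⟨r, hr, hf⟩ := topForm_frame b
  -- In the unitary basis the value is `(m - 2)!` times the sum over the pairs of basis vectors of
  -- the values of `θ ∧ θ` on two complex lines.
  have h1 := pow_mul_unitary_frame b hw hb (m - 2) 2 (toList θ * toList θ) (by omega)
  let W : DiffForm (Fin m → ℂ) Unit (2 * (m - 2)) := wedgePow (fun _ => w) (m - 2)
  let Θ : DiffForm (Fin m → ℂ) Unit (2 * m) :=
    castDeg (by omega : 2 * (m - 2) + (2 + 2) = 2 * m)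
      (wedgeForm W (fun _ => wedge θ θ))
  have hΘ : toList (Θ ()) = toList w ^ (m - 2) * (toList θ * toList θ) := by
    simp only [Θ, toList_castDeg, wedgeForm, toList_wedge, W, toList_wedgePow]
  have h2 := hf (Θ ())
  rw [← toList_ofFn, hΘ] at h2
  rw [h1] at h2
  let f : Fin m → Fin m → ℝ := fun a c => 2 * (θ ![b a, Complex.I • b a] * θ ![b c, Complex.I • b c]
    - θ ![b a, b c] ^ 2 - θ ![b a, Complex.I • b c] ^ 2)
  have h3 := two_mul_sum_sublistsLen_two f
    (fun a c => by simp only [f, hθ.symm (b a), two_swap θ (b a) (b c)]; ring)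
    (fun a => by
      have : θ ![b a, b a] = 0 := θ.map_eq_zero_of_eq _ (i := 0) (j := 1) rfl (by simp)
      simp only [f, this]; ring)
    (fun l' => (toList θ * toList θ) (frame b (fun a => Complex.I • b a) l'))
    (fun a c => sq_apply_lines hθ _ _) (List.finRange m)
  -- As the trace vanishes, the products of diagonal coefficients add up to zero, and minus a sum of
  -- squares is left.
  have h4 : ((List.finRange m).map fun a => ((List.finRange m).map fun c => f a c).sum).sum =
      -2 * ∑ a, ∑ c, (θ ![b a, b c] ^ 2 + θ ![b a, Complex.I • b c] ^ 2) := by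
    have e (g : Fin m → ℝ) : ((List.finRange m).map g).sum = ∑ a, g a := by
      rw [Fin.sum_univ_def]
    rw [e]
    simp only [e]
    have : ∑ a, ∑ c, θ ![b a, Complex.I • b a] * θ ![b c, Complex.I • b c] = 0 := by
      rw [← Finset.sum_mul_sum, htr, zero_mul]
    have h5 : ∑ a, ∑ c, f a c =
        2 * ∑ a, ∑ c, θ ![b a, Complex.I • b a] * θ ![b c, Complex.I • b c] -
        2 * ∑ a, ∑ c, (θ ![b a, b c] ^ 2 + θ ![b a, Complex.I • b c] ^ 2) := by
      simp only [Finset.mul_sum, ← Finset.sum_sub_distrib]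
      refine Finset.sum_congr rfl fun a _ => Finset.sum_congr rfl fun c _ => ?_
      simp only [f]; ring
    rw [h5, this]; ring
  set V := (toList w ^ (m - 2) * (toList θ * toList θ)) (List.ofFn (stdFrame m))
  set Q := ∑ a, ∑ c, (θ ![b a, b c] ^ 2 + θ ![b a, Complex.I • b c] ^ 2) with hQ
  have hQ0 : 0 ≤ Q := Finset.sum_nonneg fun a _ => Finset.sum_nonneg fun c _ => by positivity
  have hfac : (0 : ℝ) < (m - 2).factorial := by positivity
  have h6 : r * V = -((m - 2).factorial * Q) := by
    rw [← h2]
    rw [h4] at h3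
    have : ((List.sublistsLen 2 (List.finRange m)).map fun l' =>
      (toList θ * toList θ) (frame b (fun a => Complex.I • b a) l')).sum = -Q := by linarith
    rw [this]; ring
  constructor
  · by_contra hV
    have := mul_pos hr (not_le.1 hV)
    have := mul_nonneg hfac.le hQ0
    linarith
  · intro hV
    rw [hV, mul_zero, eq_comm, neg_eq_zero] at h6
    have hQz : Q = 0 := (mul_eq_zero.1 h6).resolve_left hfac.ne'
    have hz : ∀ a c, θ ![b a, b c] ^ 2 + θ ![b a, Complex.I • b c] ^ 2 = 0 := by
      intro a c
      have := (Finset.sum_eq_zero_iff_of_nonneg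
        (fun a _ => Finset.sum_nonneg fun c _ => by positivity)).1 (hQ ▸ hQz) a (Finset.mem_univ a)
      exact (Finset.sum_eq_zero_iff_of_nonneg (fun c _ => by positivity)).1 this c
        (Finset.mem_univ c)
    refine eq_zero_of_basis b hθ (fun a c => ?_) (fun a c => ?_)
    · have := hz a c
      nlinarith [sq_nonneg (θ ![b a, b c]), sq_nonneg (θ ![b a, Complex.I • b c])]
    · have := hz a c
      nlinarith [sq_nonneg (θ ![b a, b c]), sq_nonneg (θ ![b a, Complex.I • b c])]

end TopForms

/-! ### The horizontal lift and the geodesic curvature form -/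

section Lift

open ListForm

variable {m n : ℕ}

theorem pow_comp {E F : Type*} [NormedAddCommGroup E] [NormedSpace ℝ E] [NormedAddCommGroup F]
    [NormedSpace ℝ F] (η : F [⋀^Fin 2]→L[ℝ] ℝ) (f : E →L[ℝ] F) (N : ℕ) (ws : List E) :
    (toList (η.compContinuousLinearMap f) ^ N) ws = (toList η ^ N) (ws.map f) := by
  induction N generalizing ws with
  | zero => cases ws <;> simp
  | succ N ih =>
    rw [pow_succ, pow_succ]
    exact mul_map f ih (fun _ => toList_comp _ _ _) ws

/-- An alternating form vanishes on lists with repetitions. -/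
theorem toList_of_not_nodup {E : Type*} [NormedAddCommGroup E] [NormedSpace ℝ E] {k : ℕ}
    (η : E [⋀^Fin k]→L[ℝ] ℝ) {ws : List E} (h : ¬ ws.Nodup) : toList η ws = 0 := by
  by_cases hk : ws.length = k
  · obtain ⟨u, rfl⟩ := exists_ofFn hk
    rw [List.nodup_ofFn, Function.Injective] at h
    push Not at h
    obtain ⟨i, j, hij, hne⟩ := h
    rw [toList_ofFn]
    exact η.map_eq_zero_of_eq u hij hne
  · exact toList_of_ne η hk

/-- An alternating form annihilated by the vectors of a set only depends on its arguments modulo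
that set. -/
theorem apply_eq_of_sub_mem {E : Type*} [NormedAddCommGroup E] [NormedSpace ℝ E] (S : Set E) :
    ∀ {k : ℕ} (y : E [⋀^Fin k]→L[ℝ] ℝ) (_ : ∀ v ∈ S, ins v (toList y) = 0) (u u' : Fin k → E),
      (∀ i, u i - u' i ∈ S) → y u = y u'
  | 0, y, _, u, u', _ => by rw [Subsingleton.elim u u']
  | k + 1, y, hy, u, u', h => by
    have h0 : y.curryLeft (u 0) = y.curryLeft (u' 0) := by
      rw [← sub_eq_zero, ← map_sub]
      apply toList_injective
      rw [toList_curryLeft, hy _ (h 0), map_zero]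
    have hS : ∀ v ∈ S, ins v (toList (y.curryLeft (u' 0))) = 0 := by
      intro v hv
      ext ws
      have := (isAlt_toList y).insertIdx (u' 0 :: ws) 1 v (by simp)
      have hz : toList y (u' 0 :: v :: ws) = -ins v (toList y) (u' 0 :: ws) := by
        simpa [ins_apply] using this
      rw [toList_curryLeft, ins_apply, ins_apply, hz, hy v hv]; simp
    have := apply_eq_of_sub_mem S (y.curryLeft (u' 0)) hS (fun i => u i.succ)
      (fun i => u' i.succ) (fun i => h i.succ)
    have e1 : y u = y.curryLeft (u 0) (fun i => u i.succ) :=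
      congrArg y (Fin.cons_self_tail u).symm
    have e2 : y u' = y.curryLeft (u' 0) (fun i => u' i.succ) :=
      congrArg y (Fin.cons_self_tail u').symm
    rw [e1, e2, h0, this]

/-- The frame of the fibre directions. -/
def fibreFrame (m n : ℕ) : Fin (2 * n) → (Fin m → ℂ) × (Fin n → ℂ) :=
  fun j => ((0 : Fin m → ℂ), stdFrame n j)

/-- Positivity of a two-form on the fibre directions. -/
def IsVerticallyPositive (η : ((Fin m → ℂ) × (Fin n → ℂ)) [⋀^Fin 2]→L[ℝ] ℝ) : Prop :=
  ∀ v : Fin n → ℂ, v ≠ 0 → 0 < η ![(0, v), Complex.I • (0, v)]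

/-- The matrix of a two-form in the fibre directions. -/
def fibreMatrix (η : ((Fin m → ℂ) × (Fin n → ℂ)) [⋀^Fin 2]→L[ℝ] ℝ) : Matrix (Fin n) (Fin n) ℂ :=
  Matrix.of fun i j => hermCoeff η (0, Pi.single i 1) (0, Pi.single j 1)

/-- The mixed coefficients of a two-form. -/
def mixedMatrix (η : ((Fin m → ℂ) × (Fin n → ℂ)) [⋀^Fin 2]→L[ℝ] ℝ) : Matrix (Fin m) (Fin n) ℂ :=
  Matrix.of fun α j => hermCoeff η (Pi.single α 1, 0) (0, Pi.single j 1)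

/-- The horizontal lift of base vectors, orthogonal to the fibre directions. -/
def horizontalLift (η : ((Fin m → ℂ) × (Fin n → ℂ)) [⋀^Fin 2]→L[ℝ] ℝ) :
    (Fin m → ℂ) →L[ℂ] (Fin m → ℂ) × (Fin n → ℂ) :=
  LinearMap.toContinuousLinearMap
    ((LinearMap.id : (Fin m → ℂ) →ₗ[ℂ] (Fin m → ℂ)).prod
      (-(Matrix.vecMulLinear (mixedMatrix η * (fibreMatrix η)⁻¹))))

theorem horizontalLift_apply (η : ((Fin m → ℂ) × (Fin n → ℂ)) [⋀^Fin 2]→L[ℝ] ℝ)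
    (u : Fin m → ℂ) :
    horizontalLift η u = (u, -Matrix.vecMul u (mixedMatrix η * (fibreMatrix η)⁻¹)) := rfl

/-- The geodesic curvature form: the restriction of a two-form to the horizontal directions. -/
def geodesicForm (η : ((Fin m → ℂ) × (Fin n → ℂ)) [⋀^Fin 2]→L[ℝ] ℝ) :
    (Fin m → ℂ) [⋀^Fin 2]→L[ℝ] ℝ :=
  η.compContinuousLinearMap ((horizontalLift η).restrictScalars ℝ)

theorem geodesicForm_apply (η : ((Fin m → ℂ) × (Fin n → ℂ)) [⋀^Fin 2]→L[ℝ] ℝ) (u w : Fin m → ℂ) :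
    geodesicForm η ![u, w] = η ![horizontalLift η u, horizontalLift η w] := by
  rw [geodesicForm, ContinuousAlternatingMap.compContinuousLinearMap_apply]
  congr 1; funext i; fin_cases i <;> rfl

variable {η : ((Fin m → ℂ) × (Fin n → ℂ)) [⋀^Fin 2]→L[ℝ] ℝ}

theorem isOneOne_geodesicForm (h : IsOneOne η) : IsOneOne (geodesicForm η) := by
  intro u v
  rw [geodesicForm_apply, geodesicForm_apply, map_smul, map_smul, h]

theorem eq_sum_single {d : ℕ} (v : Fin d → ℂ) : v = ∑ i, v i • Pi.single i (1 : ℂ) :=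
  pi_eq_sum_univ' v

theorem inr_eq_sum (v : Fin n → ℂ) :
    ((0 : Fin m → ℂ), v) = ∑ i, v i • ((0 : Fin m → ℂ), (Pi.single i 1 : Fin n → ℂ)) := by
  have : ((0 : Fin m → ℂ), v) = LinearMap.inr ℂ (Fin m → ℂ) (Fin n → ℂ) v := rfl
  rw [this]
  conv_lhs => rw [eq_sum_single v]
  simp [map_sum, LinearMap.inr_apply]

theorem inl_eq_sum (u : Fin m → ℂ) :
    (u, (0 : Fin n → ℂ)) = ∑ i, u i • ((Pi.single i 1 : Fin m → ℂ), (0 : Fin n → ℂ)) := by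
  have : (u, (0 : Fin n → ℂ)) = LinearMap.inl ℂ (Fin m → ℂ) (Fin n → ℂ) u := rfl
  rw [this]
  conv_lhs => rw [eq_sum_single u]
  simp [map_sum, LinearMap.inl_apply]

theorem hermCoeff_inr_single (h : IsOneOne η) (v : Fin n → ℂ) (j : Fin n) :
    hermCoeff η (0, v) (0, Pi.single j 1) = Matrix.vecMul v (fibreMatrix η) j := by
  rw [inr_eq_sum v, hermCoeff_sum_left]
  simp only [hermCoeff_smul_left h]
  rfl

theorem hermCoeff_inl_single (h : IsOneOne η) (u : Fin m → ℂ) (j : Fin n) :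
    hermCoeff η (u, 0) (0, Pi.single j 1) = Matrix.vecMul u (mixedMatrix η) j := by
  rw [inl_eq_sum u, hermCoeff_sum_left]
  simp only [hermCoeff_smul_left h]
  rfl

theorem hermCoeff_inr_right (h : IsOneOne η) (w : (Fin m → ℂ) × (Fin n → ℂ))
    (hw : ∀ j, hermCoeff η w (0, Pi.single j 1) = 0) (v : Fin n → ℂ) :
    hermCoeff η w (0, v) = 0 := by
  rw [inr_eq_sum v, hermCoeff_sum_right h]
  simp only [hermCoeff_smul_right h, hw, mul_zero, Finset.sum_const_zero]

/-- Positivity on the fibres makes the matrix in the fibre directions invertible, so that its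
inverse is not a junk value. -/
theorem det_fibreMatrix_ne_zero (h : IsOneOne η) (hpos : IsVerticallyPositive η) :
    (fibreMatrix η).det ≠ 0 := by
  intro h0
  obtain ⟨v, hv, hv0⟩ := Matrix.exists_vecMul_eq_zero_iff.2 h0
  have h1 := hermCoeff_inr_right h (0, v) (fun j => by rw [hermCoeff_inr_single h, hv0]; rfl) v
  rw [hermCoeff_self, Complex.ofReal_eq_zero] at h1
  have := hpos v hv
  linarith

theorem hermCoeff_horizontalLift (h : IsOneOne η) (hpos : IsVerticallyPositive η)
    (u : Fin m → ℂ) (v : Fin n → ℂ) : hermCoeff η (horizontalLift η u) (0, v) = 0 := by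
  refine hermCoeff_inr_right h _ (fun j => ?_) v
  have hdet := (det_fibreMatrix_ne_zero h hpos).isUnit
  have e : horizontalLift η u = (u, 0) +
      (0, -Matrix.vecMul u (mixedMatrix η * (fibreMatrix η)⁻¹)) := by
    rw [horizontalLift_apply]; simp
  rw [e, hermCoeff_add_left, hermCoeff_inl_single h, hermCoeff_inr_single h, Matrix.neg_vecMul,
    Matrix.vecMul_vecMul, Matrix.mul_assoc, Matrix.nonsing_inv_mul _ hdet, Matrix.mul_one]
  simp

/-- Horizontal lifts are orthogonal to the fibre directions. -/
theorem horizontalLift_orth (h : IsOneOne η) (hpos : IsVerticallyPositive η)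
    (u : Fin m → ℂ) (v : Fin n → ℂ) : η ![(0, v), horizontalLift η u] = 0 := by
  rw [two_swap, two_eq_hermCoeff, hermCoeff_horizontalLift h hpos]; simp

/-- The horizontal lift is characterized by orthogonality to the fibre directions. -/
theorem eq_horizontalLift (h : IsOneOne η) (hpos : IsVerticallyPositive η)
    {w : (Fin m → ℂ) × (Fin n → ℂ)} (hw : ∀ v : Fin n → ℂ, η ![(0, v), w] = 0) :
    w = horizontalLift η w.1 := by
  by_contra hne
  let v : Fin n → ℂ := (w - horizontalLift η w.1).2
  have hv : w - horizontalLift η w.1 = (0, v) := by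
    ext1 <;> simp [v, horizontalLift_apply]
  have hv0 : v ≠ 0 := by
    intro h0
    rw [h0] at hv
    exact hne (sub_eq_zero.1 hv)
  have hI : ∀ x : Fin n → ℂ, Complex.I • ((0 : Fin m → ℂ), x) = (0, Complex.I • x) := fun x => by
    ext1 <;> simp
  have h1 := hpos v hv0
  have e : η ![(0, v), Complex.I • ((0 : Fin m → ℂ), v)] =
      -η ![Complex.I • ((0 : Fin m → ℂ), v), (0, v)] := two_swap _ _ _
  have e2 : w - horizontalLift η w.1 = w + (-1 : ℝ) • horizontalLift η w.1 := by
    rw [neg_one_smul, sub_eq_add_neg]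
  rw [e, hI, ← hv, e2, two_add_right, two_smul_right, hw,
    horizontalLift_orth h hpos] at h1
  simp at h1

/-- The coefficients of the geodesic curvature form are given by a Schur complement. -/
theorem hermCoeff_geodesicForm (h : IsOneOne η) (hpos : IsVerticallyPositive η) (α β : Fin m) :
    hermCoeff (geodesicForm η) (Pi.single α 1) (Pi.single β 1) =
      (Matrix.of (fun α β => hermCoeff η (Pi.single α 1, 0) (Pi.single β 1, 0)) -
        mixedMatrix η * (fibreMatrix η)⁻¹ *
          Matrix.of (fun i β => hermCoeff η (0, Pi.single i 1) (Pi.single β 1, 0)) :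
            Matrix (Fin m) (Fin m) ℂ) α β := by
  have e0 : hermCoeff (geodesicForm η) (Pi.single α 1) (Pi.single β 1) =
      hermCoeff η (horizontalLift η (Pi.single α 1)) (horizontalLift η (Pi.single β 1)) := by
    rw [hermCoeff, hermCoeff, geodesicForm_apply, geodesicForm_apply, map_smul]
  have e1 : ∀ u : Fin m → ℂ, horizontalLift η u = (u, 0) +
      (0, -Matrix.vecMul u (mixedMatrix η * (fibreMatrix η)⁻¹)) := fun u => by
    rw [horizontalLift_apply]; simp
  rw [e0, e1 (Pi.single β 1), hermCoeff_add_right h, hermCoeff_horizontalLift h hpos, add_zero, e1,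
    hermCoeff_add_left, inr_eq_sum, hermCoeff_sum_left, Matrix.sub_apply, Matrix.mul_apply,
    sub_eq_add_neg, ← Finset.sum_neg_distrib, Matrix.of_apply]
  congr 1
  refine Finset.sum_congr rfl fun i _ => ?_
  rw [hermCoeff_smul_left h]
  simp

/-- The value of a geodesic curvature form in terms of its coefficients. -/
theorem sum_hermCoeff_eq {d : ℕ} {θ : (Fin d → ℂ) [⋀^Fin 2]→L[ℝ] ℝ} (h : IsOneOne θ)
    (C : Matrix (Fin d) (Fin d) ℂ)
    (hC : ∀ α β, hermCoeff θ (Pi.single α 1) (Pi.single β 1) = C α β) (u w : Fin d → ℂ) :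
    ∑ α, ∑ β, C α β * Complex.I *
      (u α * (starRingEnd ℂ) (w β) - w α * (starRingEnd ℂ) (u β)) = (θ ![u, w] : ℝ) := by
  have e : ∀ x y : Fin d → ℂ, hermCoeff θ x y =
      ∑ α, ∑ β, x α * (starRingEnd ℂ) (y β) * C α β := fun x y => by
    conv_lhs => rw [eq_sum_single x, eq_sum_single y]
    rw [hermCoeff_expand h]
    simp only [hC]
  have e2 : ∑ α, ∑ β, C α β * Complex.I *
      (u α * (starRingEnd ℂ) (w β) - w α * (starRingEnd ℂ) (u β)) =
      Complex.I * (hermCoeff θ u w - hermCoeff θ w u) := by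
    rw [e, e, ← Finset.sum_sub_distrib, Finset.mul_sum]
    refine Finset.sum_congr rfl fun α _ => ?_
    rw [← Finset.sum_sub_distrib, Finset.mul_sum]
    exact Finset.sum_congr rfl fun β _ => by ring
  rw [e2, hermCoeff, hermCoeff, h.symm w u, two_swap θ w u]
  push_cast
  linear_combination (-(θ ![u, w] : ℂ)) * Complex.I_sq

/-- The trace of a `(1,1)`-form with respect to a positive one, in a unitary basis. -/
theorem trace_eq_sum_unitary {d : ℕ} {θ w : (Fin d → ℂ) [⋀^Fin 2]→L[ℝ] ℝ} (h : IsOneOne θ)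
    (hw : IsOneOne w) (b : Module.Basis (Fin d) ℂ (Fin d → ℂ))
    (hb : ∀ i j, w ![b i, b j] = 0 ∧ w ![b i, Complex.I • b j] = if i = j then 1 else 0)
    (C G : Matrix (Fin d) (Fin d) ℂ)
    (hC : ∀ α β, hermCoeff θ (Pi.single α 1) (Pi.single β 1) = C α β)
    (hG : ∀ α β, hermCoeff w (Pi.single α 1) (Pi.single β 1) = G α β) :
    (C * G⁻¹).trace = ((∑ a, θ ![b a, Complex.I • b a] : ℝ) : ℂ) := by
  -- The rows of `B` are the vectors of the unitary basis; `B G Bᴴ = 1 / 2`, hence `G⁻¹ = 2 Bᴴ B`,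
  -- and the trace is that of `2 B C Bᴴ`.
  let B : Matrix (Fin d) (Fin d) ℂ := Matrix.of fun a k => b a k
  have key : ∀ {θ : (Fin d → ℂ) [⋀^Fin 2]→L[ℝ] ℝ} (_ : IsOneOne θ) (C : Matrix (Fin d) (Fin d) ℂ)
      (_ : ∀ α β, hermCoeff θ (Pi.single α 1) (Pi.single β 1) = C α β) (i j : Fin d),
      (B * C * B.conjTranspose) i j = hermCoeff θ (b i) (b j) := by
    intro θ h C hC i j
    conv_rhs => rw [eq_sum_single (b i), eq_sum_single (b j)]
    rw [hermCoeff_expand h, Matrix.mul_apply, Finset.sum_comm]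
    refine Finset.sum_congr rfl fun l _ => ?_
    rw [Matrix.mul_apply, Finset.sum_mul]
    refine Finset.sum_congr rfl fun k _ => ?_
    rw [hC]
    simp [B, Matrix.conjTranspose_apply]
    ring
  have hBG : B * G * B.conjTranspose = (1 / 2 : ℂ) • (1 : Matrix (Fin d) (Fin d) ℂ) := by
    ext i j
    rw [key hw G hG, hermCoeff, (hb i j).1, (hb i j).2, Matrix.smul_apply, Matrix.one_apply]
    split_ifs <;> simp
  have h1 : B * (G * ((2 : ℂ) • B.conjTranspose)) = 1 := by
    rw [Matrix.mul_smul, Matrix.mul_smul, ← Matrix.mul_assoc, hBG, smul_smul]; norm_num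
  have h2 : (G * ((2 : ℂ) • B.conjTranspose)) * B = 1 := mul_eq_one_comm.1 h1
  have h3 : G⁻¹ = (2 : ℂ) • B.conjTranspose * B := by
    rw [Matrix.mul_assoc] at h2
    exact Matrix.inv_eq_right_inv h2
  rw [h3, ← Matrix.mul_assoc, Matrix.trace_mul_comm, Matrix.mul_smul, Matrix.mul_smul,
    ← Matrix.mul_assoc, Matrix.trace_smul, Matrix.trace]
  simp only [Matrix.diag_apply, key h C hC, hermCoeff_self]
  push_cast
  rw [smul_eq_mul, Finset.mul_sum]
  exact Finset.sum_congr rfl fun a _ => by ring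

/-- The volume form of the fibres is positive. -/
theorem fibreFrame_pow_pos (h : IsOneOne η) (hpos : IsVerticallyPositive η) :
    0 < (toList η ^ n) (List.ofFn (fibreFrame m n)) := by
  let w : (Fin n → ℂ) [⋀^Fin 2]→L[ℝ] ℝ :=
    η.compContinuousLinearMap (ContinuousLinearMap.inr ℝ (Fin m → ℂ) (Fin n → ℂ))
  have hw : ∀ u v, w ![u, v] = η ![(0, u), (0, v)] := fun u v => by
    rw [ContinuousAlternatingMap.compContinuousLinearMap_apply]
    congr 1; funext i; fin_cases i <;> rfl
  have hI : ∀ x : Fin n → ℂ, Complex.I • ((0 : Fin m → ℂ), x) = (0, Complex.I • x) := fun x => by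
    ext1 <;> simp
  have := pow_stdFrame_pos (w := w) (fun u v => by rw [hw, hw, ← hI, ← hI, h])
    (fun u hu => by rw [hw, ← hI]; exact hpos u hu)
  rw [pow_comp, List.map_ofFn] at this
  exact this

/-- Once a full frame of the fibre directions is inserted in a form, every further vertical vector
gives zero, being a combination of the frame. -/
theorem ins_vertical_eq_zero {k : ℕ}
    (x : ((Fin m → ℂ) × (Fin n → ℂ)) [⋀^Fin (k + 2 * n)]→L[ℝ] ℝ) (v : Fin n → ℂ) :
    ins (0, v) (toList (insertVectors (fibreFrame m n) x)) = 0 := by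
  rcases k with _ | k
  · ext ws; rw [ins_apply, toList_of_ne _ (by simp)]; rfl
  rw [← toList_curryLeft]
  set y := insertVectors (fibreFrame m n) x
  have hz : ∀ j, y.curryLeft (fibreFrame m n j) = 0 := fun j => by
    apply toList_injective
    ext ws
    rw [toList_curryLeft, ins_apply, toList_insertVectors, map_zero]
    apply toList_of_not_nodup
    rw [List.nodup_append]
    rintro ⟨-, -, hd⟩
    exact hd _ (List.mem_ofFn.2 ⟨j, rfl⟩) _ (List.mem_cons_self ..) rfl
  have h1 : ∀ a : Fin n, ((0 : Fin m → ℂ), (Pi.single a 1 : Fin n → ℂ)) =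
      fibreFrame m n ⟨2 * a, by omega⟩ := fun a => by
    simp only [fibreFrame, Prod.mk.injEq, true_and]
    funext b
    simp [stdFrame, Pi.single_apply, Fin.ext_iff]
  have h2 : ∀ a : Fin n, Complex.I • ((0 : Fin m → ℂ), (Pi.single a 1 : Fin n → ℂ)) =
      fibreFrame m n ⟨2 * a + 1, by omega⟩ := fun a => by
    ext1
    · simp [fibreFrame]
    · funext b
      have h1 : (2 * (a : ℕ) + 1) / 2 = a := by omega
      simp [fibreFrame, stdFrame, Pi.single_apply, Fin.ext_iff, h1]
  have : y.curryLeft (0, v) = 0 := by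
    rw [inr_eq_sum, map_sum]
    refine Finset.sum_eq_zero fun a _ => ?_
    rw [complex_smul_eq, map_add, map_smul, map_smul, h1, hz, ← h1, h2, hz]
    simp
  rw [this, map_zero]

/-- The fibre integrand of a power of the curvature form: in the fibre directions the power of `η`
splits off the geodesic curvature form. -/
theorem pow_fibreFrame_append (h : IsOneOne η) (hpos : IsVerticallyPositive η) (i : ℕ)
    (ws : List (Fin m → ℂ)) :
    (toList η ^ (n + i)) (List.ofFn (fibreFrame m n) ++ ws.map fun u => (u, (0 : Fin n → ℂ))) =
      ((n + i).choose n : ℝ) * ((toList η ^ n) (List.ofFn (fibreFrame m n)) *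
        (toList (geodesicForm η) ^ i) ws) := by
  by_cases hl : ws.length = 2 * i
  swap
  · rw [pow_degree (isAlt_toList η) _ _ (by simp; omega),
      pow_degree (isAlt_toList (geodesicForm η)) i ws hl]
    ring
  obtain ⟨u, rfl⟩ := exists_ofFn hl
  -- A base vector and its horizontal lift differ by a vertical vector, which the fibre frame
  -- absorbs.
  have key : (toList η ^ (n + i)) (List.ofFn (fibreFrame m n) ++
      (List.ofFn u).map fun u => (u, (0 : Fin n → ℂ))) =
      (toList η ^ (n + i)) (List.ofFn (fibreFrame m n) ++ (List.ofFn u).map (horizontalLift η)) := by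
    let x : ((Fin m → ℂ) × (Fin n → ℂ)) [⋀^Fin (2 * i + 2 * n)]→L[ℝ] ℝ :=
      castDeg (X := Unit) (by ring) (wedgePow (fun _ => η) (n + i)) ()
    have hx : toList x = toList η ^ (n + i) := by
      simp only [x, toList_castDeg, toList_wedgePow]
    rw [← hx, ← toList_insertVectors, ← toList_insertVectors, List.map_ofFn, List.map_ofFn,
      toList_ofFn, toList_ofFn]
    refine apply_eq_of_sub_mem {w | ∃ v : Fin n → ℂ, w = (0, v)} _ ?_ _ _ fun j => ?_
    · rintro _ ⟨v, rfl⟩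
      exact ins_vertical_eq_zero x v
    · refine ⟨0 - (horizontalLift η (u j)).2, ?_⟩
      simp [horizontalLift_apply]
  -- The horizontal lifts are orthogonal to the fibre frame.
  rw [key, pow_append_of_length (isAlt_toList η) i (n := n) (by simp), geodesicForm, pow_comp]
  · rfl
  · intro f hf w hw
    obtain ⟨j, rfl⟩ := List.mem_ofFn.1 hf
    obtain ⟨z, -, rfl⟩ := List.mem_map.1 hw
    rw [toList_two]
    exact horizontalLift_orth h hpos _ _

end Lift

/-! ### Form-valued functions -/

section FormValued

open ListForm

variable {E : Type*} [NormedAddCommGroup E] [NormedSpace ℝ E] [FiniteDimensional ℝ E]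
  {P : Type*} [NormedAddCommGroup P] [NormedSpace ℝ P]

/-- The value of a form in terms of its values on the tuples of vectors of a basis. -/
theorem form_apply_eq_sum {k : ℕ} {ι : Type*} [Fintype ι] (b : Module.Basis ι ℝ E)
    (A : E [⋀^Fin k]→L[ℝ] ℝ) (v : Fin k → E) :
    A v = ∑ J : Fin k → ι, (∏ i, b.repr (v i) (J i)) * A (fun i => b (J i)) := by
  classical
  conv_lhs => rw [show v = fun i => ∑ j, b.repr (v i) j • b j from
    funext fun i => (b.sum_repr (v i)).symm]
  have := A.toMultilinearMap.map_sum (fun i (j : ι) => b.repr (v i) j • b j)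
  refine this.trans (Finset.sum_congr rfl fun J _ => ?_)
  have := A.toMultilinearMap.map_smul_univ (fun i => b.repr (v i) (J i)) (fun i => b (J i))
  exact this

/-- The values of a form on the tuples of basis vectors. -/
def formCoords (E : Type*) [NormedAddCommGroup E] [NormedSpace ℝ E] [FiniteDimensional ℝ E]
    (k : ℕ) : (E [⋀^Fin k]→L[ℝ] ℝ) →ₗ[ℝ] ((Fin k → Fin (Module.finrank ℝ E)) → ℝ) where
  toFun A J := A fun i => Module.finBasis ℝ E (J i)
  map_add' _ _ := rfl
  map_smul' _ _ := rfl

theorem formCoords_injective (k : ℕ) : Function.Injective (formCoords E k) := by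
  intro A B h
  ext v
  rw [form_apply_eq_sum (Module.finBasis ℝ E), form_apply_eq_sum (Module.finBasis ℝ E) B]
  exact Finset.sum_congr rfl fun J _ => congrArg _ (congrFun h J)

instance finiteDimensional_form (k : ℕ) : FiniteDimensional ℝ (E [⋀^Fin k]→L[ℝ] ℝ) :=
  FiniteDimensional.of_injective _ (formCoords_injective k)

/-- Evaluation of forms on given vectors. -/
def evalForm {k : ℕ} (v : Fin k → E) : (E [⋀^Fin k]→L[ℝ] ℝ) →L[ℝ] ℝ :=
  LinearMap.toContinuousLinearMap
    { toFun := fun A => A v, map_add' := fun _ _ => rfl, map_smul' := fun _ _ => rfl }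

@[simp] theorem evalForm_apply {k : ℕ} (v : Fin k → E) (A : E [⋀^Fin k]→L[ℝ] ℝ) :
    evalForm v A = A v := rfl

theorem exists_formCoords_leftInverse (k : ℕ) :
    ∃ g : ((Fin k → Fin (Module.finrank ℝ E)) → ℝ) →L[ℝ] (E [⋀^Fin k]→L[ℝ] ℝ),
      ∀ A, g (formCoords E k A) = A := by
  obtain ⟨g, hg⟩ := LinearMap.exists_leftInverse_of_injective (formCoords E k)
    (LinearMap.ker_eq_bot.2 (formCoords_injective k))
  exact ⟨LinearMap.toContinuousLinearMap g, fun A => LinearMap.congr_fun hg A⟩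

/-- A form-valued function is smooth if its values on all tuples of constant vectors are. -/
theorem contDiffAt_form {k : ℕ} {r : WithTop ℕ∞} {A : P → E [⋀^Fin k]→L[ℝ] ℝ} {p : P}
    (h : ∀ v : Fin k → E, ContDiffAt ℝ r (fun q => A q v) p) : ContDiffAt ℝ r A p := by
  obtain ⟨g, hg⟩ := exists_formCoords_leftInverse (E := E) k
  have : A = fun q => g (formCoords E k (A q)) := funext fun q => (hg _).symm
  rw [this]
  have h2 : ContDiffAt ℝ r (fun q => formCoords E k (A q)) p := contDiffAt_pi.2 fun J => h _
  exact ContDiffAt.comp (g := g) p g.contDiff.contDiffAt h2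

theorem contDiffAt_form_apply {k : ℕ} {r : WithTop ℕ∞} {A : P → E [⋀^Fin k]→L[ℝ] ℝ}
    {v : P → Fin k → E} {p : P} (hA : ContDiffAt ℝ r A p)
    (hv : ∀ i, ContDiffAt ℝ r (fun q => v q i) p) : ContDiffAt ℝ r (fun q => A q (v q)) p := by
  let b := Module.finBasis ℝ E
  simp only [fun q => form_apply_eq_sum b (A q) (v q)]
  refine ContDiffAt.sum fun J _ => ContDiffAt.mul (contDiffAt_prod fun i _ => ?_) ?_
  · exact ContDiffAt.comp (g := LinearMap.toContinuousLinearMap (b.coord (J i))) p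
      (ContinuousLinearMap.contDiff _).contDiffAt (hv i)
  · exact ContDiffAt.comp (g := evalForm fun i => b (J i)) p
      (ContinuousLinearMap.contDiff _).contDiffAt hA

theorem contDiffAt_form_comp {F : Type*} [NormedAddCommGroup F] [NormedSpace ℝ F]
    [FiniteDimensional ℝ F] {k : ℕ} {r : WithTop ℕ∞} {A : P → F [⋀^Fin k]→L[ℝ] ℝ}
    {B : P → E →L[ℝ] F} {p : P} (hA : ContDiffAt ℝ r A p) (hB : ContDiffAt ℝ r B p) :
    ContDiffAt ℝ r (fun q => (A q).compContinuousLinearMap (B q)) p := by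
  refine contDiffAt_form fun v => ?_
  have := contDiffAt_form_apply (v := fun q i => B q (v i)) hA fun i =>
    hB.clm_apply contDiffAt_const
  exact this

theorem wedge_add_left {k l : ℕ} (α α' : E [⋀^Fin k]→L[ℝ] ℝ) (β : E [⋀^Fin l]→L[ℝ] ℝ) :
    wedge (α + α') β = wedge α β + wedge α' β :=
  toList_injective (by simp only [toList_wedge, map_add, add_mul])

theorem wedge_add_right {k l : ℕ} (α : E [⋀^Fin k]→L[ℝ] ℝ) (β β' : E [⋀^Fin l]→L[ℝ] ℝ) :
    wedge α (β + β') = wedge α β + wedge α β' :=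
  toList_injective (by simp only [toList_wedge, map_add, mul_add])

theorem wedge_smul_left {k l : ℕ} (c : ℝ) (α : E [⋀^Fin k]→L[ℝ] ℝ) (β : E [⋀^Fin l]→L[ℝ] ℝ) :
    wedge (c • α) β = c • wedge α β :=
  toList_injective (by simp only [toList_wedge, map_smul, smul_mul_assoc])

theorem wedge_smul_right {k l : ℕ} (c : ℝ) (α : E [⋀^Fin k]→L[ℝ] ℝ) (β : E [⋀^Fin l]→L[ℝ] ℝ) :
    wedge α (c • β) = c • wedge α β :=
  toList_injective (by simp only [toList_wedge, map_smul, mul_smul_comm])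

/-- The exterior product as a continuous bilinear map. -/
def wedgeL (E : Type*) [NormedAddCommGroup E] [NormedSpace ℝ E] [FiniteDimensional ℝ E]
    (k l : ℕ) : (E [⋀^Fin k]→L[ℝ] ℝ) →L[ℝ] (E [⋀^Fin l]→L[ℝ] ℝ) →L[ℝ] E [⋀^Fin (k + l)]→L[ℝ] ℝ :=
  LinearMap.toContinuousBilinearMap
    (LinearMap.mk₂ ℝ wedge wedge_add_left wedge_smul_left wedge_add_right wedge_smul_right)

@[simp] theorem wedgeL_apply {k l : ℕ} (α : E [⋀^Fin k]→L[ℝ] ℝ) (β : E [⋀^Fin l]→L[ℝ] ℝ) :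
    wedgeL E k l α β = wedge α β := rfl

theorem contDiffAt_clm_bilinear {V W U : Type*} [NormedAddCommGroup V] [NormedSpace ℝ V]
    [NormedAddCommGroup W] [NormedSpace ℝ W] [NormedAddCommGroup U] [NormedSpace ℝ U]
    (L : V →L[ℝ] W →L[ℝ] U) {r : WithTop ℕ∞} {A : P → V} {B : P → W} {p : P}
    (hA : ContDiffAt ℝ r A p) (hB : ContDiffAt ℝ r B p) :
    ContDiffAt ℝ r (fun q => L (A q) (B q)) p :=
  ContDiffAt.clm_apply (f := fun q => L (A q))
    (ContDiffAt.comp (g := L) p L.contDiff.contDiffAt hA) hB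

theorem contDiffAt_wedge {k l : ℕ} {r : WithTop ℕ∞} {A : P → E [⋀^Fin k]→L[ℝ] ℝ}
    {B : P → E [⋀^Fin l]→L[ℝ] ℝ} {p : P} (hA : ContDiffAt ℝ r A p) (hB : ContDiffAt ℝ r B p) :
    ContDiffAt ℝ r (fun q => wedge (A q) (B q)) p :=
  contDiffAt_clm_bilinear (wedgeL E k l) hA hB

theorem alternate_add {F : Type*} [NormedAddCommGroup F] [NormedSpace ℝ F] (G H : F → ListForm F) :
    alternate (fun v => G v + H v) = alternate G + alternate H :=
  ListForm.ext fun ws => listD_add ws G H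

/-- The Leibniz rule for the exterior derivative. -/
theorem toList_extDeriv_wedge {k l : ℕ} {A : E → E [⋀^Fin k]→L[ℝ] ℝ}
    {B : E → E [⋀^Fin l]→L[ℝ] ℝ} {p : E} (hA : DifferentiableAt ℝ A p)
    (hB : DifferentiableAt ℝ B p) :
    toList (extDeriv (fun q => wedge (A q) (B q)) p) =
      toList (extDeriv A p) * toList (B p) + inv (toList (A p)) * toList (extDeriv B p) := by
  have h1 : HasFDerivAt (fun q => wedge (A q) (B q)) _ p :=
    (wedgeL E k l).hasFDerivAt_of_bilinear hA.hasFDerivAt hB.hasFDerivAt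
  rw [extDeriv, extDeriv, extDeriv, h1.fderiv, toList_alternatizeUncurryFin,
    toList_alternatizeUncurryFin, toList_alternatizeUncurryFin, ← alternate_mul, ← mul_alternate,
    ← alternate_add]
  congr 1
  funext v
  simp [toList_wedge, add_comm]

end FormValued

/-! ### Forms in holomorphic charts -/

section Charts

variable {E : Type*} [NormedAddCommGroup E] [NormedSpace ℂ E] [NormedSpace ℝ E]
  [IsScalarTower ℝ ℂ E] {X : Type*} [TopologicalSpace X] [ChartedSpace E X]
  [IsManifold 𝓘(ℂ, E) ω X]

theorem contDiffAt_transition {e e' : OpenPartialHomeomorph X E}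
    (he : e ∈ IsManifold.maximalAtlas 𝓘(ℂ, E) ω X) (he' : e' ∈ IsManifold.maximalAtlas 𝓘(ℂ, E) ω X)
    {p : E} (hp : p ∈ e.target) (hp' : e.symm p ∈ e'.source) :
    ContDiffAt ℂ ω (fun q => e' (e.symm q)) p := by
  rw [← contMDiffAt_iff_contDiffAt]
  exact (contMDiffAt_of_mem_maximalAtlas he' hp').comp p
    (contMDiffAt_symm_of_mem_maximalAtlas he hp)

theorem contDiffAt_real_transition {e e' : OpenPartialHomeomorph X E}
    (he : e ∈ IsManifold.maximalAtlas 𝓘(ℂ, E) ω X) (he' : e' ∈ IsManifold.maximalAtlas 𝓘(ℂ, E) ω X)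
    {p : E} (hp : p ∈ e.target) (hp' : e.symm p ∈ e'.source) :
    ContDiffAt ℝ ∞ (fun q => e' (e.symm q)) p :=
  ((contDiffAt_transition he he' hp hp').restrict_scalars ℝ).of_le le_top

theorem fderiv_real_eq {F : Type*} [NormedAddCommGroup F] [NormedSpace ℂ F] [NormedSpace ℝ F]
    [IsScalarTower ℝ ℂ F] {f : E → F} {p : E} (h : DifferentiableAt ℂ f p) :
    fderiv ℝ f p = (fderiv ℂ f p).restrictScalars ℝ :=
  (h.hasFDerivAt.restrictScalars ℝ).fderiv

/-- The preferred charts belong to the maximal atlas. -/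
theorem chartAt_mem_maximalAtlas (x : X) : chartAt E x ∈ IsManifold.maximalAtlas 𝓘(ℂ, E) ω X :=
  IsManifold.chart_mem_maximalAtlas x

theorem eventually_mem_overlap {e e' : OpenPartialHomeomorph X E} {p : E} (hp : p ∈ e.target)
    (hp' : e.symm p ∈ e'.source) : ∀ᶠ q in 𝓝 p, q ∈ e.target ∧ e.symm q ∈ e'.source := by
  have h1 : ∀ᶠ q in 𝓝 p, q ∈ e.target := e.open_target.mem_nhds hp
  refine h1.and ?_
  exact (e.symm.continuousAt hp).eventually (e'.open_source.mem_nhds hp')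

/-- The coordinate expressions of a form in two charts are related by the pullback under the
transition map. -/
theorem inChart_eq {k : ℕ} (η : DiffForm E X k) {e e' : OpenPartialHomeomorph X E}
    (he : e ∈ IsManifold.maximalAtlas 𝓘(ℂ, E) ω X) (he' : e' ∈ IsManifold.maximalAtlas 𝓘(ℂ, E) ω X)
    {p : E} (hp : p ∈ e.target) (hp' : e.symm p ∈ e'.source) :
    inChart e η p = (inChart e' η (e' (e.symm p))).compContinuousLinearMap
      (fderiv ℝ (fun q => e' (e.symm q)) p) := by
  set c := chartAt E (e.symm p)
  have hc : c ∈ IsManifold.maximalAtlas 𝓘(ℂ, E) ω X := chartAt_mem_maximalAtlas _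
  have h1 : fderiv ℝ (fun q => c (e.symm q)) p =
      (fderiv ℝ (fun q => c (e'.symm q)) (e' (e.symm p))).comp
        (fderiv ℝ (fun q => e' (e.symm q)) p) := by
    have hs : e'.symm (e' (e.symm p)) = e.symm p := e'.left_inv hp'
    have hd := (contDiffAt_real_transition he' hc (e'.map_source hp')
      (by rw [hs]; exact mem_chart_source _ _)).differentiableAt (by simp)
    have hd' := (contDiffAt_real_transition he he' hp hp').differentiableAt (by simp)
    rw [← fderiv_comp p hd hd']
    apply Filter.EventuallyEq.fderiv_eq
    filter_upwards [eventually_mem_overlap hp hp'] with q hq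
    simp [e'.left_inv hq.2]
  unfold inChart
  rw [e'.left_inv hp']
  change ContinuousAlternatingMap.compContinuousLinearMap _
    (fderiv ℝ (fun q => c (e.symm q)) p) = _
  rw [h1]
  rfl

theorem inChart_chartAt {k : ℕ} (η : DiffForm E X k) (x : X) :
    inChart (chartAt E x) η (chartAt E x x) = η x := by
  unfold inChart
  rw [(chartAt E x).left_inv (mem_chart_source E x)]
  have : fderiv ℝ (fun q => chartAt E x ((chartAt E x).symm q)) (chartAt E x x) =
      ContinuousLinearMap.id ℝ E := by
    rw [← fderiv_id (𝕜 := ℝ) (E := E) (x := chartAt E x x)]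
    apply Filter.EventuallyEq.fderiv_eq
    filter_upwards [(chartAt E x).open_target.mem_nhds (mem_chart_target E x)] with q hq
    exact (chartAt E x).right_inv hq
  rw [this]
  rfl

/-- The value of a form, which is expressed in the preferred chart at the point, in terms of any
other holomorphic chart. -/
theorem form_eq_inChart_comp {k : ℕ} (η : DiffForm E X k) {e : OpenPartialHomeomorph X E}
    (he : e ∈ IsManifold.maximalAtlas 𝓘(ℂ, E) ω X) {x : X} (hx : x ∈ e.source) :
    η x = (inChart e η (e x)).compContinuousLinearMap
      (fderiv ℝ (fun q => e ((chartAt E x).symm q)) (chartAt E x x)) := by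
  have h : (chartAt E x).symm (chartAt E x x) = x := (chartAt E x).left_inv (mem_chart_source E x)
  conv_lhs => rw [← inChart_chartAt η x]
  rw [inChart_eq η (chartAt_mem_maximalAtlas x) he (mem_chart_target E x) (by rwa [h]), h]

@[simp] theorem inChart_add {k : ℕ} (e : OpenPartialHomeomorph X E) (η θ : DiffForm E X k) :
    inChart e (η + θ) = inChart e η + inChart e θ := rfl

@[simp] theorem inChart_sub {k : ℕ} (e : OpenPartialHomeomorph X E) (η θ : DiffForm E X k) :
    inChart e (η - θ) = inChart e η - inChart e θ := rfl

@[simp] theorem inChart_smul {k : ℕ} (e : OpenPartialHomeomorph X E) (c : ℝ) (η : DiffForm E X k) :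
    inChart e (c • η) = c • inChart e η := rfl

theorem inChart_wedgeForm {k l : ℕ} (e : OpenPartialHomeomorph X E) (α : DiffForm E X k)
    (β : DiffForm E X l) (p : E) :
    inChart e (wedgeForm α β) p = wedge (inChart e α p) (inChart e β p) :=
  (wedge_comp _ _ _).symm

variable [FiniteDimensional ℝ E]

/-- Smoothness of a form at a point can be checked in any holomorphic chart. -/
theorem contDiffAt_inChart_of {k : ℕ} {η : DiffForm E X k} {e e' : OpenPartialHomeomorph X E}
    (he : e ∈ IsManifold.maximalAtlas 𝓘(ℂ, E) ω X) (he' : e' ∈ IsManifold.maximalAtlas 𝓘(ℂ, E) ω X)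
    {p : E} (hp : p ∈ e.target) (hp' : e.symm p ∈ e'.source)
    (h : ContDiffAt ℝ ∞ (inChart e' η) (e' (e.symm p))) : ContDiffAt ℝ ∞ (inChart e η) p := by
  have hτ := contDiffAt_real_transition he he' hp hp'
  have h1 : ContDiffAt ℝ ∞ (fun q => (inChart e' η (e' (e.symm q))).compContinuousLinearMap
      (fderiv ℝ (fun q => e' (e.symm q)) q)) p :=
    contDiffAt_form_comp (ContDiffAt.comp (f := fun q => e' (e.symm q)) p h hτ)
      (hτ.fderiv_right (m := ∞) (by simp))
  refine h1.congr_of_eventuallyEq ?_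
  filter_upwards [eventually_mem_overlap hp hp'] with q hq
  exact inChart_eq η he he' hq.1 hq.2

theorem IsSmoothForm.contDiffAt {k : ℕ} {η : DiffForm E X k} (h : IsSmoothForm η)
    {e : OpenPartialHomeomorph X E} (he : e ∈ IsManifold.maximalAtlas 𝓘(ℂ, E) ω X) {p : E}
    (hp : p ∈ e.target) : ContDiffAt ℝ ∞ (inChart e η) p := by
  let c := chartAt E (e.symm p)
  have hc := mem_chart_source E (e.symm p)
  refine contDiffAt_inChart_of he (chartAt_mem_maximalAtlas (e.symm p)) hp hc ?_
  exact (h c (chart_mem_atlas E _)).contDiffAt (c.open_target.mem_nhds (c.map_source hc))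

theorem isSmoothForm_of {k : ℕ} {η : DiffForm E X k}
    (h : ∀ x, ∃ e ∈ IsManifold.maximalAtlas 𝓘(ℂ, E) ω X, x ∈ e.source ∧
      ContDiffAt ℝ ∞ (inChart e η) (e x)) : IsSmoothForm η := by
  intro e he p hp
  have he' : e ∈ IsManifold.maximalAtlas 𝓘(ℂ, E) ω X :=
    IsManifold.subset_maximalAtlas he
  obtain ⟨c, hc, hx, hd⟩ := h (e.symm p)
  exact (contDiffAt_inChart_of he' hc hp hx hd).contDiffWithinAt

theorem two_le_infty : minSmoothness ℝ 2 ≤ (∞ : WithTop ℕ∞) := by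
  rw [minSmoothness_of_isRCLikeNormedField]
  exact WithTop.coe_le_coe.2 le_top

/-- The exterior derivative can be computed in any holomorphic chart. -/
theorem inChart_extD {k : ℕ} {η : DiffForm E X k} (hη : IsSmoothForm η)
    {e : OpenPartialHomeomorph X E} (he : e ∈ IsManifold.maximalAtlas 𝓘(ℂ, E) ω X) {p : E}
    (hp : p ∈ e.target) : inChart e (extD η) p = extDeriv (inChart e η) p := by
  set c := chartAt E (e.symm p) with hcdef
  have hc : c ∈ IsManifold.maximalAtlas 𝓘(ℂ, E) ω X := chartAt_mem_maximalAtlas _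
  have hx := mem_chart_source E (e.symm p)
  have hτ := contDiffAt_real_transition he hc hp hx
  have hd := (hη.contDiffAt hc (c.map_source hx)).differentiableAt (by simp)
  have h1 : extDeriv (inChart e η) p = extDeriv (fun q => (inChart c η
      (c (e.symm q))).compContinuousLinearMap (fderiv ℝ (fun q => c (e.symm q)) q)) p := by
    apply Filter.EventuallyEq.extDeriv_eq
    filter_upwards [eventually_mem_overlap hp hx] with q hq
    exact inChart_eq η he hc hq.1 hq.2
  have h2 := extDeriv_pullback (f := fun q => c (e.symm q))
    (show DifferentiableAt ℝ (inChart c η) ((fun q => c (e.symm q)) p) from hd) hτ two_le_infty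
  rw [h1, h2]
  rfl

theorem inChart_extD_eventuallyEq {k : ℕ} {η : DiffForm E X k} (hη : IsSmoothForm η)
    {e : OpenPartialHomeomorph X E} (he : e ∈ IsManifold.maximalAtlas 𝓘(ℂ, E) ω X) {p : E}
    (hp : p ∈ e.target) : inChart e (extD η) =ᶠ[𝓝 p] extDeriv (inChart e η) := by
  filter_upwards [e.open_target.mem_nhds hp] with q hq using inChart_extD hη he hq

theorem contDiffAt_extDeriv {k : ℕ} {A : E → E [⋀^Fin k]→L[ℝ] ℝ} {p : E}
    (h : ContDiffAt ℝ ∞ A p) : ContDiffAt ℝ ∞ (extDeriv A) p :=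
  ContDiffAt.comp (g := ContinuousAlternatingMap.alternatizeUncurryFinCLM ℝ E ℝ) p
    (ContinuousLinearMap.contDiff _).contDiffAt (h.fderiv_right (m := ∞) (by simp))

theorem isSmoothForm_extD {k : ℕ} {η : DiffForm E X k} (hη : IsSmoothForm η) :
    IsSmoothForm (extD η) := by
  refine isSmoothForm_of fun x => ⟨chartAt E x, chartAt_mem_maximalAtlas x, mem_chart_source E x, ?_⟩
  have hp := mem_chart_target E x
  exact (contDiffAt_extDeriv (hη.contDiffAt (chartAt_mem_maximalAtlas x) hp)).congr_of_eventuallyEq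
    (inChart_extD_eventuallyEq hη (chartAt_mem_maximalAtlas x) hp)

theorem IsSmoothForm.add {k : ℕ} {η θ : DiffForm E X k} (hη : IsSmoothForm η)
    (hθ : IsSmoothForm θ) : IsSmoothForm (η + θ) := fun e he => (hη e he).add (hθ e he)

theorem IsSmoothForm.sub {k : ℕ} {η θ : DiffForm E X k} (hη : IsSmoothForm η)
    (hθ : IsSmoothForm θ) : IsSmoothForm (η - θ) := fun e he => (hη e he).sub (hθ e he)

theorem IsSmoothForm.smul {k : ℕ} {η : DiffForm E X k} (c : ℝ) (hη : IsSmoothForm η) :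
    IsSmoothForm (c • η) := fun e he => (hη e he).const_smul c

theorem isSmoothForm_wedge {k l : ℕ} {α : DiffForm E X k} {β : DiffForm E X l}
    (hα : IsSmoothForm α) (hβ : IsSmoothForm β) : IsSmoothForm (wedgeForm α β) := by
  intro e he p hp
  have he' : e ∈ IsManifold.maximalAtlas 𝓘(ℂ, E) ω X :=
    IsManifold.subset_maximalAtlas he
  have := contDiffAt_wedge (hα.contDiffAt he' hp) (hβ.contDiffAt he' hp)
  rw [show inChart e (wedgeForm α β) = _ from funext (inChart_wedgeForm e α β)]
  exact this.contDiffWithinAt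

theorem extD_add {k : ℕ} {η θ : DiffForm E X k} (hη : IsSmoothForm η) (hθ : IsSmoothForm θ) :
    extD (η + θ) = extD η + extD θ := by
  funext x
  have hp := mem_chart_target E x
  exact extDeriv_add ((hη.contDiffAt (chartAt_mem_maximalAtlas x) hp).differentiableAt (by simp))
    ((hθ.contDiffAt (chartAt_mem_maximalAtlas x) hp).differentiableAt (by simp))

theorem extD_smul {k : ℕ} (c : ℝ) (η : DiffForm E X k) : extD (c • η) = c • extD η :=
  funext fun x => (by
    change extDeriv (c • inChart (chartAt E x) η) _ = _
    rw [extDeriv_smul]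
    rfl)

/-- The Leibniz rule on a manifold. -/
theorem toList_extD_wedge {k l : ℕ} {α : DiffForm E X k} {β : DiffForm E X l}
    (hα : IsSmoothForm α) (hβ : IsSmoothForm β) (x : X) :
    toList (extD (wedgeForm α β) x) =
      toList (extD α x) * toList (β x) + ListForm.inv (toList (α x)) * toList (extD β x) := by
  have hp := mem_chart_target E x
  have := toList_extDeriv_wedge
    ((hα.contDiffAt (chartAt_mem_maximalAtlas x) hp).differentiableAt (by simp))
    ((hβ.contDiffAt (chartAt_mem_maximalAtlas x) hp).differentiableAt (by simp))
  rw [inChart_chartAt, inChart_chartAt] at this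
  refine Eq.trans ?_ this
  unfold extD
  rw [show inChart (chartAt E x) (wedgeForm α β) = _ from funext (inChart_wedgeForm _ α β)]

end Charts

/-! ### Integrals of compactly supported functions with parameters -/

section Parametric

variable {B F V : Type} [NormedAddCommGroup B] [NormedSpace ℝ B]
  [NormedAddCommGroup F] [NormedSpace ℝ F] [FiniteDimensional ℝ F] [MeasurableSpace F]
  [BorelSpace F] (μ : Measure F) [μ.IsAddHaarMeasure]
  [NormedAddCommGroup V] [NormedSpace ℝ V]

/-- The integral of a derivative of a compactly supported function vanishes. -/
theorem integral_fderiv_eq_zero [FiniteDimensional ℝ V] {g : F → V} (hg : ContDiff ℝ 1 g)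
    (hc : HasCompactSupport g) (w : F) : ∫ v, fderiv ℝ g v w ∂μ = 0 := by
  have h := integral_bilinear_hasLineDerivAt_right_eq_neg_left_of_integrable (μ := μ) (v := w)
    (f := fun _ => (1 : ℝ)) (f' := fun _ => 0) (g := g) (g' := fun v => fderiv ℝ g v w)
    (B := ContinuousLinearMap.lsmul ℝ ℝ) (by simp) ?_ ?_ ?_ ?_
  · simpa using h
  · simp only [ContinuousLinearMap.lsmul_apply, one_smul]
    exact ((hg.continuous_fderiv (by simp)).clm_apply continuous_const).integrable_of_hasCompactSupport
      (hc.fderiv_apply (𝕜 := ℝ) w)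
  · simpa using hg.continuous.integrable_of_hasCompactSupport hc
  · exact fun x _ => (hasFDerivAt_const _ _).hasLineDerivAt _
  · exact fun x _ => ((hg.differentiable (by simp) x).hasFDerivAt).hasLineDerivAt _

theorem hasCompactSupport_slice {g : B × F → V} (hc : HasCompactSupport g) (b : B) :
    HasCompactSupport fun v => g (b, v) :=
  HasCompactSupport.of_support_subset_isCompact (hc.isCompact.image continuous_snd)
    fun v hv => ⟨(b, v), subset_tsupport _ hv, rfl⟩

theorem integrable_slice {g : B × F → V} (hg : Continuous g) (hc : HasCompactSupport g)
    (b : B) : Integrable (fun v => g (b, v)) μ :=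
  (hg.comp (by fun_prop : Continuous fun v : F => (b, v))).integrable_of_hasCompactSupport
    (hasCompactSupport_slice hc b)

/-- Differentiation under the integral sign. -/
theorem hasFDerivAt_integral_slice [FiniteDimensional ℝ B] {g : B × F → V} (hg : ContDiff ℝ 1 g)
    (hc : HasCompactSupport g) (b : B) :
    HasFDerivAt (fun b => ∫ v, g (b, v) ∂μ)
      (∫ v, (fderiv ℝ g (b, v)).comp (ContinuousLinearMap.inl ℝ B F) ∂μ) b := by
  have hcf : HasCompactSupport (fderiv ℝ g) := hc.fderiv (𝕜 := ℝ)
  have hcont : Continuous (fderiv ℝ g) := hg.continuous_fderiv (by simp)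
  have hcont' : Continuous fun q => (fderiv ℝ g q).comp (ContinuousLinearMap.inl ℝ B F) :=
    hcont.clm_comp continuous_const
  have hc' : HasCompactSupport fun q => (fderiv ℝ g q).comp (ContinuousLinearMap.inl ℝ B F) :=
    hcf.comp_left (g := fun L : B × F →L[ℝ] V => L.comp (ContinuousLinearMap.inl ℝ B F))
      (ContinuousLinearMap.zero_comp _)
  obtain ⟨C, hC⟩ := hc'.exists_bound_of_continuous hcont'
  set K := Prod.snd '' tsupport fun q => (fderiv ℝ g q).comp (ContinuousLinearMap.inl ℝ B F)
  have hK : IsCompact K := hc'.isCompact.image continuous_snd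
  refine hasFDerivAt_integral_of_dominated_of_fderiv_le (s := Set.univ)
    (F' := fun b v => (fderiv ℝ g (b, v)).comp (ContinuousLinearMap.inl ℝ B F))
    (bound := K.indicator fun _ => C) Filter.univ_mem
    (Filter.Eventually.of_forall fun b => (integrable_slice μ hg.continuous hc b).1)
    (integrable_slice μ hg.continuous hc b) (integrable_slice μ hcont' hc' b).1 ?_ ?_ ?_
  · refine Filter.Eventually.of_forall fun v x _ => ?_
    by_cases hv : v ∈ K
    · rw [Set.indicator_of_mem hv]; exact hC _
    · rw [Set.indicator_of_notMem hv, norm_le_zero_iff]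
      exact image_eq_zero_of_notMem_tsupport (f := fun q =>
        (fderiv ℝ g q).comp (ContinuousLinearMap.inl ℝ B F)) fun h => hv ⟨(x, v), h, rfl⟩
  · exact (integrable_indicator_iff hK.measurableSet).2
      (integrableOn_const hK.measure_lt_top.ne)
  · refine Filter.Eventually.of_forall fun v x _ => ?_
    exact ((hg.differentiable (by simp) (x, v)).hasFDerivAt).comp x (hasFDerivAt_prodMk_left x v)

/-- Integrals over slices of smooth compactly supported functions are of class `C^r`: their
derivatives are integrals of the same kind, with values in a space of linear maps. -/
theorem contDiff_integral_slice_nat [FiniteDimensional ℝ B] (r : ℕ) : ∀ {V : Type}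
    [NormedAddCommGroup V] [NormedSpace ℝ V] {g : B × F → V}, ContDiff ℝ ∞ g →
      HasCompactSupport g → ContDiff ℝ r fun b => ∫ v, g (b, v) ∂μ := by
  induction r with
  | zero =>
    intro V _ _ g hg hc
    have : ContDiff ℝ 1 g := hg.of_le (by simp)
    exact contDiff_zero.2 (continuous_iff_continuousAt.2 fun b =>
      (hasFDerivAt_integral_slice μ this hc b).continuousAt)
  | succ r ih =>
    intro V _ _ g hg hc
    have h1 : ContDiff ℝ 1 g := hg.of_le (by simp)
    have h2 : ContDiff ℝ ∞ fun q => (fderiv ℝ g q).comp (ContinuousLinearMap.inl ℝ B F) :=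
      (hg.fderiv_right (m := ∞) (by simp)).clm_comp contDiff_const
    have hc' : HasCompactSupport fun q => (fderiv ℝ g q).comp (ContinuousLinearMap.inl ℝ B F) :=
      (hc.fderiv (𝕜 := ℝ)).comp_left
        (g := fun L : B × F →L[ℝ] V => L.comp (ContinuousLinearMap.inl ℝ B F))
        (ContinuousLinearMap.zero_comp _)
    exact contDiff_succ_iff_hasFDerivAt.2
      ⟨_, ih h2 hc', fun b => hasFDerivAt_integral_slice μ h1 hc b⟩

theorem contDiff_integral_slice [FiniteDimensional ℝ B] {g : B × F → V} (hg : ContDiff ℝ ∞ g)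
    (hc : HasCompactSupport g) : ContDiff ℝ ∞ fun b => ∫ v, g (b, v) ∂μ :=
  contDiff_infty.2 fun r => contDiff_integral_slice_nat μ r hg hc

theorem integral_fderiv_slice_eq_zero [FiniteDimensional ℝ V] {g : B × F → V}
    (hg : ContDiff ℝ 1 g) (hc : HasCompactSupport g) (b : B) (w : F) :
    ∫ v, fderiv ℝ g (b, v) (0, w) ∂μ = 0 := by
  rw [← integral_fderiv_eq_zero μ (g := fun v => g (b, v))
    (hg.comp (by fun_prop : ContDiff ℝ 1 fun v : F => (b, v))) (hasCompactSupport_slice hc b) w]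
  congr 1
  funext v
  have h : HasFDerivAt (fun v => g (b, v)) ((fderiv ℝ g (b, v)).comp
      (ContinuousLinearMap.inr ℝ B F)) v :=
    ((hg.differentiable (by simp) (b, v)).hasFDerivAt).comp v (hasFDerivAt_prodMk_right b v)
  rw [h.fderiv]
  rfl

/-- The integral `D` over the slice `{b} × F` of the derivative of `g`: it vanishes on vertical
vectors, and its restriction to horizontal vectors is the derivative of the integral of `g`. -/
theorem exists_integral_fderiv_slice [FiniteDimensional ℝ B] [FiniteDimensional ℝ V]
    {g : B × F → V} (hg : ContDiff ℝ 1 g) (hc : HasCompactSupport g) (b : B) :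
    ∃ D : B × F →L[ℝ] V, (∀ w, D (0, w) = 0) ∧
      HasFDerivAt (fun b => ∫ v, g (b, v) ∂μ) (D.comp (ContinuousLinearMap.inl ℝ B F)) b ∧
      ∀ {W : Type} [NormedAddCommGroup W] [NormedSpace ℝ W] [CompleteSpace W]
        (Φ : (B × F →L[ℝ] V) →L[ℝ] W), ∫ v, Φ (fderiv ℝ g (b, v)) ∂μ = Φ D := by
  have hi : Integrable (fun v => fderiv ℝ g (b, v)) μ :=
    integrable_slice μ (hg.continuous_fderiv (by simp)) (hc.fderiv (𝕜 := ℝ)) b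
  have hV : CompleteSpace V := FiniteDimensional.complete ℝ V
  refine ⟨∫ v, fderiv ℝ g (b, v) ∂μ, fun w => ?_, ?_, fun Φ => Φ.integral_comp_comm hi⟩
  · rw [← integral_fderiv_slice_eq_zero μ hg hc b w, ContinuousLinearMap.integral_apply hi]
  · have h2 := hasFDerivAt_integral_slice μ hg hc b
    have h3 : ∫ v, (fderiv ℝ g (b, v)).comp (ContinuousLinearMap.inl ℝ B F) ∂μ =
        (∫ v, fderiv ℝ g (b, v) ∂μ).comp (ContinuousLinearMap.inl ℝ B F) :=
      ((ContinuousLinearMap.compL ℝ B (B × F) V).flip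
        (ContinuousLinearMap.inl ℝ B F)).integral_comp_comm hi
    rwa [h3] at h2

theorem integral_slice_comp_comm [CompleteSpace V] {W : Type} [NormedAddCommGroup W]
    [NormedSpace ℝ W] [CompleteSpace W] (Φ : V →L[ℝ] W) {g : B × F → V} (hg : Continuous g)
    (hc : HasCompactSupport g) (b : B) : ∫ v, Φ (g (b, v)) ∂μ = Φ (∫ v, g (b, v) ∂μ) :=
  Φ.integral_comp_comm (integrable_slice μ hg hc b)

end Parametric

/-! ### Vertical integration on a product of vector spaces -/

section Vertical

open ListForm

variable {B F : Type} [NormedAddCommGroup B] [NormedSpace ℝ B] [FiniteDimensional ℝ B]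
  [NormedAddCommGroup F] [NormedSpace ℝ F] [FiniteDimensional ℝ F] [MeasurableSpace F]
  [BorelSpace F] (μ : Measure F) [μ.IsAddHaarMeasure]

/-- The form on the base obtained by insertion of the vertical vectors `w`. -/
def vertIns {k l : ℕ} (w : Fin l → F) (A : (B × F) [⋀^Fin (k + l)]→L[ℝ] ℝ) : B [⋀^Fin k]→L[ℝ] ℝ :=
  (insertVectors (fun j => ((0 : B), w j)) A).compContinuousLinearMap
    (ContinuousLinearMap.inl ℝ B F)

theorem toList_vertIns {k l : ℕ} (w : Fin l → F) (A : (B × F) [⋀^Fin (k + l)]→L[ℝ] ℝ)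
    (ws : List B) : toList (vertIns w A) ws =
      toList A (List.ofFn (fun j => ((0 : B), w j)) ++ ws.map fun u => (u, 0)) := by
  rw [vertIns, toList_comp, toList_insertVectors]
  rfl

/-- `vertIns` as a linear map. -/
def vertInsL (k : ℕ) {l : ℕ} (w : Fin l → F) :
    ((B × F) [⋀^Fin (k + l)]→L[ℝ] ℝ) →L[ℝ] B [⋀^Fin k]→L[ℝ] ℝ :=
  LinearMap.toContinuousLinearMap
    { toFun := vertIns w
      map_add' := fun A A' => toList_injective (ListForm.ext fun ws => by
        simp [toList_vertIns])
      map_smul' := fun c A => toList_injective (ListForm.ext fun ws => by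
        simp [toList_vertIns]) }

@[simp] theorem vertInsL_apply {k l : ℕ} (w : Fin l → F) (A : (B × F) [⋀^Fin (k + l)]→L[ℝ] ℝ) :
    vertInsL k w A = vertIns w A := rfl

/-- The vertical integral of a form on `B × F`. -/
def vertInt {k l : ℕ} (w : Fin l → F) (A : B × F → (B × F) [⋀^Fin (k + l)]→L[ℝ] ℝ) (b : B) :
    B [⋀^Fin k]→L[ℝ] ℝ := ∫ v, vertIns w (A (b, v)) ∂μ

/-- If a linear family of forms vanishes on the vectors of `W`, only the other vectors are
alternated. -/
theorem listD_append_of_zero {E : Type*} [NormedAddCommGroup E] [NormedSpace ℝ E] (W ys : List E) :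
    ∀ (G : E → ListForm E), (∀ w ∈ W, G w = 0) →
      listD (W ++ ys) G = (-1) ^ W.length * listD ys (fun u => ⟨fun xs => G u (W ++ xs)⟩) := by
  induction W with
  | nil => intro G _; simp
  | cons w W ih =>
    intro G hG
    rw [List.cons_append, listD, hG w (by simp), ih (fun v => ins w (G v)) fun v hv => by
      rw [hG v (by simp [hv])]; ext; simp]
    simp only [List.length_cons, pow_succ, mul_neg, mul_one, zero_apply, zero_sub, neg_mul]
    rfl

theorem contDiff_vertInt {k l : ℕ} (w : Fin l → F) {A : B × F → (B × F) [⋀^Fin (k + l)]→L[ℝ] ℝ}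
    (hA : ContDiff ℝ ∞ A) (hc : HasCompactSupport A) : ContDiff ℝ ∞ (vertInt μ w A) :=
  contDiff_integral_slice (g := fun q => vertInsL k w (A q)) μ
    (ContDiff.comp (g := vertInsL k w) (ContinuousLinearMap.contDiff _) hA) (hc.comp_left (g := vertInsL k w) (map_zero _))

theorem vertInt_eq {k l : ℕ} (w : Fin l → F) {A : B × F → (B × F) [⋀^Fin (k + l)]→L[ℝ] ℝ}
    (hA : Continuous A) (hc : HasCompactSupport A) (b : B) :
    vertInt μ w A b = vertIns w (∫ v, A (b, v) ∂μ) := by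
  have h := integral_slice_comp_comm (V := (B × F) [⋀^Fin (k + l)]→L[ℝ] ℝ)
    (W := B [⋀^Fin k]→L[ℝ] ℝ) μ (vertInsL k w) hA hc b
  exact h

theorem listD_map_inl (ws : List B) : ∀ (G : B → ListForm B) (H : B × F → ListForm (B × F)),
    (∀ u xs, G u xs = H (u, 0) (xs.map fun u => (u, 0))) →
      listD ws G = listD (ws.map fun u => (u, 0)) H := by
  induction ws with
  | nil => intros; rfl
  | cons y ws ih =>
    intro G H h
    rw [List.map_cons, listD, listD, h, ih _ (fun v => ins (y, 0) (H v))]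
    intro u xs
    rw [ins_apply, h, ins_apply]
    rfl

/-- The integral of an exterior derivative over the slices, when all vertical directions are
inserted. -/
theorem exists_toList_integral_extDeriv {k : ℕ} {A : B × F → (B × F) [⋀^Fin k]→L[ℝ] ℝ}
    (hA : ContDiff ℝ ∞ A) (hc : HasCompactSupport A) (b : B) :
    ∃ D : B × F →L[ℝ] (B × F) [⋀^Fin k]→L[ℝ] ℝ,
      HasFDerivAt (fun b => ∫ v, A (b, v) ∂μ) (D.comp (ContinuousLinearMap.inl ℝ B F)) b ∧
      ∀ {l : ℕ} (w : Fin l → F) (ws : List (B × F)),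
        toList (∫ v, extDeriv A (b, v) ∂μ) (List.ofFn (fun j => ((0 : B), w j)) ++ ws) =
          (-1) ^ l * listD ws (fun u => ⟨fun xs => toList (D u)
            (List.ofFn (fun j => ((0 : B), w j)) ++ xs)⟩) := by
  obtain ⟨D, h0, h1, h2⟩ := exists_integral_fderiv_slice μ (hA.of_le (by simp) : ContDiff ℝ 1 A) hc b
  refine ⟨D, h1, fun {l} w ws => ?_⟩
  have h3 : ∫ v, extDeriv A (b, v) ∂μ = ContinuousAlternatingMap.alternatizeUncurryFin D :=
    h2 (ContinuousAlternatingMap.alternatizeUncurryFinCLM ℝ (B × F) ℝ)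
  rw [h3, toList_alternatizeUncurryFin]
  change listD _ _ = _
  rw [listD_append_of_zero, List.length_ofFn]
  intro u hu
  obtain ⟨j, rfl⟩ := List.mem_ofFn.1 hu
  rw [h0, map_zero]

/-- Vertical integration of forms commutes with the exterior derivative, up to sign. -/
theorem toList_extDeriv_vertInt {k l : ℕ} (w : Fin l → F)
    {A : B × F → (B × F) [⋀^Fin (k + l)]→L[ℝ] ℝ}
    (hA : ContDiff ℝ ∞ A) (hc : HasCompactSupport A) (b : B) (ws : List B) :
    toList (∫ v, extDeriv A (b, v) ∂μ)
        (List.ofFn (fun j => ((0 : B), w j)) ++ ws.map fun u => (u, 0)) =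
      (-1) ^ l * toList (extDeriv (vertInt μ w A) b) ws := by
  obtain ⟨D, hD, h⟩ := exists_toList_integral_extDeriv μ hA hc b
  rw [h]
  congr 1
  have h1 : HasFDerivAt (vertInt μ w A) ((vertInsL k w).comp
      (D.comp (ContinuousLinearMap.inl ℝ B F))) b := by
    rw [show vertInt μ w A = fun b => vertInsL k w (∫ v, A (b, v) ∂μ) from
      funext fun b => vertInt_eq μ w hA.continuous hc b]
    exact HasFDerivAt.comp (g := vertInsL k w) b (ContinuousLinearMap.hasFDerivAt _) hD
  rw [extDeriv, h1.fderiv, toList_alternatizeUncurryFin]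
  exact (listD_map_inl _ _ _ fun u xs => toList_vertIns w _ xs).symm

/-- The integral of an exterior derivative over the slices vanishes on the vertical vectors. -/
theorem integral_extDeriv_apply_vertical {k l : ℕ} (w : Fin l → F)
    {A : B × F → (B × F) [⋀^Fin k]→L[ℝ] ℝ} (hA : ContDiff ℝ ∞ A) (hc : HasCompactSupport A)
    (b : B) :
    toList (∫ v, extDeriv A (b, v) ∂μ) (List.ofFn (fun j => ((0 : B), w j))) = 0 := by
  obtain ⟨D, -, h⟩ := exists_toList_integral_extDeriv μ hA hc b
  simpa [listD] using h w []

end Vertical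

/-! ### Forms supported in a chart -/

section Support

variable {E : Type*} [NormedAddCommGroup E] [NormedSpace ℂ E] [NormedSpace ℝ E]
  [IsScalarTower ℝ ℂ E] {X : Type*} [TopologicalSpace X] [ChartedSpace E X]
  [IsManifold 𝓘(ℂ, E) ω X]

/-- The form `η` vanishes outside `K`. -/
def SupportedIn {k : ℕ} (η : DiffForm E X k) (K : Set X) : Prop := ∀ x ∉ K, η x = 0

theorem SupportedIn.sub {k : ℕ} {η θ : DiffForm E X k} {K : Set X} (h : SupportedIn η K)
    (h' : SupportedIn θ K) : SupportedIn (η - θ) K := fun x hx => by simp [h x hx, h' x hx]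

theorem SupportedIn.inChart_eq_zero {k : ℕ} {η : DiffForm E X k} {K : Set X} (h : SupportedIn η K)
    (e : OpenPartialHomeomorph X E) {p : E} (hp : e.symm p ∉ K) : inChart e η p = 0 := by
  rw [inChart, h _ hp]; rfl

/-- The product of a form and a function. -/
def mulForm {k : ℕ} (f : X → ℝ) (η : DiffForm E X k) : DiffForm E X k := fun x => f x • η x

theorem inChart_mulForm {k : ℕ} (f : X → ℝ) (η : DiffForm E X k) (e : OpenPartialHomeomorph X E)
    (p : E) : inChart e (mulForm f η) p = f (e.symm p) • inChart e η p := rfl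

theorem supportedIn_mulForm {k : ℕ} (f : X → ℝ) (η : DiffForm E X k) :
    SupportedIn (mulForm f η) (tsupport f) := fun x hx => by
  rw [mulForm, image_eq_zero_of_notMem_tsupport hx, zero_smul]

theorem contDiffAt_comp_symm_of_at {f : X → ℝ} {e : OpenPartialHomeomorph X E} {p : E}
    (hf : ContMDiffAt 𝓘(ℝ, E) 𝓘(ℝ, ℝ) ∞ f (e.symm p))
    (he : e ∈ IsManifold.maximalAtlas 𝓘(ℂ, E) ω X) (hp : p ∈ e.target) : ContDiffAt ℝ ∞ (fun q => f (e.symm q)) p := by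
  let c := chartAt E (e.symm p)
  have hc : e.symm p ∈ c.source := mem_chart_source E (e.symm p)
  have h1 := (contMDiffAt_iff.1 hf).2
  have h2 : ContDiffAt ℝ ∞ (fun q => f (c.symm q)) (c (e.symm p)) := by
    have h3 : ContDiffWithinAt ℝ ∞ (fun q => f (c.symm q)) (Set.range (id : E → E))
      (c (e.symm p)) := h1
    rwa [Set.range_id, contDiffWithinAt_univ] at h3
  refine (ContDiffAt.comp (f := fun q => c (e.symm q)) p h2
    (contDiffAt_real_transition he (chartAt_mem_maximalAtlas _) hp hc)).congr_of_eventuallyEq ?_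
  filter_upwards [eventually_mem_overlap hp hc] with q hq
  simp [c.left_inv hq.2]

theorem contDiffAt_comp_symm {f : X → ℝ} (hf : ContMDiff 𝓘(ℝ, E) 𝓘(ℝ, ℝ) ∞ f)
    {e : OpenPartialHomeomorph X E} (he : e ∈ IsManifold.maximalAtlas 𝓘(ℂ, E) ω X) {p : E}
    (hp : p ∈ e.target) : ContDiffAt ℝ ∞ (fun q => f (e.symm q)) p :=
  contDiffAt_comp_symm_of_at (hf _) he hp

theorem isSmoothForm_mulForm {k : ℕ} {f : X → ℝ} (hf : ContMDiff 𝓘(ℝ, E) 𝓘(ℝ, ℝ) ∞ f)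
    {η : DiffForm E X k} [FiniteDimensional ℝ E] (hη : IsSmoothForm η) :
    IsSmoothForm (mulForm f η) := by
  intro e he p hp
  have he' : e ∈ IsManifold.maximalAtlas 𝓘(ℂ, E) ω X := IsManifold.subset_maximalAtlas he
  exact ((contDiffAt_comp_symm hf he' hp).smul (hη.contDiffAt he' hp)).contDiffWithinAt

variable [FiniteDimensional ℝ E]

theorem SupportedIn.extD {k : ℕ} {η : DiffForm E X k} {K : Set X} (h : SupportedIn η K)
    (hK : IsClosed K) : SupportedIn (extD η) K := by
  intro x hx
  have h1 : inChart (chartAt E x) η =ᶠ[𝓝 (chartAt E x x)] fun _ => 0 := by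
    have hc : ContinuousAt (chartAt E x).symm (chartAt E x x) :=
      (chartAt E x).symm.continuousAt (mem_chart_target E x)
    have h2 : Kᶜ ∈ 𝓝 ((chartAt E x).symm (chartAt E x x)) := by
      rw [(chartAt E x).left_inv (mem_chart_source E x)]
      exact hK.isOpen_compl.mem_nhds hx
    filter_upwards [hc.preimage_mem_nhds h2] with q hq
    exact h.inChart_eq_zero _ hq
  rw [GeodesicEinstein.extD, h1.extDeriv_eq, extDeriv, fderiv_const_apply]
  exact map_zero (ContinuousAlternatingMap.alternatizeUncurryFinCLM ℝ E ℝ)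

/-- The coordinate expression of a form, extended by zero outside the domain of the
coordinates. -/
def localForm {k : ℕ} (e : OpenPartialHomeomorph X E) (η : DiffForm E X k) (p : E) :
    E [⋀^Fin k]→L[ℝ] ℝ :=
  Set.indicator e.target (inChart e η) p

theorem localForm_of_mem {k : ℕ} {e : OpenPartialHomeomorph X E} (η : DiffForm E X k) {p : E}
    (hp : p ∈ e.target) : localForm e η p = inChart e η p := Set.indicator_of_mem hp _

theorem localForm_of_notMem {k : ℕ} {e : OpenPartialHomeomorph X E} (η : DiffForm E X k) {p : E}
    (hp : p ∉ e.target) : localForm e η p = 0 := Set.indicator_of_notMem hp _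

theorem localForm_add {k : ℕ} (e : OpenPartialHomeomorph X E) (η θ : DiffForm E X k) :
    localForm e (η + θ) = localForm e η + localForm e θ :=
  Set.indicator_add' e.target (inChart e η) (inChart e θ)

theorem localForm_eq_zero {k : ℕ} {e : OpenPartialHomeomorph X E} {η : DiffForm E X k} {K : Set X}
    (h : SupportedIn η K) {p : E} (hp : p ∉ e '' K) : localForm e η p = 0 := by
  by_cases hpt : p ∈ e.target
  · rw [localForm_of_mem _ hpt]
    exact h.inChart_eq_zero e fun hx => hp ⟨_, hx, e.right_inv hpt⟩
  · exact localForm_of_notMem _ hpt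

theorem localForm_eventuallyEq {k : ℕ} {e : OpenPartialHomeomorph X E} (η : DiffForm E X k) {p : E}
    (hp : p ∈ e.target) : localForm e η =ᶠ[𝓝 p] inChart e η := by
  filter_upwards [e.open_target.mem_nhds hp] with q hq using localForm_of_mem η hq

section

variable {k : ℕ} {e : OpenPartialHomeomorph X E} {η : DiffForm E X k} {K : Set X}

theorem isCompact_image_chart (hK : IsCompact K) (hKe : K ⊆ e.source) : IsCompact (e '' K) :=
  hK.image_of_continuousOn (e.continuousOn.mono hKe)

theorem hasCompactSupport_localForm (h : SupportedIn η K) (hK : IsCompact K)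
    (hKe : K ⊆ e.source) : HasCompactSupport (localForm e η) :=
  HasCompactSupport.of_support_subset_isCompact (isCompact_image_chart hK hKe) fun _ hp =>
    by_contra fun h' => hp (localForm_eq_zero h h')

theorem localForm_eventuallyEq_zero (h : SupportedIn η K) (hK : IsCompact K)
    (hKe : K ⊆ e.source) {p : E} (hp : p ∉ e.target) : localForm e η =ᶠ[𝓝 p] fun _ => 0 := by
  have : (e '' K)ᶜ ∈ 𝓝 p := (isCompact_image_chart hK hKe).isClosed.isOpen_compl.mem_nhds
    fun ⟨x, hx, hxp⟩ => hp (hxp ▸ e.map_source (hKe hx))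
  filter_upwards [this] with q hq using localForm_eq_zero h hq

theorem contDiff_localForm (he : e ∈ IsManifold.maximalAtlas 𝓘(ℂ, E) ω X) (hη : IsSmoothForm η)
    (h : SupportedIn η K) (hK : IsCompact K) (hKe : K ⊆ e.source) :
    ContDiff ℝ ∞ (localForm e η) := by
  refine contDiff_iff_contDiffAt.2 fun p => ?_
  by_cases hp : p ∈ e.target
  · exact (hη.contDiffAt he hp).congr_of_eventuallyEq (localForm_eventuallyEq η hp)
  · exact contDiffAt_const.congr_of_eventuallyEq (localForm_eventuallyEq_zero h hK hKe hp)

theorem extDeriv_localForm (he : e ∈ IsManifold.maximalAtlas 𝓘(ℂ, E) ω X) (hη : IsSmoothForm η)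
    (h : SupportedIn η K) (hK : IsCompact K) (hKe : K ⊆ e.source) (p : E) :
    extDeriv (localForm e η) p = localForm e (extD η) p := by
  by_cases hp : p ∈ e.target
  · rw [(localForm_eventuallyEq η hp).extDeriv_eq, localForm_of_mem _ hp, inChart_extD hη he hp]
  · rw [(localForm_eventuallyEq_zero h hK hKe hp).extDeriv_eq, localForm_of_notMem _ hp, extDeriv,
      fderiv_const_apply]
    exact map_zero (ContinuousAlternatingMap.alternatizeUncurryFinCLM ℝ E ℝ)

end

theorem isSmoothForm_zero {k : ℕ} : IsSmoothForm (0 : DiffForm E X k) := fun e _ => by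
  have : ContDiffOn ℝ ∞ (fun _ : E => (0 : E [⋀^Fin k]→L[ℝ] ℝ)) e.target := contDiffOn_const
  exact this

theorem isSmoothForm_sum {k : ℕ} {ι : Type*} (s : Finset ι) {η : ι → DiffForm E X k}
    (h : ∀ i ∈ s, IsSmoothForm (η i)) : IsSmoothForm (∑ i ∈ s, η i) :=
  Finset.sum_induction η IsSmoothForm (fun _ _ => IsSmoothForm.add) isSmoothForm_zero h

theorem extD_sum {k : ℕ} {ι : Type*} (s : Finset ι) {η : ι → DiffForm E X k}
    (h : ∀ i ∈ s, IsSmoothForm (η i)) : extD (∑ i ∈ s, η i) = ∑ i ∈ s, extD (η i) := by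
  classical
  induction s using Finset.induction_on with
  | empty =>
    have := extD_smul 0 (0 : DiffForm E X k)
    rw [Finset.sum_empty, Finset.sum_empty]
    rwa [zero_smul, zero_smul] at this
  | insert a s ha ih =>
    rw [Finset.sum_insert ha, Finset.sum_insert ha, extD_add (h a (by simp))
      (isSmoothForm_sum s fun i hi => h i (by simp [hi])), ih fun i hi => h i (by simp [hi])]

/-- Additive maps on the forms supported in the members of a partition of unity that agree on the
overlaps patch together: the terms that arise from differentiating the partition cancel. -/
theorem sum_apply_mulForm_extD {k N : ℕ} {W : Type*} [AddCommGroup W] (ρ : Fin N → X → ℝ)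
    (hρ : ∀ i, ContMDiff 𝓘(ℝ, E) 𝓘(ℝ, ℝ) ∞ (ρ i)) (hsum : ∀ x, ∑ i, ρ i x = 1)
    (T : Fin N → DiffForm E X (k + 1) → W)
    (hadd : ∀ i η θ, IsSmoothForm η → IsSmoothForm θ → SupportedIn η (tsupport (ρ i)) →
      SupportedIn θ (tsupport (ρ i)) → T i (η + θ) = T i η + T i θ)
    (hT : ∀ i j η, IsSmoothForm η → SupportedIn η (tsupport (ρ i)) →
      SupportedIn η (tsupport (ρ j)) → T i η = T j η)
    {γ : DiffForm E X k} (hγ : IsSmoothForm γ) :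
    ∑ i, T i (mulForm (ρ i) (extD γ)) = ∑ i, T i (extD (mulForm (ρ i) γ)) := by
  have hs : ∀ i, IsSmoothForm (extD (mulForm (ρ i) γ)) := fun i =>
    isSmoothForm_extD (isSmoothForm_mulForm (hρ i) hγ)
  have hs' : ∀ i, IsSmoothForm (mulForm (ρ i) (extD γ)) := fun i =>
    isSmoothForm_mulForm (hρ i) (isSmoothForm_extD hγ)
  -- The differences `θ i = d(ρ i γ) - ρ i dγ` add up to zero. Each is cut up by the partition of
  -- unity, the pieces `ρ j θ i` are moved from `T i` to `T j`, and for fixed `j` they add up to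
  -- zero.
  set θ : Fin N → DiffForm E X (k + 1) := fun i =>
    extD (mulForm (ρ i) γ) - mulForm (ρ i) (extD γ) with hθ
  have hθs : ∀ i, IsSmoothForm (θ i) := fun i => (hs i).sub (hs' i)
  have hθK : ∀ i, SupportedIn (θ i) (tsupport (ρ i)) := fun i =>
    ((supportedIn_mulForm _ _).extD (isClosed_tsupport _)).sub (supportedIn_mulForm _ _)
  have hθ0 : ∑ i, θ i = 0 := by
    simp only [hθ, Finset.sum_sub_distrib]
    rw [← extD_sum _ fun i _ => isSmoothForm_mulForm (hρ i) hγ]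
    have h1 : ∀ {l : ℕ} (η : DiffForm E X l), ∑ i, mulForm (ρ i) η = η := fun η => by
      funext x
      rw [Finset.sum_apply]
      simp only [mulForm]
      rw [← Finset.sum_smul, hsum, one_smul]
    rw [h1, h1, sub_self]
  have hzero : ∀ i, T i 0 = 0 := fun i => by
    have h0 : SupportedIn (0 : DiffForm E X (k + 1)) (tsupport (ρ i)) := fun _ _ => rfl
    have := hadd i 0 0 isSmoothForm_zero isSmoothForm_zero h0 h0
    rw [add_zero] at this
    exact left_eq_add.1 this
  have hTsum : ∀ i (s : Finset (Fin N)) (η : Fin N → DiffForm E X (k + 1)),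
      (∀ j, IsSmoothForm (η j)) → (∀ j, SupportedIn (η j) (tsupport (ρ i))) →
      T i (∑ j ∈ s, η j) = ∑ j ∈ s, T i (η j) := by
    classical
    intro i s η h1 h2
    induction s using Finset.induction_on with
    | empty => simp [hzero]
    | insert a s ha ih =>
      rw [Finset.sum_insert ha, Finset.sum_insert ha, hadd i _ _ (h1 a)
        (isSmoothForm_sum s fun i _ => h1 i) (h2 a) (fun x hx => ?_), ih]
      rw [Finset.sum_apply]
      exact Finset.sum_eq_zero fun j _ => h2 j x hx
  have hsupp : ∀ i j, SupportedIn (mulForm (ρ j) (θ i)) (tsupport (ρ i)) := fun i j x hx => by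
    rw [mulForm, hθK i x hx, smul_zero]
  have hθT : ∑ i, T i (θ i) = 0 := by
    have h1 : ∀ i, T i (θ i) = ∑ j, T j (mulForm (ρ j) (θ i)) := fun i => by
      have h2 : θ i = ∑ j, mulForm (ρ j) (θ i) := by
        funext x
        rw [Finset.sum_apply]
        simp only [mulForm]
        rw [← Finset.sum_smul, hsum, one_smul]
      conv_lhs => rw [h2]
      rw [hTsum i _ _ (fun j => isSmoothForm_mulForm (hρ j) (hθs i)) (hsupp i)]
      exact Finset.sum_congr rfl fun j _ => hT i j _ (isSmoothForm_mulForm (hρ j) (hθs i))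
        (hsupp i j) (supportedIn_mulForm _ _)
    rw [Finset.sum_congr rfl fun i _ => h1 i, Finset.sum_comm]
    refine Finset.sum_eq_zero fun j _ => ?_
    rw [← hTsum j _ _ (fun i => isSmoothForm_mulForm (hρ j) (hθs i))
      (fun i => supportedIn_mulForm _ _), ← hzero j]
    congr 1
    funext x
    rw [Finset.sum_apply]
    simp only [mulForm]
    rw [← Finset.smul_sum, ← Finset.sum_apply, hθ0]
    simp
  have h3 : ∀ i, T i (extD (mulForm (ρ i) γ)) = T i (mulForm (ρ i) (extD γ)) + T i (θ i) :=
    fun i => by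
      rw [← hadd i _ _ (hs' i) (hθs i) (supportedIn_mulForm _ _) (hθK i), hθ]
      congr 1
      exact (add_sub_cancel _ _).symm
  rw [Finset.sum_congr rfl fun i _ => h3 i, Finset.sum_add_distrib, hθT, add_zero]

end Support

/-! ### Integration over compact complex manifolds -/

section Integration

/-- Holomorphic changes of variables preserve the integrals of top-degree forms. -/
theorem setIntegral_eq_of_holomorphic {d : ℕ} {U : Set (Fin d → ℂ)} (hU : MeasurableSet U)
    {τ : (Fin d → ℂ) → (Fin d → ℂ)} (hinj : Set.InjOn τ U)
    {A : (Fin d → ℂ) → (Fin d → ℂ) →L[ℂ] (Fin d → ℂ)}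
    (hτ : ∀ p ∈ U, HasFDerivAt τ (A p) p)
    (hA : ∀ p ∈ U, LinearMap.det (A p : (Fin d → ℂ) →ₗ[ℂ] (Fin d → ℂ)) ≠ 0)
    {V : Type*} [NormedAddCommGroup V] [NormedSpace ℝ V]
    {f g : (Fin d → ℂ) → V}
    (h : ∀ p ∈ U, f p = LinearMap.det ((A p : (Fin d → ℂ) →ₗ[ℂ] (Fin d → ℂ)).restrictScalars ℝ) •
      g (τ p)) :
    ∫ p in U, f p = ∫ p in τ '' U, g p := by
  rw [integral_image_eq_integral_abs_det_fderiv_smul volume hU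
    (f' := fun p => (A p).restrictScalars ℝ)
    (fun p hp => ((hτ p hp).restrictScalars ℝ).hasFDerivWithinAt) hinj]
  refine setIntegral_congr_fun hU fun p hp => ?_
  change f p = |LinearMap.det ((A p : (Fin d → ℂ) →ₗ[ℂ] (Fin d → ℂ)).restrictScalars ℝ)| • _
  rw [abs_of_pos (det_restrictScalars_pos _ (hA p hp)), h p hp]

/-- A linear map with a left inverse has nonzero determinant. -/
theorem det_ne_zero_of_leftInverse {d : ℕ} {A B : (Fin d → ℂ) →L[ℂ] (Fin d → ℂ)}
    (h : B.comp A = ContinuousLinearMap.id ℂ _) :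
    LinearMap.det (A : (Fin d → ℂ) →ₗ[ℂ] (Fin d → ℂ)) ≠ 0 := by
  intro h0
  have h1 : (B : (Fin d → ℂ) →ₗ[ℂ] (Fin d → ℂ)) ∘ₗ (A : (Fin d → ℂ) →ₗ[ℂ] (Fin d → ℂ)) =
      LinearMap.id := by
    ext1 i; ext1; exact congrArg (fun f => f (Pi.single i 1)) h
  have h2 := congrArg LinearMap.det h1
  rw [LinearMap.det_comp, h0, mul_zero, LinearMap.det_id] at h2
  exact zero_ne_one h2

variable {d : ℕ} {M : Type*} [TopologicalSpace M] [ChartedSpace (Fin d → ℂ) M]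
  [IsManifold 𝓘(ℂ, Fin d → ℂ) ω M]

/-- The derivatives of the two transition maps between a pair of charts are inverse to each other.
-/
theorem fderiv_transition_comp {E : Type*} [NormedAddCommGroup E] [NormedSpace ℂ E] 
    {M : Type*} [TopologicalSpace M] [ChartedSpace E M] [IsManifold 𝓘(ℂ, E) ω M]
    {e e' : OpenPartialHomeomorph M E}
    (he : e ∈ IsManifold.maximalAtlas 𝓘(ℂ, E) ω M)
    (he' : e' ∈ IsManifold.maximalAtlas 𝓘(ℂ, E) ω M) {p : E} (hp : p ∈ e.target)
    (hp' : e.symm p ∈ e'.source) :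
    (fderiv ℂ (fun q => e (e'.symm q)) (e' (e.symm p))).comp
      (fderiv ℂ (fun q => e' (e.symm q)) p) = ContinuousLinearMap.id ℂ _ := by
  have hs : e'.symm (e' (e.symm p)) = e.symm p := e'.left_inv hp'
  have hd := (contDiffAt_transition he' he (e'.map_source hp')
    (by rw [hs]; exact e.map_target hp)).differentiableAt (by simp)
  have hd' := (contDiffAt_transition he he' hp hp').differentiableAt (by simp)
  rw [← fderiv_comp p hd hd', ← fderiv_id (𝕜 := ℂ) (x := p)]
  apply Filter.EventuallyEq.fderiv_eq
  filter_upwards [eventually_mem_overlap hp hp'] with q hq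
  simp [e'.left_inv hq.2, e.right_inv hq.1]

/-- The integral of a top-degree form over a chart. -/
def chartIntegral (e : OpenPartialHomeomorph M (Fin d → ℂ)) (Θ : DiffForm (Fin d → ℂ) M (2 * d)) :
    ℝ := ∫ p, localForm e Θ p (stdFrame d)

/-- The part of the target of `e` that lies over the source of `e'`. -/
def overlap {E X : Type*} [TopologicalSpace E] [TopologicalSpace X]
    (e e' : OpenPartialHomeomorph X E) : Set E := e.target ∩ e.symm ⁻¹' e'.source

theorem isOpen_overlap {E X : Type*} [TopologicalSpace E] [TopologicalSpace X]
    (e e' : OpenPartialHomeomorph X E) : IsOpen (overlap e e') :=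
  e.isOpen_inter_preimage_symm e'.open_source

theorem transition_image_overlap {E X : Type*} [TopologicalSpace E] [TopologicalSpace X]
    (e e' : OpenPartialHomeomorph X E) :
    (fun q => e' (e.symm q)) '' overlap e e' = overlap e' e := by
  ext q
  constructor
  · rintro ⟨p, ⟨hp, hp'⟩, rfl⟩
    exact ⟨e'.map_source hp', by
      change e'.symm (e' (e.symm p)) ∈ e.source
      rw [e'.left_inv hp']; exact e.map_target hp⟩
  · rintro ⟨hq, hq'⟩
    refine ⟨e (e'.symm q), ⟨e.map_source hq', ?_⟩, ?_⟩
    · change e.symm (e (e'.symm q)) ∈ e'.source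
      rw [e.left_inv hq']; exact e'.map_target hq
    · change e' (e.symm (e (e'.symm q))) = q
      rw [e.left_inv hq', e'.right_inv hq]

theorem transition_injOn {E X : Type*} [TopologicalSpace E] [TopologicalSpace X]
    (e e' : OpenPartialHomeomorph X E) :
    Set.InjOn (fun q => e' (e.symm q)) (overlap e e') := fun _ hp _ hq h =>
  e.symm.injOn hp.1 hq.1 (e'.injOn hp.2 hq.2 h)

theorem localForm_of_notMem_overlap {E X : Type*} [NormedAddCommGroup E] [NormedSpace ℂ E]
    [NormedSpace ℝ E] [IsScalarTower ℝ ℂ E] [FiniteDimensional ℝ E] [TopologicalSpace X] [ChartedSpace E X]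
    [IsManifold 𝓘(ℂ, E) ω X] {k : ℕ} {e e' : OpenPartialHomeomorph X E} {η : DiffForm E X k} (h : SupportedIn η e'.source)
    {p : E} (hp : p ∉ overlap e e') : localForm e η p = 0 := by
  by_cases hpt : p ∈ e.target
  · rw [localForm_of_mem _ hpt, inChart, h _ fun h' => hp ⟨hpt, h'⟩]; rfl
  · exact localForm_of_notMem _ hpt

/-- The integral of a form supported in two charts can be computed in either of them. -/
theorem chartIntegral_eq {e e' : OpenPartialHomeomorph M (Fin d → ℂ)}
    (he : e ∈ IsManifold.maximalAtlas 𝓘(ℂ, Fin d → ℂ) ω M)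
    (he' : e' ∈ IsManifold.maximalAtlas 𝓘(ℂ, Fin d → ℂ) ω M)
    {Θ : DiffForm (Fin d → ℂ) M (2 * d)} (h : SupportedIn Θ e.source)
    (h' : SupportedIn Θ e'.source) : chartIntegral e Θ = chartIntegral e' Θ := by
  have key : ∀ {e e' : OpenPartialHomeomorph M (Fin d → ℂ)}, SupportedIn Θ e'.source →
      chartIntegral e Θ = ∫ p in overlap e e', localForm e Θ p (stdFrame d) := fun h' =>
    (setIntegral_eq_integral_of_forall_compl_eq_zero fun p hp => by
      rw [localForm_of_notMem_overlap h' hp]; rfl).symm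
  rw [key h', key h, ← transition_image_overlap e e']
  refine setIntegral_eq_of_holomorphic (isOpen_overlap e e').measurableSet (transition_injOn e e')
    (A := fun p => fderiv ℂ (fun q => e' (e.symm q)) p) (fun p hp =>
      ((contDiffAt_transition he he' hp.1 hp.2).differentiableAt (by simp)).hasFDerivAt)
    (fun p hp => det_ne_zero_of_leftInverse (fderiv_transition_comp he he' hp.1 hp.2)) ?_
  intro p hp
  rw [localForm_of_mem _ hp.1, localForm_of_mem _ (e'.map_source hp.2), inChart_eq Θ he he' hp.1 hp.2,
    fderiv_real_eq ((contDiffAt_transition he he' hp.1 hp.2).differentiableAt (by simp)),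
    smul_eq_mul, ← topForm_map (finrank_real_pi d)]
  rfl

/-- The integral of a form by means of a partition of unity, as a sum of integrals over charts. -/
theorem integral_eq_sum (P : ChartPartition (Fin d → ℂ) M)
    (Θ : DiffForm (Fin d → ℂ) M (2 * d)) :
    ∑ i, ∫ p in (P.chart i).target,
      P.ρ i ((P.chart i).symm p) * inChart (P.chart i) Θ p (stdFrame d) =
      ∑ i, chartIntegral (P.chart i) (mulForm (P.ρ i) Θ) := by
  refine Finset.sum_congr rfl fun i _ => ?_
  rw [chartIntegral, ← integral_indicator (P.chart i).open_target.measurableSet]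
  congr 1
  funext p
  by_cases hp : p ∈ (P.chart i).target
  · rw [Set.indicator_of_mem hp, localForm_of_mem _ hp]; rfl
  · rw [Set.indicator_of_notMem hp, localForm_of_notMem _ hp]; rfl

theorem integrable_localForm_apply [CompactSpace M] {e : OpenPartialHomeomorph M (Fin d → ℂ)}
    (he : e ∈ IsManifold.maximalAtlas 𝓘(ℂ, Fin d → ℂ) ω M) {k : ℕ} {Θ : DiffForm (Fin d → ℂ) M k}
    (hΘ : IsSmoothForm Θ) {K : Set M} (hK : IsClosed K) (hKe : K ⊆ e.source)
    (h : SupportedIn Θ K) (v : Fin k → (Fin d → ℂ)) :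
    Integrable fun p => localForm e Θ p v := by
  have h1 := contDiff_localForm he hΘ h hK.isCompact hKe
  have h2 := hasCompactSupport_localForm h hK.isCompact hKe
  refine Continuous.integrable_of_hasCompactSupport ((evalForm v).continuous.comp h1.continuous) ?_
  exact h2.comp_left (g := evalForm v) (map_zero _)

/-- The integral over a vector space of the exterior derivative of a compactly supported form
vanishes. -/
theorem integral_extDeriv_apply {F : Type} [NormedAddCommGroup F] [NormedSpace ℝ F]
    [FiniteDimensional ℝ F] [MeasurableSpace F] [BorelSpace F] (μ : Measure F) [μ.IsAddHaarMeasure]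
    {k : ℕ} {A : F → F [⋀^Fin k]→L[ℝ] ℝ} (hA : ContDiff ℝ ∞ A) (hc : HasCompactSupport A)
    (v : Fin (k + 1) → F) : ∫ p, extDeriv A p v ∂μ = 0 := by
  have h1 : ContDiff ℝ 1 A := hA.of_le (by simp)
  have hint : ∀ u, Integrable (fun p => fderiv ℝ A p u) μ := fun u =>
    ((h1.continuous_fderiv (by simp)).clm_apply continuous_const).integrable_of_hasCompactSupport
      (hc.fderiv_apply (𝕜 := ℝ) u)
  have hint' : ∀ i : Fin (k + 1), Integrable (fun p =>
      (-1 : ℝ) ^ (i : ℕ) • evalForm (i.removeNth v) (fderiv ℝ A p (v i))) μ := fun i => by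
    have h2 := ((evalForm (i.removeNth v)).integrable_comp (hint (v i))).smul
      ((-1 : ℝ) ^ (i : ℕ))
    exact h2
  have h3 : ∀ p, extDeriv A p v = ∑ i : Fin (k + 1),
      (-1 : ℝ) ^ (i : ℕ) • evalForm (i.removeNth v) (fderiv ℝ A p (v i)) := fun p => by
    rw [extDeriv, ContinuousAlternatingMap.alternatizeUncurryFin_apply]
    simp
  simp only [h3]
  rw [integral_finsetSum _ fun i _ => hint' i]
  refine Finset.sum_eq_zero fun i _ => ?_
  rw [integral_smul, ContinuousLinearMap.integral_comp_comm _ (hint (v i)),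
    integral_fderiv_eq_zero μ h1 hc, map_zero, smul_zero]

section CastDeg

variable {E : Type*} [NormedAddCommGroup E] [NormedSpace ℂ E] [NormedSpace ℝ E]
  [IsScalarTower ℝ ℂ E] [FiniteDimensional ℝ E] {X : Type*} [TopologicalSpace X] [ChartedSpace E X]
  {k l : ℕ} (h : k = l)

theorem castDeg_add (η θ : DiffForm E X k) : castDeg h (η + θ) = castDeg h η + castDeg h θ := by
  subst h; rfl

theorem castDeg_mulForm (f : X → ℝ) (η : DiffForm E X k) :
    castDeg h (mulForm f η) = mulForm f (castDeg h η) := by subst h; rfl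

theorem supportedIn_castDeg {η : DiffForm E X k} {K : Set X} (hη : SupportedIn η K) :
    SupportedIn (castDeg h η) K := by subst h; exact hη

theorem isSmoothForm_castDeg {η : DiffForm E X k} (hη : IsSmoothForm η) :
    IsSmoothForm (castDeg h η) := by subst h; exact hη

theorem toList_localForm_castDeg (e : OpenPartialHomeomorph X E) (η : DiffForm E X k) (p : E) :
    toList (localForm e (castDeg h η) p) = toList (localForm e η p) := by subst h; rfl

end CastDeg

/-- Stokes' theorem: the integral of an exact form of top degree over a compact complex manifold
vanishes. -/
theorem integral_castDeg_extD [CompactSpace M] {k : ℕ} (hk : k + 1 = 2 * d)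
    {γ : DiffForm (Fin d → ℂ) M k} (hγ : IsSmoothForm γ) : integral (castDeg hk (extD γ)) = 0 := by
  unfold integral
  split_ifs with hP
  swap
  · rfl
  rw [integral_eq_sum]
  simp only [← castDeg_mulForm]
  set P := hP.some
  have hT := sum_apply_mulForm_extD P.ρ P.smooth P.sum_eq_one
    (fun i η => chartIntegral (P.chart i) (castDeg hk η)) ?_ ?_ hγ
  · refine hT.trans (Finset.sum_eq_zero fun i _ => ?_)
    obtain ⟨v, hv⟩ := exists_ofFn (ws := List.ofFn (stdFrame d)) (k := k + 1) (by simp [hk])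
    have h1 := isSmoothForm_mulForm (P.smooth i) hγ
    have h2 := supportedIn_mulForm (P.ρ i) γ
    have hK := (isClosed_tsupport (P.ρ i)).isCompact
    unfold chartIntegral
    simp only [← toList_ofFn _ (stdFrame d), toList_localForm_castDeg, hv]
    simp only [toList_ofFn, ← extDeriv_localForm (P.chart_mem i) h1 h2 hK (P.tsupport_subset i)]
    exact integral_extDeriv_apply volume
      (contDiff_localForm (P.chart_mem i) h1 h2 hK (P.tsupport_subset i))
      (hasCompactSupport_localForm h2 hK (P.tsupport_subset i)) v
  · intro i η θ hη hθ hηK hθK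
    simp only [chartIntegral, castDeg_add, localForm_add]
    exact integral_add
      (integrable_localForm_apply (P.chart_mem i) (isSmoothForm_castDeg hk hη)
        (isClosed_tsupport _) (P.tsupport_subset i) (supportedIn_castDeg hk hηK) _)
      (integrable_localForm_apply (P.chart_mem i) (isSmoothForm_castDeg hk hθ)
        (isClosed_tsupport _) (P.tsupport_subset i) (supportedIn_castDeg hk hθK) _)
  · intro i j η _ hi hj
    exact chartIntegral_eq (P.chart_mem i) (P.chart_mem j)
      (supportedIn_castDeg hk fun x hx => hi x fun h => hx (P.tsupport_subset i h))
      (supportedIn_castDeg hk fun x hx => hj x fun h => hx (P.tsupport_subset j h))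

end Integration

/-! ### Integration along the fibres -/

section LinearAlgebra

open ListForm

/-- An even number of arguments of a form can be moved past the others. -/
theorem toList_append_comm {E : Type*} [NormedAddCommGroup E] [NormedSpace ℝ E] {W : List E}
    (hW : Even W.length) (Z : List E) : ∀ {N : ℕ} (θ : E [⋀^Fin N]→L[ℝ] ℝ),
    toList θ (W ++ Z) = toList θ (Z ++ W) := by
  induction Z with
  | nil => intro N θ; simp
  | cons z Z ih =>
    intro N θ
    rcases N with _ | N
    · rw [toList_of_ne _ (by simp), toList_of_ne _ (by simp)]
    · have h1 := (isAlt_toList θ).insertIdx (W ++ Z) W.length z (by simp)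
      rw [hW.neg_one_pow, one_mul, show (W ++ Z).insertIdx W.length z = W ++ z :: Z by
          clear h1 ih hW; induction W with
          | nil => rfl
          | cons w W ihW => simpa using ihW] at h1
      rw [h1, List.cons_append, ← ins_apply, ← ins_apply, ← toList_curryLeft, ih]

variable {m n : ℕ}

/-- A linear change of coordinates that preserves the fibre directions multiplies the fibre
integrand by the real determinant of its vertical part. -/
theorem vertIns_comp {k : ℕ} (θ : ((Fin m → ℂ) × (Fin n → ℂ)) [⋀^Fin (k + 2 * n)]→L[ℝ] ℝ)
    (D : (Fin m → ℂ) × (Fin n → ℂ) →L[ℝ] (Fin m → ℂ) × (Fin n → ℂ))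
    (A : (Fin n → ℂ) →ₗ[ℝ] (Fin n → ℂ)) (S : (Fin m → ℂ) →L[ℝ] (Fin m → ℂ))
    (hA : ∀ w, D (0, w) = (0, A w)) (hS : ∀ u, (D (u, 0)).1 = S u) :
    vertIns (stdFrame n) (θ.compContinuousLinearMap D) =
      LinearMap.det A • (vertIns (stdFrame n) θ).compContinuousLinearMap S := by
  apply toList_injective
  ext ws
  by_cases hk : ws.length = k
  swap
  · rw [toList_of_ne _ hk, toList_of_ne _ hk]
  -- For fixed other arguments, the form is of top degree in the vertical ones.
  have hdet : ∀ Z : List ((Fin m → ℂ) × (Fin n → ℂ)), Z.length = k →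
      toList θ (List.ofFn (fun j => ((0 : Fin m → ℂ), A (stdFrame n j))) ++ Z) =
        LinearMap.det A * toList θ (List.ofFn (fun j => ((0 : Fin m → ℂ), stdFrame n j)) ++ Z) := by
    intro Z hZ
    rw [toList_append_comm (by simp) Z, toList_append_comm (by simp) Z]
    obtain ⟨z, rfl⟩ := exists_ofFn hZ
    let θ' := castDeg (X := Unit) (Nat.add_comm k (2 * n)) (fun _ => θ) ()
    have hθ' : toList θ = toList θ' :=
      (toList_castDeg (X := Unit) (Nat.add_comm k (2 * n)) (fun _ => θ) ()).symm
    let g := (insertVectors z θ').compContinuousLinearMap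
      (ContinuousLinearMap.inr ℝ (Fin m → ℂ) (Fin n → ℂ))
    have hg : ∀ w : Fin (2 * n) → (Fin n → ℂ),
        g w = toList θ (List.ofFn z ++ List.ofFn fun j => ((0 : Fin m → ℂ), w j)) := fun w => by
      rw [← toList_ofFn, toList_comp, toList_insertVectors, hθ', List.map_ofFn]
      rfl
    rw [← hg (fun j => A (stdFrame n j)), ← hg (stdFrame n), topForm_map (finrank_real_pi n)]
  -- Once the fibre frame is inserted, the vertical components of the other arguments do not matter.
  have hmod : toList (insertVectors (fibreFrame m n) θ) (ws.map fun u => D (u, 0)) =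
      toList (insertVectors (fibreFrame m n) θ) (ws.map fun u => (S u, 0)) := by
    obtain ⟨u, rfl⟩ := exists_ofFn hk
    rw [List.map_ofFn, List.map_ofFn, toList_ofFn, toList_ofFn]
    refine apply_eq_of_sub_mem {v | v.1 = 0} _ ?_ _ _ ?_
    · rintro ⟨v1, v2⟩ rfl
      exact ins_vertical_eq_zero θ v2
    · intro i
      simp [hS]
  rw [toList_insertVectors, toList_insertVectors] at hmod
  rw [toList_vertIns, toList_comp, List.map_append, List.map_ofFn, List.map_map, map_smul,
    ListForm.smul_apply, toList_comp, toList_vertIns, List.map_map]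
  have h1 : (D ∘ fun j : Fin (2 * n) => ((0 : Fin m → ℂ), stdFrame n j)) =
      fun j => ((0 : Fin m → ℂ), A (stdFrame n j)) := funext fun j => hA _
  rw [h1, hdet _ (by simpa using hk)]
  congr 1

theorem toList_integral_congr {F : Type*} [MeasurableSpace F] (μ : Measure F) {E : Type*}
    [NormedAddCommGroup E] [NormedSpace ℝ E] {k l : ℕ} (h : k = l)
    {A : F → E [⋀^Fin k]→L[ℝ] ℝ} {A' : F → E [⋀^Fin l]→L[ℝ] ℝ}
    (hA : ∀ v, toList (A v) = toList (A' v)) : toList (∫ v, A v ∂μ) = toList (∫ v, A' v ∂μ) := by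
  subst h
  rw [show A = A' from funext fun v => toList_injective (hA v)]

end LinearAlgebra

section Push

variable {m n : ℕ}
  {M : Type*} [TopologicalSpace M] [ChartedSpace (Fin m → ℂ) M] [IsManifold 𝓘(ℂ, Fin m → ℂ) ω M]
  {X : Type*} [TopologicalSpace X] [ChartedSpace ((Fin m → ℂ) × (Fin n → ℂ)) X]
  [IsManifold 𝓘(ℂ, (Fin m → ℂ) × (Fin n → ℂ)) ω X]

/-- Integration along the fibres in admissible coordinates. The integral over the fibre coordinates
is pulled back by the coordinate map `z`; the form is meant to be supported in the domain of `e`,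
and the result is extended by zero outside the domain of `z`. -/
def pushChart (e : OpenPartialHomeomorph X ((Fin m → ℂ) × (Fin n → ℂ)))
    (z : OpenPartialHomeomorph M (Fin m → ℂ)) {k : ℕ}
    (η : DiffForm ((Fin m → ℂ) × (Fin n → ℂ)) X (k + 2 * n)) : DiffForm (Fin m → ℂ) M k := fun y =>
  open Classical in
  if y ∈ z.source then
    (vertInt volume (stdFrame n) (localForm e η) (z y)).compContinuousLinearMap
      (fderiv ℝ (fun q => z ((chartAt (Fin m → ℂ) y).symm q)) (chartAt (Fin m → ℂ) y y))
  else 0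

/-- Integration along the fibres by means of a partition of unity, as a sum of integrations in
coordinates. -/
theorem fibreIntegral_eq_sum {π : X → M} (P : AdmissiblePartition (m := m) (n := n) π) {N k : ℕ}
    (h : N = k + 2 * n) (η : DiffForm ((Fin m → ℂ) × (Fin n → ℂ)) X N) :
    P.fibreIntegral h η =
      ∑ i, pushChart (P.chart i) (P.base i) (mulForm (P.ρ i) (castDeg h η)) := by
  funext y
  rw [AdmissiblePartition.fibreIntegral, Finset.sum_apply]
  refine Finset.sum_congr rfl fun i _ => ?_
  unfold pushChart
  split_ifs with hy
  swap
  · rfl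
  congr 1
  have hS : IsOpen {v : Fin n → ℂ | (P.base i y, v) ∈ (P.chart i).target} :=
    (P.chart i).open_target.preimage (by fun_prop : Continuous fun v : Fin n → ℂ => (P.base i y, v))
  rw [← integral_indicator hS.measurableSet, vertInt]
  congr 1
  funext v
  by_cases hv : (P.base i y, v) ∈ (P.chart i).target
  · rw [Set.indicator_of_mem (by exact hv), localForm_of_mem _ hv, inChart_mulForm]
    exact ((vertInsL k (stdFrame n)).map_smul _ _).symm
  · rw [Set.indicator_of_notMem (by exact hv), localForm_of_notMem _ hv]
    exact ((vertInsL k (stdFrame n)).map_zero).symm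

/-- In the coordinates `z`, integration along the fibres is the vertical integral of the coordinate
expression. -/
theorem inChart_pushChart (e : OpenPartialHomeomorph X ((Fin m → ℂ) × (Fin n → ℂ)))
    {z : OpenPartialHomeomorph M (Fin m → ℂ)} (hz : z ∈ IsManifold.maximalAtlas 𝓘(ℂ, Fin m → ℂ) ω M)
    {k : ℕ} (η : DiffForm ((Fin m → ℂ) × (Fin n → ℂ)) X (k + 2 * n)) {b : Fin m → ℂ}
    (hb : b ∈ z.target) :
    inChart z (pushChart e z η) b = vertInt volume (stdFrame n) (localForm e η) b := by
  set c := chartAt (Fin m → ℂ) (z.symm b)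
  have hc : c ∈ IsManifold.maximalAtlas 𝓘(ℂ, Fin m → ℂ) ω M := chartAt_mem_maximalAtlas _
  have hs := mem_chart_source (Fin m → ℂ) (z.symm b)
  have h1 := fderiv_transition_comp hz hc hb hs
  have h2 : (fderiv ℝ (fun q => z (c.symm q)) (c (z.symm b))).comp
      (fderiv ℝ (fun q => c (z.symm q)) b) = ContinuousLinearMap.id ℝ _ := by
    rw [fderiv_real_eq ((contDiffAt_transition hz hc hb hs).differentiableAt (by simp)),
      fderiv_real_eq ((contDiffAt_transition hc hz (c.map_source hs)
        (by rw [c.left_inv hs]; exact z.map_target hb)).differentiableAt (by simp))]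
    ext1 u
    exact congrArg (fun f => f u) h1
  rw [inChart, pushChart, if_pos (z.map_target hb), z.right_inv hb]
  ext v
  change vertInt volume (stdFrame n) (localForm e η) b (fun i => _) = _
  congr 1
  funext i
  exact congrArg (fun f => f (v i)) h2

variable {π : X → M} {e : OpenPartialHomeomorph X ((Fin m → ℂ) × (Fin n → ℂ))}
  {z : OpenPartialHomeomorph M (Fin m → ℂ)}

theorem IsAdmissible.proj_symm (h : IsAdmissible π e z) {q : (Fin m → ℂ) × (Fin n → ℂ)}
    (hq : q ∈ e.target) : z (π (e.symm q)) = q.1 := by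
  rw [← h.fst_eq _ (e.map_target hq), e.right_inv hq]

theorem IsAdmissible.proj_symm_eq (h : IsAdmissible π e z) {y : M} (hy : y ∈ z.source)
    {v : Fin n → ℂ} (hv : (z y, v) ∈ e.target) : π (e.symm (z y, v)) = y :=
  z.injOn (h.mapsTo (e.map_target hv)) hy (h.proj_symm hv)

theorem localForm_eq_zero_of_proj (h : IsAdmissible π e z) {k : ℕ}
    {η : DiffForm ((Fin m → ℂ) × (Fin n → ℂ)) X k} {K : Set X} (hK : SupportedIn η K) {y : M}
    (hy : y ∈ z.source) (hyK : y ∉ π '' K) (v : Fin n → ℂ) : localForm e η (z y, v) = 0 := by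
  by_cases hv : (z y, v) ∈ e.target
  · rw [localForm_of_mem _ hv]
    exact hK.inChart_eq_zero e fun hx => hyK ⟨_, hx, h.proj_symm_eq hy hv⟩
  · exact localForm_of_notMem _ hv

theorem supportedIn_pushChart (h : IsAdmissible π e z) {k : ℕ}
    {η : DiffForm ((Fin m → ℂ) × (Fin n → ℂ)) X (k + 2 * n)} {K : Set X} (hK : SupportedIn η K) :
    SupportedIn (pushChart e z η) (π '' K) := by
  intro y hy
  unfold pushChart
  split_ifs with hyz
  · have : vertInt volume (stdFrame n) (localForm e η) (z y) = 0 := by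
      rw [vertInt, ← integral_zero (Fin n → ℂ) _ (μ := volume)]
      congr 1
      funext v
      rw [localForm_eq_zero_of_proj h hK hyz hy]
      exact (vertInsL k (stdFrame n)).map_zero
    rw [this]
    rfl
  · rfl

variable [T2Space M] {K : Set X}

/-- The integral along the fibres is smooth: near the points outside the domain of `z` it vanishes,
because the projection of the compact support is closed. -/
theorem isSmoothForm_pushChart (hπ : Continuous π) (hK : IsCompact K)
    (hKe : K ⊆ e.source) (h : IsAdmissible π e z) {k : ℕ}
    {η : DiffForm ((Fin m → ℂ) × (Fin n → ℂ)) X (k + 2 * n)} (hη : IsSmoothForm η)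
    (hηK : SupportedIn η K) : IsSmoothForm (pushChart e z η) := by
  refine isSmoothForm_of fun y => ?_
  by_cases hy : y ∈ z.source
  · refine ⟨z, h.base_mem, hy, ?_⟩
    refine ((contDiff_vertInt volume (stdFrame n) (contDiff_localForm h.total_mem hη hηK hK hKe)
      (hasCompactSupport_localForm hηK hK hKe)).contDiffAt).congr_of_eventuallyEq ?_
    filter_upwards [z.open_target.mem_nhds (z.map_source hy)] with b hb
    exact inChart_pushChart e h.base_mem η hb
  · set c := chartAt (Fin m → ℂ) y
    refine ⟨c, chartAt_mem_maximalAtlas y, mem_chart_source _ y, ?_⟩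
    have hcl : IsClosed (π '' K) := (hK.image hπ).isClosed
    have hyK : y ∉ π '' K := fun ⟨x, hx, hxy⟩ => hy (hxy ▸ h.mapsTo (hKe hx))
    have hc : ContinuousAt c.symm (c y) := c.symm.continuousAt (mem_chart_target _ y)
    have h2 : (π '' K)ᶜ ∈ 𝓝 (c.symm (c y)) := by
      rw [c.left_inv (mem_chart_source _ y)]
      exact hcl.isOpen_compl.mem_nhds hyK
    have h0 : ContDiffAt ℝ ∞ (fun _ : Fin m → ℂ => (0 : (Fin m → ℂ) [⋀^Fin k]→L[ℝ] ℝ)) (c y) :=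
      contDiffAt_const
    refine h0.congr_of_eventuallyEq ?_
    filter_upwards [hc.preimage_mem_nhds h2] with q hq
    exact (supportedIn_pushChart h hηK).inChart_eq_zero c hq

theorem toList_vertInt_localForm (hK : IsCompact K)
    (hKe : K ⊆ e.source) (h : IsAdmissible π e z) {j k : ℕ} (hj : j = k + 2 * n)
    {η : DiffForm ((Fin m → ℂ) × (Fin n → ℂ)) X j} (hη : IsSmoothForm η)
    (hηK : SupportedIn η K) (b : Fin m → ℂ) (ws : List (Fin m → ℂ)) :
    toList (vertInt volume (stdFrame n) (localForm e (castDeg hj η)) b) ws =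
      toList (∫ v, localForm e η (b, v))
        (List.ofFn (fun j => ((0 : Fin m → ℂ), stdFrame n j)) ++ ws.map fun u => (u, 0)) := by
  rw [vertInt_eq _ _ (contDiff_localForm h.total_mem (isSmoothForm_castDeg hj hη)
    (supportedIn_castDeg hj hηK) hK hKe).continuous
    (hasCompactSupport_localForm (supportedIn_castDeg hj hηK) hK hKe), toList_vertIns,
    toList_integral_congr volume hj.symm fun v => toList_localForm_castDeg hj e η (b, v)]

/-- In admissible coordinates, integration along the fibres commutes with the exterior derivative.
-/
theorem extD_pushChart (hπ : Continuous π) (hK : IsCompact K)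
    (hKe : K ⊆ e.source) (h : IsAdmissible π e z) {k : ℕ}
    (hk : k + 2 * n + 1 = k + 1 + 2 * n)
    {η : DiffForm ((Fin m → ℂ) × (Fin n → ℂ)) X (k + 2 * n)} (hη : IsSmoothForm η)
    (hηK : SupportedIn η K) (hKc : IsClosed K) :
    extD (pushChart e z η) = pushChart e z (castDeg hk (extD η)) := by
  have hs := isSmoothForm_pushChart hπ hK hKe h hη hηK
  have hηK' := hηK.extD hKc
  have hA := contDiff_localForm h.total_mem hη hηK hK hKe
  have hc := hasCompactSupport_localForm (e := e) hηK hK hKe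
  funext y
  by_cases hy : y ∈ z.source
  · have hb := z.map_source hy
    rw [form_eq_inChart_comp (extD (pushChart e z η)) h.base_mem hy,
      form_eq_inChart_comp (pushChart e z (castDeg hk (extD η))) h.base_mem hy,
      inChart_pushChart e h.base_mem _ hb, inChart_extD hs h.base_mem hb]
    congr 1
    have h1 : inChart z (pushChart e z η) =ᶠ[𝓝 (z y)]
        vertInt volume (stdFrame n) (localForm e η) := by
      filter_upwards [z.open_target.mem_nhds hb] with b hb
      exact inChart_pushChart e h.base_mem η hb
    rw [h1.extDeriv_eq]
    apply toList_injective
    ext ws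
    rw [toList_vertInt_localForm hK hKe h hk (isSmoothForm_extD hη) hηK']
    simp only [← extDeriv_localForm h.total_mem hη hηK hK hKe]
    rw [toList_extDeriv_vertInt volume (stdFrame n) hA hc, pow_mul]
    simp
  · have hyK : y ∉ π '' K := fun ⟨x, hx, hxy⟩ => hy (hxy ▸ h.mapsTo (hKe hx))
    rw [(supportedIn_pushChart h hηK).extD (hK.image hπ).isClosed y hyK,
      supportedIn_pushChart h (supportedIn_castDeg hk hηK') y hyK]

/-- In admissible coordinates, exact forms of the degree of the fibres integrate to zero. -/
theorem pushChart_extD_eq_zero (hK : IsCompact K)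
    (hKe : K ⊆ e.source) (h : IsAdmissible π e z) {j : ℕ} (hj : j + 1 = 0 + 2 * n)
    {η : DiffForm ((Fin m → ℂ) × (Fin n → ℂ)) X j} (hη : IsSmoothForm η)
    (hηK : SupportedIn η K) (hKc : IsClosed K) :
    pushChart e z (castDeg hj (extD η)) = 0 := by
  have hηK' := hηK.extD hKc
  funext y
  unfold pushChart
  split_ifs with hy
  swap
  · rfl
  have : vertInt volume (stdFrame n) (localForm e (castDeg hj (extD η))) (z y) = 0 := by
    apply toList_injective
    ext ws
    by_cases hws : ws.length = 0
    swap
    · rw [toList_of_ne _ hws, map_zero]; rfl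
    obtain rfl := List.length_eq_zero_iff.1 hws
    rw [toList_vertInt_localForm hK hKe h hj (isSmoothForm_extD hη) hηK']
    simp only [← extDeriv_localForm h.total_mem hη hηK hK hKe]
    rw [List.map_nil, List.append_nil, integral_extDeriv_apply_vertical volume (stdFrame n)
      (contDiff_localForm h.total_mem hη hηK hK hKe) (hasCompactSupport_localForm hηK hK hKe)]
    simp
  rw [this]
  rfl

/-- Integration along the fibres is additive on smooth forms with a common compact support. -/
theorem pushChart_add (hK : IsCompact K)
    (hKe : K ⊆ e.source) (h : IsAdmissible π e z) {k : ℕ}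
    {η θ : DiffForm ((Fin m → ℂ) × (Fin n → ℂ)) X (k + 2 * n)} (hη : IsSmoothForm η)
    (hθ : IsSmoothForm θ) (hηK : SupportedIn η K) (hθK : SupportedIn θ K) :
    pushChart e z (η + θ) = pushChart e z η + pushChart e z θ := by
  funext y
  rw [Pi.add_apply]
  unfold pushChart
  split_ifs with hy
  swap
  · rw [add_zero]
  have hint : ∀ {η : DiffForm ((Fin m → ℂ) × (Fin n → ℂ)) X (k + 2 * n)}, IsSmoothForm η →
      SupportedIn η K → Integrable (fun v => vertIns (stdFrame n) (localForm e η (z y, v))) :=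
    fun {η} hη hηK => integrable_slice (g := fun q => vertInsL k (stdFrame n) (localForm e η q))
      volume ((vertInsL k (stdFrame n)).continuous.comp
        (contDiff_localForm h.total_mem hη hηK hK hKe).continuous)
      ((hasCompactSupport_localForm hηK hK hKe).comp_left (g := vertInsL k (stdFrame n))
        (map_zero _)) _
  have h1 : vertInt volume (stdFrame n) (localForm e (η + θ)) (z y) =
      vertInt volume (stdFrame n) (localForm e η) (z y) +
        vertInt volume (stdFrame n) (localForm e θ) (z y) := by
    rw [vertInt, vertInt, vertInt, ← integral_add (hint hη hηK) (hint hθ hθK)]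
    congr 1
    funext v
    rw [localForm_add]
    exact (vertInsL k (stdFrame n)).map_add _ _
  rw [h1]
  rfl

end Push

section PushIndependence

variable {m n : ℕ}
  {M : Type*} [TopologicalSpace M] [ChartedSpace (Fin m → ℂ) M] [IsManifold 𝓘(ℂ, Fin m → ℂ) ω M]
  {X : Type*} [TopologicalSpace X] [ChartedSpace ((Fin m → ℂ) × (Fin n → ℂ)) X]
  [IsManifold 𝓘(ℂ, (Fin m → ℂ) × (Fin n → ℂ)) ω X]
  {π : X → M} {e e' : OpenPartialHomeomorph X ((Fin m → ℂ) × (Fin n → ℂ))}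
  {z z' : OpenPartialHomeomorph M (Fin m → ℂ)}

theorem IsAdmissible.base_mem_of_overlap (h : IsAdmissible π e z) (h' : IsAdmissible π e' z')
    {p : (Fin m → ℂ) × (Fin n → ℂ)} (hp : p ∈ overlap e e') :
    p.1 ∈ z.target ∧ z.symm p.1 ∈ z'.source ∧ π (e.symm p) = z.symm p.1 := by
  have h1 := h.mapsTo (e.map_target hp.1)
  have h2 : π (e.symm p) = z.symm p.1 := by rw [← h.proj_symm hp.1, z.left_inv h1]
  refine ⟨?_, h2 ▸ h'.mapsTo hp.2, h2⟩
  rw [← h.proj_symm hp.1]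
  exact z.map_source h1

/-- The base component of the change of admissible coordinates. -/
theorem IsAdmissible.transition_fst (h : IsAdmissible π e z) (h' : IsAdmissible π e' z')
    {p : (Fin m → ℂ) × (Fin n → ℂ)} (hp : p ∈ overlap e e') :
    (e' (e.symm p)).1 = z' (z.symm p.1) := by
  rw [h'.fst_eq _ hp.2, (h.base_mem_of_overlap h' hp).2.2]

theorem IsAdmissible.fderiv_transition_fst (h : IsAdmissible π e z) (h' : IsAdmissible π e' z')
    {p : (Fin m → ℂ) × (Fin n → ℂ)} (hp : p ∈ overlap e e') (u : (Fin m → ℂ) × (Fin n → ℂ)) :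
    (fderiv ℂ (fun q => e' (e.symm q)) p u).1 = fderiv ℂ (fun b => z' (z.symm b)) p.1 u.1 := by
  have hd := ((contDiffAt_transition h.total_mem h'.total_mem hp.1 hp.2).differentiableAt
    (by simp)).hasFDerivAt
  have hb := h.base_mem_of_overlap h' hp
  have hd' := ((contDiffAt_transition h.base_mem h'.base_mem hb.1 hb.2.1).differentiableAt
    (by simp)).hasFDerivAt
  have h1 := hd.fst
  have h2 : HasFDerivAt (fun q : (Fin m → ℂ) × (Fin n → ℂ) => z' (z.symm q.1)) _ p :=
    hd'.comp p hasFDerivAt_fst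
  have h3 : (fun q => (e' (e.symm q)).1) =ᶠ[𝓝 p] fun q => z' (z.symm q.1) := by
    filter_upwards [(isOpen_overlap e e').mem_nhds hp] with q hq using h.transition_fst h' hq
  exact congrArg (fun f => f u) (h1.unique (h2.congr_of_eventuallyEq h3))

/-- The vertical part of the derivative of the change of admissible coordinates. -/
def vertDeriv (e e' : OpenPartialHomeomorph X ((Fin m → ℂ) × (Fin n → ℂ)))
    (p : (Fin m → ℂ) × (Fin n → ℂ)) : (Fin n → ℂ) →L[ℂ] (Fin n → ℂ) :=
  (ContinuousLinearMap.snd ℂ _ _).comp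
    ((fderiv ℂ (fun q => e' (e.symm q)) p).comp (ContinuousLinearMap.inr ℂ _ _))

theorem IsAdmissible.fderiv_transition_vertical (h : IsAdmissible π e z)
    (h' : IsAdmissible π e' z') {p : (Fin m → ℂ) × (Fin n → ℂ)} (hp : p ∈ overlap e e')
    (w : Fin n → ℂ) :
    fderiv ℂ (fun q => e' (e.symm q)) p (0, w) = (0, vertDeriv e e' p w) := by
  ext1
  · rw [h.fderiv_transition_fst h' hp]; simp
  · rfl

theorem overlap_symm {p : (Fin m → ℂ) × (Fin n → ℂ)} (hp : p ∈ overlap e e') :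
    e' (e.symm p) ∈ overlap e' e := by
  rw [← transition_image_overlap e e']; exact ⟨p, hp, rfl⟩

theorem IsAdmissible.det_vertDeriv_ne_zero (h : IsAdmissible π e z) (h' : IsAdmissible π e' z')
    {p : (Fin m → ℂ) × (Fin n → ℂ)} (hp : p ∈ overlap e e') :
    LinearMap.det (vertDeriv e e' p : (Fin n → ℂ) →ₗ[ℂ] (Fin n → ℂ)) ≠ 0 := by
  refine det_ne_zero_of_leftInverse (B := vertDeriv e' e (e' (e.symm p))) ?_
  ext1 w
  have h1 := congrArg (fun f => f (0, w))
    (fderiv_transition_comp h.total_mem h'.total_mem hp.1 hp.2)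
  simp only [ContinuousLinearMap.comp_apply] at h1
  rw [h.fderiv_transition_vertical h' hp,
    h'.fderiv_transition_vertical h (overlap_symm hp)] at h1
  exact congrArg Prod.snd h1

/-- The pullback of forms under a linear map, as a linear map. -/
def pullL {E F : Type*} [NormedAddCommGroup E] [NormedSpace ℝ E] [NormedAddCommGroup F]
    [NormedSpace ℝ F] [FiniteDimensional ℝ F] (k : ℕ) (S : E →L[ℝ] F) :
    (F [⋀^Fin k]→L[ℝ] ℝ) →L[ℝ] E [⋀^Fin k]→L[ℝ] ℝ :=
  LinearMap.toContinuousLinearMap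
    { toFun := fun A => A.compContinuousLinearMap S
      map_add' := fun _ _ => rfl
      map_smul' := fun _ _ => rfl }

/-- Integration along the fibres does not depend on the admissible coordinates. -/
theorem pushChart_eq (h : IsAdmissible π e z) (h' : IsAdmissible π e' z') {K K' : Set X}
    (hKe : K ⊆ e.source) (hK' : IsCompact K') (hKe' : K' ⊆ e'.source)
    {k : ℕ} {η : DiffForm ((Fin m → ℂ) × (Fin n → ℂ)) X (k + 2 * n)} (hη : IsSmoothForm η)
    (hηK : SupportedIn η K) (hηK' : SupportedIn η K') :
    pushChart e z η = pushChart e' z' η := by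
  have hηe : SupportedIn η e.source := fun x hx => hηK x fun h => hx (hKe h)
  have hηe' : SupportedIn η e'.source := fun x hx => hηK' x fun h => hx (hKe' h)
  funext y
  by_cases hy : y ∈ z.source
  swap
  · rw [supportedIn_pushChart h' hηe y fun ⟨x, hx, hxy⟩ => hy (hxy ▸ h.mapsTo hx), pushChart,
      if_neg hy]
  by_cases hy' : y ∈ z'.source
  swap
  · rw [supportedIn_pushChart h hηe' y fun ⟨x, hx, hxy⟩ => hy' (hxy ▸ h'.mapsTo hx), pushChart,
      if_neg hy']
  have hyt : z.symm (z y) ∈ z'.source := by rwa [z.left_inv hy]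
  set S := fderiv ℝ (fun b => z' (z.symm b)) (z y) with hS
  have hSc : S = (fderiv ℂ (fun b => z' (z.symm b)) (z y)).restrictScalars ℝ :=
    fderiv_real_eq ((contDiffAt_transition h.base_mem h'.base_mem (z.map_source hy) hyt).differentiableAt
      (by simp))
  set V := {v : Fin n → ℂ | (z y, v) ∈ overlap e e'}
  have hV : IsOpen V := (isOpen_overlap e e').preimage
    (by fun_prop : Continuous fun v : Fin n → ℂ => (z y, v))
  have hτ1 : ∀ v ∈ V, e' (e.symm (z y, v)) = (z' y, (e' (e.symm (z y, v))).2) := fun v hv => by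
    ext1
    · rw [h.transition_fst h' hv, z.left_inv hy]
    · rfl
  -- The change of coordinates maps the part of the fibre in the overlap onto the corresponding
  -- part.
  have himg : (fun v => (e' (e.symm (z y, v))).2) '' V = {v | (z' y, v) ∈ overlap e' e} := by
    ext v'
    constructor
    · rintro ⟨v, hv, rfl⟩
      change (z' y, _) ∈ overlap e' e
      rw [← hτ1 v hv]
      exact overlap_symm hv
    · intro hv'
      have h1 : e (e'.symm (z' y, v')) = (z y, (e (e'.symm (z' y, v'))).2) := by
        ext1
        · rw [h'.transition_fst h hv', z'.left_inv hy']
        · rfl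
      have h2 : (z y, (e (e'.symm (z' y, v'))).2) ∈ overlap e e' := h1 ▸ overlap_symm hv'
      refine ⟨_, h2, ?_⟩
      change (e' (e.symm (z y, _))).2 = v'
      rw [← h1, e.left_inv hv'.2, e'.right_inv hv'.1]
  have hinj : Set.InjOn (fun v => (e' (e.symm (z y, v))).2) V := by
    intro v hv w hw hvw
    have h1 : e' (e.symm (z y, v)) = e' (e.symm (z y, w)) := by
      rw [hτ1 v hv, hτ1 w hw]; exact congrArg _ hvw
    exact congrArg Prod.snd (transition_injOn e e' hv hw h1)
  have hset : ∀ {e e' : OpenPartialHomeomorph X ((Fin m → ℂ) × (Fin n → ℂ))} (b : Fin m → ℂ),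
      SupportedIn η e'.source → ∀ Φ : ((Fin m → ℂ) [⋀^Fin k]→L[ℝ] ℝ) →L[ℝ]
        ((Fin m → ℂ) [⋀^Fin k]→L[ℝ] ℝ),
      ∫ v, Φ (vertIns (stdFrame n) (localForm e η (b, v))) =
        ∫ v in {v | (b, v) ∈ overlap e e'}, Φ (vertIns (stdFrame n) (localForm e η (b, v))) :=
    fun b hs Φ => (setIntegral_eq_integral_of_forall_compl_eq_zero fun v hv => by
      rw [localForm_of_notMem_overlap hs hv, ← vertInsL_apply, map_zero, map_zero]).symm
  -- The change of variables formula in the fibre: `vertIns_comp` produces the determinant of the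
  -- vertical part of the derivative, which is positive.
  have hmain : vertInt volume (stdFrame n) (localForm e η) (z y) =
      (vertInt volume (stdFrame n) (localForm e' η) (z' y)).compContinuousLinearMap S := by
    have h1 : (vertInt volume (stdFrame n) (localForm e' η) (z' y)).compContinuousLinearMap S =
        ∫ v, pullL k S (vertIns (stdFrame n) (localForm e' η (z' y, v))) := by
      have h2 := integral_slice_comp_comm (V := (Fin m → ℂ) [⋀^Fin k]→L[ℝ] ℝ)
        (W := (Fin m → ℂ) [⋀^Fin k]→L[ℝ] ℝ) volume (pullL k S)
        (g := fun q => vertInsL k (stdFrame n) (localForm e' η q))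
        ((vertInsL k (stdFrame n)).continuous.comp
          (contDiff_localForm h'.total_mem hη hηK' hK' hKe').continuous)
        ((hasCompactSupport_localForm hηK' hK' hKe').comp_left (g := vertInsL k (stdFrame n))
          (map_zero _)) (z' y)
      exact h2.symm
    rw [h1, hset (z' y) hηe, vertInt]
    refine (hset (z y) hηe' (ContinuousLinearMap.id ℝ _)).trans ?_
    rw [← himg]
    refine setIntegral_eq_of_holomorphic hV.measurableSet hinj
      (A := fun v => vertDeriv e e' (z y, v)) (fun v hv => ?_)
      (fun v hv => h.det_vertDeriv_ne_zero h' hv) (fun v hv => ?_)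
    · have hd := ((contDiffAt_transition h.total_mem h'.total_mem hv.1 hv.2).differentiableAt
        (by simp)).hasFDerivAt
      exact (hd.comp v (hasFDerivAt_prodMk_right (z y) v)).snd
    · have hv2 := hτ1 v hv
      have hv3 : (z' y, (e' (e.symm (z y, v))).2) ∈ overlap e' e := hv2 ▸ overlap_symm hv
      rw [localForm_of_mem _ hv.1, localForm_of_mem _ hv3.1, ← hv2,
        inChart_eq η h.total_mem h'.total_mem hv.1 hv.2]
      refine vertIns_comp _ _ _ S (fun w => ?_) fun u => ?_
      · rw [fderiv_real_eq ((contDiffAt_transition h.total_mem h'.total_mem hv.1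
          hv.2).differentiableAt (by simp))]
        exact h.fderiv_transition_vertical h' hv w
      · rw [fderiv_real_eq ((contDiffAt_transition h.total_mem h'.total_mem hv.1
          hv.2).differentiableAt (by simp)), hSc]
        exact h.fderiv_transition_fst h' hv (u, 0)
  rw [pushChart, pushChart, if_pos hy, if_pos hy', hmain]
  set c := chartAt (Fin m → ℂ) y
  have hcy := mem_chart_source (Fin m → ℂ) y
  have hc : c ∈ IsManifold.maximalAtlas 𝓘(ℂ, Fin m → ℂ) ω M := chartAt_mem_maximalAtlas y
  have hct : c.symm (c y) ∈ z.source := by rwa [c.left_inv hcy]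
  -- The transition between the coordinates of the base is accounted for by the chain rule.
  have hchain : S.comp (fderiv ℝ (fun q => z (c.symm q)) (c y)) =
      fderiv ℝ (fun q => z' (c.symm q)) (c y) := by
    have hd := (contDiffAt_real_transition h.base_mem h'.base_mem (z.map_source hy)
      hyt).differentiableAt (by simp)
    have hd' := (contDiffAt_real_transition hc h.base_mem (c.map_source hcy) hct).differentiableAt
      (by simp)
    have hzy : z y = z (c.symm (c y)) := by rw [c.left_inv hcy]
    rw [hS, hzy, ← fderiv_comp (c y) (by rwa [← hzy]) hd']
    apply Filter.EventuallyEq.fderiv_eq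
    filter_upwards [eventually_mem_overlap (c.map_source hcy) hct] with q hq
    simp [z.left_inv hq.2]
  rw [← hchain]
  rfl

end PushIndependence

/-! ### Fibre integrals of smooth and of exact forms -/

section FibreIntegral

variable {m n : ℕ}
  {M : Type*} [TopologicalSpace M] [ChartedSpace (Fin m → ℂ) M] [IsManifold 𝓘(ℂ, Fin m → ℂ) ω M]
  [T2Space M]
  {X : Type*} [TopologicalSpace X] [ChartedSpace ((Fin m → ℂ) × (Fin n → ℂ)) X]
  [IsManifold 𝓘(ℂ, (Fin m → ℂ) × (Fin n → ℂ)) ω X] [CompactSpace X]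
  {π : X → M} (hπ : Continuous π) (P : AdmissiblePartition (m := m) (n := n) π)

theorem AdmissiblePartition.isSmoothForm_fibreIntegral (hπ : Continuous π) {N k : ℕ}
    (h : N = k + 2 * n) {η : DiffForm ((Fin m → ℂ) × (Fin n → ℂ)) X N} (hη : IsSmoothForm η) :
    IsSmoothForm (P.fibreIntegral h η) := by
  rw [fibreIntegral_eq_sum]
  exact isSmoothForm_sum _ fun i _ => isSmoothForm_pushChart hπ (isClosed_tsupport _).isCompact
    (P.tsupport_subset i) (P.admissible i)
    (isSmoothForm_mulForm (P.smooth i) (isSmoothForm_castDeg h hη)) (supportedIn_mulForm _ _)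

theorem AdmissiblePartition.fibreIntegral_sub {N k : ℕ}
    (h : N = k + 2 * n) {η θ : DiffForm ((Fin m → ℂ) × (Fin n → ℂ)) X N} (hη : IsSmoothForm η)
    (hθ : IsSmoothForm θ) :
    P.fibreIntegral h (η - θ) = P.fibreIntegral h η - P.fibreIntegral h θ := by
  rw [eq_sub_iff_add_eq, fibreIntegral_eq_sum, fibreIntegral_eq_sum, fibreIntegral_eq_sum,
    ← Finset.sum_add_distrib]
  refine Finset.sum_congr rfl fun i _ => ?_
  rw [← pushChart_add (isClosed_tsupport (P.ρ i)).isCompact (P.tsupport_subset i)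
    (P.admissible i) (isSmoothForm_mulForm (P.smooth i) (isSmoothForm_castDeg h (hη.sub hθ)))
    (isSmoothForm_mulForm (P.smooth i) (isSmoothForm_castDeg h hθ)) (supportedIn_mulForm _ _)
    (supportedIn_mulForm _ _), ← castDeg_mulForm, ← castDeg_mulForm, ← castDeg_mulForm,
    ← castDeg_add]
  congr 2
  funext x
  simp [mulForm, smul_sub]

/-- The integral of an exact form along the fibres, with the partition of unity moved inside the
exterior derivative. -/
theorem AdmissiblePartition.sum_pushChart_extD {j k : ℕ} (hj : j + 1 = k + 2 * n)
    {γ : DiffForm ((Fin m → ℂ) × (Fin n → ℂ)) X j} (hγ : IsSmoothForm γ) :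
    P.fibreIntegral hj (extD γ) =
      ∑ i, pushChart (P.chart i) (P.base i) (castDeg hj (extD (mulForm (P.ρ i) γ))) := by
  rw [fibreIntegral_eq_sum]
  simp only [← castDeg_mulForm]
  refine sum_apply_mulForm_extD P.ρ P.smooth P.sum_eq_one
    (fun i η => pushChart (P.chart i) (P.base i) (castDeg hj η)) ?_ ?_ hγ
  · intro i η θ hη hθ hηK hθK
    simp only [castDeg_add]
    exact pushChart_add (isClosed_tsupport (P.ρ i)).isCompact (P.tsupport_subset i)
      (P.admissible i) (isSmoothForm_castDeg hj hη) (isSmoothForm_castDeg hj hθ)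
      (supportedIn_castDeg hj hηK) (supportedIn_castDeg hj hθK)
  · intro i i' η hη hi hi'
    exact pushChart_eq (P.admissible i) (P.admissible i') (P.tsupport_subset i)
      (isClosed_tsupport (P.ρ i')).isCompact (P.tsupport_subset i') (isSmoothForm_castDeg hj hη)
      (supportedIn_castDeg hj hi) (supportedIn_castDeg hj hi')

/-- Integration along the fibres commutes with the exterior derivative. -/
theorem AdmissiblePartition.fibreIntegral_extD (hπ : Continuous π) {N k : ℕ} (h : N = k + 2 * n)
    (h' : N + 1 = k + 1 + 2 * n)
    {γ : DiffForm ((Fin m → ℂ) × (Fin n → ℂ)) X N} (hγ : IsSmoothForm γ) :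
    P.fibreIntegral h' (extD γ) = extD (P.fibreIntegral h γ) := by
  subst h
  rw [P.sum_pushChart_extD h' hγ, fibreIntegral_eq_sum, extD_sum]
  · refine Finset.sum_congr rfl fun i _ => ?_
    exact (extD_pushChart hπ (isClosed_tsupport (P.ρ i)).isCompact (P.tsupport_subset i)
      (P.admissible i) h' (isSmoothForm_mulForm (P.smooth i) hγ) (supportedIn_mulForm _ _)
      (isClosed_tsupport _)).symm
  · exact fun i _ => isSmoothForm_pushChart hπ (isClosed_tsupport _).isCompact
      (P.tsupport_subset i) (P.admissible i) (isSmoothForm_mulForm (P.smooth i) hγ)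
      (supportedIn_mulForm _ _)

/-- The function obtained by integrating an exact form along the fibres vanishes. -/
theorem AdmissiblePartition.fibreIntegral_extD_zero {j : ℕ} (hj : j + 1 = 0 + 2 * n)
    {γ : DiffForm ((Fin m → ℂ) × (Fin n → ℂ)) X j} (hγ : IsSmoothForm γ) :
    P.fibreIntegral hj (extD γ) = 0 := by
  rw [P.sum_pushChart_extD hj hγ]
  exact Finset.sum_eq_zero fun i _ => pushChart_extD_eq_zero
    (isClosed_tsupport (P.ρ i)).isCompact (P.tsupport_subset i) (P.admissible i) hj
    (isSmoothForm_mulForm (P.smooth i) hγ) (supportedIn_mulForm _ _) (isClosed_tsupport _)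

/-- Integration along the fibres preserves exactness. In degree zero, where only the zero form
counts as exact, this uses that exact forms of the degree of the fibres integrate to zero. -/
theorem AdmissiblePartition.isExactForm_fibreIntegral (hπ : Continuous π) {N k : ℕ}
    (h : N = k + 2 * n) {η : DiffForm ((Fin m → ℂ) × (Fin n → ℂ)) X N} (hη : IsExactForm η) :
    IsExactForm (P.fibreIntegral h η) := by
  have hz : P.fibreIntegral h (0 : DiffForm ((Fin m → ℂ) × (Fin n → ℂ)) X N) = 0 := by
    rw [← sub_self (0 : DiffForm ((Fin m → ℂ) × (Fin n → ℂ)) X N),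
      P.fibreIntegral_sub h isSmoothForm_zero isSmoothForm_zero, sub_self]
  rcases N with _ | N
  · obtain rfl : η = 0 := hη
    obtain rfl : k = 0 := by omega
    exact hz
  · obtain ⟨γ, hγ, rfl⟩ := hη
    rcases k with _ | k
    · exact P.fibreIntegral_extD_zero h hγ
    · exact ⟨_, P.isSmoothForm_fibreIntegral hπ (by omega : N = k + 2 * n) hγ,
        P.fibreIntegral_extD hπ _ h hγ⟩

theorem AdmissiblePartition.isClosedForm_fibreIntegral (hπ : Continuous π) {N k : ℕ}
    (h : N = k + 2 * n) {η : DiffForm ((Fin m → ℂ) × (Fin n → ℂ)) X N} (hη : IsClosedForm η) :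
    IsClosedForm (P.fibreIntegral h η) := by
  refine ⟨P.isSmoothForm_fibreIntegral hπ h hη.1, ?_⟩
  rw [← P.fibreIntegral_extD hπ h (by omega) hη.1, hη.2,
    ← sub_self (0 : DiffForm ((Fin m → ℂ) × (Fin n → ℂ)) X (N + 1)),
    P.fibreIntegral_sub _ isSmoothForm_zero isSmoothForm_zero, sub_self]

/-- Integration along the fibres is well defined on de Rham cohomology. -/
theorem Cohomologous.fibreIntegral (hπ : Continuous π) {N k : ℕ}
    (h : N = k + 2 * n) {η θ : DiffForm ((Fin m → ℂ) × (Fin n → ℂ)) X N} (hη : Cohomologous η θ) :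
    Cohomologous (GeodesicEinstein.fibreIntegral π h η) (GeodesicEinstein.fibreIntegral π h θ) := by
  by_cases hP : Nonempty (AdmissiblePartition (m := m) (n := n) π)
  · rw [GeodesicEinstein.fibreIntegral, GeodesicEinstein.fibreIntegral, dif_pos hP, dif_pos hP]
    refine ⟨hP.some.isClosedForm_fibreIntegral hπ h hη.1,
      hP.some.isClosedForm_fibreIntegral hπ h hη.2.1, ?_⟩
    rw [← hP.some.fibreIntegral_sub h hη.1.1 hη.2.1.1]
    exact hP.some.isExactForm_fibreIntegral hπ h hη.2.2
  · rw [GeodesicEinstein.fibreIntegral, GeodesicEinstein.fibreIntegral, dif_neg hP, dif_neg hP]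
    have h0 : extD (0 : DiffForm (Fin m → ℂ) M k) = 0 := by
      have := extD_smul 0 (0 : DiffForm (Fin m → ℂ) M k)
      rwa [zero_smul, zero_smul] at this
    refine ⟨⟨isSmoothForm_zero, h0⟩, ⟨isSmoothForm_zero, h0⟩, ?_⟩
    rw [sub_self]
    rcases k with _ | k
    · rfl
    · refine ⟨0, isSmoothForm_zero, ?_⟩
      have := extD_smul 0 (0 : DiffForm (Fin m → ℂ) M k)
      rw [zero_smul, zero_smul] at this
      exact this.symm

end FibreIntegral

/-! ### Products of cohomology classes -/

section Cohomology

open ListForm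

variable {E : Type*} [NormedAddCommGroup E] [NormedSpace ℂ E] [NormedSpace ℝ E]
  [IsScalarTower ℝ ℂ E] [FiniteDimensional ℝ E] {X : Type*} [TopologicalSpace X] [ChartedSpace E X]
  [IsManifold 𝓘(ℂ, E) ω X]

theorem form_ext {k : ℕ} {η θ : DiffForm E X k} (h : ∀ x, toList (η x) = toList (θ x)) : η = θ :=
  funext fun x => toList_injective (h x)

theorem extD_zero {k : ℕ} : extD (0 : DiffForm E X k) = 0 := by
  have := extD_smul 0 (0 : DiffForm E X k)
  rwa [zero_smul, zero_smul] at this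

theorem isExactForm_zero {k : ℕ} : IsExactForm (0 : DiffForm E X k) := by
  rcases k with _ | k
  · rfl
  · exact ⟨0, isSmoothForm_zero, extD_zero.symm⟩

theorem IsExactForm.add {k : ℕ} {η θ : DiffForm E X k} (hη : IsExactForm η) (hθ : IsExactForm θ) :
    IsExactForm (η + θ) := by
  rcases k with _ | k
  · rw [show η = 0 from hη, show θ = 0 from hθ, add_zero]; exact isExactForm_zero
  · obtain ⟨γ, hγ, rfl⟩ := hη
    obtain ⟨γ', hγ', rfl⟩ := hθ
    exact ⟨_, hγ.add hγ', (extD_add hγ hγ').symm⟩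

theorem IsExactForm.smul {k : ℕ} (c : ℝ) {η : DiffForm E X k} (hη : IsExactForm η) :
    IsExactForm (c • η) := by
  rcases k with _ | k
  · rw [show η = 0 from hη, smul_zero]; exact isExactForm_zero
  · obtain ⟨γ, hγ, rfl⟩ := hη
    exact ⟨_, hγ.smul c, (extD_smul c γ).symm⟩

theorem isExactForm_castDeg {k l : ℕ} (h : k = l) {η : DiffForm E X k} (hη : IsExactForm η) :
    IsExactForm (castDeg h η) := by subst h; exact hη

theorem IsClosedForm.add {k : ℕ} {η θ : DiffForm E X k} (hη : IsClosedForm η)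
    (hθ : IsClosedForm θ) : IsClosedForm (η + θ) :=
  ⟨hη.1.add hθ.1, by rw [extD_add hη.1 hθ.1, hη.2, hθ.2, add_zero]⟩

theorem IsClosedForm.smul {k : ℕ} (c : ℝ) {η : DiffForm E X k} (hη : IsClosedForm η) :
    IsClosedForm (c • η) :=
  ⟨hη.1.smul c, by rw [extD_smul, hη.2, smul_zero]⟩

theorem IsClosedForm.wedge {k l : ℕ} {α : DiffForm E X k} {β : DiffForm E X l}
    (hα : IsClosedForm α) (hβ : IsClosedForm β) : IsClosedForm (wedgeForm α β) := by
  refine ⟨isSmoothForm_wedge hα.1 hβ.1, form_ext fun x => ?_⟩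
  rw [toList_extD_wedge hα.1 hβ.1, hα.2, hβ.2]
  simp

/-- The product of an exact form with a closed form is exact. -/
theorem IsExactForm.wedge_left {k l : ℕ} {α : DiffForm E X k} {β : DiffForm E X l}
    (hα : IsExactForm α) (hβ : IsClosedForm β) : IsExactForm (wedgeForm α β) := by
  rcases k with _ | k
  · rw [show α = 0 from hα, show wedgeForm (0 : DiffForm E X 0) β = 0 from form_ext fun x => by
      rw [wedgeForm, toList_wedge]; simp]
    exact isExactForm_zero
  · obtain ⟨γ, hγ, rfl⟩ := hα
    have h1 : wedgeForm (extD γ) β = castDeg (by omega : k + l + 1 = k + 1 + l)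
        (extD (wedgeForm γ β)) := form_ext fun x => by
      rw [toList_castDeg, toList_extD_wedge hγ hβ.1, hβ.2, wedgeForm, toList_wedge]
      simp
    rw [h1]
    exact isExactForm_castDeg _ ⟨_, isSmoothForm_wedge hγ hβ.1, rfl⟩

theorem IsExactForm.wedge_right {k l : ℕ} {α : DiffForm E X k} {β : DiffForm E X l}
    (hα : IsClosedForm α) (hβ : IsExactForm β) : IsExactForm (wedgeForm α β) := by
  rcases l with _ | l
  · rw [show β = 0 from hβ, show wedgeForm α (0 : DiffForm E X 0) = 0 from form_ext fun x => by
      rw [wedgeForm, toList_wedge]; simp]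
    exact isExactForm_zero
  · obtain ⟨γ, hγ, rfl⟩ := hβ
    refine ⟨(-1 : ℝ) ^ k • wedgeForm α γ, (isSmoothForm_wedge hα.1 hγ).smul _,
      form_ext fun x => ?_⟩
    rw [extD_smul, Pi.smul_apply, map_smul, toList_extD_wedge hα.1 hγ, hα.2,
      (isAlt_toList (α x)).inv_eq, wedgeForm, toList_wedge]
    simp only [Pi.zero_apply, map_zero, zero_mul, zero_add, smul_mul_assoc, smul_smul, ← mul_pow]
    simp

theorem IsClosedForm.cohomologous_refl {k : ℕ} {η : DiffForm E X k} (h : IsClosedForm η) :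
    Cohomologous η η := ⟨h, h, by rw [sub_self]; exact isExactForm_zero⟩

theorem Cohomologous.add {k : ℕ} {α α' β β' : DiffForm E X k} (h : Cohomologous α α')
    (h' : Cohomologous β β') : Cohomologous (α + β) (α' + β') :=
  ⟨h.1.add h'.1, h.2.1.add h'.2.1, by rw [add_sub_add_comm]; exact h.2.2.add h'.2.2⟩

theorem Cohomologous.smul {k : ℕ} (c : ℝ) {α α' : DiffForm E X k} (h : Cohomologous α α') :
    Cohomologous (c • α) (c • α') :=
  ⟨h.1.smul c, h.2.1.smul c, by
    have := h.2.2.smul c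
    rwa [show c • (α - α') = c • α - c • α' from
      funext fun x => smul_sub c (α x) (α' x)] at this⟩

theorem Cohomologous.sub {k : ℕ} {α α' β β' : DiffForm E X k} (h : Cohomologous α α')
    (h' : Cohomologous β β') : Cohomologous (α - β) (α' - β') := by
  rw [sub_eq_add_neg, sub_eq_add_neg, ← neg_one_smul ℝ β, ← neg_one_smul ℝ β']
  exact h.add (h'.smul _)

theorem Cohomologous.trans {k : ℕ} {α β γ : DiffForm E X k} (h : Cohomologous α β)
    (h' : Cohomologous β γ) : Cohomologous α γ :=
  ⟨h.1, h'.2.1, by rw [← sub_add_sub_cancel α β γ]; exact h.2.2.add h'.2.2⟩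

theorem cohomologous_castDeg {k l : ℕ} (h : k = l) {α α' : DiffForm E X k}
    (hα : Cohomologous α α') :
    Cohomologous (castDeg h α) (castDeg h α') := by
  subst h; exact hα

theorem Cohomologous.wedge {k l : ℕ} {α α' : DiffForm E X k} {β β' : DiffForm E X l}
    (h : Cohomologous α α') (h' : Cohomologous β β') :
    Cohomologous (wedgeForm α β) (wedgeForm α' β') := by
  refine ⟨h.1.wedge h'.1, h.2.1.wedge h'.2.1, ?_⟩
  have : wedgeForm α β - wedgeForm α' β' = wedgeForm (α - α') β + wedgeForm α' (β - β') :=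
    form_ext fun x => by
      simp only [Pi.sub_apply, Pi.add_apply, wedgeForm, map_sub, map_add, toList_wedge]
      noncomm_ring
  rw [this]
  exact (h.2.2.wedge_left h'.1).add (h'.2.2.wedge_right h.2.1)

theorem Cohomologous.sum {k : ℕ} {ι : Type*} (s : Finset ι) {α β : ι → DiffForm E X k}
    (h : ∀ i ∈ s, Cohomologous (α i) (β i)) : Cohomologous (∑ i ∈ s, α i) (∑ i ∈ s, β i) := by
  classical
  induction s using Finset.induction_on with
  | empty => exact IsClosedForm.cohomologous_refl ⟨isSmoothForm_zero, extD_zero⟩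
  | insert a s ha ih =>
    rw [Finset.sum_insert ha, Finset.sum_insert ha]
    exact (h a (by simp)).add (ih fun i hi => h i (by simp [hi]))

/-! ### Forms of degree zero -/

theorem inChart_zeroForm (f : X → ℝ) (e : OpenPartialHomeomorph X E) (p : E) :
    inChart e (zeroForm f) p =
      ContinuousAlternatingMap.constOfIsEmpty ℝ E (Fin 0) (f (e.symm p)) := by
  ext v; rfl

theorem zeroForm_zeroFormValue (η : DiffForm E X 0) : zeroForm (zeroFormValue η) = η := by
  funext x; ext v
  rw [Subsingleton.elim v ![]]
  rfl

theorem contDiffAt_zeroForm_iff {f : X → ℝ} {e : OpenPartialHomeomorph X E} {p : E} :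
    ContDiffAt ℝ ∞ (inChart e (zeroForm f)) p ↔ ContDiffAt ℝ ∞ (fun q => f (e.symm q)) p := by
  constructor
  · intro h
    exact contDiffAt_form_apply (v := fun _ => ![]) h fun i => i.elim0
  · intro h
    exact contDiffAt_form fun v => h

/-- A function is closed as a form of degree zero if and only if it is smooth with vanishing
derivative. -/
theorem isClosedForm_zeroForm_iff {f : X → ℝ} :
    IsClosedForm (zeroForm f : DiffForm E X 0) ↔
      ∀ x, ContDiffAt ℝ ∞ (fun q => f ((chartAt E x).symm q)) (chartAt E x x) ∧
        fderiv ℝ (fun q => f ((chartAt E x).symm q)) (chartAt E x x) = 0 := by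
  have h1 : ∀ x, extD (zeroForm f : DiffForm E X 0) x =
      ContinuousAlternatingMap.ofSubsingleton ℝ E ℝ (0 : Fin 1)
        (fderiv ℝ (fun q => f ((chartAt E x).symm q)) (chartAt E x x)) := fun x => by
    rw [extD, show inChart (chartAt E x) (zeroForm f) = _ from
      funext (inChart_zeroForm f (chartAt E x)), extDeriv_constOfIsEmpty]
  constructor
  · rintro ⟨hs, hd⟩ x
    refine ⟨contDiffAt_zeroForm_iff.1 (hs.contDiffAt (chartAt_mem_maximalAtlas x)
      (mem_chart_target E x)), ?_⟩
    have := congrFun hd x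
    rw [h1] at this
    ext u
    exact congrArg (fun A => A fun _ => u) this
  · intro h
    refine ⟨isSmoothForm_of fun x => ⟨chartAt E x, chartAt_mem_maximalAtlas x,
      mem_chart_source E x, contDiffAt_zeroForm_iff.2 (h x).1⟩, funext fun x => ?_⟩
    rw [h1, (h x).2]
    ext u; rfl

/-- The inverse of a locally constant function without zeros is locally constant. -/
theorem IsClosedForm.zeroForm_inv {f : X → ℝ} (h : IsClosedForm (zeroForm f : DiffForm E X 0))
    (hf : ∀ x, f x ≠ 0) : IsClosedForm (zeroForm (fun x => (f x)⁻¹) : DiffForm E X 0) := by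
  rw [isClosedForm_zeroForm_iff] at h ⊢
  intro x
  obtain ⟨h1, h2⟩ := h x
  refine ⟨h1.inv (hf _), ?_⟩
  have h3 := (h1.differentiableAt (by simp)).hasFDerivAt
  rw [h2] at h3
  have h4 := HasDerivAt.comp_hasFDerivAt (chartAt E x x)
    (h₂ := fun t : ℝ => t⁻¹) (f := fun q => f ((chartAt E x).symm q))
    (hasDerivAt_inv (hf ((chartAt E x).symm (chartAt E x x)))) h3
  rw [smul_zero] at h4
  exact h4.fderiv

theorem isClosedForm_one : IsClosedForm (zeroForm (fun _ => 1) : DiffForm E X 0) := by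
  rw [isClosedForm_zeroForm_iff]
  exact fun x => ⟨contDiffAt_const, fderiv_const_apply _⟩

theorem cohomologous_wedgePow {η θ : DiffForm E X 2} (h : Cohomologous η θ) (k : ℕ) :
    Cohomologous (wedgePow η k) (wedgePow θ k) := by
  induction k with
  | zero => exact isClosedForm_one.cohomologous_refl
  | succ k ih => exact ih.wedge h

end Cohomology

section Integral

variable {d : ℕ} {M : Type*} [TopologicalSpace M] [ChartedSpace (Fin d → ℂ) M]
  [IsManifold 𝓘(ℂ, Fin d → ℂ) ω M] [CompactSpace M]

/-- The integral of a form of top degree only depends on its cohomology class. -/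
theorem Cohomologous.integral_eq {Θ Θ' : DiffForm (Fin d → ℂ) M (2 * d)} (h : Cohomologous Θ Θ') :
    integral Θ = integral Θ' := by
  have h0 : integral (Θ - Θ') = 0 := by
    -- In positive degree this is Stokes’ theorem; for `d = 0` only the zero form is exact.
    have key : ∀ {k : ℕ} (hk : k = 2 * d) (η : DiffForm (Fin d → ℂ) M k), IsExactForm η →
        integral (castDeg hk η) = 0 := by
      intro k hk η hη
      rcases k with _ | k
      · rw [show η = 0 from hη, show castDeg hk (0 : DiffForm (Fin d → ℂ) M 0) = 0 from form_ext fun x => by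
            rw [toList_castDeg]; simp]
        unfold integral
        split_ifs
        · refine Finset.sum_eq_zero fun i _ => ?_
          have : ∀ (e : OpenPartialHomeomorph M (Fin d → ℂ)) p,
            inChart e (0 : DiffForm (Fin d → ℂ) M (2 * d)) p = 0 := fun _ _ => rfl
          simp [this]
        · rfl
      · obtain ⟨γ, hγ, rfl⟩ := hη
        exact integral_castDeg_extD hk hγ
    exact key rfl _ h.2.2
  have h1 : integral Θ = integral (Θ - Θ') + integral Θ' := by
    unfold integral
    split_ifs with hP
    · generalize hP.some = P
      rw [integral_eq_sum, integral_eq_sum, integral_eq_sum, ← Finset.sum_add_distrib]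
      refine Finset.sum_congr rfl fun i _ => ?_
      have hint : ∀ {η : DiffForm (Fin d → ℂ) M (2 * d)}, IsSmoothForm η →
          Integrable fun p => localForm (P.chart i) (mulForm (P.ρ i) η) p (stdFrame d) :=
        fun hη => integrable_localForm_apply (P.chart_mem i) (isSmoothForm_mulForm (P.smooth i) hη)
          (isClosed_tsupport _) (P.tsupport_subset i) (supportedIn_mulForm _ _) _
      rw [chartIntegral, chartIntegral, chartIntegral,
        ← integral_add (hint (h.1.1.sub h.2.1.1)) (hint h.2.1.1)]
      congr 1
      funext p
      rw [← ContinuousAlternatingMap.add_apply, ← Pi.add_apply, ← localForm_add]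
      congr 3
      funext x
      simp [mulForm, smul_sub]
    · rw [add_zero]
  rw [h1, h0, zero_add]

end Integral

section InverseForm

variable {m : ℕ} {M : Type*} [TopologicalSpace M] [ChartedSpace (Fin m → ℂ) M]
  [IsManifold 𝓘(ℂ, Fin m → ℂ) ω M]

/-- The inverses of cohomologous total forms are cohomologous. The leading terms `s 0` and `t 0` are
equal, as only zero is exact in degree zero. -/
theorem cohomologous_inverseForm {s t : ∀ i, DiffForm (Fin m → ℂ) M (2 * i)}
    (h : ∀ i, Cohomologous (s i) (t i)) (hs : ∀ y, zeroFormValue (s 0) y ≠ 0) (k : ℕ) :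
    Cohomologous (inverseForm s k) (inverseForm t k) := by
  have h0 : s 0 = t 0 := sub_eq_zero.1 (h 0).2.2
  have hinv : IsClosedForm (zeroForm (fun y => (zeroFormValue (s 0) y)⁻¹) :
      DiffForm (Fin m → ℂ) M 0) := by
    refine IsClosedForm.zeroForm_inv ?_ hs
    rw [zeroForm_zeroFormValue]
    exact (h 0).1
  induction k using Nat.strong_induction_on with
  | _ k ih =>
    rcases k with _ | k
    · rw [inverseForm, inverseForm, ← h0]
      exact hinv.cohomologous_refl
    -- The recursion, with the scalar function `1 / s 0` rewritten as a form of degree zero.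
    · have key : ∀ s : (∀ i, DiffForm (Fin m → ℂ) M (2 * i)),
          inverseForm s (k + 1) = (-1 : ℝ) •
            castDeg (Nat.zero_add (2 * (k + 1)))
              (wedgeForm (zeroForm (fun y => (zeroFormValue (s 0) y)⁻¹))
                (∑ j : Fin (k + 1), castDeg (by have := j.2; omega)
                  (wedgeForm (inverseForm s j) (s (k + 1 - j))))) := by
        intro s
        refine form_ext fun y => ?_
        rw [inverseForm, Pi.smul_apply, map_smul, map_smul, toList_castDeg, wedgeForm, toList_wedge,
          zeroForm, toList_constOfIsEmpty, smul_mul_assoc, one_mul, smul_smul, neg_one_mul,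
          Finset.sum_apply]
      rw [key s, key t, ← h0]
      refine Cohomologous.smul _ (cohomologous_castDeg _ (hinv.cohomologous_refl.wedge
        (Cohomologous.sum _ fun j _ => cohomologous_castDeg _ ((ih j j.2).wedge (h _)))))

/-- The class of the Kobayashi–Lübke form only depends on the classes of the forms that it is built
from. -/
theorem cohomologous_kobayashiLubkeForm (n : ℕ) (hm : 2 ≤ m)
    {s t : ∀ i, DiffForm (Fin m → ℂ) M (2 * i)}
    (h : ∀ i, Cohomologous (s i) (t i)) (hs : ∀ y, zeroFormValue (s 0) y ≠ 0)
    {w w' : DiffForm (Fin m → ℂ) M 2} (hw : Cohomologous w w') :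
    Cohomologous (kobayashiLubkeForm n hm s w)
      (kobayashiLubkeForm n hm t w') := by
  have hk := cohomologous_inverseForm h hs
  exact cohomologous_castDeg _ (Cohomologous.wedge
    ((((hk 1).wedge (hk 1)).smul (n : ℝ)).sub (((hk 0).wedge (hk 2)).smul (2 * ((n : ℝ) + 1))))
    (cohomologous_wedgePow hw _))

end InverseForm

/-! ### The operator `√-1 ∂∂̄` -/

section Iddbar

variable {E : Type*} [NormedAddCommGroup E] [NormedSpace ℂ E] [NormedSpace ℝ E]
  [IsScalarTower ℝ ℂ E] [FiniteDimensional ℝ E]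

/-- The one-form `df ∘ J`. -/
def dcForm (f : E → ℝ) (q : E) : E [⋀^Fin 1]→L[ℝ] ℝ :=
  ContinuousAlternatingMap.ofSubsingleton ℝ E ℝ (0 : Fin 1)
    ((fderiv ℝ f q).comp (complexStructure E))

theorem dcForm_apply (f : E → ℝ) (q : E) (v : Fin 1 → E) :
    dcForm f q v = fderiv ℝ f q (Complex.I • v 0) := rfl

theorem iddbar_eq (f : E → ℝ) (p : E) : iddbar f p = -(2⁻¹ : ℝ) • extDeriv (dcForm f) p := rfl

theorem contDiffAt_dcForm {f : E → ℝ} {p : E} (hf : ContDiffAt ℝ ∞ f p) :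
    ContDiffAt ℝ ∞ (dcForm f) p :=
  contDiffAt_form fun _ => (hf.fderiv_right (m := ∞) (by simp)).clm_apply contDiffAt_const

theorem contDiffAt_iddbar {f : E → ℝ} {p : E} (hf : ContDiffAt ℝ ∞ f p) :
    ContDiffAt ℝ ∞ (iddbar f) p :=
  (contDiffAt_extDeriv (contDiffAt_dcForm hf)).const_smul (-(2⁻¹ : ℝ))

theorem eventuallyEq_dcForm {f g : E → ℝ} {p : E} (h : f =ᶠ[𝓝 p] g) :
    dcForm f =ᶠ[𝓝 p] dcForm g := by
  filter_upwards [h.fderiv (𝕜 := ℝ)] with q hq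
  rw [dcForm, hq, dcForm]

theorem iddbar_congr {f g : E → ℝ} {p : E} (h : f =ᶠ[𝓝 p] g) : iddbar f p = iddbar g p := by
  rw [iddbar_eq, iddbar_eq, (eventuallyEq_dcForm h).extDeriv_eq]

theorem dcForm_sub_eventuallyEq {f g : E → ℝ} {p : E} (hf : ContDiffAt ℝ ∞ f p)
    (hg : ContDiffAt ℝ ∞ g p) :
    dcForm (fun q => f q - g q) =ᶠ[𝓝 p] dcForm f - dcForm g := by
  have h1 : ∀ {f : E → ℝ}, ContDiffAt ℝ ∞ f p → ∀ᶠ q in 𝓝 p, DifferentiableAt ℝ f q := fun hf =>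
    ((hf.of_le (m := 1) (by simp)).eventually (by simp)).mono fun q hq =>
      hq.differentiableAt (by simp)
  filter_upwards [h1 hf, h1 hg] with q hq hq'
  ext v
  rw [Pi.sub_apply, ContinuousAlternatingMap.sub_apply, dcForm_apply, dcForm_apply, dcForm_apply,
    fderiv_fun_sub hq hq']
  rfl

theorem iddbar_sub {f g : E → ℝ} {p : E} (hf : ContDiffAt ℝ ∞ f p) (hg : ContDiffAt ℝ ∞ g p) :
    iddbar (fun q => f q - g q) p = iddbar f p - iddbar g p := by
  have h1 := ((contDiffAt_dcForm hf).differentiableAt (by simp))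
  have h2 := ((contDiffAt_dcForm hg).differentiableAt (by simp))
  rw [iddbar_eq, iddbar_eq, iddbar_eq, (dcForm_sub_eventuallyEq hf hg).extDeriv_eq,
    sub_eq_add_neg (dcForm f), ← neg_one_smul ℝ (dcForm g), extDeriv_add h1 (h2.const_smul _),
    extDeriv_smul]
  module

/-- Real parts of holomorphic functions are pluriharmonic: by the Cauchy–Riemann equations, `d(Re h)
∘ J = -d(Im h)` is exact. -/
theorem iddbar_re {h : E → ℂ} {p : E} (hh : ContDiffAt ℂ ω h p) :
    iddbar (fun q => (h q).re) p = 0 := by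
  have hr : ContDiffAt ℝ ∞ h p := (hh.restrict_scalars ℝ).of_le le_top
  have him : ContDiffAt ℝ ∞ (fun q => (h q).im) p :=
    Complex.imCLM.contDiff.contDiffAt.comp p hr
  have h1 : dcForm (fun q => (h q).re) =ᶠ[𝓝 p] -extDeriv (fun q =>
      ContinuousAlternatingMap.constOfIsEmpty ℝ E (Fin 0) (h q).im) := by
    filter_upwards [((hh.of_le (m := 1) le_top).eventually (by simp))] with q hq
    have hd : HasFDerivAt h ((fderiv ℂ h q).restrictScalars ℝ) q :=
      (hq.differentiableAt (by simp)).hasFDerivAt.restrictScalars ℝ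
    have hre : HasFDerivAt (fun q => (h q).re) (Complex.reCLM.comp _) q :=
      Complex.reCLM.hasFDerivAt.comp q hd
    have him : HasFDerivAt (fun q => (h q).im) (Complex.imCLM.comp _) q :=
      Complex.imCLM.hasFDerivAt.comp q hd
    ext v
    rw [Pi.neg_apply, extDeriv_constOfIsEmpty, dcForm_apply, hre.fderiv, him.fderiv]
    change ((fderiv ℂ h q) (Complex.I • v 0)).re = -((fderiv ℂ h q) (v 0)).im
    rw [map_smul]
    simp
  have h2 : ContDiffAt ℝ ∞ (fun q => ContinuousAlternatingMap.constOfIsEmpty ℝ E (Fin 0) (h q).im)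
      p := contDiffAt_form fun v => him
  rw [iddbar_eq, h1.extDeriv_eq, ← neg_one_smul ℝ (extDeriv _), extDeriv_smul,
    extDeriv_extDeriv_apply h2 two_le_infty]
  simp

/-- `log |g|²` is pluriharmonic for a holomorphic function `g` without zeros. -/
theorem iddbar_log_normSq {g : E → ℂ} {p : E} (hg : ContDiffAt ℂ ω g p) (h0 : g p ≠ 0) :
    iddbar (fun q => Real.log (‖g q‖ ^ 2)) p = 0 := by
  -- A branch of `2 log g` near `p`: dividing by `g p` keeps the argument of `log` away from the
  -- slit.
  let h : E → ℂ := fun q => 2 * Complex.log (g q / g p) + Real.log (‖g p‖ ^ 2)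
  have hq : ContDiffAt ℂ ω (fun q => g q / g p) p := hg.div_const _
  have hs : g p / g p ∈ Complex.slitPlane := by
    rw [div_self h0]; exact Complex.one_mem_slitPlane
  have hh : ContDiffAt ℂ ω h p :=
    (contDiffAt_const.mul (ContDiffAt.comp p (Complex.contDiffAt_log hs) hq)).add contDiffAt_const
  rw [← iddbar_re hh]
  apply iddbar_congr
  filter_upwards [hg.continuousAt.eventually_ne h0] with q hq
  simp only [h]
  rw [Complex.add_re, Complex.ofReal_re, show (2 : ℂ) = ((2 : ℝ) : ℂ) by simp, Complex.re_ofReal_mul,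
    Complex.log_re, norm_div, Real.log_pow, Real.log_pow,
    Real.log_div (norm_ne_zero_iff.2 hq) (norm_ne_zero_iff.2 h0)]
  push_cast
  ring

theorem dcForm_comp {τ : E → E} {p : E} (hτ : DifferentiableAt ℂ τ p) {f : E → ℝ}
    (hf : DifferentiableAt ℝ f (τ p)) :
    dcForm (fun q => f (τ q)) p = (dcForm f (τ p)).compContinuousLinearMap (fderiv ℝ τ p) := by
  have h1 : HasFDerivAt (fun q => f (τ q)) ((fderiv ℝ f (τ p)).comp (fderiv ℝ τ p)) p := by
    rw [fderiv_real_eq hτ]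
    exact hf.hasFDerivAt.comp p (hτ.hasFDerivAt.restrictScalars ℝ)
  ext v
  rw [dcForm_apply, h1.fderiv]
  change fderiv ℝ f (τ p) (fderiv ℝ τ p (Complex.I • v 0)) =
    fderiv ℝ f (τ p) (Complex.I • fderiv ℝ τ p (v 0))
  rw [fderiv_real_eq hτ]
  exact congrArg _ ((fderiv ℂ τ p).map_smul _ _)

/-- `√-1 ∂∂̄` commutes with holomorphic changes of coordinates. -/
theorem iddbar_comp {τ : E → E} {p : E} (hτ : ContDiffAt ℂ ω τ p) {f : E → ℝ}
    (hf : ContDiffAt ℝ ∞ f (τ p)) :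
    iddbar (fun q => f (τ q)) p = (iddbar f (τ p)).compContinuousLinearMap (fderiv ℝ τ p) := by
  have hτr : ContDiffAt ℝ ∞ τ p := (hτ.restrict_scalars ℝ).of_le le_top
  have h1 : dcForm (fun q => f (τ q)) =ᶠ[𝓝 p] fun q =>
      (dcForm f (τ q)).compContinuousLinearMap (fderiv ℝ τ q) := by
    filter_upwards [(hτ.of_le (m := 1) le_top).eventually (by simp),
      hτ.continuousAt.eventually ((hf.of_le (m := 1) (by simp)).eventually (by simp))] with q hq hq'
    exact dcForm_comp (hq.differentiableAt (by simp)) (hq'.differentiableAt (by simp))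
  rw [iddbar_eq, h1.extDeriv_eq, extDeriv_pullback ((contDiffAt_dcForm hf).differentiableAt
    (by simp)) hτr two_le_infty, iddbar_eq]
  rfl

theorem isOneOne_iddbar {f : E → ℝ} {p : E} (hf : ContDiffAt ℝ ∞ f p) : IsOneOne (iddbar f p) := by
  have hd : DifferentiableAt ℝ (fderiv ℝ f) p :=
    (hf.fderiv_right (m := ∞) (by simp)).differentiableAt (by simp)
  have hsymm : IsSymmSndFDerivAt ℝ f p := hf.isSymmSndFDerivAt two_le_infty
  have h1 : ∀ u w, fderiv ℝ (dcForm f) p u (fun _ => w) =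
      fderiv ℝ (fderiv ℝ f) p u (Complex.I • w) := by
    intro u w
    have h2 : HasFDerivAt (fun q => dcForm f q (fun _ => w))
        ((evalForm (fun _ => w)).comp (fderiv ℝ (dcForm f) p)) p :=
      (evalForm (fun _ => w)).hasFDerivAt.comp p
        ((contDiffAt_dcForm hf).differentiableAt (by simp)).hasFDerivAt
    have h3 : HasFDerivAt (fun q => fderiv ℝ f q (Complex.I • w))
        ((fderiv ℝ (fderiv ℝ f) p).flip (Complex.I • w)) p := by
      have := hd.hasFDerivAt.clm_apply (hasFDerivAt_const (Complex.I • w) p)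
      simpa using this
    exact congrArg (fun L => L u) (h2.unique h3)
  have h4 : ∀ u w, iddbar f p ![u, w] = -(2⁻¹ : ℝ) *
      (fderiv ℝ (fderiv ℝ f) p u (Complex.I • w) - fderiv ℝ (fderiv ℝ f) p w (Complex.I • u)) := by
    intro u w
    rw [iddbar_eq, ← h1, ← h1, ContinuousAlternatingMap.smul_apply, extDeriv,
      ContinuousAlternatingMap.alternatizeUncurryFin_apply, Fin.sum_univ_two, smul_eq_mul]
    have e0 : (0 : Fin 2).removeNth ![u, w] = fun _ => w := by
      ext i; fin_cases i; rfl
    have e1 : (1 : Fin 2).removeNth ![u, w] = fun _ => u := by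
      ext i; fin_cases i; rfl
    rw [e0, e1]
    simp [sub_eq_add_neg]
  intro u w
  have h5 : ∀ u w, fderiv ℝ (fderiv ℝ f) p (Complex.I • u) ((-1 : ℝ) • w) =
      -fderiv ℝ (fderiv ℝ f) p w (Complex.I • u) := fun u w => by
    rw [ContinuousLinearMap.map_smul, hsymm.eq (Complex.I • u) w]
    simp
  rw [h4, h4, I_smul_I_smul, I_smul_I_smul, h5, h5]
  ring

end Iddbar

/-! ### The curvature of Hermitian metrics -/

section Curvature

variable {E : Type*} [NormedAddCommGroup E] [NormedSpace ℂ E] [NormedSpace ℝ E]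
  [IsScalarTower ℝ ℂ E] {X : Type*} [TopologicalSpace X] [ChartedSpace E X]
  [IsManifold 𝓘(ℂ, E) ω X]
  {L : X → Type*} [∀ x, AddCommGroup (L x)] [∀ x, Module ℂ (L x)]
  [∀ x, TopologicalSpace (L x)] [TopologicalSpace (Bundle.TotalSpace ℂ L)] [FiberBundle ℂ L]
  [VectorBundle ℂ ℂ L]

/-- The local frame given by a trivialization has no zeros. -/
theorem symm_one_ne_zero (t : Bundle.Trivialization ℂ (Bundle.TotalSpace.proj : Bundle.TotalSpace ℂ L → X))
    [MemTrivializationAtlas t] {x : X} (hx : x ∈ t.baseSet) : t.symm x (1 : ℂ) ≠ 0 := by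
  intro h
  have h1 := congrArg Prod.snd (t.apply_mk_symm hx (1 : ℂ))
  rw [h] at h1
  have h2 : (t ⟨x, (0 : L x)⟩).2 = 0 := by
    have h3 := congrFun (t.coe_linearMapAt_of_mem (R := ℂ) hx) (0 : L x)
    rw [map_zero] at h3
    exact h3.symm
  rw [h2] at h1
  exact zero_ne_one h1

theorem HermitianMetric.contDiffAt_weight (φ : HermitianMetric E L)
    (t : Bundle.Trivialization ℂ (Bundle.TotalSpace.proj : Bundle.TotalSpace ℂ L → X))
    [MemTrivializationAtlas t] {e : OpenPartialHomeomorph X E}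
    (he : e ∈ IsManifold.maximalAtlas 𝓘(ℂ, E) ω X) {p : E} (hp : p ∈ e.target)
    (hpt : e.symm p ∈ t.baseSet) : ContDiffAt ℝ ∞ (fun q => φ.weight t (e.symm q)) p := by
  have h1 := contDiffAt_comp_symm_of_at
    ((φ.smooth t).contMDiffAt (t.open_baseSet.mem_nhds hpt)) he hp
  exact (h1.log (φ.pos _ _ (symm_one_ne_zero t hpt)).ne').neg

variable [ContMDiffVectorBundle ω ℂ L 𝓘(ℂ, E)]

/-- The weights with respect to two local frames differ by `log |g|²`, where `g` is the transition
function. -/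
theorem HermitianMetric.weight_sub_weight (φ : HermitianMetric E L)
    (t t' : Bundle.Trivialization ℂ (Bundle.TotalSpace.proj : Bundle.TotalSpace ℂ L → X))
    [MemTrivializationAtlas t] [MemTrivializationAtlas t'] {x : X} (hx : x ∈ t.baseSet)
    (hx' : x ∈ t'.baseSet) :
    φ.weight t' x - φ.weight t x = Real.log (‖t.coordChangeL ℂ t' x 1‖ ^ 2) ∧
      t.coordChangeL ℂ t' x 1 ≠ 0 := by
  have h1 : t.symm x (1 : ℂ) = (t.coordChangeL ℂ t' x 1) • t'.symm x (1 : ℂ) := by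
    have h2 : t'.symm x (t.coordChangeL ℂ t' x 1) = t.symm x (1 : ℂ) := by
      rw [t.coordChangeL_apply t' ⟨hx, hx'⟩, t'.symm_apply_apply_mk hx']
    rw [← h2, ← t'.symmₗ_apply (R := ℂ) hx', ← t'.symmₗ_apply (R := ℂ) hx', ← map_smul, smul_eq_mul, mul_one]
  have h0 : t.coordChangeL ℂ t' x 1 ≠ 0 := fun h => symm_one_ne_zero t hx (by rw [h1, h, zero_smul])
  refine ⟨?_, h0⟩
  rw [weight, weight, h1, φ.smul, Real.log_mul (by positivity)
    (φ.pos _ _ (symm_one_ne_zero t' hx')).ne']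
  ring

theorem contDiffAt_coordChange
    (t t' : Bundle.Trivialization ℂ (Bundle.TotalSpace.proj : Bundle.TotalSpace ℂ L → X))
    [MemTrivializationAtlas t] [MemTrivializationAtlas t'] {e : OpenPartialHomeomorph X E}
    (he : e ∈ IsManifold.maximalAtlas 𝓘(ℂ, E) ω X) {p : E} (hp : p ∈ e.target)
    (hpt : e.symm p ∈ t.baseSet) (hpt' : e.symm p ∈ t'.baseSet) :
    ContDiffAt ℂ ω (fun q => t.coordChangeL ℂ t' (e.symm q) 1) p := by
  have h1 := (contMDiffOn_coordChangeL (n := ω) (IB := 𝓘(ℂ, E)) t t').contMDiffAt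
    ((t.open_baseSet.inter t'.open_baseSet).mem_nhds ⟨hpt, hpt'⟩)
  have h2 := h1.comp p (contMDiffAt_symm_of_mem_maximalAtlas he hp)
  rw [contMDiffAt_iff_contDiffAt] at h2
  exact h2.clm_apply contDiffAt_const

variable [FiniteDimensional ℝ E]

/-- The curvature does not depend on the local holomorphic frame. -/
theorem HermitianMetric.iddbar_weight (φ : HermitianMetric E L)
    (t t' : Bundle.Trivialization ℂ (Bundle.TotalSpace.proj : Bundle.TotalSpace ℂ L → X))
    [MemTrivializationAtlas t] [MemTrivializationAtlas t'] {e : OpenPartialHomeomorph X E}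
    (he : e ∈ IsManifold.maximalAtlas 𝓘(ℂ, E) ω X) {p : E} (hp : p ∈ e.target)
    (hpt : e.symm p ∈ t.baseSet) (hpt' : e.symm p ∈ t'.baseSet) :
    iddbar (fun q => φ.weight t (e.symm q)) p = iddbar (fun q => φ.weight t' (e.symm q)) p := by
  have h1 := iddbar_sub (φ.contDiffAt_weight t' he hp hpt') (φ.contDiffAt_weight t he hp hpt)
  have h2 := iddbar_log_normSq (contDiffAt_coordChange t t' he hp hpt hpt')
    (φ.weight_sub_weight t t' hpt hpt').2
  have h3 : iddbar (fun q => φ.weight t' (e.symm q) - φ.weight t (e.symm q)) p = 0 := by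
    rw [← h2]
    apply iddbar_congr
    have hc := e.symm.continuousAt hp
    filter_upwards [hc.preimage_mem_nhds (t.open_baseSet.mem_nhds hpt),
      hc.preimage_mem_nhds (t'.open_baseSet.mem_nhds hpt')] with q hq hq'
    exact (φ.weight_sub_weight t t' hq hq').1
  rw [h3] at h1
  exact (sub_eq_zero.1 h1.symm).symm

/-- The curvature is given by `√-1 ∂∂̄` of the weight in any holomorphic chart and for any local
holomorphic frame. -/
theorem HermitianMetric.inChart_curvature (φ : HermitianMetric E L)
    (t : Bundle.Trivialization ℂ (Bundle.TotalSpace.proj : Bundle.TotalSpace ℂ L → X))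
    [MemTrivializationAtlas t] {e : OpenPartialHomeomorph X E}
    (he : e ∈ IsManifold.maximalAtlas 𝓘(ℂ, E) ω X) {p : E} (hp : p ∈ e.target)
    (hpt : e.symm p ∈ t.baseSet) :
    inChart e φ.curvature p = iddbar (fun q => φ.weight t (e.symm q)) p := by
  set x := e.symm p with hx
  set c := chartAt E x with hc
  have hxs : x ∈ c.source := mem_chart_source E x
  have hxt := FiberBundle.mem_baseSet_trivializationAt ℂ L x
  have hcm : c ∈ IsManifold.maximalAtlas 𝓘(ℂ, E) ω X := chartAt_mem_maximalAtlas x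
  have h1 : ContDiffAt ℝ ∞ (fun q => φ.weight (trivializationAt ℂ L x) (c.symm q)) (c x) :=
    φ.contDiffAt_weight _ hcm (c.map_source hxs) (by rwa [c.left_inv hxs])
  rw [φ.iddbar_weight t (trivializationAt ℂ L x) he hp hpt hxt]
  have h2 := iddbar_comp (contDiffAt_transition he hcm hp hxs) h1
  refine Eq.trans ?_ (h2.symm.trans (iddbar_congr ?_))
  · rfl
  · filter_upwards [eventually_mem_overlap hp hxs] with q hq
    rw [c.left_inv hq.2]

theorem HermitianMetric.inChart_curvature_eventuallyEq (φ : HermitianMetric E L)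
    (t : Bundle.Trivialization ℂ (Bundle.TotalSpace.proj : Bundle.TotalSpace ℂ L → X))
    [MemTrivializationAtlas t] {e : OpenPartialHomeomorph X E}
    (he : e ∈ IsManifold.maximalAtlas 𝓘(ℂ, E) ω X) {p : E} (hp : p ∈ e.target)
    (hpt : e.symm p ∈ t.baseSet) :
    inChart e φ.curvature =ᶠ[𝓝 p] iddbar (fun q => φ.weight t (e.symm q)) := by
  filter_upwards [e.open_target.mem_nhds hp, (e.symm.continuousAt hp).preimage_mem_nhds
    (t.open_baseSet.mem_nhds hpt)] with q hq hq'
  exact φ.inChart_curvature t he hq hq'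

theorem HermitianMetric.isSmoothForm_curvature (φ : HermitianMetric E L) :
    IsSmoothForm φ.curvature := by
  refine isSmoothForm_of fun x => ⟨chartAt E x, chartAt_mem_maximalAtlas x,
    mem_chart_source E x, ?_⟩
  have hp := mem_chart_target E x
  have ht : (chartAt E x).symm (chartAt E x x) ∈ (trivializationAt ℂ L x).baseSet := by
    rw [(chartAt E x).left_inv (mem_chart_source E x)]
    exact FiberBundle.mem_baseSet_trivializationAt ℂ L x
  exact (contDiffAt_iddbar (φ.contDiffAt_weight _ (chartAt_mem_maximalAtlas x) hp
    ht)).congr_of_eventuallyEq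
    (φ.inChart_curvature_eventuallyEq _ (chartAt_mem_maximalAtlas x) hp ht)

theorem HermitianMetric.isClosedForm_curvature (φ : HermitianMetric E L) :
    IsClosedForm φ.curvature := by
  refine ⟨φ.isSmoothForm_curvature, funext fun x => ?_⟩
  have hp := mem_chart_target E x
  have ht : (chartAt E x).symm (chartAt E x x) ∈ (trivializationAt ℂ L x).baseSet := by
    rw [(chartAt E x).left_inv (mem_chart_source E x)]
    exact FiberBundle.mem_baseSet_trivializationAt ℂ L x
  have h1 := φ.inChart_curvature_eventuallyEq _ (chartAt_mem_maximalAtlas x) hp ht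
  have h2 := φ.contDiffAt_weight _ (chartAt_mem_maximalAtlas x) hp ht
  rw [extD, h1.extDeriv_eq]
  change extDeriv (-(2⁻¹ : ℝ) • extDeriv (dcForm _)) _ = 0
  rw [extDeriv_smul, extDeriv_extDeriv_apply (contDiffAt_dcForm h2) two_le_infty, smul_zero]

theorem HermitianMetric.isOneOne_curvature (φ : HermitianMetric E L) {e : OpenPartialHomeomorph X E}
    (he : e ∈ IsManifold.maximalAtlas 𝓘(ℂ, E) ω X) {p : E} (hp : p ∈ e.target) :
    IsOneOne (inChart e φ.curvature p) := by
  have ht := FiberBundle.mem_baseSet_trivializationAt ℂ L (e.symm p)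
  rw [φ.inChart_curvature (trivializationAt ℂ L (e.symm p)) he hp ht]
  exact isOneOne_iddbar (φ.contDiffAt_weight _ he hp ht)

/-- The curvatures of two metrics on a line bundle are cohomologous: they differ by `√-1 ∂∂̄` of a
global function. -/
theorem HermitianMetric.cohomologous_curvature (φ ψ : HermitianMetric E L) :
    Cohomologous φ.curvature ψ.curvature := by
  -- The difference of the weights does not depend on the frame, so that it is a global function
  -- `u`.
  let u : X → ℝ := fun x => φ.weight (trivializationAt ℂ L x) x - ψ.weight (trivializationAt ℂ L x) x
  have hu : ∀ (t : Bundle.Trivialization ℂ (Bundle.TotalSpace.proj : Bundle.TotalSpace ℂ L → X))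
      [MemTrivializationAtlas t] {x : X}, x ∈ t.baseSet → u x = φ.weight t x - ψ.weight t x := by
    intro t _ x hx
    have hx' := FiberBundle.mem_baseSet_trivializationAt ℂ L x
    have h1 := (φ.weight_sub_weight t (trivializationAt ℂ L x) hx hx').1
    have h2 := (ψ.weight_sub_weight t (trivializationAt ℂ L x) hx hx').1
    simp only [u]
    linarith
  have hue : ∀ {e : OpenPartialHomeomorph X E} {p : E}, p ∈ e.target →
      (fun q => u (e.symm q)) =ᶠ[𝓝 p] fun q =>
        φ.weight (trivializationAt ℂ L (e.symm p)) (e.symm q) -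
          ψ.weight (trivializationAt ℂ L (e.symm p)) (e.symm q) := fun {e p} hp => by
    filter_upwards [(e.symm.continuousAt hp).preimage_mem_nhds ((trivializationAt ℂ L
      (e.symm p)).open_baseSet.mem_nhds (FiberBundle.mem_baseSet_trivializationAt ℂ L _))] with q hq
    exact hu _ hq
  have hus : ∀ {e : OpenPartialHomeomorph X E}, e ∈ IsManifold.maximalAtlas 𝓘(ℂ, E) ω X →
      ∀ {p : E}, p ∈ e.target → ContDiffAt ℝ ∞ (fun q => u (e.symm q)) p := by
    intro e he p hp
    have ht := FiberBundle.mem_baseSet_trivializationAt ℂ L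
    exact ((φ.contDiffAt_weight _ he hp (ht _)).sub
      (ψ.contDiffAt_weight _ he hp (ht _))).congr_of_eventuallyEq (hue hp)
  -- A primitive of `√-1 ∂∂̄ u` is `-(du ∘ J) / 2`, which is independent of the chart.
  let β : DiffForm E X 1 := fun x =>
    -(2⁻¹ : ℝ) • dcForm (fun q => u ((chartAt E x).symm q)) (chartAt E x x)
  have hβ : ∀ {e : OpenPartialHomeomorph X E}, e ∈ IsManifold.maximalAtlas 𝓘(ℂ, E) ω X →
      ∀ {p : E}, p ∈ e.target →
        inChart e β p = -(2⁻¹ : ℝ) • dcForm (fun q => u (e.symm q)) p := by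
    intro e he p hp
    set c := chartAt E (e.symm p)
    have hxs : e.symm p ∈ c.source := mem_chart_source E _
    have hcm : c ∈ IsManifold.maximalAtlas 𝓘(ℂ, E) ω X := chartAt_mem_maximalAtlas _
    have h1 : ContDiffAt ℝ ∞ (fun q => u (c.symm q)) (c (e.symm p)) := hus hcm (c.map_source hxs)
    have h2 := dcForm_comp ((contDiffAt_transition he hcm hp hxs).differentiableAt (by simp))
      (h1.differentiableAt (by simp))
    have h3 : dcForm (fun q => u (e.symm q)) p = dcForm (fun q => u (c.symm (c (e.symm q)))) p := by
      refine (eventuallyEq_dcForm ?_).eq_of_nhds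
      filter_upwards [eventually_mem_overlap hp hxs] with q hq
      rw [c.left_inv hq.2]
    rw [h3, h2]
    rfl
  refine ⟨φ.isClosedForm_curvature, ψ.isClosedForm_curvature, β, ?_, ?_⟩
  · refine isSmoothForm_of fun x => ⟨chartAt E x, chartAt_mem_maximalAtlas x,
      mem_chart_source E x, ?_⟩
    have hp := mem_chart_target E x
    refine ((contDiffAt_dcForm (hus (chartAt_mem_maximalAtlas x) hp)).const_smul
      (-(2⁻¹ : ℝ))).congr_of_eventuallyEq ?_
    filter_upwards [(chartAt E x).open_target.mem_nhds hp] with q hq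
    exact hβ (chartAt_mem_maximalAtlas x) hq
  · funext x
    have hp := mem_chart_target E x
    have ht := FiberBundle.mem_baseSet_trivializationAt ℂ L
      ((chartAt E x).symm (chartAt E x x))
    have hm := chartAt_mem_maximalAtlas (E := E) x
    have h1 : inChart (chartAt E x) β =ᶠ[𝓝 (chartAt E x x)]
        -(2⁻¹ : ℝ) • dcForm (fun q => u ((chartAt E x).symm q)) := by
      filter_upwards [(chartAt E x).open_target.mem_nhds hp] with q hq
      exact hβ (chartAt_mem_maximalAtlas x) hq
    rw [extD, h1.extDeriv_eq, extDeriv_smul]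
    change _ = iddbar (fun q => u ((chartAt E x).symm q)) (chartAt E x x)
    rw [iddbar_congr (hue hp), iddbar_sub (φ.contDiffAt_weight _ hm hp ht)
      (ψ.contDiffAt_weight _ hm hp ht), ← φ.inChart_curvature _ hm hp ht,
      ← ψ.inChart_curvature _ hm hp ht, inChart_chartAt, inChart_chartAt]
    rfl

theorem HermitianMetric.cohomologous_chernForm (φ ψ : HermitianMetric E L) :
    Cohomologous φ.chernForm ψ.chernForm :=
  (φ.cohomologous_curvature ψ).smul _

end Curvature

/-! ### Existence of admissible coordinates and of admissible partitions of unity -/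

section Existence

variable {m n : ℕ}

/-- A surjection onto the base directions is the first component of a linear isomorphism. -/
theorem exists_equiv_prod_of_surjective (A : (Fin m → ℂ) × (Fin n → ℂ) →L[ℂ] (Fin m → ℂ))
    (hA : Function.Surjective A) :
    ∃ (B : (Fin m → ℂ) × (Fin n → ℂ) →L[ℂ] (Fin n → ℂ))
      (T : ((Fin m → ℂ) × (Fin n → ℂ)) ≃L[ℂ] (Fin m → ℂ) × (Fin n → ℂ)),
      (T : (Fin m → ℂ) × (Fin n → ℂ) →L[ℂ] (Fin m → ℂ) × (Fin n → ℂ)) = A.prod B := by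
  let K := LinearMap.ker (A : (Fin m → ℂ) × (Fin n → ℂ) →ₗ[ℂ] (Fin m → ℂ))
  have hK : Module.finrank ℂ K = Module.finrank ℂ (Fin n → ℂ) := by
    have h1 := LinearMap.finrank_range_add_finrank_ker
      (A : (Fin m → ℂ) × (Fin n → ℂ) →ₗ[ℂ] (Fin m → ℂ))
    rw [LinearMap.range_eq_top.2 hA, finrank_top, Module.finrank_prod] at h1
    have h2 : Module.finrank ℂ (Fin m → ℂ) + Module.finrank ℂ K =
      Module.finrank ℂ (Fin m → ℂ) + Module.finrank ℂ (Fin n → ℂ) := h1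
    omega
  let l : K ≃ₗ[ℂ] (Fin n → ℂ) := LinearEquiv.ofFinrankEq _ _ hK
  obtain ⟨g, hg⟩ := LinearMap.exists_leftInverse_of_injective K.subtype K.ker_subtype
  -- `B` is a projection to the kernel of `A`, followed by an identification of the kernel with
  -- `ℂ^n`.
  let B : (Fin m → ℂ) × (Fin n → ℂ) →L[ℂ] (Fin n → ℂ) :=
    LinearMap.toContinuousLinearMap ((l : K →ₗ[ℂ] (Fin n → ℂ)).comp g)
  have hinj : Function.Injective
      ((A.prod B : (Fin m → ℂ) × (Fin n → ℂ) →L[ℂ] (Fin m → ℂ) × (Fin n → ℂ)) :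
        (Fin m → ℂ) × (Fin n → ℂ) →ₗ[ℂ] (Fin m → ℂ) × (Fin n → ℂ)) := by
    refine (injective_iff_map_eq_zero _).2 fun v hv => ?_
    have h1 : A v = 0 := congrArg Prod.fst hv
    have h2 : l (g v) = 0 := congrArg Prod.snd hv
    have h3 : g v = ⟨v, h1⟩ := by
      have := LinearMap.congr_fun hg ⟨v, h1⟩
      exact this
    rw [h3] at h2
    have h4 := (LinearEquiv.map_eq_zero_iff l).1 h2
    exact congrArg Subtype.val h4
  exact ⟨B, (LinearEquiv.ofInjectiveEndo _ hinj).toContinuousLinearEquiv, ContinuousLinearMap.ext fun _ => rfl⟩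

variable {M : Type*} [TopologicalSpace M] [ChartedSpace (Fin m → ℂ) M]
  [IsManifold 𝓘(ℂ, Fin m → ℂ) ω M]
  {X : Type*} [TopologicalSpace X] [ChartedSpace ((Fin m → ℂ) × (Fin n → ℂ)) X]
  [IsManifold 𝓘(ℂ, (Fin m → ℂ) × (Fin n → ℂ)) ω X] {π : X → M}

/-- The expression of `π` in holomorphic charts is holomorphic. -/
theorem IsHolomorphicFibration.contDiffAt (hπ : IsHolomorphicFibration m n π)
    {e : OpenPartialHomeomorph X ((Fin m → ℂ) × (Fin n → ℂ))}
    {z : OpenPartialHomeomorph M (Fin m → ℂ)}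
    (he : e ∈ IsManifold.maximalAtlas 𝓘(ℂ, (Fin m → ℂ) × (Fin n → ℂ)) ω X)
    (hz : z ∈ IsManifold.maximalAtlas 𝓘(ℂ, Fin m → ℂ) ω M)
    {p : (Fin m → ℂ) × (Fin n → ℂ)} (hp : p ∈ e.target) (hp' : π (e.symm p) ∈ z.source) :
    ContDiffAt ℂ ω (fun q => z (π (e.symm q))) p := by
  rw [← contMDiffAt_iff_contDiffAt]
  have h1 := contMDiffAt_symm_of_mem_maximalAtlas he hp
  have h2 := (hπ.holomorphic (e.symm p)).comp p h1
  exact (contMDiffAt_of_mem_maximalAtlas hz hp').comp p h2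

/-- The differential of `π` is the derivative of its expression in the preferred charts. -/
theorem IsHolomorphicFibration.mfderiv_eq (hπ : IsHolomorphicFibration m n π) (x : X) :
    mfderiv 𝓘(ℂ, (Fin m → ℂ) × (Fin n → ℂ)) 𝓘(ℂ, Fin m → ℂ) π x =
      fderiv ℂ (fun q => chartAt (Fin m → ℂ) (π x)
        (π ((chartAt ((Fin m → ℂ) × (Fin n → ℂ)) x).symm q)))
        (chartAt ((Fin m → ℂ) × (Fin n → ℂ)) x x) := by
  have h : MDifferentiableAt 𝓘(ℂ, (Fin m → ℂ) × (Fin n → ℂ)) 𝓘(ℂ, Fin m → ℂ) π x :=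
    (hπ.holomorphic x).mdifferentiableAt (by simp)
  rw [h.mfderiv]
  simp only [writtenInExtChartAt, extChartAt, mfld_simps, fderivWithin_univ]
  rfl

/-- Admissible coordinates exist around every point: complete `z ∘ π` by a linear function of given
coordinates to a local biholomorphism. -/
theorem IsHolomorphicFibration.exists_isAdmissible (hπ : IsHolomorphicFibration m n π) (x : X) :
    ∃ (e : OpenPartialHomeomorph X ((Fin m → ℂ) × (Fin n → ℂ)))
      (z : OpenPartialHomeomorph M (Fin m → ℂ)), IsAdmissible π e z ∧ x ∈ e.source := by
  set e0 := chartAt ((Fin m → ℂ) × (Fin n → ℂ)) x with he0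
  set z := chartAt (Fin m → ℂ) (π x) with hz
  have he0m := chartAt_mem_maximalAtlas (E := (Fin m → ℂ) × (Fin n → ℂ)) x
  have hzm := chartAt_mem_maximalAtlas (E := Fin m → ℂ) (π x)
  have hx : e0.symm (e0 x) = x := e0.left_inv (mem_chart_source _ x)
  let W : Set ((Fin m → ℂ) × (Fin n → ℂ)) := e0.target ∩ e0.symm ⁻¹' (π ⁻¹' z.source)
  have hW : IsOpen W := e0.isOpen_inter_preimage_symm
    (z.open_source.preimage hπ.holomorphic.continuous)
  have hpW : e0 x ∈ W := ⟨mem_chart_target _ x, by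
    rw [Set.mem_preimage, hx]; exact mem_chart_source _ (π x)⟩
  let f : (Fin m → ℂ) × (Fin n → ℂ) → (Fin m → ℂ) := fun q => z (π (e0.symm q))
  have hf : ∀ q ∈ W, ContDiffAt ℂ ω f q := fun q hq => hπ.contDiffAt he0m hzm hq.1 hq.2
  have hsurj : Function.Surjective (fderiv ℂ f (e0 x)) := by
    have := hπ.submersion x
    rwa [hπ.mfderiv_eq] at this
  obtain ⟨B, T, hT⟩ := exists_equiv_prod_of_surjective (fderiv ℂ f (e0 x)) hsurj
  let G : (Fin m → ℂ) × (Fin n → ℂ) → (Fin m → ℂ) × (Fin n → ℂ) := fun q => (f q, B q)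
  have hG : ∀ q ∈ W, ContDiffAt ℂ ω G q := fun q hq => (hf q hq).prodMk B.contDiff.contDiffAt
  have hG' : HasFDerivAt G (T : (Fin m → ℂ) × (Fin n → ℂ) →L[ℂ] (Fin m → ℂ) × (Fin n → ℂ))
      (e0 x) := by
    rw [hT]
    exact (((hf _ hpW).differentiableAt (by simp)).hasFDerivAt).prodMk B.hasFDerivAt
  let H := (hG _ hpW).toOpenPartialHomeomorph G hG' (by simp)
  -- the open set on which `G` is holomorphic with invertible derivative
  let V : Set ((Fin m → ℂ) × (Fin n → ℂ)) := W ∩ fderiv ℂ G ⁻¹' Set.range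
    ((↑) : (((Fin m → ℂ) × (Fin n → ℂ)) ≃L[ℂ] (Fin m → ℂ) × (Fin n → ℂ)) → _)
  have hV : IsOpen V := by
    refine ContinuousOn.isOpen_inter_preimage (fun q hq => ?_) hW
      (ContinuousLinearEquiv.isOpen (𝕜 := ℂ))
    exact ((hG q hq).fderiv_right (m := ω) (by simp)).continuousAt.continuousWithinAt
  have hpV : e0 x ∈ V := ⟨hpW, T, hG'.fderiv.symm⟩
  let e := e0.trans (H.restrOpen V hV)
  have hsrc : ∀ y, y ∈ e.source → y ∈ e0.source ∧ e0 y ∈ H.source ∧ e0 y ∈ V := fun y hy => by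
    have h1 : y ∈ e0.source ∩ e0 ⁻¹' (H.restrOpen V hV).source := by
      rw [← OpenPartialHomeomorph.trans_source]; exact hy
    exact ⟨h1.1, h1.2.1, h1.2.2⟩
  have hcoe : ∀ y, e y = G (e0 y) := fun y => rfl
  refine ⟨e, z, ⟨?_, hzm, fun y hy => ?_, fun y hy => ?_⟩, ?_⟩
  · refine OpenPartialHomeomorph.mem_maximalAtlas_of_contMDiffOn _ (fun y hy => ?_) fun q hq => ?_
    · obtain ⟨h1, h2, h3⟩ := hsrc y hy
      have h4 := (contMDiffAt_iff_contDiffAt.2 (hG _ h3.1)).comp y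
        (contMDiffAt_of_mem_maximalAtlas he0m h1)
      exact h4.contMDiffWithinAt
    · have h0 := e.map_target hq
      obtain ⟨h1, h2, h3⟩ := hsrc _ h0
      have h5 : q ∈ H.target := by
        have : q ∈ (H.restrOpen V hV).target := by
          have h6 : q ∈ (e0.trans (H.restrOpen V hV)).target := hq
          rw [OpenPartialHomeomorph.trans_target] at h6
          exact h6.1
        have h7 := (H.restrOpen V hV).map_target this
        rw [← (H.restrOpen V hV).right_inv this]
        exact H.map_source h7.1
      have h8 : e0 (e.symm q) = H.symm q := by
        change e0 (e0.symm (H.symm q)) = _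
        apply e0.right_inv
        have h6 : q ∈ (e0.trans (H.restrOpen V hV)).target := hq
        rw [OpenPartialHomeomorph.trans_target] at h6
        exact h6.2
      rw [h8] at h2 h3
      obtain ⟨T', hT'⟩ := h3.2
      have h9 : HasFDerivAt H (T' : (Fin m → ℂ) × (Fin n → ℂ) →L[ℂ] (Fin m → ℂ) × (Fin n → ℂ))
          (H.symm q) := by
        rw [hT']
        exact ((hG _ h3.1).differentiableAt (by simp)).hasFDerivAt
      have h10 : ContDiffAt ℂ ω H.symm q := H.contDiffAt_symm h5 h9 (hG _ h3.1)
      have h11 := (contMDiffAt_symm_of_mem_maximalAtlas he0m (x := H.symm q) h3.1.1).comp q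
        (contMDiffAt_iff_contDiffAt.2 h10)
      exact h11.contMDiffWithinAt
  · obtain ⟨h1, h2, h3⟩ := hsrc y hy
    have := h3.1.2
    rwa [Set.mem_preimage, e0.left_inv h1] at this
  · obtain ⟨h1, h2, h3⟩ := hsrc y hy
    rw [hcoe]
    change z (π (e0.symm (e0 y))) = _
    rw [e0.left_inv h1]
  · change x ∈ (e0.trans (H.restrOpen V hV)).source
    rw [OpenPartialHomeomorph.trans_source]
    exact ⟨mem_chart_source _ x, (hG _ hpW).mem_toOpenPartialHomeomorph_source hG' (by simp), hpV⟩

/-- The total space is compact, because `π` is proper. -/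
theorem IsHolomorphicFibration.compactSpace [CompactSpace M]
    (hπ : IsHolomorphicFibration m n π) : CompactSpace X :=
  ⟨by simpa using hπ.proper.isCompact_preimage (isCompact_univ (X := M))⟩

/-- The real manifold underlying a complex manifold. -/
theorem isManifold_real {E : Type*} [NormedAddCommGroup E] [NormedSpace ℂ E] [NormedSpace ℝ E]
    [IsScalarTower ℝ ℂ E] (X : Type*) [TopologicalSpace X] [ChartedSpace E X]
    [IsManifold 𝓘(ℂ, E) ω X] : IsManifold 𝓘(ℝ, E) ∞ X := by
  refine isManifold_of_contDiffOn _ _ _ fun e e' he he' => fun p hp => ?_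
  have hp' : p ∈ e.target ∧ e.symm p ∈ e'.source := by
    simpa using hp
  have h1 := contDiffAt_real_transition (IsManifold.subset_maximalAtlas (I := 𝓘(ℂ, E)) (n := ω) he)
    (IsManifold.subset_maximalAtlas he') hp'.1 hp'.2
  exact h1.contDiffWithinAt

/-- Over a compact base there is a finite partition of unity subordinate to admissible coordinates.
-/
theorem IsHolomorphicFibration.nonempty_admissiblePartition [CompactSpace M] [T2Space X]
    (hπ : IsHolomorphicFibration m n π) : Nonempty (AdmissiblePartition (m := m) (n := n) π) := by
  have := hπ.compactSpace
  have : IsManifold 𝓘(ℝ, (Fin m → ℂ) × (Fin n → ℂ)) ∞ X := isManifold_real X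
  choose e z h hx using hπ.exists_isAdmissible
  obtain ⟨t, ht⟩ := CompactSpace.elim_nhds_subcover (fun x => (e x).source)
    fun x => (e x).open_source.mem_nhds (hx x)
  let c : Fin t.card → X := fun i => t.equivFin.symm i
  obtain ⟨ρ, hρ⟩ := SmoothPartitionOfUnity.exists_isSubordinate
    𝓘(ℝ, (Fin m → ℂ) × (Fin n → ℂ)) isClosed_univ (fun i => (e (c i)).source)
    (fun i => (e (c i)).open_source) (fun x _ => by
      have hx' : x ∈ ⋃ y ∈ t, (e y).source := ht ▸ Set.mem_univ x
      obtain ⟨y, hy, hxy⟩ := Set.mem_iUnion₂.1 hx'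
      refine Set.mem_iUnion.2 ⟨t.equivFin ⟨y, hy⟩, ?_⟩
      simpa [c] using hxy)
  exact ⟨{
    N := t.card
    chart := fun i => e (c i)
    chart_mem := fun i => (h (c i)).total_mem
    ρ := fun i => ρ i
    smooth := fun i => (ρ i).contMDiff
    nonneg := fun i x => ρ.nonneg i x
    sum_eq_one := fun x => by
      rw [← finsum_eq_sum_of_fintype]
      exact ρ.sum_eq_one (Set.mem_univ x)
    tsupport_subset := fun i => hρ i
    base := fun i => z (c i)
    admissible := fun i => h (c i) }⟩

end Existence

/-! ### The geodesic curvature in different coordinates -/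

section GeodesicAt

variable {m n : ℕ}

theorem two_comp {E F : Type*} [NormedAddCommGroup E] [NormedSpace ℝ E] [NormedAddCommGroup F]
    [NormedSpace ℝ F] (θ : F [⋀^Fin 2]→L[ℝ] ℝ) (f : E →L[ℝ] F) (u v : E) :
    θ.compContinuousLinearMap f ![u, v] = θ ![f u, f v] := by
  rw [ContinuousAlternatingMap.compContinuousLinearMap_apply]
  congr 1; funext i; fin_cases i <;> rfl

/-- The geodesic curvature form is natural under complex linear maps that preserve the fibre
directions. -/
theorem geodesicForm_comp {θ θ' : ((Fin m → ℂ) × (Fin n → ℂ)) [⋀^Fin 2]→L[ℝ] ℝ}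
    (h : IsOneOne θ) (hpos : IsVerticallyPositive θ) (h' : IsOneOne θ')
    (hpos' : IsVerticallyPositive θ')
    {T : (Fin m → ℂ) × (Fin n → ℂ) →L[ℂ] (Fin m → ℂ) × (Fin n → ℂ)}
    (hT : θ = θ'.compContinuousLinearMap (T.restrictScalars ℝ))
    {A : (Fin m → ℂ) →L[ℂ] (Fin m → ℂ)} (hA : ∀ u, (T u).1 = A u.1)
    {V : (Fin n → ℂ) →L[ℂ] (Fin n → ℂ)} (hV : ∀ v, T (0, v) = (0, V v))
    (hVs : Function.Surjective V) :
    geodesicForm θ = (geodesicForm θ').compContinuousLinearMap (A.restrictScalars ℝ) := by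
  -- `T` maps horizontal vectors to horizontal vectors, since horizontality is orthogonality to the
  -- fibre directions.
  have key : ∀ u, T (horizontalLift θ u) = horizontalLift θ' (A u) := fun u => by
    have h1 := eq_horizontalLift h' hpos' (w := T (horizontalLift θ u)) fun v => by
      obtain ⟨v, rfl⟩ := hVs v
      have h2 := horizontalLift_orth h hpos u v
      have h3 : ∀ x y, θ ![x, y] = θ' ![T x, T y] := fun x y => by rw [hT, two_comp]; rfl
      rw [h3] at h2
      rwa [← hV]
    rw [h1, hA]
    rfl
  refine two_ext fun u w => ?_
  rw [two_comp, geodesicForm_apply, geodesicForm_apply]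
  change _ = θ' ![horizontalLift θ' (A u), horizontalLift θ' (A w)]
  rw [← key, ← key]
  conv_lhs => rw [hT]
  rw [two_comp, ← hT]
  rfl

variable {M : Type*} [TopologicalSpace M] [ChartedSpace (Fin m → ℂ) M]
  [IsManifold 𝓘(ℂ, Fin m → ℂ) ω M]

/-- The derivative at `y` of the coordinate map `z`, in terms of the preferred chart. -/
def baseDeriv (z : OpenPartialHomeomorph M (Fin m → ℂ)) (y : M) :
    (Fin m → ℂ) →L[ℂ] (Fin m → ℂ) :=
  fderiv ℂ (fun q => z ((chartAt (Fin m → ℂ) y).symm q)) (chartAt (Fin m → ℂ) y y)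

section BaseDeriv

variable {z z' : OpenPartialHomeomorph M (Fin m → ℂ)} {y : M}

theorem contDiffAt_baseDeriv
    (hz : z ∈ IsManifold.maximalAtlas 𝓘(ℂ, Fin m → ℂ) ω M) (hy : y ∈ z.source) : ContDiffAt ℂ ω (fun q => z ((chartAt (Fin m → ℂ) y).symm q))
    (chartAt (Fin m → ℂ) y y) :=
  contDiffAt_transition (chartAt_mem_maximalAtlas y) hz (mem_chart_target _ y)
    (by rwa [(chartAt (Fin m → ℂ) y).left_inv (mem_chart_source _ y)])

theorem fderiv_eq_baseDeriv
    (hz : z ∈ IsManifold.maximalAtlas 𝓘(ℂ, Fin m → ℂ) ω M) (hy : y ∈ z.source) :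
    fderiv ℝ (fun q => z ((chartAt (Fin m → ℂ) y).symm q)) (chartAt (Fin m → ℂ) y y) =
      (baseDeriv z y).restrictScalars ℝ :=
  fderiv_real_eq ((contDiffAt_baseDeriv hz hy).differentiableAt (by simp))

theorem baseDeriv_comp
    (hz : z ∈ IsManifold.maximalAtlas 𝓘(ℂ, Fin m → ℂ) ω M) (hy : y ∈ z.source) : (fderiv ℂ (fun q => chartAt (Fin m → ℂ) y (z.symm q)) (z y)).comp
    (baseDeriv z y) = ContinuousLinearMap.id ℂ _ := by
  have hyc := mem_chart_source (Fin m → ℂ) y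
  have h := (chartAt (Fin m → ℂ) y).left_inv hyc
  have := fderiv_transition_comp (chartAt_mem_maximalAtlas y) hz (mem_chart_target _ y)
    (by rwa [h])
  rwa [h] at this

theorem comp_baseDeriv
    (hz : z ∈ IsManifold.maximalAtlas 𝓘(ℂ, Fin m → ℂ) ω M) (hy : y ∈ z.source) : (baseDeriv z y).comp
    (fderiv ℂ (fun q => chartAt (Fin m → ℂ) y (z.symm q)) (z y)) = ContinuousLinearMap.id ℂ _ := by
  have hyc := mem_chart_source (Fin m → ℂ) y
  have h := z.left_inv hy
  have := fderiv_transition_comp hz (chartAt_mem_maximalAtlas y) (z.map_source hy)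
    (by rwa [h])
  rwa [h] at this

/-- The derivative of a holomorphic coordinate map, as a linear isomorphism. -/
theorem exists_equiv_baseDeriv
    (hz : z ∈ IsManifold.maximalAtlas 𝓘(ℂ, Fin m → ℂ) ω M) (hy : y ∈ z.source) : ∃ T : (Fin m → ℂ) ≃ₗ[ℂ] (Fin m → ℂ), ∀ u, T u = baseDeriv z y u :=
  ⟨LinearEquiv.ofLinearMap (baseDeriv z y : (Fin m → ℂ) →ₗ[ℂ] (Fin m → ℂ))
    (fderiv ℂ (fun q => chartAt (Fin m → ℂ) y (z.symm q)) (z y) : (Fin m → ℂ) →ₗ[ℂ] (Fin m → ℂ))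
    (by
      have := comp_baseDeriv hz hy
      exact congrArg (fun f : (Fin m → ℂ) →L[ℂ] (Fin m → ℂ) =>
        (f : (Fin m → ℂ) →ₗ[ℂ] (Fin m → ℂ))) this)
    (by
      have := baseDeriv_comp hz hy
      exact congrArg (fun f : (Fin m → ℂ) →L[ℂ] (Fin m → ℂ) =>
        (f : (Fin m → ℂ) →ₗ[ℂ] (Fin m → ℂ))) this), fun _ => rfl⟩

theorem baseDeriv_eq_comp
    (hz : z ∈ IsManifold.maximalAtlas 𝓘(ℂ, Fin m → ℂ) ω M) (hy : y ∈ z.source)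
    (hz' : z' ∈ IsManifold.maximalAtlas 𝓘(ℂ, Fin m → ℂ) ω M) (hy' : y ∈ z'.source) :
    baseDeriv z' y = (fderiv ℂ (fun q => z' (z.symm q)) (z y)).comp (baseDeriv z y) := by
  have hyc := mem_chart_source (Fin m → ℂ) y
  have h := (chartAt (Fin m → ℂ) y).left_inv hyc
  have h1 : z ((chartAt (Fin m → ℂ) y).symm (chartAt (Fin m → ℂ) y y)) = z y := by rw [h]
  have hd := (contDiffAt_transition hz hz' (z.map_source hy)
    (by rwa [z.left_inv hy])).differentiableAt (by simp)
  rw [← h1] at hd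
  have h2 := fderiv_comp (g := fun q => z' (z.symm q))
    (f := fun q => z ((chartAt (Fin m → ℂ) y).symm q)) (chartAt (Fin m → ℂ) y y) hd
    ((contDiffAt_baseDeriv hz hy).differentiableAt (by simp))
  rw [← h1, baseDeriv, baseDeriv]
  refine Eq.trans ?_ h2
  apply Filter.EventuallyEq.fderiv_eq
  filter_upwards [eventually_mem_overlap (mem_chart_target (Fin m → ℂ) y)
    (e' := z) (by rwa [h])] with q hq
  simp [z.left_inv hq.2]

theorem form_eq_comp_baseDeriv
    (hz : z ∈ IsManifold.maximalAtlas 𝓘(ℂ, Fin m → ℂ) ω M) (hy : y ∈ z.source)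
    {k : ℕ} (η : DiffForm (Fin m → ℂ) M k) :
    η y = (inChart z η (z y)).compContinuousLinearMap ((baseDeriv z y).restrictScalars ℝ) := by
  rw [form_eq_inChart_comp η hz hy, fderiv_eq_baseDeriv hz hy]

end BaseDeriv

variable {X : Type*} [TopologicalSpace X] [ChartedSpace ((Fin m → ℂ) × (Fin n → ℂ)) X]
  [IsManifold 𝓘(ℂ, (Fin m → ℂ) × (Fin n → ℂ)) ω X]
  {L : X → Type*} [∀ x, AddCommGroup (L x)] [∀ x, Module ℂ (L x)]
  [∀ x, TopologicalSpace (L x)] [TopologicalSpace (Bundle.TotalSpace ℂ L)] [FiberBundle ℂ L]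
  [VectorBundle ℂ ℂ L] [ContMDiffVectorBundle ω ℂ L 𝓘(ℂ, (Fin m → ℂ) × (Fin n → ℂ))]
  {π : X → M} {φ : HermitianMetric ((Fin m → ℂ) × (Fin n → ℂ)) L}
  {e e' : OpenPartialHomeomorph X ((Fin m → ℂ) × (Fin n → ℂ))}
  {z z' : OpenPartialHomeomorph M (Fin m → ℂ)}

/-- Positivity on the fibres, in admissible coordinates. -/
theorem isVerticallyPositive_curvature (hπ : IsHolomorphicFibration m n π)
    (hφ : IsFibrewisePositive π φ) (h : IsAdmissible π e z)
    {p : (Fin m → ℂ) × (Fin n → ℂ)} (hp : p ∈ e.target) :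
    IsVerticallyPositive (inChart e φ.curvature p) := by
  intro v hv
  set x := e.symm p with hx
  set c := chartAt ((Fin m → ℂ) × (Fin n → ℂ)) x with hc
  have hxc : x ∈ c.source := mem_chart_source _ x
  have hcm := chartAt_mem_maximalAtlas (E := (Fin m → ℂ) × (Fin n → ℂ)) x
  set c' := chartAt (Fin m → ℂ) (π x) with hc'
  have hc'm := chartAt_mem_maximalAtlas (E := Fin m → ℂ) (π x)
  have hd := (contDiffAt_transition h.total_mem hcm hp hxc).differentiableAt (by simp)
  let D := fderiv ℂ (fun q => c (e.symm q)) p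
  have hD0 : D (0, v) ≠ 0 := fun h0 => by
    have := congrArg (fun f => f ((0 : Fin m → ℂ), v))
      (fderiv_transition_comp h.total_mem hcm hp hxc)
    have h1 : fderiv ℂ (fun q => e (c.symm q)) (c (e.symm p)) (D (0, v)) = (0, v) := this
    rw [h0, map_zero] at h1
    exact hv (congrArg Prod.snd h1).symm
  -- `D (0, v)` is tangent to the fibre, because `π` is the first projection in the coordinates `(e,
  -- z)`.
  have hker : mfderiv 𝓘(ℂ, (Fin m → ℂ) × (Fin n → ℂ)) 𝓘(ℂ, Fin m → ℂ) π x (D (0, v)) = 0 := by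
    rw [hπ.mfderiv_eq]
    have hcx : c.symm (c x) = x := c.left_inv hxc
    have hf := (hπ.contDiffAt hcm hc'm (c.map_source hxc)
      (by rw [hcx]; exact mem_chart_source _ _)).differentiableAt (by simp)
    have h2 : (fderiv ℂ (fun q => c' (π (c.symm q))) (c x)).comp D =
        fderiv ℂ (fun q => c' (z.symm q.1)) p := by
      rw [← fderiv_comp p hf hd]
      apply Filter.EventuallyEq.fderiv_eq
      filter_upwards [eventually_mem_overlap hp hxc] with q hq
      have h3 : π (e.symm q) = z.symm q.1 := by
        rw [← h.proj_symm hq.1, z.left_inv (h.mapsTo (e.map_target hq.1))]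
      simp only [Function.comp]
      rw [c.left_inv hq.2, h3]
    have h4 : fderiv ℂ (fun q : (Fin m → ℂ) × (Fin n → ℂ) => c' (z.symm q.1)) p (0, v) = 0 := by
      have hzx := h.mapsTo (e.map_target hp)
      have h5 : p.1 = z (π x) := (h.proj_symm hp).symm
      have h6 : DifferentiableAt ℂ (fun b => c' (z.symm b)) p.1 := by
        rw [h5]
        exact (contDiffAt_transition h.base_mem hc'm (z.map_source hzx)
          (by rw [z.left_inv hzx]; exact mem_chart_source _ _)).differentiableAt (by simp)
      have h7 := (h6.hasFDerivAt.comp p (hasFDerivAt_fst (𝕜 := ℂ) (p := p))).fderiv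
      have h8 : fderiv ℂ (fun q : (Fin m → ℂ) × (Fin n → ℂ) => c' (z.symm q.1)) p = _ := h7
      rw [h8]; simp
    rw [← h2] at h4
    exact h4
  have hmain := hφ x (D (0, v)) hD0 hker
  rw [← map_smul] at hmain
  rw [inChart, fderiv_real_eq hd, two_comp]
  exact hmain

/-- The geodesic curvature at `x`, as a two-form on the tangent space of `M` at `π x`, computed in
the admissible coordinates `(e, z)`. -/
def geodesicAt (π : X → M) (φ : HermitianMetric ((Fin m → ℂ) × (Fin n → ℂ)) L)
    (e : OpenPartialHomeomorph X ((Fin m → ℂ) × (Fin n → ℂ)))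
    (z : OpenPartialHomeomorph M (Fin m → ℂ)) (x : X) : (Fin m → ℂ) [⋀^Fin 2]→L[ℝ] ℝ :=
  (geodesicForm (inChart e φ.curvature (e x))).compContinuousLinearMap
    ((baseDeriv z (π x)).restrictScalars ℝ)

theorem isOneOne_comp {E F : Type*} [NormedAddCommGroup E] [NormedSpace ℝ E] [NormedSpace ℂ E]
    [IsScalarTower ℝ ℂ E] [NormedAddCommGroup F] [NormedSpace ℝ F] [NormedSpace ℂ F]
    [IsScalarTower ℝ ℂ F] {θ : F [⋀^Fin 2]→L[ℝ] ℝ} (h : IsOneOne θ) (A : E →L[ℂ] F) :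
    IsOneOne (θ.compContinuousLinearMap (A.restrictScalars ℝ)) := fun u v => by
  rw [two_comp, two_comp]
  change θ ![A (Complex.I • u), A (Complex.I • v)] = θ ![A u, A v]
  rw [map_smul, map_smul, h]

theorem isOneOne_geodesicAt (h : IsAdmissible π e z) {x : X} (hx : x ∈ e.source) :
    IsOneOne (geodesicAt π φ e z x) :=
  isOneOne_comp (isOneOne_geodesicForm (φ.isOneOne_curvature h.total_mem (e.map_source hx))) _

/-- The geodesic curvature does not depend on the admissible coordinates. -/
theorem geodesicAt_eq (hπ : IsHolomorphicFibration m n π)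
    (hφ : IsFibrewisePositive π φ) (h : IsAdmissible π e z) (h' : IsAdmissible π e' z') {x : X}
    (hx : x ∈ e.source) (hx' : x ∈ e'.source) : geodesicAt π φ e z x = geodesicAt π φ e' z' x := by
  have hp : e x ∈ overlap e e' := ⟨e.map_source hx, by
    rw [Set.mem_preimage, e.left_inv hx]; exact hx'⟩
  have hd := (contDiffAt_transition h.total_mem h'.total_mem hp.1 hp.2).differentiableAt (by simp)
  have h1 := inChart_eq φ.curvature h.total_mem h'.total_mem hp.1 hp.2
  rw [fderiv_real_eq hd, e.left_inv hx] at h1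
  have h2 := geodesicForm_comp (φ.isOneOne_curvature h.total_mem hp.1)
    (isVerticallyPositive_curvature hπ hφ h hp.1)
    (φ.isOneOne_curvature h'.total_mem (e'.map_source hx'))
    (isVerticallyPositive_curvature hπ hφ h' (e'.map_source hx')) h1
    (h.fderiv_transition_fst h' hp) (h.fderiv_transition_vertical h' hp)
    (LinearMap.equivOfDetNeZero _ (h.det_vertDeriv_ne_zero h' hp)).surjective
  rw [geodesicAt, geodesicAt, h2, h.fst_eq x hx,
    baseDeriv_eq_comp h.base_mem (h.mapsTo hx) h'.base_mem (h'.mapsTo hx')]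
  rfl

theorem hermCoeff_geodesicForm_curvature (hπ : IsHolomorphicFibration m n π)
    (hφ : IsFibrewisePositive π φ) (h : IsAdmissible π e z) {x : X} (hx : x ∈ e.source)
    (α β : Fin m) : hermCoeff (geodesicForm (inChart e φ.curvature (e x))) (Pi.single α 1)
      (Pi.single β 1) = geodesicCoeff φ e x α β :=
  hermCoeff_geodesicForm (φ.isOneOne_curvature h.total_mem (e.map_source hx))
    (isVerticallyPositive_curvature hπ hφ h (e.map_source hx)) α β

/-- The geodesic curvature, defined by a Schur complement in coordinates, is given by the geodesic
curvature form. -/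
theorem geodesicCurvature_eq (hπ : IsHolomorphicFibration m n π)
    (hφ : IsFibrewisePositive π φ) (h : IsAdmissible π e z) {x : X} (hx : x ∈ e.source)
    (u w : (Fin m → ℂ) × (Fin n → ℂ)) :
    geodesicCurvature φ e x u w =
      (geodesicForm (inChart e φ.curvature (e x)) ![u.1, w.1] : ℝ) :=
  sum_hermCoeff_eq
    (isOneOne_geodesicForm (φ.isOneOne_curvature h.total_mem (e.map_source hx))) _
    (hermCoeff_geodesicForm_curvature hπ hφ h hx) u.1 w.1

/-- The geodesic curvature is a multiple of a two-form of the base, in coordinates and without. -/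
theorem geodesicCurvature_eq_iff (hπ : IsHolomorphicFibration m n π)
    (hφ : IsFibrewisePositive π φ) (h : IsAdmissible π e z) {x : X} (hx : x ∈ e.source)
    (κ : ℝ) (σ : DiffForm (Fin m → ℂ) M 2) :
    (∀ u w : (Fin m → ℂ) × (Fin n → ℂ), geodesicCurvature φ e x u w =
      ((κ * inChart z σ (z (π x)) ![u.1, w.1] : ℝ) : ℂ)) ↔
      geodesicAt π φ e z x = κ • σ (π x) := by
  have hy := h.mapsTo hx
  have hσ := form_eq_comp_baseDeriv h.base_mem hy σ
  have hs : geodesicAt π φ e z x = κ • σ (π x) ↔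
      geodesicForm (inChart e φ.curvature (e x)) = κ • inChart z σ (z (π x)) := by
    obtain ⟨T, hT⟩ := exists_equiv_baseDeriv h.base_mem hy
    constructor
    · intro h1
      refine two_ext fun u w => ?_
      have h2 := congrArg (fun f => f ![T.symm u, T.symm w]) h1
      simp only [geodesicAt, hσ, ContinuousAlternatingMap.smul_apply, two_comp] at h2
      have h3 : ∀ u, (baseDeriv z (π x)).restrictScalars ℝ (T.symm u) = u := fun u =>
        (hT (T.symm u)).symm.trans (T.apply_symm_apply u)
      rw [h3, h3] at h2
      exact h2
    · intro h1
      rw [geodesicAt, h1, hσ]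
      rfl
  rw [hs]
  constructor
  · intro h1
    refine two_ext fun u w => ?_
    have h2 := h1 (u, 0) (w, 0)
    rw [geodesicCurvature_eq hπ hφ h hx] at h2
    exact_mod_cast h2
  · intro h1 u w
    rw [geodesicCurvature_eq hπ hφ h hx, h1]
    rfl

/-- The trace of the geodesic curvature in a unitary basis. -/
theorem sum_geodesicAt (hπ : IsHolomorphicFibration m n π) (hφ : IsFibrewisePositive π φ) {ωM : DiffForm (Fin m → ℂ) M 2}
    (hω : ∀ y, IsOneOne (ωM y)) (h : IsAdmissible π e z)
    {x : X} (hx : x ∈ e.source) (b : Module.Basis (Fin m) ℂ (Fin m → ℂ))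
    (hb : ∀ i j, ωM (π x) ![b i, b j] = 0 ∧
      ωM (π x) ![b i, Complex.I • b j] = if i = j then 1 else 0) :
    (geodesicCoeff φ e x * (kahlerCoeff ωM z (π x))⁻¹).trace =
      ((∑ a, geodesicAt π φ e z x ![b a, Complex.I • b a] : ℝ) : ℂ) := by
  have hy := h.mapsTo hx
  obtain ⟨T, hT⟩ := exists_equiv_baseDeriv h.base_mem hy
  have hσ := form_eq_comp_baseDeriv h.base_mem hy ωM
  have hcomp : ∀ (θ : (Fin m → ℂ) [⋀^Fin 2]→L[ℝ] ℝ) u v,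
      θ.compContinuousLinearMap ((baseDeriv z (π x)).restrictScalars ℝ) ![u, v] =
        θ ![T u, T v] := fun θ u v => by
    rw [two_comp, hT, hT]; rfl
  have hwO : IsOneOne (inChart z ωM (z (π x))) := fun u v => by
    have := hω (π x) (T.symm u) (T.symm v)
    rw [hσ, hcomp, hcomp, map_smul, map_smul] at this
    simpa using this
  have key := trace_eq_sum_unitary
    (isOneOne_geodesicForm (φ.isOneOne_curvature h.total_mem (e.map_source hx))) hwO (b.map T)
    (fun i j => by
      have := hb i j
      rw [hσ, hcomp, hcomp, map_smul] at this
      simpa using this) _ (kahlerCoeff ωM z (π x))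
    (hermCoeff_geodesicForm_curvature hπ hφ h hx) (fun α β => rfl)
  rw [key]
  congr 1
  refine Finset.sum_congr rfl fun a _ => ?_
  rw [geodesicAt, hcomp, map_smul, Module.Basis.map_apply]

end GeodesicAt

/-! ### Integration along the fibres of the powers of the Chern form -/

section Density

variable {m n : ℕ} {M : Type*} [TopologicalSpace M] [ChartedSpace (Fin m → ℂ) M]
  [IsManifold 𝓘(ℂ, Fin m → ℂ) ω M]
  {X : Type*} [TopologicalSpace X] [ChartedSpace ((Fin m → ℂ) × (Fin n → ℂ)) X]
  [IsManifold 𝓘(ℂ, (Fin m → ℂ) × (Fin n → ℂ)) ω X] {π : X → M}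
  (P : AdmissiblePartition (m := m) (n := n) π)

/-- The integrand, in the `j`-th chart, of the integral of a form along the fibre over `y`. -/
def AdmissiblePartition.fibreForm {k : ℕ}
    (η : DiffForm ((Fin m → ℂ) × (Fin n → ℂ)) X (k + 2 * n)) (y : M) (j : Fin P.N)
    (v : Fin n → ℂ) : (Fin m → ℂ) [⋀^Fin k]→L[ℝ] ℝ :=
  open Classical in
  if y ∈ (P.base j).source then
    (vertIns (stdFrame n) (localForm (P.chart j) (mulForm (P.ρ j) η)
      (P.base j y, v))).compContinuousLinearMap ((baseDeriv (P.base j) y).restrictScalars ℝ)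
  else 0

/-- The point of `X` with coordinates `(z y, v)` in the `j`-th chart, where `z` is the `j`-th chart
of the base. Outside the domains of the charts it is a junk value. -/
def AdmissiblePartition.point (y : M) (j : Fin P.N) (v : Fin n → ℂ) : X :=
  (P.chart j).symm (P.base j y, v)

theorem AdmissiblePartition.continuous_fibreForm [CompactSpace X] {k : ℕ}
    {η : DiffForm ((Fin m → ℂ) × (Fin n → ℂ)) X (k + 2 * n)} (hη : IsSmoothForm η) (y : M)
    (j : Fin P.N) : Continuous (P.fibreForm η y j) ∧ HasCompactSupport (P.fibreForm η y j) := by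
  by_cases hy : y ∈ (P.base j).source
  swap
  · have : P.fibreForm η y j = fun _ => 0 := funext fun v => if_neg hy
    rw [this]
    exact ⟨continuous_const, HasCompactSupport.zero⟩
  have hK : IsCompact (tsupport (P.ρ j)) := (isClosed_tsupport _).isCompact
  have hs := supportedIn_mulForm (P.ρ j) η
  have h1 := contDiff_localForm (P.chart_mem j) (isSmoothForm_mulForm (P.smooth j) hη) hs hK
    (P.tsupport_subset j)
  have h2 := hasCompactSupport_localForm hs hK (P.tsupport_subset j)
  let T := (pullL k ((baseDeriv (P.base j) y).restrictScalars ℝ)).comp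
    (vertInsL (B := Fin m → ℂ) k (stdFrame n))
  have h3 : P.fibreForm η y j = fun v =>
      T (localForm (P.chart j) (mulForm (P.ρ j) η) (P.base j y, v)) := funext fun v => if_pos hy
  rw [h3]
  refine ⟨T.continuous.comp (h1.continuous.comp (by fun_prop)), ?_⟩
  exact (hasCompactSupport_slice h2 (P.base j y)).comp_left (g := T) (map_zero _)

/-- The value at `y` of the integral along the fibres, as a sum of integrals of functions of the
fibre coordinates. -/
theorem AdmissiblePartition.fibreIntegral_apply [CompactSpace X] {N k : ℕ} (h : N = k + 2 * n)
    {η : DiffForm ((Fin m → ℂ) × (Fin n → ℂ)) X N} (hη : IsSmoothForm η) (y : M) :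
    P.fibreIntegral h η y = ∑ j, ∫ v, P.fibreForm (castDeg h η) y j v := by
  rw [fibreIntegral_eq_sum, Finset.sum_apply]
  refine Finset.sum_congr rfl fun j _ => ?_
  by_cases hy : y ∈ (P.base j).source
  swap
  · rw [pushChart, if_neg hy]
    have : P.fibreForm (castDeg h η) y j = fun _ => 0 := funext fun v => if_neg hy
    rw [this, integral_zero]
  have hK : IsCompact (tsupport (P.ρ j)) := (isClosed_tsupport _).isCompact
  have hs := supportedIn_mulForm (P.ρ j) (castDeg h η)
  have h1 := (contDiff_localForm (P.chart_mem j)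
    (isSmoothForm_mulForm (P.smooth j) (isSmoothForm_castDeg h hη)) hs hK
    (P.tsupport_subset j)).continuous
  have h2 := hasCompactSupport_localForm hs hK (P.tsupport_subset j)
  rw [pushChart, if_pos hy, fderiv_eq_baseDeriv (P.admissible j).base_mem hy]
  let T := vertInsL (B := Fin m → ℂ) k (stdFrame n)
  have h3 := integral_slice_comp_comm (V := (Fin m → ℂ) [⋀^Fin k]→L[ℝ] ℝ)
    (W := (Fin m → ℂ) [⋀^Fin k]→L[ℝ] ℝ) volume
    (pullL k ((baseDeriv (P.base j) y).restrictScalars ℝ))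
    (g := fun q : (Fin m → ℂ) × (Fin n → ℂ) =>
      T (localForm (P.chart j) (mulForm (P.ρ j) (castDeg h η)) q))
    (T.continuous.comp h1) (h2.comp_left (g := T) (map_zero _)) (P.base j y)
  refine Eq.trans h3.symm ?_
  congr 1
  funext v
  exact (if_pos hy).symm

variable {L : X → Type*} [∀ x, AddCommGroup (L x)] [∀ x, Module ℂ (L x)]
  [∀ x, TopologicalSpace (L x)] [TopologicalSpace (Bundle.TotalSpace ℂ L)] [FiberBundle ℂ L]
  [VectorBundle ℂ ℂ L] [ContMDiffVectorBundle ω ℂ L 𝓘(ℂ, (Fin m → ℂ) × (Fin n → ℂ))]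
  {φ : HermitianMetric ((Fin m → ℂ) × (Fin n → ℂ)) L}

variable (φ) in
/-- The density, in the `j`-th chart, of the volume form `(√-1 ∂∂̄ φ)^n` of the fibre over `y`,
multiplied by the function of the partition of unity. -/
def AdmissiblePartition.weight (y : M) (j : Fin P.N) (v : Fin n → ℂ) : ℝ :=
  open Classical in
  if y ∈ (P.base j).source ∧ (P.base j y, v) ∈ (P.chart j).target then
    P.ρ j (P.point y j v) *
      (toList (inChart (P.chart j) φ.curvature (P.base j y, v)) ^ n) (List.ofFn (fibreFrame m n))
  else 0

variable (φ) in
/-- The geodesic curvature at the point with coordinates `(y, v)` in the `j`-th chart. -/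
def AdmissiblePartition.geodesic (y : M) (j : Fin P.N) (v : Fin n → ℂ) :
    (Fin m → ℂ) [⋀^Fin 2]→L[ℝ] ℝ :=
  geodesicAt π φ (P.chart j) (P.base j) (P.point y j v)

/-- The constants in `S_i(L, φ) = fibreConst n i • ∫ c(φ)^i (√-1 ∂∂̄ φ)^n`. -/
def fibreConst (n i : ℕ) : ℝ := ((2 * Real.pi)⁻¹) ^ (n + i) * ((n + i).choose n : ℝ)

theorem fibreConst_pos (n i : ℕ) : 0 < fibreConst n i := by
  have : 0 < (n + i).choose n := Nat.choose_pos (Nat.le_add_right n i)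
  unfold fibreConst
  positivity

theorem AdmissiblePartition.mem_of_weight_ne_zero {y : M} {j : Fin P.N} {v : Fin n → ℂ}
    (h : P.weight φ y j v ≠ 0) :
    y ∈ (P.base j).source ∧ (P.base j y, v) ∈ (P.chart j).target ∧
      P.point y j v ∈ (P.chart j).source ∧ π (P.point y j v) = y := by
  by_cases hv : y ∈ (P.base j).source ∧ (P.base j y, v) ∈ (P.chart j).target
  · exact ⟨hv.1, hv.2, (P.chart j).map_target hv.2, (P.admissible j).proj_symm_eq hv.1 hv.2⟩
  · exact absurd (if_neg hv) h

theorem AdmissiblePartition.weight_nonneg (hπ : IsHolomorphicFibration m n π)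
    (hφ : IsFibrewisePositive π φ) (y : M) (j : Fin P.N) (v : Fin n → ℂ) :
    0 ≤ P.weight φ y j v := by
  unfold AdmissiblePartition.weight
  split_ifs with h
  · exact mul_nonneg (P.nonneg _ _) (fibreFrame_pow_pos
      (φ.isOneOne_curvature (P.chart_mem j) h.2)
      (isVerticallyPositive_curvature hπ hφ (P.admissible j) h.2)).le
  · exact le_rfl

/-- Every point of `X` lies in a chart in which its weight does not vanish. -/
theorem AdmissiblePartition.exists_weight_pos (hπ : IsHolomorphicFibration m n π)
    (hφ : IsFibrewisePositive π φ) (x : X) :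
    ∃ j v, P.weight φ (π x) j v ≠ 0 ∧ P.point (π x) j v = x := by
  obtain ⟨j, hj⟩ : ∃ j, P.ρ j x ≠ 0 := by
    by_contra! h
    have := P.sum_eq_one x
    simp [h] at this
  have hx : x ∈ (P.chart j).source :=
    P.tsupport_subset j (subset_tsupport _ (Function.mem_support.2 hj))
  have h1 : (P.base j (π x), (P.chart j x).2) = P.chart j x := by
    rw [← (P.admissible j).fst_eq x hx]
  have h2 : P.point (π x) j (P.chart j x).2 = x := by
    rw [AdmissiblePartition.point, h1, (P.chart j).left_inv hx]
  have h3 : (P.base j (π x), (P.chart j x).2) ∈ (P.chart j).target := by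
    rw [h1]; exact (P.chart j).map_source hx
  refine ⟨j, (P.chart j x).2, ?_, h2⟩
  rw [AdmissiblePartition.weight, if_pos ⟨(P.admissible j).mapsTo hx, h3⟩, h2]
  exact mul_ne_zero hj (fibreFrame_pow_pos (φ.isOneOne_curvature (P.chart_mem j) h3)
    (isVerticallyPositive_curvature hπ hφ (P.admissible j) h3)).ne'

theorem pow_smul_comp {E F : Type*} [NormedAddCommGroup E] [NormedSpace ℝ E] [NormedAddCommGroup F]
    [NormedSpace ℝ F] (c : ℝ) (η : F [⋀^Fin 2]→L[ℝ] ℝ) (f : E →L[ℝ] F) (N : ℕ) (ws : List E) :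
    (toList (c • η) ^ N) (ws.map f) =
      c ^ N * (toList (η.compContinuousLinearMap f) ^ N) ws := by
  rw [pow_comp, map_smul, smul_pow, ListForm.smul_apply]

/-- The integrand of `S_i(L, φ)`: the powers of the curvature split into the volume form of the
fibre and the powers of the geodesic curvature. -/
theorem AdmissiblePartition.toList_fibreForm (hπ : IsHolomorphicFibration m n π)
    (hφ : IsFibrewisePositive π φ) {N i : ℕ} (h : N = 2 * i + 2 * n)
    {η : DiffForm ((Fin m → ℂ) × (Fin n → ℂ)) X N}
    (hη : ∀ x, toList (η x) = toList (φ.chernForm x) ^ (n + i)) (y : M) (j : Fin P.N)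
    (v : Fin n → ℂ) :
    toList (P.fibreForm (castDeg h η) y j v) =
      (fibreConst n i * P.weight φ y j v) • toList (P.geodesic φ y j v) ^ i := by
  by_cases hy : y ∈ (P.base j).source
  swap
  · rw [AdmissiblePartition.fibreForm, if_neg hy, AdmissiblePartition.weight,
      if_neg fun h => hy h.1, map_zero, mul_zero, zero_smul]
  by_cases hv : (P.base j y, v) ∈ (P.chart j).target
  swap
  · rw [AdmissiblePartition.fibreForm, if_pos hy, AdmissiblePartition.weight,
      if_neg fun h => hv h.2, mul_zero, zero_smul, localForm_of_notMem _ hv]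
    ext ws
    rw [toList_comp, toList_vertIns, map_zero]
    rfl
  have hO := φ.isOneOne_curvature (P.chart_mem j) hv
  have hpos := isVerticallyPositive_curvature hπ hφ (P.admissible j) hv
  have hpt : π (P.point y j v) = y := (P.admissible j).proj_symm_eq hy hv
  have hpt' : P.chart j (P.point y j v) = (P.base j y, v) := (P.chart j).right_inv hv
  ext ws
  rw [AdmissiblePartition.fibreForm, if_pos hy, toList_comp, toList_vertIns,
    localForm_of_mem _ hv, inChart_mulForm, map_smul, ListForm.smul_apply, inChart, toList_comp,
    toList_castDeg, hη, HermitianMetric.chernForm, Pi.smul_apply, pow_smul_comp]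
  change _ * (_ * (toList (inChart (P.chart j) φ.curvature (P.base j y, v)) ^ (n + i))
    (List.ofFn (fibreFrame m n) ++ _)) = _
  rw [pow_fibreFrame_append hO hpos, ListForm.smul_apply, AdmissiblePartition.weight,
    if_pos ⟨hy, hv⟩, AdmissiblePartition.geodesic, geodesicAt, hpt, hpt', pow_comp, fibreConst,
    AdmissiblePartition.point]
  ring

end Density

/-! ### A reverse Jensen inequality for indefinite quadratic forms -/

section Jensen

variable {V : Type*} [TopologicalSpace V] [MeasurableSpace V] [BorelSpace V] [T2Space V]
  (μ : Measure V) [μ.IsOpenPosMeasure] [IsFiniteMeasureOnCompacts μ]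

/-- A sum of integrals of nonpositive continuous functions is nonpositive, and vanishes only if all
functions do. -/
theorem sum_integral_nonpos {ι : Type*} [Fintype ι] {F : ι → V → ℝ}
    (hF : ∀ j, Continuous (F j) ∧ HasCompactSupport (F j)) (hneg : ∀ j v, F j v ≤ 0) :
    ∑ j, ∫ v, F j v ∂μ ≤ 0 ∧ (∑ j, ∫ v, F j v ∂μ = 0 ↔ ∀ j v, F j v = 0) := by
  have h1 : ∀ j, ∫ v, F j v ∂μ ≤ 0 := fun j => integral_nonpos (hneg j)
  refine ⟨Finset.sum_nonpos fun j _ => h1 j, fun h0 j => ?_, fun h0 => ?_⟩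
  · have h2 := (Finset.sum_eq_zero_iff_of_nonpos fun j _ => h1 j).1 h0 j (Finset.mem_univ j)
    have h3 : ∫ v, -F j v ∂μ = 0 := by rw [integral_neg, h2, neg_zero]
    rw [integral_eq_zero_iff_of_nonneg (fun v => neg_nonneg.2 (hneg j v))
      ((hF j).1.integrable_of_hasCompactSupport (hF j).2).neg] at h3
    have h4 := (Continuous.ae_eq_iff_eq μ (hF j).1.neg continuous_zero).1 h3
    intro v
    exact neg_eq_zero.1 (congrFun h4 v)
  · exact Finset.sum_eq_zero fun j _ => by simp [h0]

variable {G : Type*} [NormedAddCommGroup G] [NormedSpace ℝ G] [FiniteDimensional ℝ G]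

/-- If a symmetric bilinear form `Λ` is nonpositive on the deviations of a weighted function `θ`
from its mean `c`, then the mean of `Λ(θ, θ)` is at most `Λ(c, c)`. -/
theorem sum_integral_le_of_mean {ι : Type*} [Fintype ι] (Λ : G →ₗ[ℝ] G →ₗ[ℝ] ℝ)
    (hΛ : ∀ a b, Λ a b = Λ b a) {W : ι → V → ℝ} {θ : ι → V → G}
    (hW : ∀ j, Continuous (W j) ∧ HasCompactSupport (W j)) (hW0 : ∀ j v, 0 ≤ W j v)
    (hθ : ∀ j, Continuous fun v => W j v • θ j v)
    (hθ2 : ∀ j, Continuous fun v => W j v * Λ (θ j v) (θ j v)) {c : G}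
    (hc : ∑ j, ∫ v, W j v • θ j v ∂μ = (∑ j, ∫ v, W j v ∂μ) • c)
    (hneg : ∀ j v, W j v ≠ 0 → Λ (θ j v - c) (θ j v - c) ≤ 0 ∧
      (Λ (θ j v - c) (θ j v - c) = 0 → θ j v - c = 0)) :
    ∑ j, ∫ v, W j v * Λ (θ j v) (θ j v) ∂μ ≤ (∑ j, ∫ v, W j v ∂μ) * Λ c c ∧
      (∑ j, ∫ v, W j v * Λ (θ j v) (θ j v) ∂μ = (∑ j, ∫ v, W j v ∂μ) * Λ c c ↔
        ∀ j v, W j v ≠ 0 → θ j v = c) := by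
  let l : G →L[ℝ] ℝ := LinearMap.toContinuousLinearMap (Λ c)
  -- `F` is the weighted value of `Λ` on the deviation from the mean. Its integral is the difference
  -- of the two sides: by the definition of the mean the mixed term integrates to `-2 Λ(c, c)`.
  let F : ι → V → ℝ := fun j v => W j v * Λ (θ j v - c) (θ j v - c)
  have hFe : ∀ j v, F j v = W j v * Λ (θ j v) (θ j v) - 2 * l (W j v • θ j v) +
      W j v * Λ c c := fun j v => by
    have : l (W j v • θ j v) = W j v * Λ c (θ j v) := (Λ c).map_smul _ _
    rw [this]
    simp only [F, map_sub, LinearMap.sub_apply, hΛ (θ j v) c]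
    ring
  have hsθ : ∀ j, HasCompactSupport fun v => W j v • θ j v := fun j => (hW j).2.smul_right
  have hsθ2 : ∀ j, HasCompactSupport fun v => W j v * Λ (θ j v) (θ j v) := fun j =>
    (hW j).2.mul_right
  have hF : ∀ j, Continuous (F j) ∧ HasCompactSupport (F j) := fun j => by
    refine ⟨?_, (hW j).2.mul_right⟩
    rw [show F j = _ from funext (hFe j)]
    exact ((hθ2 j).sub (continuous_const.mul (l.continuous.comp (hθ j)))).add
      ((hW j).1.mul continuous_const)
  have hFn : ∀ j v, F j v ≤ 0 := fun j v => by
    by_cases h : W j v = 0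
    · simp [F, h]
    · exact mul_nonpos_of_nonneg_of_nonpos (hW0 j v) (hneg j v h).1
  have hsum : ∑ j, ∫ v, F j v ∂μ =
      ∑ j, ∫ v, W j v * Λ (θ j v) (θ j v) ∂μ - (∑ j, ∫ v, W j v ∂μ) * Λ c c := by
    have h1 : ∀ j, ∫ v, F j v ∂μ = ∫ v, W j v * Λ (θ j v) (θ j v) ∂μ -
        2 * l (∫ v, W j v • θ j v ∂μ) + (∫ v, W j v ∂μ) * Λ c c := fun j => by
      have i1 := (hθ2 j).integrable_of_hasCompactSupport (μ := μ) (hsθ2 j)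
      have i2 := (hθ j).integrable_of_hasCompactSupport (μ := μ) (hsθ j)
      have i3 := (hW j).1.integrable_of_hasCompactSupport (μ := μ) (hW j).2
      have i2' : Integrable (fun v => 2 * l (W j v • θ j v)) μ :=
        (l.integrable_comp i2).const_mul 2
      have i12 : Integrable (fun v => W j v * Λ (θ j v) (θ j v) - 2 * l (W j v • θ j v)) μ :=
        i1.sub i2'
      rw [integral_congr_ae (Filter.Eventually.of_forall (hFe j)),
        integral_add i12 (i3.mul_const _), integral_sub i1 i2', integral_const_mul,
        integral_mul_const, l.integral_comp_comm i2]
    simp only [h1]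
    rw [Finset.sum_add_distrib, Finset.sum_sub_distrib, ← Finset.mul_sum, ← map_sum, hc,
      ← Finset.sum_mul, map_smul]
    change _ - 2 * (_ * Λ c c) + _ = _
    ring
  obtain ⟨h1, h2⟩ := sum_integral_nonpos μ hF hFn
  rw [hsum] at h1 h2
  refine ⟨sub_nonpos.1 h1, sub_eq_zero.symm.trans (h2.trans ?_)⟩
  refine forall_congr' fun j => forall_congr' fun v => ⟨fun h hw => ?_, fun h => ?_⟩
  · rcases mul_eq_zero.1 h with h | h
    · exact absurd h hw
    · exact sub_eq_zero.1 ((hneg j v hw).2 h)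
  · by_cases hw : W j v = 0
    · simp [F, hw]
    · simp [F, h hw]

end Jensen

/-! ### The Kobayashi–Lübke form at a point -/

section KobayashiLubke

variable {m : ℕ} {M : Type*} [TopologicalSpace M] [ChartedSpace (Fin m → ℂ) M]

theorem toList_zeroForm (f : M → ℝ) (y : M) :
    toList ((zeroForm f : DiffForm (Fin m → ℂ) M 0) y) = f y • (1 : ListForm (Fin m → ℂ)) :=
  toList_constOfIsEmpty (f y)

variable (s : ∀ i, DiffForm (Fin m → ℂ) M (2 * i)) (y : M)

theorem toList_inverseForm_zero :
    toList (inverseForm s 0 y) = (zeroFormValue (s 0) y)⁻¹ • (1 : ListForm (Fin m → ℂ)) := by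
  rw [inverseForm, toList_zeroForm]

theorem toList_inverseForm_one :
    toList (inverseForm s 1 y) = -((zeroFormValue (s 0) y)⁻¹ ^ 2) • toList (s 1 y) := by
  rw [inverseForm, map_smul, map_sum, Fin.sum_univ_one, toList_castDeg, wedgeForm, toList_wedge,
    Fin.val_zero, toList_inverseForm_zero, smul_mul_assoc, one_mul, smul_smul]
  congr 1
  ring

theorem toList_inverseForm_two :
    toList (inverseForm s 2 y) = -((zeroFormValue (s 0) y)⁻¹ ^ 2) • toList (s 2 y) +
      ((zeroFormValue (s 0) y)⁻¹ ^ 3) • (toList (s 1 y) * toList (s 1 y)) := by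
  rw [inverseForm, map_smul, map_sum, Fin.sum_univ_two, toList_castDeg, toList_castDeg, wedgeForm,
    wedgeForm, toList_wedge, toList_wedge, Fin.val_zero, Fin.val_one, toList_inverseForm_zero,
    toList_inverseForm_one, smul_mul_assoc, smul_mul_assoc, one_mul, smul_add, smul_smul, smul_smul]
  congr 2 <;> ring

/-- The Kobayashi–Lübke form in terms of the `S`-forms, with the recursion for `C₁` and `C₂` solved.
-/
theorem toList_kobayashiLubkeForm (n : ℕ) (hm : 2 ≤ m) (w : DiffForm (Fin m → ℂ) M 2) :
    toList (kobayashiLubkeForm n hm s w y) = toList (w y) ^ (m - 2) *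
      ((2 * ((n : ℝ) + 1) * (zeroFormValue (s 0) y)⁻¹ ^ 3) • toList (s 2 y) -
        (((n : ℝ) + 2) * (zeroFormValue (s 0) y)⁻¹ ^ 4) • (toList (s 1 y) * toList (s 1 y))) := by
  rw [kobayashiLubkeForm, toList_castDeg, wedgeForm, toList_wedge, toList_wedgePow,
    (ListForm.commute_of_inv (ListForm.inv_pow (inv_toList_two (w y)) _) _).eq]
  congr 1
  have h1 : toList (k := 4) (wedgeForm (inverseForm s 1) (inverseForm s 1) y) =
      toList (inverseForm s 1 y) * toList (inverseForm s 1 y) :=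
    toList_wedge (inverseForm s 1 y) (inverseForm s 1 y)
  have h2 : toList (k := 4) (wedgeForm (inverseForm s 0) (inverseForm s 2) y) =
      toList (inverseForm s 0 y) * toList (inverseForm s 2 y) :=
    toList_wedge (inverseForm s 0 y) (inverseForm s 2 y)
  rw [Pi.sub_apply, map_sub, Pi.smul_apply, Pi.smul_apply, map_smul, map_smul, h1, h2,
    toList_inverseForm_zero, toList_inverseForm_one, toList_inverseForm_two, smul_mul_smul_comm, smul_mul_assoc, one_mul]
  module

/-- A form of top degree that vanishes on the standard frame is zero. -/
theorem eq_zero_of_stdFrame {d : ℕ} {w : (Fin d → ℂ) [⋀^Fin 2]→L[ℝ] ℝ} (hw : IsOneOne w)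
    (hpos : ∀ u, u ≠ 0 → 0 < w ![u, Complex.I • u])
    {f : (Fin d → ℂ) [⋀^Fin (2 * d)]→L[ℝ] ℝ} (hf : f (stdFrame d) = 0) : f = 0 := by
  let e : Module.Basis (Fin (2 * d)) ℝ (Fin d → ℂ) :=
    Module.finBasisOfFinrankEq ℝ _ (finrank_real_pi d)
  have key : ∀ (f : (Fin d → ℂ) [⋀^Fin (2 * d)]→L[ℝ] ℝ) v, f v = f e * e.det v := fun f v => by
    have := congrArg (fun g : (Fin d → ℂ) [⋀^Fin (2 * d)]→ₗ[ℝ] ℝ => g v)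
      (AlternatingMap.eq_smul_basis_det e f.toAlternatingMap)
    simpa using this
  have h1 := pow_stdFrame_pos hw hpos
  rw [← toList_wedgePow (X := Unit) (fun _ => w) d (), toList_ofFn, key] at h1
  rw [key] at hf
  have h2 : f e = 0 := (mul_eq_zero.1 hf).resolve_right (right_ne_zero_of_mul h1.ne')
  ext v
  rw [key, h2, zero_mul]
  rfl

/-- The pairing `Λ(α, β) = (w^{m-2} ∧ α ∧ β)(e₁, i e₁, …)`. -/
def hodgeRiemannPairing (w : (Fin m → ℂ) [⋀^Fin 2]→L[ℝ] ℝ) :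
    ((Fin m → ℂ) [⋀^Fin 2]→L[ℝ] ℝ) →ₗ[ℝ] ((Fin m → ℂ) [⋀^Fin 2]→L[ℝ] ℝ) →ₗ[ℝ] ℝ :=
  LinearMap.mk₂ ℝ
    (fun α β => (toList w ^ (m - 2) * (toList α * toList β)) (List.ofFn (stdFrame m)))
    (fun α α' β => by rw [map_add, add_mul, mul_add, ListForm.add_apply])
    (fun c α β => by rw [map_smul, smul_mul_assoc, mul_smul_comm, ListForm.smul_apply, smul_eq_mul])
    (fun α β β' => by rw [map_add, mul_add, mul_add, ListForm.add_apply])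
    (fun c α β => by rw [map_smul, mul_smul_comm, mul_smul_comm, ListForm.smul_apply, smul_eq_mul])

theorem hodgeRiemannPairing_apply (w α β : (Fin m → ℂ) [⋀^Fin 2]→L[ℝ] ℝ) :
    hodgeRiemannPairing w α β =
      (toList w ^ (m - 2) * (toList α * toList β)) (List.ofFn (stdFrame m)) := rfl

theorem hodgeRiemannPairing_symm (w α β : (Fin m → ℂ) [⋀^Fin 2]→L[ℝ] ℝ) :
    hodgeRiemannPairing w α β = hodgeRiemannPairing w β α := by
  rw [hodgeRiemannPairing_apply, hodgeRiemannPairing_apply,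
    (ListForm.commute_of_inv (inv_toList_two α) (toList β)).eq]

/-- The functional `γ ↦ (w^{m-2} ∧ γ)(e₁, i e₁, …)` on `k`-forms. For `m ≥ 2`
it vanishes unless `k = 4`. -/
def primitiveFunctional (w : (Fin m → ℂ) [⋀^Fin 2]→L[ℝ] ℝ) (k : ℕ) :
    ((Fin m → ℂ) [⋀^Fin k]→L[ℝ] ℝ) →L[ℝ] ℝ :=
  LinearMap.toContinuousLinearMap
    { toFun := fun γ => (toList w ^ (m - 2) * toList γ) (List.ofFn (stdFrame m))
      map_add' := fun γ γ' => by rw [map_add, mul_add, ListForm.add_apply]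
      map_smul' := fun c γ => by
        rw [map_smul, mul_smul_comm, ListForm.smul_apply, RingHom.id_apply, smul_eq_mul] }

theorem primitiveFunctional_apply (w : (Fin m → ℂ) [⋀^Fin 2]→L[ℝ] ℝ) (k : ℕ)
    (γ : (Fin m → ℂ) [⋀^Fin k]→L[ℝ] ℝ) : primitiveFunctional w k γ =
      (toList w ^ (m - 2) * toList γ) (List.ofFn (stdFrame m)) := rfl

end KobayashiLubke

/-! ### The pointwise inequality -/

section Pointwise

/-- The relation between binomial coefficients that makes the Kobayashi–Lübke form a multiple of a
variance. -/
theorem two_mul_fibreConst (n : ℕ) :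
    2 * ((n : ℝ) + 1) * fibreConst n 2 * fibreConst n 0 =
      ((n : ℝ) + 2) * fibreConst n 1 ^ 2 := by
  have h1 : ((n + 1).choose n : ℝ) = n + 1 := by
    rw [Nat.choose_succ_self_right]; push_cast; ring
  have h2 : ((n + 2).choose n : ℝ) = ((n : ℝ) + 2) * (n + 1) / 2 := by
    rw [Nat.choose_symm_add, Nat.cast_choose_two]; push_cast; ring
  rw [fibreConst, fibreConst, fibreConst, h1, h2]
  simp only [add_zero, Nat.choose_self, Nat.cast_one]
  ring

/-- The constant in the case of equality. -/
theorem fibreConst_one (n : ℕ) :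
    2 * Real.pi * fibreConst n 1 = ((n : ℝ) + 1) * fibreConst n 0 := by
  have h1 : ((n + 1).choose n : ℝ) = n + 1 := by
    rw [Nat.choose_succ_self_right]; push_cast; ring
  have hpi := Real.pi_ne_zero
  rw [fibreConst, fibreConst, h1]
  simp only [add_zero, Nat.choose_self, Nat.cast_one]
  rw [pow_succ]
  field_simp

variable {m n : ℕ} {M : Type*} [TopologicalSpace M] [ChartedSpace (Fin m → ℂ) M]
  [IsManifold 𝓘(ℂ, Fin m → ℂ) ω M]
  {X : Type*} [TopologicalSpace X] [ChartedSpace ((Fin m → ℂ) × (Fin n → ℂ)) X]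
  [IsManifold 𝓘(ℂ, (Fin m → ℂ) × (Fin n → ℂ)) ω X] {π : X → M}
  {L : X → Type*} [∀ x, AddCommGroup (L x)] [∀ x, Module ℂ (L x)]
  [∀ x, TopologicalSpace (L x)] [TopologicalSpace (Bundle.TotalSpace ℂ L)] [FiberBundle ℂ L]
  [VectorBundle ℂ ℂ L] [ContMDiffVectorBundle ω ℂ L 𝓘(ℂ, (Fin m → ℂ) × (Fin n → ℂ))]
  {φ : HermitianMetric ((Fin m → ℂ) × (Fin n → ℂ)) L}

/-- The `S`-forms in terms of the partition of unity that is used in their definition. -/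
theorem sForm_eq (hπ : Nonempty (AdmissiblePartition (m := m) (n := n) π)) (i : ℕ) :
    sForm π φ i = hπ.some.fibreIntegral (by ring : 2 * (n + i) = 2 * i + 2 * n)
      (wedgePow φ.chernForm (n + i)) := by
  rw [sForm, fibreIntegral, dif_pos hπ]

theorem isSmoothForm_wedgePow_chernForm (φ : HermitianMetric ((Fin m → ℂ) × (Fin n → ℂ)) L)
    (k : ℕ) : IsSmoothForm (wedgePow φ.chernForm k) :=
  (cohomologous_wedgePow (φ.cohomologous_chernForm φ) k).1.1

variable (P : AdmissiblePartition (m := m) (n := n) π)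

variable (φ) in
/-- The integrand of `S_i(L, φ)` in the `j`-th chart. -/
def AdmissiblePartition.integrand (y : M) (i : ℕ) (j : Fin P.N) (v : Fin n → ℂ) :
    (Fin m → ℂ) [⋀^Fin (2 * i)]→L[ℝ] ℝ :=
  P.fibreForm (castDeg (by ring : 2 * (n + i) = 2 * i + 2 * n) (wedgePow φ.chernForm (n + i))) y j v

theorem AdmissiblePartition.toList_integrand (hπ : IsHolomorphicFibration m n π)
    (hφ : IsFibrewisePositive π φ) (y : M) (i : ℕ) (j : Fin P.N) (v : Fin n → ℂ) :
    toList (P.integrand φ y i j v) =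
      (fibreConst n i * P.weight φ y j v) • toList (P.geodesic φ y j v) ^ i :=
  P.toList_fibreForm hπ hφ _ (fun x => toList_wedgePow _ _ x) y j v

variable [CompactSpace X]

theorem AdmissiblePartition.continuous_integrand (y : M) (i : ℕ) (j : Fin P.N) :
    Continuous (P.integrand φ y i j) ∧ HasCompactSupport (P.integrand φ y i j) :=
  P.continuous_fibreForm (isSmoothForm_castDeg _ (isSmoothForm_wedgePow_chernForm φ _)) y j

/-- Linear functionals of a fibre integral. -/
theorem AdmissiblePartition.apply_fibreIntegral_eq (i : ℕ) (y : M)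
    (l : ((Fin m → ℂ) [⋀^Fin (2 * i)]→L[ℝ] ℝ) →L[ℝ] ℝ) :
    l (P.fibreIntegral (by ring : 2 * (n + i) = 2 * i + 2 * n) (wedgePow φ.chernForm (n + i)) y) =
      ∑ j, ∫ v, l (P.integrand φ y i j v) := by
  rw [P.fibreIntegral_apply _ (isSmoothForm_wedgePow_chernForm φ _), map_sum]
  refine Finset.sum_congr rfl fun j _ => ?_
  have h1 := P.continuous_integrand (φ := φ) y i j
  exact (l.integral_comp_comm (h1.1.integrable_of_hasCompactSupport h1.2)).symm

theorem AdmissiblePartition.integrand_zero_apply (hπ : IsHolomorphicFibration m n π)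
    (hφ : IsFibrewisePositive π φ) (y : M) (j : Fin P.N) (v : Fin n → ℂ) :
    P.integrand φ y 0 j v ![] = fibreConst n 0 * P.weight φ y j v := by
  have h3 := congrArg (fun a : ListForm (Fin m → ℂ) => a [])
    (P.toList_integrand hπ hφ y 0 j v)
  have h4 : toList (P.integrand φ y 0 j v) [] = P.integrand φ y 0 j v ![] := toList_nil _
  have h5 : (1 : ListForm (Fin m → ℂ)) [] = 1 := by simp
  simpa only [h4, pow_zero, ListForm.smul_apply, h5, mul_one] using h3

theorem AdmissiblePartition.continuous_weight (hπ : IsHolomorphicFibration m n π)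
    (hφ : IsFibrewisePositive π φ) (y : M) (j : Fin P.N) :
    Continuous (P.weight φ y j) ∧ HasCompactSupport (P.weight φ y j) := by
  have h1 := P.continuous_integrand (φ := φ) y 0 j
  let l : ((Fin m → ℂ) [⋀^Fin (2 * 0)]→L[ℝ] ℝ) →L[ℝ] ℝ :=
    (fibreConst n 0)⁻¹ • evalForm (k := 2 * 0) (![] : Fin 0 → Fin m → ℂ)
  have h2 : P.weight φ y j = fun v => l (P.integrand φ y 0 j v) := by
    funext v
    change _ = (fibreConst n 0)⁻¹ * P.integrand φ y 0 j v ![]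
    rw [P.integrand_zero_apply hπ hφ, inv_mul_cancel_left₀ (fibreConst_pos n 0).ne']
  rw [h2]
  exact ⟨l.continuous.comp h1.1, h1.2.comp_left (g := l) (map_zero l)⟩

theorem AdmissiblePartition.integrand_one (hπ : IsHolomorphicFibration m n π)
    (hφ : IsFibrewisePositive π φ) (y : M) (j : Fin P.N) (v : Fin n → ℂ) :
    P.integrand φ y 1 j v = fibreConst n 1 • P.weight φ y j v • P.geodesic φ y j v := by
  refine toList_injective (k := 2) ?_
  have := P.toList_integrand hπ hφ y 1 j v
  rw [pow_one] at this
  rw [map_smul, map_smul, smul_smul]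
  exact this

variable (φ) in
/-- The total weight of the fibre over `y`. -/
def AdmissiblePartition.mass (y : M) : ℝ := ∑ j, ∫ v, P.weight φ y j v

variable (φ) in
/-- The mean of the geodesic curvature over the fibre over `y`. -/
def AdmissiblePartition.mean (y : M) : (Fin m → ℂ) [⋀^Fin 2]→L[ℝ] ℝ :=
  (P.mass φ y)⁻¹ • ∑ j, ∫ v, P.weight φ y j v • P.geodesic φ y j v

/-- The total weight is positive, because the fibre is not empty. -/
theorem AdmissiblePartition.mass_pos (hπ : IsHolomorphicFibration m n π)
    (hφ : IsFibrewisePositive π φ) (y : M) : 0 < P.mass φ y := by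
  have h1 := sum_integral_nonpos (volume : Measure (Fin n → ℂ)) (F := fun j v => -P.weight φ y j v)
    (fun j => ⟨(P.continuous_weight hπ hφ y j).1.neg, (P.continuous_weight hπ hφ y j).2.neg⟩)
    (fun j v => neg_nonpos.2 (P.weight_nonneg hπ hφ y j v))
  simp only [integral_neg, Finset.sum_neg_distrib] at h1
  have h2 : 0 ≤ P.mass φ y := neg_nonpos.1 h1.1
  refine h2.lt_of_ne fun h0 => ?_
  have h3 := h1.2.1 (neg_eq_zero.2 h0.symm)
  obtain ⟨x, rfl⟩ := hπ.surjective y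
  obtain ⟨j, v, h4, -⟩ := P.exists_weight_pos hπ hφ x
  exact h4 (neg_eq_zero.1 (h3 j v))

/-- `S₀` is a multiple of the total weight. -/
theorem AdmissiblePartition.zeroFormValue_fibreIntegral (hπ : IsHolomorphicFibration m n π)
    (hφ : IsFibrewisePositive π φ) (y : M) :
    zeroFormValue (P.fibreIntegral (by ring : 2 * (n + 0) = 2 * 0 + 2 * n)
      (wedgePow φ.chernForm (n + 0))) y = fibreConst n 0 * P.mass φ y := by
  have h1 := P.apply_fibreIntegral_eq (φ := φ) 0 y (evalForm (k := 2 * 0) (![] : Fin 0 → Fin m → ℂ))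
  refine Eq.trans h1 ?_
  rw [AdmissiblePartition.mass, Finset.mul_sum]
  refine Finset.sum_congr rfl fun j _ => ?_
  rw [← integral_const_mul]
  congr 1
  funext v
  exact P.integrand_zero_apply hπ hφ y j v

theorem AdmissiblePartition.continuous_weight_smul (hπ : IsHolomorphicFibration m n π)
    (hφ : IsFibrewisePositive π φ) (y : M) (j : Fin P.N) :
    Continuous fun v => P.weight φ y j v • P.geodesic φ y j v := by
  have h1 : Continuous fun v => (fibreConst n 1)⁻¹ • P.integrand φ y 1 j v :=
    (continuous_const_smul ((fibreConst n 1)⁻¹)).comp (P.continuous_integrand (φ := φ) y 1 j).1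
  have h2 : (fun v => (fibreConst n 1)⁻¹ • P.integrand φ y 1 j v) =
      fun v => P.weight φ y j v • P.geodesic φ y j v := funext fun v => by
    rw [P.integrand_one hπ hφ, smul_smul, inv_mul_cancel₀ (fibreConst_pos n 1).ne', one_smul]
  exact h2 ▸ h1

theorem AdmissiblePartition.mass_smul_mean (hπ : IsHolomorphicFibration m n π)
    (hφ : IsFibrewisePositive π φ) (y : M) :
    ∑ j, ∫ v, P.weight φ y j v • P.geodesic φ y j v = P.mass φ y • P.mean φ y := by
  rw [AdmissiblePartition.mean, smul_smul, mul_inv_cancel₀ (P.mass_pos hπ hφ y).ne', one_smul]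

/-- `S₁` is a multiple of the mean of the geodesic curvature. -/
theorem AdmissiblePartition.fibreIntegral_one (hπ : IsHolomorphicFibration m n π)
    (hφ : IsFibrewisePositive π φ) (y : M) :
    P.fibreIntegral (by ring : 2 * (n + 1) = 2 * 1 + 2 * n) (wedgePow φ.chernForm (n + 1)) y =
      (fibreConst n 1 * P.mass φ y) • P.mean φ y := by
  rw [P.fibreIntegral_apply _ (isSmoothForm_wedgePow_chernForm φ _), mul_smul,
    ← P.mass_smul_mean hπ hφ, Finset.smul_sum]
  refine Finset.sum_congr rfl fun j _ => ?_
  rw [← integral_smul]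
  congr 1
  funext v
  exact P.integrand_one hπ hφ y j v

/-- A linear functional that is constant on the values of the geodesic curvature takes the same
value on the mean. -/
theorem AdmissiblePartition.apply_mean (hπ : IsHolomorphicFibration m n π)
    (hφ : IsFibrewisePositive π φ) (y : M) (l : ((Fin m → ℂ) [⋀^Fin 2]→L[ℝ] ℝ) →L[ℝ] ℝ) (κ : ℝ)
    (hl : ∀ j v, P.weight φ y j v ≠ 0 → l (P.geodesic φ y j v) = κ) : l (P.mean φ y) = κ := by
  have hm := P.mass_pos hπ hφ y
  have h1 : l (∑ j, ∫ v, P.weight φ y j v • P.geodesic φ y j v) = P.mass φ y * κ := by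
    rw [map_sum, AdmissiblePartition.mass, Finset.sum_mul]
    refine Finset.sum_congr rfl fun j _ => ?_
    rw [← l.integral_comp_comm ((P.continuous_weight_smul hπ hφ y j).integrable_of_hasCompactSupport
      (P.continuous_weight hπ hφ y j).2.smul_right), ← integral_mul_const]
    congr 1
    funext v
    rw [map_smul, smul_eq_mul]
    by_cases h : P.weight φ y j v = 0
    · rw [h, zero_mul, zero_mul]
    · rw [hl j v h]
  rw [P.mass_smul_mean hπ hφ, map_smul, smul_eq_mul] at h1
  exact mul_left_cancel₀ hm.ne' h1

theorem AdmissiblePartition.isOneOne_geodesic {y : M} {j : Fin P.N} {v : Fin n → ℂ}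
    (h : P.weight φ y j v ≠ 0) : IsOneOne (P.geodesic φ y j v) :=
  isOneOne_geodesicAt (P.admissible j) (P.mem_of_weight_ne_zero h).2.2.1

theorem AdmissiblePartition.isOneOne_mean (hπ : IsHolomorphicFibration m n π)
    (hφ : IsFibrewisePositive π φ) (y : M) : IsOneOne (P.mean φ y) := fun u v => by
  have h1 := P.apply_mean hπ hφ y
    (evalForm ![Complex.I • u, Complex.I • v] - evalForm ![u, v]) 0
    (fun j x hx => sub_eq_zero.2 (P.isOneOne_geodesic hx u v))
  exact sub_eq_zero.1 h1

/-- The Kobayashi–Lübke form is, up to a positive factor, the difference of the two sides of the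
reverse Jensen inequality. -/
theorem AdmissiblePartition.kobayashiLubkeForm_eq (hπ : IsHolomorphicFibration m n π)
    (hφ : IsFibrewisePositive π φ) (hm : 2 ≤ m) (y : M) (ωM : DiffForm (Fin m → ℂ) M 2)
    {s : ∀ i, DiffForm (Fin m → ℂ) M (2 * i)}
    (hs : ∀ i, s i = P.fibreIntegral (by ring : 2 * (n + i) = 2 * i + 2 * n)
      (wedgePow φ.chernForm (n + i))) :
    ∃ K : ℝ, 0 < K ∧ kobayashiLubkeForm n hm s ωM y (stdFrame m) =
      K * ((∑ j, ∫ v, P.weight φ y j v * hodgeRiemannPairing (ωM y) (P.geodesic φ y j v)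
        (P.geodesic φ y j v)) - P.mass φ y * hodgeRiemannPairing (ωM y) (P.mean φ y) (P.mean φ y)) := by
  have ha0 := fibreConst_pos n 0
  have ha1 := fibreConst_pos n 1
  have ha2 := fibreConst_pos n 2
  have hT := P.mass_pos hπ hφ y
  have h0 : zeroFormValue (s 0) y = fibreConst n 0 * P.mass φ y := by
    rw [hs]; exact P.zeroFormValue_fibreIntegral hπ hφ y
  have h1 : toList (s 1 y) = (fibreConst n 1 * P.mass φ y) • toList (P.mean φ y) := by
    rw [← map_smul, ← P.fibreIntegral_one hπ hφ, hs]
  have h2 : (toList (ωM y) ^ (m - 2) * toList (s 2 y)) (List.ofFn (stdFrame m)) =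
      fibreConst n 2 * ∑ j, ∫ v, P.weight φ y j v *
        hodgeRiemannPairing (ωM y) (P.geodesic φ y j v) (P.geodesic φ y j v) := by
    rw [hs, ← primitiveFunctional_apply, P.apply_fibreIntegral_eq, Finset.mul_sum]
    refine Finset.sum_congr rfl fun j _ => ?_
    rw [← integral_const_mul]
    congr 1
    funext v
    rw [primitiveFunctional_apply, P.toList_integrand hπ hφ, mul_smul_comm, ListForm.smul_apply,
      pow_two, hodgeRiemannPairing_apply, mul_assoc]
  refine ⟨2 * ((n : ℝ) + 1) * fibreConst n 2 * ((fibreConst n 0 * P.mass φ y)⁻¹ ^ 3),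
    by positivity, ?_⟩
  rw [← toList_ofFn, toList_kobayashiLubkeForm, mul_sub, ListForm.sub_apply, mul_smul_comm,
    mul_smul_comm, ListForm.smul_apply, ListForm.smul_apply, h2, h0, h1, smul_mul_smul_comm,
    mul_smul_comm, ListForm.smul_apply, ← hodgeRiemannPairing_apply]
  have hc := two_mul_fibreConst n
  have e : ((n : ℝ) + 2) * (fibreConst n 0 * P.mass φ y)⁻¹ ^ 4 *
      (fibreConst n 1 * P.mass φ y * (fibreConst n 1 * P.mass φ y)) =
      2 * ((n : ℝ) + 1) * fibreConst n 2 * ((fibreConst n 0 * P.mass φ y)⁻¹ ^ 3) *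
        P.mass φ y := by
    have hne := hT.ne'
    have hne0 := ha0.ne'
    field_simp
    linear_combination -hc
  linear_combination -(hodgeRiemannPairing (ωM y) (P.mean φ y) (P.mean φ y)) * e

theorem AdmissiblePartition.continuous_weight_mul (hπ : IsHolomorphicFibration m n π)
    (hφ : IsFibrewisePositive π φ) (y : M) (w : (Fin m → ℂ) [⋀^Fin 2]→L[ℝ] ℝ) (j : Fin P.N) :
    Continuous fun v => P.weight φ y j v *
      hodgeRiemannPairing w (P.geodesic φ y j v) (P.geodesic φ y j v) := by
  let l : ((Fin m → ℂ) [⋀^Fin (2 * 2)]→L[ℝ] ℝ) →L[ℝ] ℝ :=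
    (fibreConst n 2)⁻¹ • primitiveFunctional w (2 * 2)
  have h1 : Continuous fun v => l (P.integrand φ y 2 j v) :=
    l.continuous.comp (P.continuous_integrand (φ := φ) y 2 j).1
  have h2 : (fun v => l (P.integrand φ y 2 j v)) = fun v => P.weight φ y j v *
      hodgeRiemannPairing w (P.geodesic φ y j v) (P.geodesic φ y j v) := funext fun v => by
    change (fibreConst n 2)⁻¹ * primitiveFunctional w (2 * 2) (P.integrand φ y 2 j v) = _
    rw [primitiveFunctional_apply, P.toList_integrand hπ hφ, mul_smul_comm, ListForm.smul_apply,
      pow_two, hodgeRiemannPairing_apply, mul_assoc,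
      inv_mul_cancel_left₀ (fibreConst_pos n 2).ne']
  exact h2 ▸ h1

/-- The pointwise inequality: the reverse Jensen inequality holds by the Hodge–Riemann bilinear
relations, because the deviations of the geodesic curvature from its mean are primitive. -/
theorem AdmissiblePartition.kobayashiLubkeForm_nonpos (hπ : IsHolomorphicFibration m n π)
    (hm : 2 ≤ m) {ωM : DiffForm (Fin m → ℂ) M 2} (hω : IsKahlerForm ωM)
    (hφ : IsGeodesicEinstein π ωM φ) (y : M)
    {s : ∀ i, DiffForm (Fin m → ℂ) M (2 * i)}
    (hs : ∀ i, s i = P.fibreIntegral (by ring : 2 * (n + i) = 2 * i + 2 * n)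
      (wedgePow φ.chernForm (n + i))) :
    kobayashiLubkeForm n hm s ωM y (stdFrame m) ≤ 0 ∧
      (kobayashiLubkeForm n hm s ωM y = 0 ↔
        ∀ j v, P.weight φ y j v ≠ 0 → P.geodesic φ y j v = P.mean φ y) := by
  obtain ⟨hφ, κ, hκ⟩ := hφ
  have hO : ∀ y, IsOneOne (ωM y) := fun y => hω.type_one_one y
  obtain ⟨b, hb⟩ := exists_unitary_basis (hO y) (hω.pos y) (Module.finrank_fin_fun ℂ)
  -- The trace with respect to `ω` at `y`, in a unitary basis. It is constant on the fibre, hence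
  -- takes the same value on the mean.
  let tr : ((Fin m → ℂ) [⋀^Fin 2]→L[ℝ] ℝ) →L[ℝ] ℝ := ∑ a, evalForm ![b a, Complex.I • b a]
  have htr : ∀ θ, tr θ = ∑ a, θ ![b a, Complex.I • b a] := fun θ => by
    simp only [tr, sum_apply]
    rfl
  have htrg : ∀ j v, P.weight φ y j v ≠ 0 → tr (P.geodesic φ y j v) = κ := fun j v h => by
    obtain ⟨-, -, hx, hy⟩ := P.mem_of_weight_ne_zero h
    have h1 := hκ _ _ (P.admissible j) _ hx
    rw [sum_geodesicAt hπ hφ hO (P.admissible j) hx b (by rw [hy]; exact hb)] at h1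
    rw [htr]
    exact_mod_cast h1
  have htrm := P.apply_mean hπ hφ y tr κ htrg
  have key := sum_integral_le_of_mean (volume : Measure (Fin n → ℂ)) (hodgeRiemannPairing (ωM y))
    (hodgeRiemannPairing_symm (ωM y)) (P.continuous_weight hπ hφ y)
    (P.weight_nonneg hπ hφ y) (P.continuous_weight_smul hπ hφ y)
    (P.continuous_weight_mul hπ hφ y (ωM y)) (P.mass_smul_mean hπ hφ y)
    (fun j v h => by
      -- The deviations from the mean are of type `(1,1)` and trace free.
      refine hodgeRiemann hm (hO y) b hb (θ := P.geodesic φ y j v - P.mean φ y) ?_ ?_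
      · intro u w
        have h1 := P.isOneOne_geodesic h u w
        have h2 := P.isOneOne_mean hπ hφ y u w
        rw [ContinuousAlternatingMap.sub_apply, ContinuousAlternatingMap.sub_apply, h1, h2]
      · rw [← htr, map_sub, htrg j v h, htrm, sub_self])
  obtain ⟨K, hK, hKL⟩ := P.kobayashiLubkeForm_eq hπ hφ hm y ωM hs
  refine ⟨?_, ?_⟩
  · rw [hKL]
    exact mul_nonpos_of_nonneg_of_nonpos hK.le (sub_nonpos.2 key.1)
  · rw [← key.2, ← sub_eq_zero (b := _ * _)]
    constructor
    · intro h
      rw [h] at hKL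
      exact (mul_eq_zero.1 hKL.symm).resolve_left hK.ne'
    · intro h
      refine eq_zero_of_stdFrame (hO y) (hω.pos y) ?_
      rw [hKL]
      exact mul_eq_zero_of_right _ h

/-- The case of equality in terms of the geodesic curvature in admissible coordinates. -/
theorem AdmissiblePartition.geodesic_eq_mean_iff (hπ : IsHolomorphicFibration m n π)
    (hφ : IsFibrewisePositive π φ) (y : M)
    {s : ∀ i, DiffForm (Fin m → ℂ) M (2 * i)}
    (hs : ∀ i, s i = P.fibreIntegral (by ring : 2 * (n + i) = 2 * i + 2 * n)
      (wedgePow φ.chernForm (n + i))) :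
    (∀ j v, P.weight φ y j v ≠ 0 → P.geodesic φ y j v = P.mean φ y) ↔
      ∀ e z, IsAdmissible π e z → ∀ x ∈ e.source, π x = y →
        ∀ u w : (Fin m → ℂ) × (Fin n → ℂ), geodesicCurvature φ e x u w =
          ((2 * Real.pi / ((n + 1) * zeroFormValue (s 0) y) *
            inChart z (s 1) (z y) ![u.1, w.1] : ℝ) : ℂ) := by
  have hT := (P.mass_pos hπ hφ y).ne'
  have h0 : zeroFormValue (s 0) y = fibreConst n 0 * P.mass φ y := by
    rw [hs]; exact P.zeroFormValue_fibreIntegral hπ hφ y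
  -- The right-hand side of the equality condition is the mean of the geodesic curvature.
  have h1 : P.mean φ y = (2 * Real.pi / ((n + 1) * zeroFormValue (s 0) y)) • s 1 y := by
    rw [hs 1, P.fibreIntegral_one hπ hφ, h0, smul_smul]
    have e : 2 * Real.pi / ((n + 1) * (fibreConst n 0 * P.mass φ y)) *
        (fibreConst n 1 * P.mass φ y) = 1 := by
      have h2 := fibreConst_one n
      have h3 := (fibreConst_pos n 0).ne'
      have h4 : (n : ℝ) + 1 ≠ 0 := by positivity
      field_simp
      linear_combination h2
    rw [e, one_smul]
  constructor
  · intro h e z hez x hx hxy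
    subst hxy
    rw [geodesicCurvature_eq_iff hπ hφ hez hx _ (s 1), ← h1]
    obtain ⟨j, v, hw, hp⟩ := P.exists_weight_pos hπ hφ x
    have hm := P.mem_of_weight_ne_zero hw
    have h5 := h j v hw
    rw [AdmissiblePartition.geodesic, hp] at h5
    rw [hp] at hm
    rw [← h5]
    exact geodesicAt_eq hπ hφ hez (P.admissible j) hx hm.2.2.1
  · intro h j v hw
    obtain ⟨-, -, hx, hy⟩ := P.mem_of_weight_ne_zero hw
    have h5 := h _ _ (P.admissible j) _ hx hy
    rw [h1]
    have h6 := geodesicCurvature_eq_iff hπ hφ (P.admissible j) hx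
      (2 * Real.pi / ((n + 1) * zeroFormValue (s 0) y)) (s 1)
    rw [hy] at h6
    exact h6.1 h5

end Pointwise

/-! ### The inequality of cohomology classes -/

section Class

variable {d : ℕ} {M : Type*} [TopologicalSpace M] [ChartedSpace (Fin d → ℂ) M]
  [IsManifold 𝓘(ℂ, Fin d → ℂ) ω M]

/-- A top-degree form that is nonpositive on the standard frame at every point has nonpositive
integral, since holomorphic changes of coordinates preserve the orientation. -/
theorem integral_nonpos_of_stdFrame {Θ : DiffForm (Fin d → ℂ) M (2 * d)}
    (h : ∀ y, Θ y (stdFrame d) ≤ 0) : integral Θ ≤ 0 := by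
  unfold integral
  split_ifs with hP
  swap
  · exact le_rfl
  refine Finset.sum_nonpos fun i _ => ?_
  refine setIntegral_nonpos (hP.some.chart i).open_target.measurableSet fun p hp => ?_
  refine mul_nonpos_of_nonneg_of_nonpos (hP.some.nonneg i _) ?_
  set e := hP.some.chart i
  have he : e ∈ IsManifold.maximalAtlas 𝓘(ℂ, Fin d → ℂ) ω M := hP.some.chart_mem i
  have hc := chartAt_mem_maximalAtlas (E := Fin d → ℂ) (e.symm p)
  have hs := mem_chart_source (Fin d → ℂ) (e.symm p)
  let D := fderiv ℂ (fun q => chartAt (Fin d → ℂ) (e.symm p) (e.symm q)) p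
  have hD : LinearMap.det (D : (Fin d → ℂ) →ₗ[ℂ] (Fin d → ℂ)) ≠ 0 :=
    det_ne_zero_of_leftInverse (fderiv_transition_comp he hc hp hs)
  have h1 : inChart e Θ p (stdFrame d) =
      Θ (e.symm p) (fun i => ((D : (Fin d → ℂ) →ₗ[ℂ] (Fin d → ℂ)).restrictScalars ℝ)
        (stdFrame d i)) := by
    rw [inChart, fderiv_real_eq ((contDiffAt_transition he hc hp hs).differentiableAt (by simp))]
    rfl
  rw [h1, topForm_map (finrank_real_pi d)]
  exact mul_nonpos_of_nonneg_of_nonpos (det_restrictScalars_pos _ hD).le (h _)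

end Class

section

variable {m n : ℕ} {M : Type*} [TopologicalSpace M] [ChartedSpace (Fin m → ℂ) M]
  [IsManifold 𝓘(ℂ, Fin m → ℂ) ω M] [T2Space M]
  {X : Type*} [TopologicalSpace X] [ChartedSpace ((Fin m → ℂ) × (Fin n → ℂ)) X]
  [IsManifold 𝓘(ℂ, (Fin m → ℂ) × (Fin n → ℂ)) ω X] [CompactSpace X] {π : X → M}
  {L : X → Type*} [∀ x, AddCommGroup (L x)] [∀ x, Module ℂ (L x)]
  [∀ x, TopologicalSpace (L x)] [TopologicalSpace (Bundle.TotalSpace ℂ L)] [FiberBundle ℂ L]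
  [VectorBundle ℂ ℂ L] [ContMDiffVectorBundle ω ℂ L 𝓘(ℂ, (Fin m → ℂ) × (Fin n → ℂ))]

/-- The classes of the `S`-forms do not depend on the metric. -/
theorem cohomologous_sForm (hπ : Continuous π)
    (φ ψ : HermitianMetric ((Fin m → ℂ) × (Fin n → ℂ)) L) (i : ℕ) :
    Cohomologous (sForm π φ i) (sForm π ψ i) :=
  (cohomologous_wedgePow (φ.cohomologous_chernForm ψ) (n + i)).fibreIntegral hπ _

theorem Cohomologous.zeroFormValue_eq {s t : DiffForm (Fin m → ℂ) M 0} (h : Cohomologous s t)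
    (y : M) : zeroFormValue s y = zeroFormValue t y := by
  have h1 : s - t = 0 := h.2.2
  rw [sub_eq_zero.1 h1]

end

end GeodesicEinstein

end

open GeodesicEinstein in
theorem theorem4p3 {m n : ℕ} (hm : 2 ≤ m)
    {M : Type*} [TopologicalSpace M] [ChartedSpace (Fin m → ℂ) M]
    [IsManifold 𝓘(ℂ, Fin m → ℂ) ω M] [CompactSpace M] [T2Space M]
    {X : Type*} [TopologicalSpace X] [ChartedSpace ((Fin m → ℂ) × (Fin n → ℂ)) X]
    [IsManifold 𝓘(ℂ, (Fin m → ℂ) × (Fin n → ℂ)) ω X] [T2Space X]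
    (π : X → M) (hπ : IsHolomorphicFibration m n π)
    (L : X → Type*) [∀ x, AddCommGroup (L x)] [∀ x, Module ℂ (L x)]
    [∀ x, TopologicalSpace (L x)] [TopologicalSpace (Bundle.TotalSpace ℂ L)] [FiberBundle ℂ L]
    [VectorBundle ℂ ℂ L] [ContMDiffVectorBundle ω ℂ L 𝓘(ℂ, (Fin m → ℂ) × (Fin n → ℂ))]
    (ωM : DiffForm (Fin m → ℂ) M 2) (hω : IsKahlerForm ωM)
    (φ : HermitianMetric ((Fin m → ℂ) × (Fin n → ℂ)) L) (hφ : IsGeodesicEinstein π ωM φ) :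
    -- the pointwise inequality, and the case of equality
    (∀ y : M, kobayashiLubkeForm n hm (sForm π φ) ωM y (stdFrame m) ≤ 0 ∧
      (kobayashiLubkeForm n hm (sForm π φ) ωM y = 0 ↔
        ∀ e z, IsAdmissible π e z → ∀ x ∈ e.source, π x = y →
          ∀ u w : (Fin m → ℂ) × (Fin n → ℂ),
            geodesicCurvature φ e x u w =
              ((2 * Real.pi / ((n + 1) * zeroFormValue (sForm π φ 0) y) *
                inChart z (sForm π φ 1) (z y) ![u.1, w.1] : ℝ) : ℂ))) ∧
    -- the inequality of cohomology classes
    (∀ s : (∀ i, DiffForm (Fin m → ℂ) M (2 * i)), (∀ i, RepresentsSClass n L π i (s i)) →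
      ∀ w : DiffForm (Fin m → ℂ) M 2, Cohomologous w ωM →
        integral (kobayashiLubkeForm n hm s w) ≤ 0) := by
  obtain hX := hπ.compactSpace
  have hP := hπ.nonempty_admissiblePartition
  have hs : ∀ i, sForm π φ i = hP.some.fibreIntegral (by ring : 2 * (n + i) = 2 * i + 2 * n)
      (wedgePow φ.chernForm (n + i)) := sForm_eq hP
  have key := fun y => hP.some.kobayashiLubkeForm_nonpos hπ hm hω hφ y hs
  refine ⟨fun y => ⟨(key y).1, (key y).2.trans (hP.some.geodesic_eq_mean_iff hπ hφ.1 y hs)⟩, ?_⟩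
  intro s hS w hw
  have h1 : ∀ i, Cohomologous (s i) (sForm π φ i) := fun i => by
    obtain ⟨ψ, hψ⟩ := hS i
    exact hψ.trans (cohomologous_sForm hπ.holomorphic.continuous ψ φ i)
  have h2 : ∀ y, zeroFormValue (s 0) y ≠ 0 := fun y => by
    rw [Cohomologous.zeroFormValue_eq (h1 0), hs 0,
      hP.some.zeroFormValue_fibreIntegral hπ hφ.1 y]
    exact (mul_pos (fibreConst_pos n 0) (hP.some.mass_pos hπ hφ.1 y)).ne'
  rw [(cohomologous_kobayashiLubkeForm n hm h1 h2 hw).integral_eq]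
  exact integral_nonpos_of_stdFrame fun y => (key y).1
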